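/- Let $n\ge 0$ and let $n_-,n_+,n_E\ge 0$ be integers with $n_-+n_++n_E\le n$, let $\omega_k>0$ for $1\le k\le n_-+n_+$ and $E_k\in\mathbb R\setminus\{0\}$ for $n_-+n_+<k\le n_-+n_++n_E$. On $L^2(\mathbb R^n;\mathbb C)$ consider $$H_0=-\Delta+U,\qquad U(x)=-\sum_{k=1}^{n_-}\omega_k^2x_k^2+\sum_{k=n_-+1}^{n_-+n_+}\omega_k^2x_k^2+\sum_{k=n_-+n_++1}^{n_-+n_++n_E}E_kx_k ,$$ and $H=H_0+V$ with a real-valued potential $V$, both defined on $C_0^\infty(\mathbb R^n)$. Write $\langle x\rangle=(1+|x|^2)^{1/2}$. Consider the following conditions. - (Singular part) A real function $V_j$ is called admissible if $V_j\in L^{p_j}(\mathbb R^n;\mathbb R)$ for some $p_j$ with $2\le p_j<\infty$ if $n\le 3$, $2<p_j<\infty$ if $n=4$, and $n/2\le p_j<\infty$ if $n\ge5$. - (Decaying part) A real function $W$ is called decaying if it is a finite sum of functions $w\in L^\infty(\mathbb R^n;\mathbb R)$ each of which satisfies, for some constant $C$ and some exponents $\beta_j\ge 0$ (both depending on $w$;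 $1\le j\le n_-$ or $n_-+n_+<j\le n$) with $\sum_j\beta_j>1$, $$|w(x)|\le C\prod_{j=1}^{n_-}\langle\ln\langle x\rangle\rangle^{-\beta_j}\prod_{j=n_-+n_++1}^{n_-+n_++n_E}\langle x_j\rangle^{-\beta_j/2}\prod_{j=n_-+n_++n_E+1}^{n}\langle x_j\rangle^{-\beta_j}\quad\text{for a.e. }x .$$ Suppose that one of the following holds: (i) $n_-\ge1$, $n_+\le1$, and $V=V_1+V_2+W$ with $V_1,V_2$ admissible and $W$ decaying; (ii) $n_-\ge1$ ($n_+$ arbitrary), and $V=V_1+V_2+W$ with $V_1,V_2$ admissible and compactly supported and $W$ decaying; (iii) $V=W$ is decaying (no condition on $n_-$ and $n_+$). Then $H_0$ and $H$ are well defined as operators on $C_0^\infty(\mathbb R^n)$ with values in $L^2(\mathbb R^n)$, each admits a unique self-adjoint extension (denoted by the same letter), and the strong limits $$\operatorname*{s-lim}_{t\to+\infty}e^{itH}e^{-itH_0}\quad\text{and}\quad \operatorname*{s-lim}_{t\to-\infty}e^{itH}e^{-itH_0}$$ exist in $L^2(\mathbb R^n)$. -/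

import Mathlib

open MeasureTheory Filter Topology
open scoped ContDiff

noncomputable section

/-- Configuration space `ℝⁿ` with its Euclidean norm. -/
abbrev RSpace (n : ℕ) : Type := EuclideanSpace ℝ (Fin n)

/-- The complex Hilbert space `L²(ℝⁿ)` (Lebesgue measure). -/
abbrev L2 (n : ℕ) : Type := Lp ℂ 2 (volume : Measure (RSpace n))

/-- The Japanese bracket `⟨x⟩ = (1 + |x|²)^{1/2}`. -/
def japaneseBracket {X : Type*} [Norm X] (x : X) : ℝ := √(1 + ‖x‖ ^ 2)

/-- The data of the quadratic/Stark polynomial `U` on `ℝⁿ`. With indices counted from `0`, the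
coordinates `k < nNeg` are the repulsive directions, `nNeg ≤ k < nNeg + nPos` the confining ones,
`nNeg + nPos ≤ k < nNeg + nPos + nStark` the Stark directions, and the remaining ones are free.
Here `freq` is `ω` and `field` is `E`; their values outside of the directions concerned are irrelevant. -/
structure QuadraticStark (n : ℕ) where
  nNeg : ℕ
  nPos : ℕ
  nStark : ℕ
  le_dim : nNeg + nPos + nStark ≤ n
  freq : Fin n → ℝ
  freq_pos : ∀ k : Fin n, (k : ℕ) < nNeg + nPos → 0 < freq k
  field : Fin n → ℝ
  field_ne_zero : ∀ k : Fin n, nNeg + nPos ≤ (k : ℕ) → (k : ℕ) < nNeg + nPos + nStark → field k ≠ 0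

namespace QuadraticStark

variable {n : ℕ}

/-- The polynomial
`U(x) = - ∑_{repulsive} ω_k² x_k² + ∑_{confining} ω_k² x_k² + ∑_{Stark} E_k x_k`. -/
def U (S : QuadraticStark n) (x : RSpace n) : ℝ :=
  ∑ k : Fin n,
    if (k : ℕ) < S.nNeg then -(S.freq k ^ 2 * x k ^ 2)
    else if (k : ℕ) < S.nNeg + S.nPos then S.freq k ^ 2 * x k ^ 2
    else if (k : ℕ) < S.nNeg + S.nPos + S.nStark then S.field k * x k
    else 0

/-- The decay weight with exponents `b`:
`∏_{repulsive} ⟨ln⟨x⟩⟩^{-b_j} · ∏_{Stark} ⟨x_j⟩^{-b_j/2} · ∏_{free} ⟨x_j⟩^{-b_j}`. -/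
def weight (S : QuadraticStark n) (b : Fin n → ℝ) (x : RSpace n) : ℝ :=
  ∏ j : Fin n,
    if (j : ℕ) < S.nNeg then japaneseBracket (Real.log (japaneseBracket x)) ^ (-b j)
    else if (j : ℕ) < S.nNeg + S.nPos then 1
    else if (j : ℕ) < S.nNeg + S.nPos + S.nStark then japaneseBracket (x j) ^ (-b j / 2)
    else japaneseBracket (x j) ^ (-b j)

/-- The total decay exponent: the sum of the `b_j` over the directions that occur in the weight,
i.e. all but the confining ones. -/
def totalExponent (S : QuadraticStark n) (b : Fin n → ℝ) : ℝ :=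
  ∑ j : Fin n, if (j : ℕ) < S.nNeg ∨ S.nNeg + S.nPos ≤ (j : ℕ) then b j else 0

/-- One term of the pointwise decaying part: a real function in `L^∞` bounded a.e. by a constant
times a weight whose exponents are nonnegative with sum `> 1`. -/
def IsDecayingTerm (S : QuadraticStark n) (w : RSpace n → ℝ) : Prop :=
  MemLp w ⊤ volume ∧
    ∃ b : Fin n → ℝ, (∀ j, 0 ≤ b j) ∧ 1 < S.totalExponent b ∧
      ∃ C : ℝ, ∀ᵐ x : RSpace n, |w x| ≤ C * S.weight b x

/-- `W` is a finite sum of decaying terms (each with its own exponents). -/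
def IsDecaying (S : QuadraticStark n) (W : RSpace n → ℝ) : Prop :=
  ∃ (m : ℕ) (w : Fin m → RSpace n → ℝ), (∀ i, S.IsDecayingTerm (w i)) ∧
    W =ᵐ[volume] fun x => ∑ i, w i x

end QuadraticStark

/-- Exponents `p < ∞` with `p ≥ 2` if `n ≤ 3`, `p > 2` if `n = 4`, `p ≥ n/2` if `n ≥ 5`. -/
def IsAdmissibleExponent (n : ℕ) (p : ℝ) : Prop :=
  (n ≤ 3 → 2 ≤ p) ∧ (n = 4 → 2 < p) ∧ (5 ≤ n → (n : ℝ) / 2 ≤ p)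

/-- `V ∈ L^p(ℝⁿ; ℝ)` for some admissible finite exponent `p`. -/
def IsSingularPotential {n : ℕ} (V : RSpace n → ℝ) : Prop :=
  ∃ p : ℝ, IsAdmissibleExponent n p ∧ MemLp V (ENNReal.ofReal p) volume

/-- `V` has compact essential support, i.e. it vanishes a.e. outside some ball. -/
def IsEssCompactlySupported {n : ℕ} (V : RSpace n → ℝ) : Prop :=
  ∃ R : ℝ, ∀ᵐ x : RSpace n, R < ‖x‖ → V x = 0

/-- The differential expression `-Δφ + q φ`. -/
def schrodingerExpr {n : ℕ} (q : RSpace n → ℝ) (φ : RSpace n → ℂ) (x : RSpace n) : ℂ :=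
  -(Laplacian.laplacian φ x) + (q x : ℂ) * φ x

/-- The graph of `-Δ + q` on `C_c^∞(ℝⁿ)`: all pairs `(φ, -Δφ + qφ)` of (classes of) `L²` functions
with `φ ∈ C_c^∞(ℝⁿ; ℂ)`. -/
def schrodingerGraph {n : ℕ} (q : RSpace n → ℝ) : Submodule ℂ (L2 n × L2 n) where
  carrier := {z | ∃ φ : RSpace n → ℂ, ContDiff ℝ ∞ φ ∧ HasCompactSupport φ ∧
    z.1 =ᵐ[volume] φ ∧ z.2 =ᵐ[volume] schrodingerExpr q φ}
  zero_mem' := by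
    refine ⟨0, contDiff_const, HasCompactSupport.zero, Lp.coeFn_zero _ _ _, ?_⟩
    filter_upwards [Lp.coeFn_zero ℂ 2 (volume : Measure (RSpace n))] with x hx
    change (0 : L2 n) x = _
    rw [hx]
    simp [schrodingerExpr, show (0 : RSpace n → ℂ) = fun _ => 0 from rfl]
  add_mem' := by
    rintro ⟨u, f⟩ ⟨v, g⟩ ⟨φ, hφ, cφ, hu, hf⟩ ⟨χ, hχ, cχ, hv, hg⟩
    refine ⟨φ + χ, hφ.add hχ, cφ.add cχ, ?_, ?_⟩
    · filter_upwards [Lp.coeFn_add u v, hu, hv] with x h1 h2 h3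
      simp only [Prod.mk_add_mk, Pi.add_apply] at h1 h2 h3 ⊢
      rw [h1, h2, h3]
    · filter_upwards [Lp.coeFn_add f g, hf, hg] with x h1 h2 h3
      simp only [Prod.mk_add_mk, Pi.add_apply] at h1 h2 h3 ⊢
      have h2d : ContDiffAt ℝ 2 φ x := (contDiff_infty.1 hφ 2).contDiffAt
      have h2e : ContDiffAt ℝ 2 χ x := (contDiff_infty.1 hχ 2).contDiffAt
      rw [h1, h2, h3, schrodingerExpr, schrodingerExpr, schrodingerExpr, h2d.laplacian_add h2e,
        Pi.add_apply]
      ring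
  smul_mem' := by
    rintro c ⟨u, f⟩ ⟨φ, hφ, cφ, hu, hf⟩
    refine ⟨c • φ, contDiff_const.smul hφ, cφ.smul_left (f := fun _ => c), ?_, ?_⟩
    · filter_upwards [Lp.coeFn_smul c u, hu] with x h1 h2
      simp only [Prod.smul_mk, Pi.smul_apply] at h1 h2 ⊢
      rw [h1, h2]
    · filter_upwards [Lp.coeFn_smul c f, hf] with x h1 h2
      simp only [Prod.smul_mk, Pi.smul_apply] at h1 h2 ⊢
      have h2d : ContDiffAt ℝ 2 φ x := (contDiff_infty.1 hφ 2).contDiffAt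
      rw [h1, h2, schrodingerExpr, schrodingerExpr, InnerProductSpace.laplacian_smul c h2d,
        Pi.smul_apply, smul_eq_mul, smul_eq_mul, smul_eq_mul]
      ring

/-- The graph above is the graph of a function. -/
theorem schrodingerGraph_functional {n : ℕ} (q : RSpace n → ℝ) :
    ∀ z ∈ schrodingerGraph q, z.1 = 0 → z.2 = 0 := by
  rintro ⟨u, f⟩ ⟨φ, hφ, cφ, hu, hf⟩ h0
  simp only at hu hf h0 ⊢
  subst h0
  have hz : φ =ᵐ[volume] fun _ => (0 : ℂ) := hu.symm.trans (Lp.coeFn_zero _ _ _)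
  have hφ0 : φ = fun _ => (0 : ℂ) :=
    (Continuous.ae_eq_iff_eq volume hφ.continuous continuous_const).1 hz
  subst hφ0
  apply Lp.ext
  filter_upwards [hf, Lp.coeFn_zero ℂ 2 (volume : Measure (RSpace n))] with x h1 h2
  rw [h1, h2]
  simp [schrodingerExpr]

/-- The operator `-Δ + q` in `L²(ℝⁿ)` with domain `C_c^∞(ℝⁿ)` (more precisely, those
`φ ∈ C_c^∞(ℝⁿ)` for which `-Δφ + qφ ∈ L²`, which is all of them when `q ∈ L²_loc`). -/
def minimalSchrodinger {n : ℕ} (q : RSpace n → ℝ) : L2 n →ₗ.[ℂ] L2 n :=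
  (schrodingerGraph q).toLinearPMap

/-- Description of the operator `-Δ + q` on `C_c^∞(ℝⁿ)` through its graph. -/
theorem mem_graph_minimalSchrodinger {n : ℕ} (q : RSpace n → ℝ) (z : L2 n × L2 n) :
    z ∈ (minimalSchrodinger q).graph ↔
      ∃ φ : RSpace n → ℂ, ContDiff ℝ ∞ φ ∧ HasCompactSupport φ ∧
        z.1 =ᵐ[volume] φ ∧ z.2 =ᵐ[volume] schrodingerExpr q φ := by
  rw [minimalSchrodinger, Submodule.toLinearPMap_graph_eq _ (schrodingerGraph_functional q)]
  rfl

/-- `A` is the unique self-adjoint extension of `T`. -/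
def IsUniqueSelfAdjointExtension {X : Type*} [NormedAddCommGroup X] [InnerProductSpace ℂ X]
    [CompleteSpace X] (T A : X →ₗ.[ℂ] X) : Prop :=
  (T ≤ A ∧ IsSelfAdjoint A) ∧ ∀ B : X →ₗ.[ℂ] X, T ≤ B → IsSelfAdjoint B → B = A

/-- `U(t) = e^{-itA}`: `U` is the strongly continuous one-parameter unitary group whose
infinitesimal generator is `-iA` (with equality of domains). -/
structure IsUnitaryGroupOf {X : Type*} [NormedAddCommGroup X] [InnerProductSpace ℂ X]
    [CompleteSpace X] (A : X →ₗ.[ℂ] X) (U : ℝ → X →L[ℂ] X) : Prop where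
  map_zero : U 0 = 1
  map_add : ∀ s t : ℝ, U (s + t) = U s * U t
  mem_unitary : ∀ t : ℝ, U t ∈ unitary (X →L[ℂ] X)
  continuous : ∀ ψ : X, Continuous fun t => U t ψ
  generator : ∀ ψ η : X,
    (ψ, η) ∈ A.graph ↔ HasDerivAt (fun t => U t ψ) (-Complex.I • η) 0

/-- The wave operators `s-lim_{t → ±∞} e^{itA} e^{-itA₀}` exist. -/
def WaveOperatorsExist {X : Type*} [NormedAddCommGroup X] [InnerProductSpace ℂ X]
    [CompleteSpace X] (A₀ A : X →ₗ.[ℂ] X) : Prop :=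
  ∃ U₀ U : ℝ → X →L[ℂ] X, IsUnitaryGroupOf A₀ U₀ ∧ IsUnitaryGroupOf A U ∧
    ∃ Ωplus Ωminus : X →L[ℂ] X, ∀ ψ : X,
      Tendsto (fun t : ℝ => U (-t) (U₀ t ψ)) atTop (𝓝 (Ωplus ψ)) ∧
      Tendsto (fun t : ℝ => U (-t) (U₀ t ψ)) atBot (𝓝 (Ωminus ψ))

/-- `H₀ = -Δ + U` and `H = H₀ + V`, defined on `C_c^∞(ℝⁿ)`, have unique self-adjoint extensions
(in particular all of `C_c^∞(ℝⁿ)` is in the domain of `H`), and the wave operators for the pair of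
extensions exist. -/
def ScatteringConclusion {n : ℕ} (S : QuadraticStark n) (V : RSpace n → ℝ) : Prop :=
  (∀ φ : RSpace n → ℂ, ContDiff ℝ ∞ φ → HasCompactSupport φ →
    MemLp (schrodingerExpr (fun x => S.U x + V x) φ) 2 volume) ∧
  ∃ A₀ A : L2 n →ₗ.[ℂ] L2 n,
    IsUniqueSelfAdjointExtension (minimalSchrodinger S.U) A₀ ∧
    IsUniqueSelfAdjointExtension (minimalSchrodinger fun x => S.U x + V x) A ∧
    WaveOperatorsExist A₀ A

end

/-! The proof is Cook's method applied to explicit solutions of the free equation. The polynomial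
`U` is a sum over coordinates, so products of solutions of `i ∂ₜ f = -f'' + (c x² + e x) f` on the
line evolve under `H₀`. Such solutions are Gaussians `exp (α x² + β x)`, possibly times a linear
factor; `α` and `β` come from a complex solution `y` of the classical equation `y'' + 4 c y = 0`
(`ClassicalFlow`). The squared modulus of the pure Gaussian solution has width `‖y t‖` and an
explicit centre (`ClassicalFlow.exists_norm_sq_packet`). If the `L²` norm of `V u(t)` is
`O(|t|^{-B})` with `B > 1` for a total set of initial states, then `e^{itH} u(t)` has an integrable
derivative and the wave operators exist (`waveOperatorsExist_of_cook`).

Decay along packets. In a repulsive direction the width grows like `e^{2ω|t|}`, so `⟨ln⟨x⟩⟩` is of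
order `|t|` on most of the mass, and the supremum of the packet is exponentially small. In a Stark
direction the width is of order `|t|` but the centre lies at distance of order `t²`, so `⟨x⟩^{1/2}`
is of order `|t|`. In a free direction the derivative of a Gaussian is used: its amplitude at zero
velocity vanishes, which makes `⟨x⟩^{-B}` cost `|t|^{-B}` even though the weight is large near the
origin. In a confining direction bounded mass is enough. A product of weights with total exponent
above `1` is at most a sum of single-direction weights to some power `B > 1`
(`QuadraticStark.weight_le_sum`), and Tonelli's theorem reduces everything to one dimension. For an
`L^p` potential with `p ≥ 2` the exponentially small supremum suffices
(`hasFastDecay_mul_of_memLp`).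

Totality of the initial states. Orthogonality to Gaussians with all complex parameters forces a
Fourier transform to vanish; the linear factors in the free directions are removed first, by
recovering a Gaussian from the translates of its derivative (`eq_zero_of_inner_coherentState`).

Self-adjointness. For `-Δ + polynomial + V` the commutator argument of Faris and Lavine is used,
with comparison operator `N = -Δ + |x|² + b + V` (`eq_zero_of_commutator_bound`,
`hasTotalRange_hamiltonian`). The potential is infinitesimally small relative to the Laplacian by
the Sobolev embeddings of `H²`. Density of the range of `N` rests on essential self-adjointness of
the oscillator, which again follows from explicit packets: a deficiency vector is orthogonal to
every state with a norm-preserving evolution inside the closed graph (`inner_eq_zero_of_flow`).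
Packets are not compactly supported; a cutoff argument places them in the domains of the closures
(`SmoothWithDerivs.mem_closure`). -/

/-! ### Symmetric graphs, deficiency and self-adjointness -/

section AbstractOperators

variable {X : Type*} [NormedAddCommGroup X] [InnerProductSpace ℂ X]

/-- A graph in `X × X` is symmetric. -/
def IsSymmetricGraph (G : Submodule ℂ (X × X)) : Prop :=
  ∀ z ∈ G, ∀ w ∈ G, inner ℂ z.2 w.1 = inner ℂ z.1 w.2

/-- A closed condition on pairs that holds on a graph holds on its closure. -/
theorem IsSymmetricGraph.closure {G : Submodule ℂ (X × X)} (h : IsSymmetricGraph G) :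
    IsSymmetricGraph G.topologicalClosure := by
  have h1 : ∀ z ∈ G, ∀ w ∈ G.topologicalClosure, inner ℂ z.2 w.1 = inner ℂ z.1 w.2 := by
    intro z hz w hw
    have hc : IsClosed {w : X × X | inner ℂ z.2 w.1 = inner ℂ z.1 w.2} :=
      isClosed_eq (by fun_prop) (by fun_prop)
    exact closure_minimal (fun w hw => h z hz w hw) hc hw
  intro z hz w hw
  have hc : IsClosed {z : X × X | inner ℂ z.2 w.1 = inner ℂ z.1 w.2} :=
    isClosed_eq (by fun_prop) (by fun_prop)
  exact closure_minimal (fun z hz => h1 z hz w hw) hc hz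

/-- Symmetry makes the inner product of `z.2` and `z.1` real, so the cross term, which carries a
factor `i`, has no real part. All later bounds on resolvents come from this identity. -/
theorem IsSymmetricGraph.norm_sq {G : Submodule ℂ (X × X)} (h : IsSymmetricGraph G)
    {z : X × X} (hz : z ∈ G) (K : ℝ) :
    ‖z.2 + ((K : ℂ) * Complex.I) • z.1‖ ^ 2 = ‖z.2‖ ^ 2 + K ^ 2 * ‖z.1‖ ^ 2 := by
  have h0 := h z hz z hz
  have him : (inner ℂ z.2 z.1).im = 0 := by
    have := inner_conj_symm (𝕜 := ℂ) z.2 z.1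
    rw [← h0] at this
    exact Complex.conj_eq_iff_im.1 this
  rw [@norm_add_sq ℂ, inner_smul_right, norm_smul]
  have : RCLike.re ((K : ℂ) * Complex.I * inner ℂ z.2 z.1) = 0 := by
    simp [him]
  rw [this]
  simp [mul_pow]

/-- The map `(a, b) ↦ b + iKa`. -/
def shiftMap (K : ℝ) : X × X →ₗ[ℂ] X :=
  LinearMap.snd ℂ X X + ((K : ℂ) * Complex.I) • LinearMap.fst ℂ X X

@[simp] theorem shiftMap_apply (K : ℝ) (z : X × X) :
    shiftMap K z = z.2 + ((K : ℂ) * Complex.I) • z.1 := rfl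

theorem IsSymmetricGraph.norm_fst_le {G : Submodule ℂ (X × X)} (h : IsSymmetricGraph G)
    {z : X × X} (hz : z ∈ G) (K : ℝ) : |K| * ‖z.1‖ ≤ ‖shiftMap K z‖ := by
  apply (sq_le_sq₀ (by positivity) (norm_nonneg _)).1
  rw [shiftMap_apply, h.norm_sq hz K, mul_pow, sq_abs]
  nlinarith [sq_nonneg ‖z.2‖]

theorem IsSymmetricGraph.norm_snd_le {G : Submodule ℂ (X × X)} (h : IsSymmetricGraph G)
    {z : X × X} (hz : z ∈ G) (K : ℝ) : ‖z.2‖ ≤ ‖shiftMap K z‖ := by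
  apply (sq_le_sq₀ (by positivity) (norm_nonneg _)).1
  rw [shiftMap_apply, h.norm_sq hz K]
  nlinarith [sq_nonneg ‖z.1‖, sq_nonneg (K * ‖z.1‖)]

variable [CompleteSpace X]

/-- The norm identity bounds the shift from below on the graph, hence its range is closed when the
graph is; `hd` says that nothing is orthogonal to that range. -/
theorem IsSymmetricGraph.shiftMap_surjective {G : Submodule ℂ (X × X)} (h : IsSymmetricGraph G)
    (hG : IsClosed (G : Set (X × X))) {K : ℝ} (hK : K ≠ 0)
    (hd : ∀ η : X, (∀ z ∈ G, inner ℂ η (shiftMap K z) = 0) → η = 0) (x : X) :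
    ∃ z ∈ G, shiftMap K z = x := by
  let f : G →ₗ[ℂ] X := (shiftMap K).comp G.subtype
  have hK' : 0 < |K| := abs_pos.2 hK
  have hanti : AntilipschitzWith (Real.toNNReal (max 1 |K|⁻¹)) f := by
    apply AddMonoidHomClass.antilipschitz_of_bound
    intro z
    have h1 := h.norm_fst_le z.2 K
    have h2 := h.norm_snd_le z.2 K
    rw [Real.coe_toNNReal _ (by positivity)]
    change max ‖(z : X × X).1‖ ‖(z : X × X).2‖ ≤ _ * ‖shiftMap K (z : X × X)‖
    have h0 : 0 ≤ ‖shiftMap K (z : X × X)‖ := norm_nonneg _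
    apply max_le
    · calc ‖(z : X × X).1‖ ≤ |K|⁻¹ * ‖shiftMap K (z : X × X)‖ := by
            rw [← div_eq_inv_mul, le_div_iff₀ hK', mul_comm]; exact h1
        _ ≤ _ := by gcongr; exact le_max_right _ _
    · calc ‖(z : X × X).2‖ ≤ 1 * ‖shiftMap K (z : X × X)‖ := by rw [one_mul]; exact h2
        _ ≤ _ := by gcongr; exact le_max_left _ _
  have hcomp : CompleteSpace G := hG.completeSpace_coe
  have hcont : UniformContinuous f := by
    have : Continuous f := by
      change Continuous fun z : G => (z : X × X).2 + ((K : ℂ) * Complex.I) • (z : X × X).1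
      fun_prop
    exact (⟨f, this⟩ : G →L[ℂ] X).uniformContinuous
  have hcl : IsClosed (Set.range f) := hanti.isClosed_range hcont
  have htop : LinearMap.range f = ⊤ := by
    have hcl' : IsClosed (LinearMap.range f : Set X) := hcl
    rw [← hcl'.submodule_topologicalClosure_eq, Submodule.topologicalClosure_eq_top_iff,
      Submodule.eq_bot_iff]
    intro η hη
    apply hd
    intro z hz
    rw [Submodule.mem_orthogonal'] at hη
    exact hη _ ⟨⟨z, hz⟩, rfl⟩
  obtain ⟨z, hz⟩ := LinearMap.range_eq_top.1 htop x
  exact ⟨z, z.2, hz⟩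

/-- Basic criterion for essential self-adjointness. -/
theorem isUniqueSelfAdjointExtension_closure {T : X →ₗ.[ℂ] X} (hdom : Dense (T.domain : Set X))
    (hsymm : IsSymmetricGraph T.graph) {K : ℝ} (hK : K ≠ 0)
    (hp : ∀ η : X, (∀ z ∈ T.graph, inner ℂ η (shiftMap K z) = 0) → η = 0)
    (hm : ∀ η : X, (∀ z ∈ T.graph, inner ℂ η (shiftMap (-K) z) = 0) → η = 0) :
    IsUniqueSelfAdjointExtension T T.closure ∧
      T.closure.graph = T.graph.topologicalClosure := by
  have hTle : T ≤ T.adjoint := by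
    apply LinearPMap.IsFormalAdjoint.le_adjoint hdom
    intro x y
    exact hsymm (x, T x) (T.mem_graph x) (y, T y) (T.mem_graph y)
  have hclos : T.IsClosable := (LinearPMap.adjoint_isClosed hdom).isClosable.leIsClosable hTle
  have hgr : T.closure.graph = T.graph.topologicalClosure :=
    hclos.graph_closure_eq_closure_graph.symm
  have hle : T ≤ T.closure := T.le_closure
  have hleg : ∀ z ∈ T.graph, z ∈ T.closure.graph := fun z hz => LinearPMap.le_graph_of_le hle hz
  have hdom' : Dense (T.closure.domain : Set X) := hdom.mono hle.1
  have hs' : IsSymmetricGraph T.closure.graph := hgr ▸ hsymm.closure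
  have hcl : IsClosed (T.closure.graph : Set (X × X)) := hclos.closure_isClosed
  have hsa : IsSelfAdjoint T.closure := by
    rw [LinearPMap.isSelfAdjoint_def]
    apply LinearPMap.eq_of_eq_graph
    rw [LinearPMap.adjoint_graph_eq_graph_adjoint hdom']
    apply le_antisymm
    · rintro ⟨y, w⟩ hyw
      rw [Submodule.mem_adjoint_iff] at hyw
      -- For `(y, w)` in the adjoint graph, solve `(A + iK) z = w + iK y` inside the closure. Then
      -- `z.1 - y` is orthogonal to the range of the shift by `-K`, hence zero, and `(y, w)` is `z`.
      obtain ⟨z, hz, hzeq⟩ := hs'.shiftMap_surjective hcl hK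
        (fun η hη => hp η fun z hz => hη z (hleg z hz)) (w + ((K : ℂ) * Complex.I) • y)
      have hy : z.1 - y = 0 := by
        apply hm
        intro u hu
        have e1 := hs' z hz u (hleg u hu)
        have e2 := hyw u.1 u.2 (hleg u hu)
        have e2' : inner ℂ y u.2 = inner ℂ w u.1 := by
          rw [← inner_conj_symm y, ← inner_conj_symm w, sub_eq_zero.1 e2]
        have e3 : inner ℂ (z.2 - w) u.1 = inner ℂ (((K : ℂ) * Complex.I) • (y - z.1)) u.1 := by
          congr 1
          rw [shiftMap_apply] at hzeq
          rw [smul_sub, sub_eq_sub_iff_add_eq_add, hzeq, add_comm]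
        rw [inner_sub_left, inner_smul_left, inner_sub_left] at e3
        rw [shiftMap_apply, inner_sub_left, inner_add_right, inner_add_right, inner_smul_right,
          inner_smul_right, e2', ← e1]
        simp only [map_mul, Complex.conj_ofReal, Complex.conj_I] at e3
        push_cast
        linear_combination e3
      have hy' : z.1 = y := sub_eq_zero.1 hy
      rw [shiftMap_apply, hy'] at hzeq
      have : z = (y, w) := Prod.ext hy' (add_right_cancel hzeq)
      exact this ▸ hz
    · rintro ⟨y, w⟩ hyw
      rw [Submodule.mem_adjoint_iff]
      intro a b hab
      exact sub_eq_zero.2 (hs' _ hab _ hyw)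
  refine ⟨⟨⟨hle, hsa⟩, fun B hTB hB => ?_⟩, hgr⟩
  have hBle : T.closure ≤ B := by
    apply LinearPMap.le_of_le_graph
    rw [hgr]
    exact Submodule.topologicalClosure_minimal _ (LinearPMap.le_graph_of_le hTB) hB.isClosed
  -- A self-adjoint operator is maximal among symmetric ones: taking adjoints in `T.closure ≤ B`
  -- reverses the inclusion while both operators stay the same.
  apply le_antisymm _ hBle
  apply LinearPMap.le_of_le_graph
  rintro ⟨y, w⟩ hyw
  rw [← LinearPMap.isSelfAdjoint_def.1 hsa, LinearPMap.adjoint_graph_eq_graph_adjoint hdom',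
    Submodule.mem_adjoint_iff]
  intro a b hab
  have hab' : (a, b) ∈ B.graph := LinearPMap.le_graph_of_le hBle hab
  rw [← LinearPMap.isSelfAdjoint_def.1 hB, LinearPMap.adjoint_graph_eq_graph_adjoint
    hB.dense_domain, Submodule.mem_adjoint_iff] at hyw
  exact hyw a b hab'

theorem IsSelfAdjoint.isSymmetricGraph {A : X →ₗ.[ℂ] X} (hA : IsSelfAdjoint A) :
    IsSymmetricGraph A.graph := by
  intro z hz w hw
  have hw' : w ∈ A.graph.adjoint := by
    rw [← LinearPMap.adjoint_graph_eq_graph_adjoint hA.dense_domain,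
      LinearPMap.isSelfAdjoint_def.1 hA]
    exact hw
  exact sub_eq_zero.1 ((Submodule.mem_adjoint_iff _ _).1 hw' z.1 z.2 hz)

theorem IsSelfAdjoint.mem_graph_of_forall {A : X →ₗ.[ℂ] X} (hA : IsSelfAdjoint A) {y w : X}
    (h : ∀ z ∈ A.graph, inner ℂ z.2 y = inner ℂ z.1 w) : (y, w) ∈ A.graph := by
  rw [← LinearPMap.isSelfAdjoint_def.1 hA,
    LinearPMap.adjoint_graph_eq_graph_adjoint hA.dense_domain, Submodule.mem_adjoint_iff]
  intro a b hab
  exact sub_eq_zero.2 (h _ hab)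

/-- A vector `η` orthogonal to the range satisfies `A η = iK η` by self-adjointness. Testing `η`
against its own shift `2iK η` then gives zero. -/
theorem IsSelfAdjoint.shiftMap_surjective {A : X →ₗ.[ℂ] X} (hA : IsSelfAdjoint A) {K : ℝ}
    (hK : K ≠ 0) (x : X) : ∃ z ∈ A.graph, shiftMap K z = x := by
  apply hA.isSymmetricGraph.shiftMap_surjective hA.isClosed hK
  intro η hη
  have hmem : (η, ((K : ℂ) * Complex.I) • η) ∈ A.graph := by
    apply hA.mem_graph_of_forall
    intro z hz
    have := hη z hz
    rw [shiftMap_apply, inner_add_right, inner_smul_right] at this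
    have h2 := congrArg (starRingEnd ℂ) this
    simp only [map_add, map_mul, inner_conj_symm, Complex.conj_ofReal, Complex.conj_I,
      map_zero] at h2
    rw [inner_smul_right]
    linear_combination h2
  have h1 := hη _ hmem
  simp only [shiftMap_apply, ← two_smul ℂ (((K : ℂ) * Complex.I) • η), inner_smul_right] at h1
  have : inner ℂ η η = (0 : ℂ) := by
    have h2 : (2 : ℂ) * ((K : ℂ) * Complex.I) ≠ 0 := by simp [hK]
    rw [← mul_assoc] at h1
    exact (mul_eq_zero.1 h1).resolve_left h2
  exact inner_self_eq_zero.1 this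

end AbstractOperators

/-! ### Resolvents, Yosida approximations and Stone's theorem -/

section Stone

variable {X : Type*} [NormedAddCommGroup X] [InnerProductSpace ℂ X]

theorem IsSymmetricGraph.fst_eq_of_shiftMap_eq {G : Submodule ℂ (X × X)}
    (h : IsSymmetricGraph G) {K : ℝ} (hK : K ≠ 0) {z w : X × X} (hz : z ∈ G) (hw : w ∈ G)
    (hzw : shiftMap K z = shiftMap K w) : z.1 = w.1 := by
  have h1 := h.norm_fst_le (G.sub_mem hz hw) K
  rw [map_sub, hzw, sub_self, norm_zero] at h1
  have h2 : ‖(z - w).1‖ ≤ 0 := by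
    have := abs_pos.2 hK
    by_contra hcon
    push Not at hcon
    nlinarith [mul_pos this hcon]
  exact sub_eq_zero.1 (norm_le_zero_iff.1 h2)

variable [CompleteSpace X] {A : X →ₗ.[ℂ] X}

theorem IsSelfAdjoint.exists_resolvent (hA : IsSelfAdjoint A) {K : ℝ} (hK : K ≠ 0) :
    ∃ R : X →L[ℂ] X, (∀ x, (R x, x - ((K : ℂ) * Complex.I) • R x) ∈ A.graph) ∧
      ∀ x, ‖R x‖ ≤ |K|⁻¹ * ‖x‖ := by
  have hs := hA.isSymmetricGraph
  choose r hr hrx using fun x => hA.shiftMap_surjective hK x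
  let L : X →ₗ[ℂ] X :=
    { toFun := fun x => (r x).1
      map_add' := fun x y => by
        refine hs.fst_eq_of_shiftMap_eq hK (hr _) (A.graph.add_mem (hr x) (hr y)) ?_
        rw [map_add, hrx, hrx, hrx]
      map_smul' := fun c x => by
        refine hs.fst_eq_of_shiftMap_eq hK (hr _) (A.graph.smul_mem c (hr x)) ?_
        rw [map_smul, hrx, hrx] }
  have hb : ∀ x, ‖L x‖ ≤ |K|⁻¹ * ‖x‖ := fun x => by
    have := hs.norm_fst_le (hr x) K
    rw [hrx] at this
    rw [← div_eq_inv_mul, le_div_iff₀ (abs_pos.2 hK), mul_comm]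
    exact this
  refine ⟨L.mkContinuous _ hb, fun x => ?_, hb⟩
  have : ((r x).1, x - ((K : ℂ) * Complex.I) • (r x).1) = r x := by
    ext
    · rfl
    · change x - ((K : ℂ) * Complex.I) • (r x).1 = (r x).2
      nth_rw 1 [← hrx x]
      simp
  change ((r x).1, x - ((K : ℂ) * Complex.I) • (r x).1) ∈ A.graph
  rw [this]
  exact hr x

/-- The resolvent `(A + iK)⁻¹` of a self-adjoint operator. -/
noncomputable def saResolvent (hA : IsSelfAdjoint A) {K : ℝ} (hK : K ≠ 0) : X →L[ℂ] X :=
  (hA.exists_resolvent hK).choose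

theorem saResolvent_mem (hA : IsSelfAdjoint A) {K : ℝ} (hK : K ≠ 0) (x : X) :
    (saResolvent hA hK x, x - ((K : ℂ) * Complex.I) • saResolvent hA hK x) ∈ A.graph :=
  (hA.exists_resolvent hK).choose_spec.1 x

theorem norm_saResolvent_le (hA : IsSelfAdjoint A) {K : ℝ} (hK : K ≠ 0) (x : X) :
    ‖saResolvent hA hK x‖ ≤ |K|⁻¹ * ‖x‖ :=
  (hA.exists_resolvent hK).choose_spec.2 x

theorem saResolvent_shiftMap (hA : IsSelfAdjoint A) {K : ℝ} (hK : K ≠ 0) {z : X × X}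
    (hz : z ∈ A.graph) : saResolvent hA hK (shiftMap K z) = z.1 :=
  hA.isSymmetricGraph.fst_eq_of_shiftMap_eq hK (saResolvent_mem hA hK _) hz (by simp)

theorem inner_saResolvent (hA : IsSelfAdjoint A) {K : ℝ} (hK : K ≠ 0) (hK' : -K ≠ 0) (x y : X) :
    inner ℂ (saResolvent hA hK x) y = inner ℂ x (saResolvent hA hK' y) := by
  have h := hA.isSymmetricGraph _ (saResolvent_mem hA hK x) _ (saResolvent_mem hA hK' y)
  simp only [inner_sub_left, inner_sub_right, inner_smul_left, inner_smul_right] at h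
  simp only [map_mul, Complex.conj_ofReal, Complex.conj_I] at h
  push_cast at h
  linear_combination -h

/-- The first resolvent identity: the resolvent at `L` is rewritten as the resolvent at `K` of its
own shift by `K`. It yields commutativity of the resolvents. -/
theorem saResolvent_sub (hA : IsSelfAdjoint A) {K L : ℝ} (hK : K ≠ 0) (hL : L ≠ 0) (x : X) :
    saResolvent hA hK x - saResolvent hA hL x =
      (((L - K : ℝ) : ℂ) * Complex.I) • saResolvent hA hK (saResolvent hA hL x) := by
  have h1 := saResolvent_shiftMap hA hK (saResolvent_mem hA hL x)
  rw [shiftMap_apply] at h1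
  simp only at h1
  have h2 : saResolvent hA hK x - saResolvent hA hL x = saResolvent hA hK
      (x - (x - ((L : ℂ) * Complex.I) • saResolvent hA hL x +
        ((K : ℂ) * Complex.I) • saResolvent hA hL x)) := by
    rw [map_sub, h1]
  rw [h2, ← map_smul (saResolvent hA hK)]
  refine congrArg (saResolvent hA hK) ?_
  push_cast
  module

theorem saResolvent_comm (hA : IsSelfAdjoint A) {K L : ℝ} (hK : K ≠ 0) (hL : L ≠ 0) (x : X) :
    saResolvent hA hK (saResolvent hA hL x) = saResolvent hA hL (saResolvent hA hK x) := by
  rcases eq_or_ne K L with rfl | hKL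
  · rfl
  have h1 := saResolvent_sub hA hK hL x
  have h2 := saResolvent_sub hA hL hK x
  have h3 : (((L - K : ℝ) : ℂ) * Complex.I) ≠ 0 := by
    simp only [ne_eq, mul_eq_zero, Complex.I_ne_zero, or_false]
    exact_mod_cast sub_ne_zero.2 hKL.symm
  apply smul_right_injective _ h3
  simp only
  rw [← h1, ← neg_sub, h2, ← neg_smul]
  congr 1
  push_cast
  ring

/-- The bounded self-adjoint (Yosida) approximations `k²A(A² + k²)⁻¹`, with `k = m + 1`, of a
self-adjoint operator. -/
noncomputable def yosida (hA : IsSelfAdjoint A) (m : ℕ) : X →L[ℂ] X :=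
  (((m + 1 : ℝ) ^ 2 / 2 : ℝ) : ℂ) •
    (saResolvent hA (K := m + 1) (by positivity) +
      saResolvent hA (K := -(m + 1 : ℝ)) (neg_ne_zero.2 (by positivity)))

theorem isSelfAdjoint_yosida (hA : IsSelfAdjoint A) (m : ℕ) : IsSelfAdjoint (yosida hA m) := by
  rw [ContinuousLinearMap.isSelfAdjoint_iff_isSymmetric]
  intro x y
  have hm : (m + 1 : ℝ) ≠ 0 := by positivity
  have h1 := inner_saResolvent hA hm (neg_ne_zero.2 hm) x y
  have h2 := inner_saResolvent hA (neg_ne_zero.2 hm) (by simpa using hm) x y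
  have h3 : saResolvent hA (K := - -(m + 1 : ℝ)) (by simpa using hm) =
      saResolvent hA (K := (m + 1 : ℝ)) hm := by
    congr 1
    exact neg_neg _
  rw [h3] at h2
  simp only [ContinuousLinearMap.coe_coe, yosida, smul_apply,
    add_apply, inner_smul_left, inner_smul_right, inner_add_left,
    inner_add_right, Complex.conj_ofReal, h1, h2]
  ring

theorem yosida_comm (hA : IsSelfAdjoint A) (m l : ℕ) :
    Commute (yosida hA m) (yosida hA l) := by
  have hm : (m + 1 : ℝ) ≠ 0 := by positivity
  have hl : (l + 1 : ℝ) ≠ 0 := by positivity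
  have key : ∀ {K L : ℝ} (hK : K ≠ 0) (hL : L ≠ 0),
      Commute (saResolvent hA hK) (saResolvent hA hL) := fun hK hL =>
    ContinuousLinearMap.ext fun x => saResolvent_comm hA hK hL x
  unfold yosida
  refine Commute.smul_left (Commute.smul_right ?_ _) _
  exact ((key _ _).add_right (key _ _)).add_left ((key _ _).add_right (key _ _))

theorem norm_smul_saResolvent_sub_le (hA : IsSelfAdjoint A) {K : ℝ} (hK : K ≠ 0) {z : X × X}
    (hz : z ∈ A.graph) :
    ‖((K : ℂ) * Complex.I) • saResolvent hA hK z.1 - z.1‖ ≤ |K|⁻¹ * ‖z.2‖ := by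
  have h1 := saResolvent_shiftMap hA hK hz
  rw [shiftMap_apply, map_add, map_smul] at h1
  have h2 : ((K : ℂ) * Complex.I) • saResolvent hA hK z.1 - z.1 = - saResolvent hA hK z.2 := by
    nth_rw 2 [← h1]
    abel
  rw [h2, norm_neg]
  exact norm_saResolvent_le hA hK _

/-- On the domain the error is at most `|K|⁻¹ ‖A z‖`. Elsewhere one approximates by the dense domain
and uses that the operators `iK (A + iK)⁻¹` are contractions. -/
theorem tendsto_smul_saResolvent (hA : IsSelfAdjoint A) {K : ℕ → ℝ} (hK : ∀ m, K m ≠ 0)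
    (hlim : Tendsto (fun m => |K m|) atTop atTop) (x : X) :
    Tendsto (fun m => ((K m : ℂ) * Complex.I) • saResolvent hA (hK m) x) atTop (𝓝 x) := by
  rw [Metric.tendsto_atTop]
  intro ε hε
  obtain ⟨y, hy, hxy⟩ := Metric.dense_iff.1 hA.dense_domain x (ε / 4) (by positivity)
  rw [Metric.mem_ball, dist_comm, dist_eq_norm] at hy
  have hz := A.mem_graph ⟨y, hxy⟩
  set w := A ⟨y, hxy⟩
  obtain ⟨N, hN⟩ := eventually_atTop.1
    ((tendsto_inv_atTop_zero.comp hlim).eventually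
      (gt_mem_nhds (show (0 : ℝ) < ε / 4 / (‖w‖ + 1) by positivity)))
  refine ⟨N, fun m hm => ?_⟩
  have h1 := norm_smul_saResolvent_sub_le hA (hK m) hz
  have h2 : |K m|⁻¹ * ‖w‖ ≤ ε / 4 := by
    calc |K m|⁻¹ * ‖w‖ ≤ ε / 4 / (‖w‖ + 1) * (‖w‖ + 1) := by
          gcongr
          · exact (hN m hm).le
          · linarith
      _ = ε / 4 := by field_simp
  have h3 : ‖((K m : ℂ) * Complex.I) • saResolvent hA (hK m) (x - y)‖ ≤ ‖x - y‖ := by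
    rw [norm_smul]
    have := norm_saResolvent_le hA (hK m) (x - y)
    have h0 := abs_pos.2 (hK m)
    calc _ ≤ |K m| * (|K m|⁻¹ * ‖x - y‖) := by
          simp only [Complex.norm_mul, Complex.norm_real, Complex.norm_I, mul_one, Real.norm_eq_abs]
          gcongr
      _ = _ := by field_simp
  rw [dist_eq_norm]
  have h4 : ((K m : ℂ) * Complex.I) • saResolvent hA (hK m) x - x =
      ((K m : ℂ) * Complex.I) • saResolvent hA (hK m) (x - y) +
      (((K m : ℂ) * Complex.I) • saResolvent hA (hK m) y - y) - (x - y) := by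
    rw [map_sub, smul_sub]
    abel
  rw [h4]
  calc _ ≤ _ := norm_sub_le _ _
    _ ≤ _ := add_le_add (norm_add_le _ _) le_rfl
    _ < ε := by
      have : ‖((K m : ℂ) * Complex.I) • saResolvent hA (hK m) y - y‖ ≤ ε / 4 := h1.trans h2
      linarith

/-- On the domain the approximation equals the mean of `iK (A + iK)⁻¹` and `-iK (A - iK)⁻¹` applied
to `A z`, and both of these converge strongly to the identity. -/
theorem tendsto_yosida (hA : IsSelfAdjoint A) {z : X × X} (hz : z ∈ A.graph) :
    Tendsto (fun m => yosida hA m z.1) atTop (𝓝 z.2) := by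
  have hm : ∀ m : ℕ, (m + 1 : ℝ) ≠ 0 := fun m => by positivity
  have hm' : ∀ m : ℕ, -(m + 1 : ℝ) ≠ 0 := fun m => neg_ne_zero.2 (hm m)
  have hlim : Tendsto (fun m : ℕ => |(m + 1 : ℝ)|) atTop atTop :=
    tendsto_abs_atTop_atTop.comp (tendsto_natCast_atTop_atTop.atTop_add tendsto_const_nhds)
  have l1 := tendsto_smul_saResolvent hA hm hlim z.2
  have l2 := tendsto_smul_saResolvent hA hm' (by simpa only [abs_neg] using hlim) z.2
  have h := (l1.add l2).const_smul (1 / 2 : ℂ)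
  have e : (1 / 2 : ℂ) • (z.2 + z.2) = z.2 := by
    rw [← two_smul ℂ z.2, smul_smul]
    norm_num
  rw [e] at h
  refine h.congr fun m => ?_
  have a1 := saResolvent_shiftMap hA (hm m) hz
  have a2 := saResolvent_shiftMap hA (hm' m) hz
  rw [shiftMap_apply, map_add, map_smul] at a1 a2
  have b1 : saResolvent hA (hm m) z.2 =
      z.1 - (((m + 1 : ℝ) : ℂ) * Complex.I) • saResolvent hA (hm m) z.1 := eq_sub_of_add_eq a1
  have b2 : saResolvent hA (hm' m) z.2 =
      z.1 - (((-(m + 1 : ℝ) : ℝ) : ℂ) * Complex.I) • saResolvent hA (hm' m) z.1 :=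
    eq_sub_of_add_eq a2
  rw [b1, b2, yosida]
  simp only [smul_apply, add_apply]
  push_cast
  have hI : Complex.I * Complex.I = -1 := Complex.I_mul_I
  match_scalars
  · ring
  · linear_combination (-(1 / 2 : ℂ) * (m + 1) ^ 2) * hI
  · linear_combination (-(1 / 2 : ℂ) * (m + 1) ^ 2) * hI

/-- The unitary group generated by the Yosida approximation. -/
noncomputable def yosidaExp (hA : IsSelfAdjoint A) (m : ℕ) (t : ℝ) : X →L[ℂ] X :=
  NormedSpace.exp (t • (-Complex.I • yosida hA m))

theorem yosidaExp_zero (hA : IsSelfAdjoint A) (m : ℕ) : yosidaExp hA m 0 = 1 := by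
  simp [yosidaExp]

theorem yosidaExp_add (hA : IsSelfAdjoint A) (m : ℕ) (s t : ℝ) :
    yosidaExp hA m (s + t) = yosidaExp hA m s * yosidaExp hA m t := by
  let _ := NormedAlgebra.restrictScalars ℚ ℝ (X →L[ℂ] X)
  rw [yosidaExp, add_smul]
  exact NormedSpace.exp_add_of_commute (((Commute.refl _).smul_left s).smul_right t)

theorem hasDerivAt_yosidaExp (hA : IsSelfAdjoint A) (m : ℕ) (t : ℝ) :
    HasDerivAt (yosidaExp hA m) (yosidaExp hA m t * (-Complex.I • yosida hA m)) t :=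
  hasDerivAt_exp_smul_const _ t

theorem star_yosidaExp (hA : IsSelfAdjoint A) (m : ℕ) (t : ℝ) :
    star (yosidaExp hA m t) = yosidaExp hA m (-t) := by
  rw [yosidaExp, yosidaExp, NormedSpace.star_exp]
  congr 1
  rw [star_smul, star_smul, (isSelfAdjoint_yosida hA m).star_eq]
  simp

theorem yosidaExp_neg_mul (hA : IsSelfAdjoint A) (m : ℕ) (t : ℝ) :
    yosidaExp hA m (-t) * yosidaExp hA m t = 1 := by
  rw [← yosidaExp_add, neg_add_cancel, yosidaExp_zero]

theorem inner_yosidaExp (hA : IsSelfAdjoint A) (m : ℕ) (t : ℝ) (x y : X) :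
    inner ℂ (yosidaExp hA m t x) y = inner ℂ x (yosidaExp hA m (-t) y) := by
  rw [← star_yosidaExp, ContinuousLinearMap.star_eq_adjoint,
    ContinuousLinearMap.adjoint_inner_right]

theorem norm_yosidaExp (hA : IsSelfAdjoint A) (m : ℕ) (t : ℝ) (x : X) :
    ‖yosidaExp hA m t x‖ = ‖x‖ := by
  have h : inner ℂ (yosidaExp hA m t x) (yosidaExp hA m t x) = inner ℂ x x := by
    rw [inner_yosidaExp, ← mul_apply_eq_comp, yosidaExp_neg_mul,
      one_apply_eq_self]
  rw [@norm_eq_sqrt_re_inner ℂ, h, ← @norm_eq_sqrt_re_inner ℂ]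

/-- The interpolation `s ↦ e^{is A_m} e^{-is A_l} x` between the two groups has a derivative of
constant norm `‖(A_m - A_l) x‖`, because the approximations commute and the exponentials are
isometric. -/
theorem norm_yosidaExp_sub_le (hA : IsSelfAdjoint A) (m l : ℕ) (t : ℝ) (x : X) :
    ‖yosidaExp hA m t x - yosidaExp hA l t x‖ ≤ |t| * ‖yosida hA m x - yosida hA l x‖ := by
  have hcomm : ∀ s, Commute (yosidaExp hA l s) (yosida hA m - yosida hA l) := fun s => by
    apply Commute.sub_right
    · exact (((yosida_comm hA l m).smul_left (-Complex.I)).smul_left s).exp_left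
    · exact (((yosida_comm hA l l).smul_left (-Complex.I)).smul_left s).exp_left
  let g : ℝ → X := fun s => (yosidaExp hA m (-s) * yosidaExp hA l s) x
  have hg : ∀ s, HasDerivAt g ((yosidaExp hA m (-s) * yosidaExp hA l s)
      (Complex.I • (yosida hA m x - yosida hA l x))) s := fun s => by
    have h1 : HasDerivAt (fun s => yosidaExp hA m (-s))
        (-(yosidaExp hA m (-s) * (-Complex.I • yosida hA m))) s := by
      simpa [Function.comp_def] using (hasDerivAt_yosidaExp hA m (-s)).scomp s (hasDerivAt_neg s)
    have h2 := h1.mul (hasDerivAt_yosidaExp hA l s)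
    have h3 := (ContinuousLinearMap.apply ℂ X x).restrictScalars ℝ |>.hasFDerivAt.comp_hasDerivAt s h2
    refine h3.congr_deriv ?_
    have e : -(yosidaExp hA m (-s) * (-Complex.I • yosida hA m)) * yosidaExp hA l s +
        yosidaExp hA m (-s) * (yosidaExp hA l s * (-Complex.I • yosida hA l)) =
        Complex.I • (yosidaExp hA m (-s) * (yosidaExp hA l s * (yosida hA m - yosida hA l))) := by
      rw [(hcomm s).eq]
      have : yosidaExp hA l s * yosida hA l = yosida hA l * yosidaExp hA l s :=
        (((yosida_comm hA l l).smul_left (-Complex.I)).smul_left s).exp_left.eq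
      rw [mul_smul_comm, mul_smul_comm, this]
      simp only [neg_smul, mul_neg, neg_neg, smul_mul_assoc, mul_assoc]
      rw [sub_mul, mul_sub, smul_sub, sub_eq_add_neg, mul_smul_comm Complex.I]
    rw [e]
    simp
  have hb := Convex.norm_image_sub_le_of_norm_hasDerivWithin_le (f := g) (s := Set.univ)
    (C := ‖yosida hA m x - yosida hA l x‖) (fun s _ => (hg s).hasDerivWithinAt)
    (fun s _ => by
      rw [mul_apply_eq_comp, norm_yosidaExp, norm_yosidaExp, norm_smul]
      simp) convex_univ (Set.mem_univ 0) (Set.mem_univ t)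
  have e1 : g 0 = x := by simp [g, yosidaExp_zero]
  have e2 : ‖g t - x‖ = ‖yosidaExp hA l t x - yosidaExp hA m t x‖ := by
    rw [← norm_yosidaExp hA m t (g t - x), map_sub]
    congr 2
    simp only [g]
    rw [← mul_apply_eq_comp, ← mul_assoc]
    nth_rw 1 [← neg_neg t]
    rw [neg_neg, ← yosidaExp_add, add_neg_cancel, yosidaExp_zero, one_mul]
  rw [e1, e2, norm_sub_rev, sub_zero, Real.norm_eq_abs, mul_comm] at hb
  exact hb

/-- The approximating groups are Cauchy, locally uniformly in time. -/
theorem yosidaExp_cauchy (hA : IsSelfAdjoint A) (x : X) (T : ℝ) {ε : ℝ} (hε : 0 < ε) :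
    ∃ N, ∀ m ≥ N, ∀ l ≥ N, ∀ t : ℝ, |t| ≤ T →
      ‖yosidaExp hA m t x - yosidaExp hA l t x‖ < ε := by
  obtain ⟨y, hy, hxy⟩ := Metric.dense_iff.1 hA.dense_domain x (ε / 4) (by positivity)
  rw [Metric.mem_ball, dist_comm, dist_eq_norm] at hy
  have hc := (tendsto_yosida hA (A.mem_graph ⟨y, hxy⟩)).cauchySeq
  rw [Metric.cauchySeq_iff] at hc
  obtain ⟨N, hN⟩ := hc (ε / 4 / (|T| + 1)) (by positivity)
  refine ⟨N, fun m hm l hl t ht => ?_⟩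
  have h1 := norm_yosidaExp_sub_le hA m l t y
  have h2 := hN m hm l hl
  rw [dist_eq_norm] at h2
  have h3 : |t| * ‖yosida hA m y - yosida hA l y‖ ≤ ε / 4 := by
    calc _ ≤ (|T| + 1) * (ε / 4 / (|T| + 1)) := by
          gcongr
          · exact ht.trans ((le_abs_self T).trans (by linarith))
      _ = ε / 4 := by field_simp
  have h4 : yosidaExp hA m t x - yosidaExp hA l t x =
      yosidaExp hA m t (x - y) + (yosidaExp hA m t y - yosidaExp hA l t y) -
        yosidaExp hA l t (x - y) := by
    rw [map_sub, map_sub]; abel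
  rw [h4]
  calc _ ≤ _ := norm_sub_le _ _
    _ ≤ _ := add_le_add (norm_add_le _ _) le_rfl
    _ < ε := by
      rw [norm_yosidaExp, norm_yosidaExp]
      linarith

theorem yosidaExp_cauchySeq (hA : IsSelfAdjoint A) (t : ℝ) (x : X) :
    CauchySeq fun m => yosidaExp hA m t x := by
  rw [Metric.cauchySeq_iff]
  intro ε hε
  obtain ⟨N, hN⟩ := yosidaExp_cauchy hA x |t| hε
  exact ⟨N, fun m hm l hl => by rw [dist_eq_norm]; exact hN m hm l hl t le_rfl⟩

theorem exists_yosidaExp_limit (hA : IsSelfAdjoint A) (t : ℝ) (x : X) :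
    ∃ y, Tendsto (fun m => yosidaExp hA m t x) atTop (𝓝 y) :=
  cauchySeq_tendsto_of_complete (yosidaExp_cauchySeq hA t x)

/-- The unitary group `e^{-itA}` of a self-adjoint operator, as a linear map. -/
noncomputable def unitaryGroupAux (hA : IsSelfAdjoint A) (t : ℝ) : X →ₗ[ℂ] X where
  toFun x := (exists_yosidaExp_limit hA t x).choose
  map_add' x y := by
    refine tendsto_nhds_unique (exists_yosidaExp_limit hA t (x + y)).choose_spec ?_
    simpa only [map_add] using (exists_yosidaExp_limit hA t x).choose_spec.add
      (exists_yosidaExp_limit hA t y).choose_spec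
  map_smul' c x := by
    refine tendsto_nhds_unique (exists_yosidaExp_limit hA t (c • x)).choose_spec ?_
    simpa only [map_smul, RingHom.id_apply] using
      (exists_yosidaExp_limit hA t x).choose_spec.const_smul c

/-- The unitary group `e^{-itA}` of a self-adjoint operator. -/
noncomputable def unitaryGroup (hA : IsSelfAdjoint A) (t : ℝ) : X →L[ℂ] X :=
  (unitaryGroupAux hA t).mkContinuous 1 fun x => by
    rw [one_mul]
    refine le_of_tendsto (exists_yosidaExp_limit hA t x).choose_spec.norm ?_
    exact Eventually.of_forall fun m => (norm_yosidaExp hA m t x).le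

theorem tendsto_unitaryGroup (hA : IsSelfAdjoint A) (t : ℝ) (x : X) :
    Tendsto (fun m => yosidaExp hA m t x) atTop (𝓝 (unitaryGroup hA t x)) :=
  (exists_yosidaExp_limit hA t x).choose_spec

theorem norm_unitaryGroup (hA : IsSelfAdjoint A) (t : ℝ) (x : X) :
    ‖unitaryGroup hA t x‖ = ‖x‖ :=
  tendsto_nhds_unique (tendsto_unitaryGroup hA t x).norm
    (by simp only [norm_yosidaExp]; exact tendsto_const_nhds)

theorem inner_unitaryGroup (hA : IsSelfAdjoint A) (t : ℝ) (x y : X) :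
    inner ℂ (unitaryGroup hA t x) y = inner ℂ x (unitaryGroup hA (-t) y) := by
  refine tendsto_nhds_unique ((tendsto_unitaryGroup hA t x).inner tendsto_const_nhds) ?_
  simp only [inner_yosidaExp]
  exact tendsto_const_nhds.inner (tendsto_unitaryGroup hA (-t) y)

theorem unitaryGroup_zero (hA : IsSelfAdjoint A) : unitaryGroup hA 0 = 1 := by
  ext x
  refine tendsto_nhds_unique (tendsto_unitaryGroup hA 0 x) ?_
  simp only [yosidaExp_zero]
  exact tendsto_const_nhds

theorem unitaryGroup_add (hA : IsSelfAdjoint A) (s t : ℝ) :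
    unitaryGroup hA (s + t) = unitaryGroup hA s * unitaryGroup hA t := by
  ext x
  refine tendsto_nhds_unique (tendsto_unitaryGroup hA (s + t) x) ?_
  have h1 : Tendsto (fun m => yosidaExp hA m s (yosidaExp hA m t x - unitaryGroup hA t x))
      atTop (𝓝 0) := by
    rw [tendsto_zero_iff_norm_tendsto_zero]
    simp only [norm_yosidaExp]
    simpa using ((tendsto_unitaryGroup hA t x).sub_const (unitaryGroup hA t x)).norm
  have h2 := h1.add (tendsto_unitaryGroup hA s (unitaryGroup hA t x))
  rw [zero_add] at h2
  refine h2.congr fun m => ?_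
  rw [yosidaExp_add, mul_apply_eq_comp, map_sub, sub_add_cancel]

/-- The vector may vary with `m` so that the statement covers the derivatives as well, in which the
`m`-th Yosida approximation has acted on the initial vector. -/
theorem tendstoLocallyUniformlyOn_unitaryGroup (hA : IsSelfAdjoint A) {z : ℕ → X} {x : X}
    (hz : Tendsto z atTop (𝓝 x)) :
    TendstoLocallyUniformlyOn (fun m t => yosidaExp hA m t (z m)) (fun t => unitaryGroup hA t x)
      atTop Set.univ := by
  rw [Metric.tendstoLocallyUniformlyOn_iff]
  intro ε hε t _
  obtain ⟨N, hN⟩ := yosidaExp_cauchy hA x (|t| + 1) (show 0 < ε / 4 by positivity)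
  refine ⟨Metric.ball t 1, mem_nhdsWithin_of_mem_nhds (Metric.ball_mem_nhds t one_pos), ?_⟩
  have hz' : ∀ᶠ m in atTop, ‖x - z m‖ < ε / 4 := by
    have := Metric.tendsto_nhds.1 hz (ε / 4) (by positivity)
    simpa only [dist_eq_norm, norm_sub_rev] using this
  filter_upwards [hz', eventually_ge_atTop N] with m hm hmN s hs
  have hs' : |s| ≤ |t| + 1 := by
    rw [Metric.mem_ball, Real.dist_eq] at hs
    have := abs_sub_abs_le_abs_sub s t
    linarith
  have h1 : ‖unitaryGroup hA s x - yosidaExp hA m s x‖ ≤ ε / 4 := by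
    refine le_of_tendsto ((tendsto_unitaryGroup hA s x).sub_const (yosidaExp hA m s x)).norm ?_
    filter_upwards [eventually_ge_atTop N] with l hl
    exact (hN l hl m hmN s hs').le
  rw [dist_eq_norm]
  have h2 : unitaryGroup hA s x - yosidaExp hA m s (z m) =
      (unitaryGroup hA s x - yosidaExp hA m s x) + yosidaExp hA m s (x - z m) := by
    rw [map_sub]; abel
  rw [h2]
  calc _ ≤ _ := norm_add_le _ _
    _ < ε := by rw [norm_yosidaExp]; linarith

theorem continuous_unitaryGroup (hA : IsSelfAdjoint A) (x : X) :
    Continuous fun t => unitaryGroup hA t x := by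
  rw [← continuousOn_univ]
  refine (tendstoLocallyUniformlyOn_unitaryGroup hA (z := fun _ => x)
    tendsto_const_nhds).continuousOn (Eventually.of_forall fun m => ?_).frequently
  refine Continuous.continuousOn ?_
  have : Continuous (yosidaExp hA m) :=
    continuous_iff_continuousAt.2 fun t => (hasDerivAt_yosidaExp hA m t).continuousAt
  exact (ContinuousLinearMap.apply ℂ X x).continuous.comp this

/-- On the domain both the approximating orbits and their time derivatives converge, the latter
locally uniformly, so the limit may be differentiated. -/
theorem hasDerivAt_unitaryGroup (hA : IsSelfAdjoint A) {z : X × X} (hz : z ∈ A.graph) (t : ℝ) :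
    HasDerivAt (fun t => unitaryGroup hA t z.1) (unitaryGroup hA t (-Complex.I • z.2)) t := by
  refine hasDerivAt_of_tendstoLocallyUniformlyOn (l := atTop) isOpen_univ
    (tendstoLocallyUniformlyOn_unitaryGroup hA
      (z := fun m => -Complex.I • yosida hA m z.1) ((tendsto_yosida hA hz).const_smul _))
    (Eventually.of_forall fun m s _ => ?_) (fun s _ => tendsto_unitaryGroup hA s z.1)
    (Set.mem_univ t)
  exact (ContinuousLinearMap.apply ℂ X z.1).restrictScalars ℝ |>.hasFDerivAt.comp_hasDerivAt s
    (hasDerivAt_yosidaExp hA m s)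

/-- **Stone's theorem**: a self-adjoint operator generates a unitary group. -/
theorem isUnitaryGroupOf_unitaryGroup (hA : IsSelfAdjoint A) :
    IsUnitaryGroupOf A (unitaryGroup hA) where
  map_zero := unitaryGroup_zero hA
  map_add := unitaryGroup_add hA
  mem_unitary t := by
    have h : star (unitaryGroup hA t) = unitaryGroup hA (-t) := by
      rw [ContinuousLinearMap.star_eq_adjoint]
      symm
      rw [ContinuousLinearMap.eq_adjoint_iff]
      intro x y
      rw [inner_unitaryGroup, neg_neg]
    rw [Unitary.mem_iff, h, ← unitaryGroup_add, ← unitaryGroup_add, neg_add_cancel,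
      add_neg_cancel, unitaryGroup_zero]
    exact ⟨rfl, rfl⟩
  continuous := continuous_unitaryGroup hA
  generator ψ η := by
    constructor
    · intro h
      have := hasDerivAt_unitaryGroup hA h 0
      rwa [unitaryGroup_zero] at this
    -- Differentiability at `0` puts the vector in the domain of the adjoint: differentiate `⟨U(-t)
    -- z, ψ⟩ = ⟨z, U(t) ψ⟩` at `0` for `z` in the domain.
    · intro h
      apply hA.mem_graph_of_forall
      intro z hz
      have h1 : HasDerivAt (fun t => inner ℂ z.1 (unitaryGroup hA t ψ))
          (inner ℂ z.1 (-Complex.I • η)) 0 := by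
        have := (hasDerivAt_const (0 : ℝ) z.1).inner ℂ h
        simpa using this
      have h2 : HasDerivAt (fun t => unitaryGroup hA (-t) z.1) (-(-Complex.I • z.2)) 0 := by
        have h0 : HasDerivAt (fun t => unitaryGroup hA t z.1) (-Complex.I • z.2) (-0) := by
          have := hasDerivAt_unitaryGroup hA hz (-0)
          rw [neg_zero, unitaryGroup_zero] at this
          rwa [neg_zero]
        simpa [Function.comp_def] using h0.scomp 0 (hasDerivAt_neg 0)
      have h3 : HasDerivAt (fun t => inner ℂ (unitaryGroup hA (-t) z.1) ψ)
          (inner ℂ (-(-Complex.I • z.2)) ψ) 0 := by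
        have := h2.inner ℂ (hasDerivAt_const (0 : ℝ) ψ)
        simpa only [neg_zero, inner_zero_right, zero_add] using this
      have h4 : (fun t => inner ℂ (unitaryGroup hA (-t) z.1) ψ) =
          fun t => inner ℂ z.1 (unitaryGroup hA t ψ) := by
        ext t
        rw [inner_unitaryGroup, neg_neg]
      rw [h4] at h3
      have h5 := h3.unique h1
      rw [inner_neg_left, inner_smul_left, inner_smul_right] at h5
      simp only [map_neg, Complex.conj_I] at h5
      have hI : Complex.I * Complex.I = -1 := Complex.I_mul_I
      linear_combination Complex.I * h5 + (inner ℂ z.2 ψ - inner ℂ z.1 η) * hI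

end Stone

/-! ### Cook's method -/

section Cook

variable {X : Type*} [NormedAddCommGroup X]

/-- A mean value inequality with the explicit primitive of `C t^{-B}` as majorant bounds `m t - m s`
by a multiple of `s^{1-B}`, so `m` is Cauchy at infinity. -/
theorem exists_tendsto_of_norm_deriv_le [NormedSpace ℝ X] [CompleteSpace X] {m m' : ℝ → X}
    (hm : ∀ t, HasDerivAt m (m' t) t) {C B T : ℝ} (hB : 1 < B) (hT : 0 < T)
    (hb : ∀ t, T ≤ t → ‖m' t‖ ≤ C * t ^ (-B)) : ∃ L, Tendsto m atTop (𝓝 L) := by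
  have key : ∀ s t, T ≤ s → s ≤ t → ‖m t - m s‖ ≤ C / (B - 1) * s ^ (1 - B) := by
    intro s t hs hst
    have hpow : ∀ x, s ≤ x → HasDerivAt (fun x => C / (B - 1) * (s ^ (1 - B) - x ^ (1 - B)))
        (C * x ^ (-B)) x := fun x hx => by
      have hx0 : x ≠ 0 := (hT.trans_le (hs.trans hx)).ne'
      have := (((Real.hasDerivAt_rpow_const (p := 1 - B) (Or.inl hx0)).const_sub
        (s ^ (1 - B))).const_mul (C / (B - 1)))
      refine this.congr_deriv ?_
      have h1 : B - 1 ≠ 0 := by linarith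
      rw [show 1 - B - 1 = -B by ring]
      field_simp
      ring
    have h := image_norm_le_of_norm_deriv_right_le_deriv_boundary' (a := s) (b := t)
      (f := fun x => m x - m s) (f' := m')
      (fun x _ => ((hm x).sub_const _).continuousAt.continuousWithinAt)
      (fun x _ => ((hm x).sub_const _).hasDerivWithinAt)
      (B := fun x => C / (B - 1) * (s ^ (1 - B) - x ^ (1 - B))) (B' := fun x => C * x ^ (-B))
      (by simp) (fun x hx => (hpow x hx.1).continuousAt.continuousWithinAt)
      (fun x hx => (hpow x hx.1).hasDerivWithinAt)
      (fun x hx => hb x (hs.trans hx.1)) (Set.right_mem_Icc.2 hst)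
    refine h.trans ?_
    have hC : 0 ≤ C := by
      have := (norm_nonneg _).trans (hb T le_rfl)
      exact nonneg_of_mul_nonneg_left this (Real.rpow_pos_of_pos hT _)
    have h0 : 0 ≤ C / (B - 1) := div_nonneg hC (by linarith)
    gcongr
    have : 0 ≤ t ^ (1 - B) := Real.rpow_nonneg (hT.le.trans (hs.trans hst)) _
    linarith
  have hlim : Tendsto (fun s : ℝ => C / (B - 1) * s ^ (1 - B)) atTop (𝓝 0) := by
    have := (tendsto_rpow_neg_atTop (show 0 < B - 1 by linarith)).const_mul (C / (B - 1))
    simpa using this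
  have hc : CauchySeq m := by
    rw [Metric.cauchySeq_iff']
    intro ε hε
    obtain ⟨s, hs1, hs2⟩ := ((hlim.eventually (gt_mem_nhds hε)).and (eventually_ge_atTop T)).exists
    refine ⟨s, fun t ht => ?_⟩
    rw [dist_eq_norm]
    exact (key s t hs2 ht).trans_lt hs1
  exact cauchySeq_tendsto_of_complete hc

variable [InnerProductSpace ℂ X] [CompleteSpace X]

theorem Submodule.eq_top_of_orthogonal_trivial {S : Submodule ℂ X}
    (h : ∀ η : X, (∀ ψ ∈ S, inner ℂ η ψ = 0) → η = 0) : S.topologicalClosure = ⊤ := by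
  rw [Submodule.topologicalClosure_eq_top_iff, Submodule.eq_bot_iff]
  intro η hη
  rw [Submodule.mem_orthogonal'] at hη
  exact h η hη

/-- A uniformly bounded family that converges strongly on a total set converges strongly. -/
theorem exists_strong_limit {W : ℝ → X →L[ℂ] X} (hW : ∀ t x, ‖W t x‖ ≤ ‖x‖) {l : Filter ℝ}
    [l.NeBot] {D : Set X} (hD : ∀ η : X, (∀ ψ ∈ D, inner ℂ η ψ = 0) → η = 0)
    (hlim : ∀ ψ ∈ D, ∃ L, Tendsto (fun t => W t ψ) l (𝓝 L)) :
    ∃ Ω : X →L[ℂ] X, ∀ ψ, Tendsto (fun t => W t ψ) l (𝓝 (Ω ψ)) := by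
  let S : Submodule ℂ X :=
    { carrier := {ψ | ∃ L, Tendsto (fun t => W t ψ) l (𝓝 L)}
      zero_mem' := ⟨0, by simp⟩
      add_mem' := by
        rintro a b ⟨L, hL⟩ ⟨M, hM⟩
        exact ⟨L + M, by simpa using hL.add hM⟩
      smul_mem' := by
        rintro c a ⟨L, hL⟩
        exact ⟨c • L, by simpa using hL.const_smul c⟩ }
  have hS : S.topologicalClosure = ⊤ :=
    Submodule.eq_top_of_orthogonal_trivial fun η hη => hD η fun ψ hψ => hη ψ (hlim ψ hψ)
  have hall : ∀ ψ, ∃ L, Tendsto (fun t => W t ψ) l (𝓝 L) := by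
    intro ψ
    have hψ : ψ ∈ closure (S : Set X) := by
      rw [← Submodule.topologicalClosure_coe, hS]; trivial
    rw [← cauchy_map_iff_exists_tendsto, Metric.cauchy_iff]
    refine ⟨inferInstance, fun ε hε => ?_⟩
    obtain ⟨χ, ⟨L, hL⟩, hχ⟩ := Metric.mem_closure_iff.1 hψ (ε / 4) (by positivity)
    rw [dist_eq_norm] at hχ
    refine ⟨(fun t => W t ψ) '' {t | dist (W t χ) L < ε / 4}, image_mem_map
      (Metric.tendsto_nhds.1 hL (ε / 4) (by positivity)), ?_⟩
    rintro _ ⟨s, hs, rfl⟩ _ ⟨t, ht, rfl⟩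
    have h1 := hW s (ψ - χ)
    have h2 := hW t (ψ - χ)
    simp only [Set.mem_ofPred_eq, dist_eq_norm] at hs ht ⊢
    have e : W s ψ - W t ψ = W s (ψ - χ) + (W s χ - L) - (W t χ - L) - W t (ψ - χ) := by
      simp only [map_sub]; abel
    rw [e]
    have n1 := norm_sub_le (W s (ψ - χ) + (W s χ - L) - (W t χ - L)) (W t (ψ - χ))
    have n2 := norm_sub_le (W s (ψ - χ) + (W s χ - L)) (W t χ - L)
    have n3 := norm_add_le (W s (ψ - χ)) (W s χ - L)
    linarith
  choose Ω hΩ using hall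
  let Ω' : X →ₗ[ℂ] X :=
    { toFun := Ω
      map_add' := fun x y => by
        refine tendsto_nhds_unique (hΩ (x + y)) ?_
        simpa only [map_add] using (hΩ x).add (hΩ y)
      map_smul' := fun c x => by
        refine tendsto_nhds_unique (hΩ (c • x)) ?_
        simpa only [map_smul, RingHom.id_apply] using (hΩ x).const_smul c }
  refine ⟨Ω'.mkContinuous 1 fun x => ?_, hΩ⟩
  rw [one_mul]
  exact le_of_tendsto (hΩ x).norm (Eventually.of_forall fun t => hW t x)

variable {A₀ A : X →ₗ.[ℂ] X}

/-- The product rule needs care because the group is only strongly continuous. The orbit of the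
fixed vector `w t` is differentiable since that vector lies in the domain; on `w s - w t` isometry
lets the group act on the difference quotient. -/
theorem hasDerivAt_unitaryGroup_neg (hA : IsSelfAdjoint A) {w : ℝ → X} {w' b : X} {t : ℝ}
    (hw : HasDerivAt w w' t) (hb : (w t, b) ∈ A.graph) :
    HasDerivAt (fun s => unitaryGroup hA (-s) (w s))
      (unitaryGroup hA (-t) (Complex.I • b + w')) t := by
  have h1 : HasDerivAt (fun s => unitaryGroup hA (-s) (w t))
      (unitaryGroup hA (-t) (Complex.I • b)) t := by
    simpa [Function.comp_def] using (hasDerivAt_unitaryGroup hA hb (-t)).scomp t (hasDerivAt_neg t)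
  have h2 : HasDerivAt (fun s => unitaryGroup hA (-s) (w s - w t)) (unitaryGroup hA (-t) w') t := by
    rw [hasDerivAt_iff_tendsto_slope] at hw ⊢
    have c1 : Tendsto (fun s => unitaryGroup hA (-s) w') (𝓝[≠] t) (𝓝 (unitaryGroup hA (-t) w')) :=
      (((continuous_unitaryGroup hA w').comp continuous_neg).tendsto t).mono_left
        nhdsWithin_le_nhds
    have c2 : Tendsto (fun s => unitaryGroup hA (-s) (slope w t s - w')) (𝓝[≠] t) (𝓝 0) := by
      rw [tendsto_zero_iff_norm_tendsto_zero]
      simp only [norm_unitaryGroup]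
      simpa using (hw.sub_const w').norm
    have c3 := c2.add c1
    rw [zero_add] at c3
    refine c3.congr fun s => ?_
    have hreal : ∀ (c : ℝ) (x : X), unitaryGroup hA (-s) (c • x) = c • unitaryGroup hA (-s) x :=
      fun c x => by
        rw [← Complex.coe_smul, map_smul, Complex.coe_smul]
    simp only [slope, vsub_eq_sub, sub_self, map_zero, sub_zero, map_sub, hreal]
    abel
  have h3 := h1.add h2
  rw [← map_add] at h3
  refine h3.congr_of_eventuallyEq (Eventually.of_forall fun s => ?_)
  simp

/-- Uniqueness for the abstract Schrödinger equation: `e^{itA} u(t)` has zero derivative. -/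
theorem unitaryGroup_apply_eq (hA : IsSelfAdjoint A) {u η : ℝ → X}
    (hu : ∀ t, HasDerivAt u (-Complex.I • η t) t) (hg : ∀ t, (u t, η t) ∈ A.graph) (t : ℝ) :
    unitaryGroup hA t (u 0) = u t := by
  have h1 : ∀ t, HasDerivAt (fun s => unitaryGroup hA (-s) (u s)) 0 t := fun t => by
    have := hasDerivAt_unitaryGroup_neg hA (hu t) (hg t)
    simpa using this
  have h2 := is_const_of_deriv_eq_zero (fun t => (h1 t).differentiableAt) (fun t => (h1 t).deriv)
    t 0
  simp only [neg_zero, unitaryGroup_zero, one_apply_eq_self] at h2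
  rw [← h2, ← mul_apply_eq_comp, ← unitaryGroup_add, add_neg_cancel, unitaryGroup_zero,
    one_apply_eq_self]

/-- **Cook's method** for explicitly known free evolutions. -/
theorem waveOperatorsExist_of_cook (h₀ : IsSelfAdjoint A₀) (hA : IsSelfAdjoint A) {D : Set X}
    (hD : ∀ η : X, (∀ ψ ∈ D, inner ℂ η ψ = 0) → η = 0)
    (h : ∀ ψ ∈ D, ∃ u η v : ℝ → X, u 0 = ψ ∧ (∀ t, HasDerivAt u (-Complex.I • η t) t) ∧
      (∀ t, (u t, η t) ∈ A₀.graph) ∧ (∀ t, (u t, η t + v t) ∈ A.graph) ∧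
      ∃ C B T : ℝ, 1 < B ∧ 0 < T ∧ ∀ t, T ≤ |t| → ‖v t‖ ≤ C * |t| ^ (-B)) :
    WaveOperatorsExist A₀ A := by
  let W : ℝ → X →L[ℂ] X := fun t => unitaryGroup hA (-t) * unitaryGroup h₀ t
  have hW : ∀ t x, ‖W t x‖ ≤ ‖x‖ := fun t x => by
    simp only [W, mul_apply_eq_comp, norm_unitaryGroup, le_refl]
  have key : ∀ ψ ∈ D, (∃ L, Tendsto (fun t => W t ψ) atTop (𝓝 L)) ∧
      ∃ L, Tendsto (fun t => W t ψ) atBot (𝓝 L) := by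
    intro ψ hψ
    obtain ⟨u, η, v, rfl, hu, hg₀, hg, C, B, T, hB, hT, hv⟩ := h ψ hψ
    have hWu : ∀ t, W t (u 0) = unitaryGroup hA (-t) (u t) := fun t => by
      simp only [W, mul_apply_eq_comp, unitaryGroup_apply_eq h₀ hu hg₀]
    simp only [hWu]
    -- The two contributions of `η` cancel, and the derivative is `i e^{itA} v(t)`, whose norm is
    -- that of `v t`.
    have hd : ∀ t, HasDerivAt (fun t => unitaryGroup hA (-t) (u t))
        (unitaryGroup hA (-t) (Complex.I • v t)) t := fun t => by
      have := hasDerivAt_unitaryGroup_neg hA (hu t) (hg t)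
      refine this.congr_deriv ?_
      congr 1
      module
    have hn : ∀ t, ‖unitaryGroup hA (-t) (Complex.I • v t)‖ = ‖v t‖ := fun t => by
      rw [norm_unitaryGroup, norm_smul, Complex.norm_I, one_mul]
    constructor
    · refine exists_tendsto_of_norm_deriv_le hd hB hT (C := C) fun t ht => ?_
      have ht0 := abs_of_pos (hT.trans_le ht)
      rw [hn, ← ht0]
      nth_rw 1 [ht0]
      exact hv t (by rwa [ht0])
    · have hd' : ∀ t, HasDerivAt (fun t => unitaryGroup hA (- -t) (u (-t)))
          (-(unitaryGroup hA (- -t) (Complex.I • v (-t)))) t := fun t => by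
        simpa [Function.comp_def] using (hd (-t)).scomp t (hasDerivAt_neg t)
      obtain ⟨L, hL⟩ := exists_tendsto_of_norm_deriv_le hd' hB hT (C := C) fun t ht => by
        have ht0 : |(-t)| = t := by rw [abs_neg, abs_of_pos (hT.trans_le ht)]
        rw [norm_neg, hn]
        have := hv (-t) (by rwa [ht0])
        rwa [ht0] at this
      refine ⟨L, ?_⟩
      have := hL.comp tendsto_neg_atBot_atTop
      simpa [Function.comp_def] using this
  obtain ⟨Ωp, hp⟩ := exists_strong_limit hW hD fun ψ hψ => (key ψ hψ).1
  obtain ⟨Ωm, hm⟩ := exists_strong_limit hW hD fun ψ hψ => (key ψ hψ).2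
  exact ⟨unitaryGroup h₀, unitaryGroup hA, isUnitaryGroupOf_unitaryGroup h₀,
    isUnitaryGroupOf_unitaryGroup hA, Ωp, Ωm, fun ψ => ⟨hp ψ, hm ψ⟩⟩

end Cook

/-! ### Commutator and perturbation arguments on a core -/

section RelativeBounds

variable {X E : Type*} [NormedAddCommGroup X] [InnerProductSpace ℂ X] [AddCommGroup E] [Module ℂ E]

/-- The range of `f` has trivial orthogonal complement. -/
def HasTotalRange (f : E →ₗ[ℂ] X) : Prop :=
  ∀ η : X, (∀ φ, inner ℂ η (f φ) = 0) → η = 0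

theorem HasTotalRange.denseRange [CompleteSpace X] {f : E →ₗ[ℂ] X} (hf : HasTotalRange f) :
    DenseRange f := by
  have : (LinearMap.range f).topologicalClosure = ⊤ :=
    Submodule.eq_top_of_orthogonal_trivial fun η hη => hf η fun φ => hη _ ⟨φ, rfl⟩
  rw [DenseRange, dense_iff_closure_eq]
  have h2 := congrArg (fun S : Submodule ℂ X => (S : Set X)) this
  rw [Submodule.topologicalClosure_coe] at h2
  exact h2

theorem HasTotalRange.exists_seq [CompleteSpace X] {f : E →ₗ[ℂ] X} (hf : HasTotalRange f) (η : X) :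
    ∃ φ : ℕ → E, Tendsto (fun k => f (φ k)) atTop (𝓝 η) := by
  obtain ⟨x, hx, hlim⟩ := mem_closure_iff_seq_limit.1 (hf.denseRange η)
  choose φ hφ using hx
  exact ⟨φ, by simpa only [hφ] using hlim⟩

/-- The form of the commutator argument of Faris and Lavine. -/
theorem eq_zero_of_commutator_bound [CompleteSpace X] {j T N : E →ₗ[ℂ] X} (hj : HasTotalRange j)
    (hN : HasTotalRange N) (hNs : ∀ φ χ, inner ℂ (N φ) (j χ) = inner ℂ (j φ) (N χ))
    {c d : ℝ} (hT : ∀ φ, ‖T φ‖ ≤ c * ‖N φ‖)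
    (hN1 : ∀ φ, ‖j φ‖ ^ 2 ≤ (inner ℂ (N φ) (j φ)).re)
    (hcom : ∀ φ, |(inner ℂ (N φ) (T φ)).im| ≤ d * (inner ℂ (N φ) (j φ)).re)
    {K : ℝ} (hK : d < |K|) {η : X}
    (hη : ∀ φ, inner ℂ η (T φ + ((K : ℂ) * Complex.I) • j φ) = 0) : η = 0 := by
  -- Choose `N φ_k → η`. As `η` is orthogonal to `(T + iK) φ_k`, the inner products of `N φ_k` with
  -- these vectors tend to zero; their imaginary parts dominate `(|K| - d) ⟨N φ_k, j φ_k⟩`, so `j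
  -- φ_k → 0`. By symmetry `⟨η, j χ⟩` is the limit of `⟨j φ_k, N χ⟩`, which is zero.
  obtain ⟨φ, hφ⟩ := hN.exists_seq η
  have hjN : ∀ φ, ‖j φ‖ ≤ ‖N φ‖ := fun φ => by
    by_contra! hcon
    have h1 := (hN1 φ).trans ((Complex.re_le_norm _).trans (norm_inner_le_norm _ _))
    nlinarith [norm_nonneg (N φ)]
  have hs : Tendsto (fun k => inner ℂ (N (φ k)) (T (φ k) + ((K : ℂ) * Complex.I) • j (φ k)))
      atTop (𝓝 0) := by
    have hb : ∀ k, ‖inner ℂ (N (φ k)) (T (φ k) + ((K : ℂ) * Complex.I) • j (φ k))‖ ≤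
        ‖N (φ k) - η‖ * ((c + |K|) * ‖N (φ k)‖) := fun k => by
      have e : inner ℂ (N (φ k)) (T (φ k) + ((K : ℂ) * Complex.I) • j (φ k)) =
          inner ℂ (N (φ k) - η) (T (φ k) + ((K : ℂ) * Complex.I) • j (φ k)) := by
        rw [inner_sub_left, hη, sub_zero]
      rw [e]
      refine (norm_inner_le_norm _ _).trans ?_
      gcongr
      refine (norm_add_le _ _).trans ?_
      rw [norm_smul, add_mul]
      simp only [Complex.norm_mul, Complex.norm_real, Complex.norm_I, mul_one, Real.norm_eq_abs]
      exact add_le_add (hT _) (by gcongr; exact hjN _)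
    refine squeeze_zero_norm hb ?_
    have h1 : Tendsto (fun k => ‖N (φ k) - η‖) atTop (𝓝 0) := by
      simpa using (hφ.sub_const η).norm
    simpa using h1.mul (hφ.norm.const_mul (c + |K|))
  have hj0 : Tendsto (fun k => ‖j (φ k)‖ ^ 2) atTop (𝓝 0) := by
    refine squeeze_zero (fun k => by positivity) (fun k => ?_)
      (g := fun k => (|K| - d)⁻¹ * ‖inner ℂ (N (φ k)) (T (φ k) + ((K : ℂ) * Complex.I) • j (φ k))‖)
      (by simpa using hs.norm.const_mul (|K| - d)⁻¹)
    have hpos : 0 < |K| - d := by linarith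
    rw [← div_eq_inv_mul, le_div_iff₀ hpos]
    have h1 := hN1 (φ k)
    have h2 := hcom (φ k)
    have him : (inner ℂ (N (φ k)) (T (φ k) + ((K : ℂ) * Complex.I) • j (φ k))).im =
        (inner ℂ (N (φ k)) (T (φ k))).im + K * (inner ℂ (N (φ k)) (j (φ k))).re := by
      rw [inner_add_right, inner_smul_right]
      simp [Complex.mul_im]
    have h3 := Complex.abs_im_le_norm
      (inner ℂ (N (φ k)) (T (φ k) + ((K : ℂ) * Complex.I) • j (φ k)))
    rw [him] at h3
    have h4 : 0 ≤ (inner ℂ (N (φ k)) (j (φ k))).re := (sq_nonneg _).trans h1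
    have h5 : |K| * (inner ℂ (N (φ k)) (j (φ k))).re =
        |K * (inner ℂ (N (φ k)) (j (φ k))).re| := by rw [abs_mul, abs_of_nonneg h4]
    have h6 := abs_sub_abs_le_abs_sub (K * (inner ℂ (N (φ k)) (j (φ k))).re)
      (-(inner ℂ (N (φ k)) (T (φ k))).im)
    rw [abs_neg, sub_neg_eq_add, add_comm (K * _)] at h6
    nlinarith
  have hj1 : Tendsto (fun k => j (φ k)) atTop (𝓝 0) := by
    rw [tendsto_zero_iff_norm_tendsto_zero]
    have := hj0.sqrt
    simpa using this
  apply hj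
  intro χ
  have l1 : Tendsto (fun k => inner ℂ (N (φ k)) (j χ)) atTop (𝓝 (inner ℂ η (j χ))) :=
    hφ.inner tendsto_const_nhds
  have l2 : Tendsto (fun k => inner ℂ (j (φ k)) (N χ)) atTop (𝓝 (inner ℂ 0 (N χ))) :=
    hj1.inner tendsto_const_nhds
  simp only [hNs] at l1
  rw [tendsto_nhds_unique l1 l2, inner_zero_left]

/-- Density of the range is stable under small relatively bounded perturbations. -/
theorem HasTotalRange.add [CompleteSpace X] {A V : E →ₗ[ℂ] X} (hA : HasTotalRange A) {a : ℝ}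
    (ha : a < 1) (hV : ∀ φ, ‖V φ‖ ≤ a * ‖A φ‖) : HasTotalRange (A + V) := by
  intro η hη
  obtain ⟨φ, hφ⟩ := hA.exists_seq η
  have l1 : Tendsto (fun k => ‖inner ℂ η (A (φ k))‖) atTop (𝓝 ‖inner ℂ η η‖) :=
    (tendsto_const_nhds.inner hφ).norm
  have l2 : Tendsto (fun k => ‖η‖ * (a * ‖A (φ k)‖)) atTop (𝓝 (‖η‖ * (a * ‖η‖))) :=
    (hφ.norm.const_mul a).const_mul _
  have h := le_of_tendsto_of_tendsto' l1 l2 fun k => by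
    have h1 := hη (φ k)
    rw [LinearMap.add_apply, inner_add_right] at h1
    rw [eq_neg_of_add_eq_zero_left h1, norm_neg]
    exact (norm_inner_le_norm _ _).trans (by gcongr; exact hV _)
  rw [inner_self_eq_norm_sq_to_K] at h
  simp only [Complex.coe_algebraMap, norm_pow, Complex.norm_real, norm_norm] at h
  have : ‖η‖ = 0 := by
    by_contra h0
    have : 0 < ‖η‖ := lt_of_le_of_ne (norm_nonneg _) (Ne.symm h0)
    nlinarith [mul_pos this this]
  exact norm_eq_zero.1 this

theorem norm_le_norm_add_smul {A j : E →ₗ[ℂ] X} (φ : E) (hA : 0 ≤ (inner ℂ (A φ) (j φ)).re)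
    {s : ℝ} (hs : 0 ≤ s) : ‖A φ‖ ≤ ‖(A + (s : ℂ) • j) φ‖ := by
  apply (sq_le_sq₀ (by positivity) (norm_nonneg _)).1
  rw [LinearMap.add_apply, LinearMap.smul_apply, @norm_add_sq ℂ, inner_smul_right]
  have : RCLike.re ((s : ℂ) * inner ℂ (A φ) (j φ)) = s * (inner ℂ (A φ) (j φ)).re := by
    simp
  rw [this]
  nlinarith [mul_nonneg hs hA, sq_nonneg ‖(s : ℂ) • j φ‖]

/-- A symmetric relatively bounded perturbation with bound `< 1` of a symmetric operator `A ≥ 1`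
with dense ranges `A + s`, `s ≥ 0`, is nonnegative. -/
theorem nonneg_of_relative_bound [CompleteSpace X] {j A V : E →ₗ[ℂ] X}
    (hA : ∀ s : ℝ, 0 ≤ s → HasTotalRange (A + (s : ℂ) • j))
    (hA1 : ∀ φ, ‖j φ‖ ^ 2 ≤ (inner ℂ (A φ) (j φ)).re)
    (hS : ∀ φ χ, inner ℂ ((A + V) φ) (j χ) = inner ℂ (j φ) ((A + V) χ))
    {a : ℝ} (ha0 : 0 ≤ a) (ha : a < 1) (hV : ∀ φ, ‖V φ‖ ≤ a * ‖A φ‖) (φ : E) :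
    0 ≤ (inner ℂ ((A + V) φ) (j φ)).re := by
  have hA0 : ∀ φ, 0 ≤ (inner ℂ (A φ) (j φ)).re := fun φ => (sq_nonneg _).trans (hA1 φ)
  have hjA : ∀ φ, ‖j φ‖ ≤ ‖A φ‖ := fun φ => by
    by_contra! hcon
    have h1 := (hA1 φ).trans ((Complex.re_le_norm _).trans (norm_inner_le_norm _ _))
    nlinarith [norm_nonneg (A φ)]
  have hlow : ∀ s : ℝ, 0 ≤ s → ∀ φ, (1 - a) * ‖A φ‖ ≤ ‖(A + V + (s : ℂ) • j) φ‖ :=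
    fun s hs φ => by
      have h1 := norm_le_norm_add_smul φ (hA0 φ) hs
      have h2 : (A + V + (s : ℂ) • j) φ = (A + (s : ℂ) • j) φ + V φ := by
        simp only [LinearMap.add_apply]; abel
      have h3 := norm_sub_le_norm_add ((A + (s : ℂ) • j) φ) (V φ)
      rw [h2]
      have := hV φ
      linarith
  have htot : ∀ s : ℝ, 0 ≤ s → HasTotalRange (A + V + (s : ℂ) • j) := fun s hs => by
    have := (hA s hs).add ha (V := V) fun φ => (hV φ).trans (by
      gcongr; exact norm_le_norm_add_smul φ (hA0 φ) hs)
    rwa [add_right_comm] at this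
  have hSd : HasTotalRange (A + V) := by simpa using htot 0 le_rfl
  have h1a : 0 < 1 - a := by linarith
  have hjS : ∀ φ, ‖j φ‖ ≤ (1 - a)⁻¹ * ‖(A + V) φ‖ := fun φ => by
    rw [← div_eq_inv_mul, le_div_iff₀ h1a, mul_comm]
    refine le_trans ?_ (by simpa using hlow 0 le_rfl φ)
    gcongr
    exact hjA φ
  -- `G` is the bounded inverse of `A + V`, extended from its dense range. Positivity of `A + V` is
  -- read off from the spectrum of the bounded operator `G`.
  let G : X →L[ℂ] X := j.extendOfNorm (A + V)
  have hG : ∀ φ, G ((A + V) φ) = j φ := LinearMap.extendOfNorm_eq hSd.denseRange ⟨_, hjS⟩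
  have hGsa : IsSelfAdjoint G := by
    rw [ContinuousLinearMap.isSelfAdjoint_iff_isSymmetric]
    intro x y
    refine hSd.denseRange.induction_on₂ (p := fun x y => inner ℂ (G x) y = inner ℂ x (G y))
      ?_ (fun φ χ => ?_) x y
    · exact isClosed_eq (by fun_prop) (by fun_prop)
    · rw [hG, hG, hS]
  have hGpos : 0 ≤ G := by
    rw [StarOrderedRing.nonneg_iff_spectrum_nonneg (R := ℝ) G hGsa]
    intro r hr
    by_contra! hr0
    apply hr
    -- A negative `r` lies in the resolvent set because `r - G = r (1 + s G)` and `1 + s G` extends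
    -- `(A + V + s)(A + V)⁻¹`, which is bounded below and has dense range by the estimates above.
    let s : ℝ := -r⁻¹
    have hs : 0 < s := neg_pos.2 (inv_lt_zero.2 hr0)
    let M : X →L[ℂ] X := 1 + (s : ℂ) • G
    have hMS : ∀ φ, M ((A + V) φ) = (A + V + (s : ℂ) • j) φ := fun φ => by
      change (A + V) φ + (s : ℂ) • G ((A + V) φ) = (A + V) φ + (s : ℂ) • j φ
      rw [hG]
    have hbd : ∀ x, ‖x‖ ≤ ((1 + a) / (1 - a)) * ‖M x‖ := fun x => by
      refine hSd.denseRange.induction_on (p := fun x => ‖x‖ ≤ ((1 + a) / (1 - a)) * ‖M x‖) x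
        (isClosed_le (by fun_prop) (by fun_prop)) fun φ => ?_
      rw [hMS, div_mul_eq_mul_div, le_div_iff₀ h1a]
      have h1 := hlow s hs.le φ
      have h2 : ‖(A + V) φ‖ ≤ (1 + a) * ‖A φ‖ :=
        (norm_add_le _ _).trans (by have := hV φ; linarith)
      nlinarith
    have hanti : AntilipschitzWith (Real.toNNReal ((1 + a) / (1 - a))) M := by
      apply AddMonoidHomClass.antilipschitz_of_bound
      intro x
      rw [Real.coe_toNNReal _ (by positivity)]
      exact hbd x
    have hrange : LinearMap.range M.toLinearMap = ⊤ := by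
      have hcl : IsClosed (LinearMap.range M.toLinearMap : Set X) :=
        hanti.isClosed_range M.uniformContinuous
      rw [← hcl.submodule_topologicalClosure_eq]
      refine Submodule.eq_top_of_orthogonal_trivial fun η hη => htot s hs.le η fun φ => ?_
      exact hη _ ⟨(A + V) φ, hMS φ⟩
    have hMu : IsUnit M := by
      let e := ContinuousLinearEquiv.ofBijective M (LinearMap.ker_eq_bot.2 hanti.injective) hrange
      have : M = (e : X →L[ℂ] X) := by ext x; rfl
      rw [this]
      exact (ContinuousLinearEquiv.toUnit e).isUnit
    have hfac : algebraMap ℝ (X →L[ℂ] X) r - G = (r : ℂ) • M := by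
      ext x
      have hrs : (r : ℂ) * (s : ℂ) = -1 := by
        simp only [s]
        push_cast
        have : (r : ℂ) ≠ 0 := by exact_mod_cast hr0.ne
        field_simp
      change r • x - G x = (r : ℂ) • (x + (s : ℂ) • G x)
      rw [smul_add, smul_smul, hrs, Complex.coe_smul, neg_one_smul, sub_eq_add_neg]
    rw [spectrum.mem_resolventSet_iff, hfac]
    have hr' : IsUnit (r : ℂ) := by
      rw [isUnit_iff_ne_zero]; exact_mod_cast hr0.ne
    rw [← one_mul M, ← smul_mul_assoc, ← Algebra.algebraMap_eq_smul_one]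
    exact (hr'.map (algebraMap ℂ (X →L[ℂ] X))).mul hMu
  have hfin := ((ContinuousLinearMap.nonneg_iff_isPositive G).1 hGpos).re_inner_nonneg_left
    ((A + V) φ)
  rw [hG, ← hS] at hfin
  exact hfin

/-- A nonnegative essentially self-adjoint operator plus a positive constant has dense range. -/
theorem HasTotalRange.add_smul_of_nonneg [CompleteSpace X] {j T : E →ₗ[ℂ] X}
    (hTs : ∀ φ χ, inner ℂ (T φ) (j χ) = inner ℂ (j φ) (T χ))
    (hT0 : ∀ φ, 0 ≤ (inner ℂ (T φ) (j φ)).re)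
    (hp : HasTotalRange (T + Complex.I • j)) (hm : HasTotalRange (T - Complex.I • j))
    {b : ℝ} (hb : 0 < b) : HasTotalRange (T + (b : ℂ) • j) := by
  intro η hη
  -- For `η` orthogonal to the range of `T + b`, approximate `(-b + i) η` by `(T + i) φ_k`. Then `j
  -- φ_k` converges, necessarily to `η`, and the nonnegative numbers `Re ⟨T φ_k, j φ_k⟩` tend to `-b
  -- ‖η‖²`.
  obtain ⟨φ, hφ⟩ := hp.exists_seq ((-(b : ℂ) + Complex.I) • η)
  have hn : ∀ χ, ‖(T + Complex.I • j) χ‖ ^ 2 = ‖T χ‖ ^ 2 + ‖j χ‖ ^ 2 := fun χ => by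
    have h0 := hTs χ χ
    have him : (inner ℂ (T χ) (j χ)).im = 0 := by
      have := inner_conj_symm (𝕜 := ℂ) (T χ) (j χ)
      rw [← h0] at this
      exact Complex.conj_eq_iff_im.1 this
    rw [LinearMap.add_apply, LinearMap.smul_apply, @norm_add_sq ℂ, inner_smul_right, norm_smul]
    simp [him]
  have hle : ∀ χ, ‖j χ‖ ≤ ‖(T + Complex.I • j) χ‖ := fun χ => by
    apply (sq_le_sq₀ (norm_nonneg _) (norm_nonneg _)).1
    rw [hn]
    nlinarith [sq_nonneg ‖T χ‖]
  have hcau : CauchySeq fun k => j (φ k) := by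
    have h1 := hφ.cauchySeq
    rw [Metric.cauchySeq_iff] at h1 ⊢
    intro ε hε
    obtain ⟨M, hM⟩ := h1 ε hε
    refine ⟨M, fun m hm n hn => lt_of_le_of_lt ?_ (hM m hm n hn)⟩
    rw [dist_eq_norm, dist_eq_norm, ← map_sub, ← map_sub]
    exact hle _
  obtain ⟨ψ, hψ⟩ := cauchySeq_tendsto_of_complete hcau
  have hψη : ψ - η = 0 := by
    apply hm
    intro χ
    have l1 : Tendsto (fun k => inner ℂ (j (φ k)) ((T - Complex.I • j) χ)) atTop
        (𝓝 (inner ℂ ψ ((T - Complex.I • j) χ))) := hψ.inner tendsto_const_nhds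
    have l2 : Tendsto (fun k => inner ℂ ((T + Complex.I • j) (φ k)) (j χ)) atTop
        (𝓝 (inner ℂ ((-(b : ℂ) + Complex.I) • η) (j χ))) := hφ.inner tendsto_const_nhds
    have e : ∀ k, inner ℂ (j (φ k)) ((T - Complex.I • j) χ) =
        inner ℂ ((T + Complex.I • j) (φ k)) (j χ) := fun k => by
      simp only [LinearMap.sub_apply, LinearMap.add_apply, LinearMap.smul_apply, inner_sub_right,
        inner_add_left, inner_smul_left, inner_smul_right, hTs, Complex.conj_I]
      ring
    simp only [e] at l1
    have h1 := tendsto_nhds_unique l1 l2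
    have h2 := hη χ
    rw [LinearMap.add_apply, LinearMap.smul_apply, inner_add_right, inner_smul_right] at h2
    rw [inner_sub_left, h1, inner_smul_left, LinearMap.sub_apply, LinearMap.smul_apply,
      inner_sub_right, inner_smul_right]
    simp only [map_add, map_neg, Complex.conj_ofReal, Complex.conj_I]
    linear_combination -h2
  have hψη' : ψ = η := sub_eq_zero.1 hψη
  rw [hψη'] at hψ
  have l3 : Tendsto (fun k => (inner ℂ ((T + Complex.I • j) (φ k)) (j (φ k))).re) atTop
      (𝓝 (inner ℂ ((-(b : ℂ) + Complex.I) • η) η).re) :=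
    (Complex.continuous_re.tendsto _).comp (hφ.inner hψ)
  have h4 : 0 ≤ (inner ℂ ((-(b : ℂ) + Complex.I) • η) η).re := by
    refine ge_of_tendsto l3 (Eventually.of_forall fun k => ?_)
    have e : (inner ℂ ((T + Complex.I • j) (φ k)) (j (φ k))).re =
        (inner ℂ (T (φ k)) (j (φ k))).re := by
      rw [LinearMap.add_apply, LinearMap.smul_apply, inner_add_left, inner_smul_left,
        inner_self_eq_norm_sq_to_K]
      simp [← Complex.ofReal_pow]
    rw [e]
    exact hT0 _
  rw [inner_smul_left, inner_self_eq_norm_sq_to_K] at h4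
  simp only [map_add, map_neg, Complex.conj_ofReal, Complex.conj_I, Complex.coe_algebraMap,
    ← Complex.ofReal_pow] at h4
  simp only [Complex.mul_re, Complex.add_re, Complex.neg_re, Complex.ofReal_re, Complex.I_re,
    neg_zero, add_zero, Complex.ofReal_im, mul_zero, sub_zero] at h4
  have : ‖η‖ ^ 2 = 0 := by
    by_contra h0
    have : 0 < ‖η‖ ^ 2 := lt_of_le_of_ne (sq_nonneg _) (Ne.symm h0)
    nlinarith [mul_pos hb this]
  exact norm_eq_zero.1 (pow_eq_zero_iff two_ne_zero |>.1 this)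

/-- Along the evolution a deficiency vector satisfies `d/dt ⟨ζ, u⟩ = -K ⟨ζ, u⟩`, so `e^{Kt} ⟨ζ,
u(t)⟩` is constant. Symmetry of the closed graph keeps `‖u(t)‖` fixed, so letting `K t → -∞` shows
that this constant is zero. No generator of the evolution is needed, only membership in the closed
graph. -/
theorem inner_eq_zero_of_flow {j T : E →ₗ[ℂ] X}
    (hTs : ∀ φ χ, inner ℂ (T φ) (j χ) = inner ℂ (j φ) (T χ)) {u η : ℝ → X}
    (hu : ∀ t, HasDerivAt u (-Complex.I • η t) t)
    (hg : ∀ t, (u t, η t) ∈ closure (Set.range fun φ => (j φ, T φ)))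
    {K : ℝ} (hK : K ≠ 0) {ζ : X} (hζ : ∀ φ, inner ℂ ζ (T φ + ((K : ℂ) * Complex.I) • j φ) = 0) :
    inner ℂ ζ (u 0) = 0 := by
  have h1 : ∀ t, inner ℂ ζ (η t + ((K : ℂ) * Complex.I) • u t) = 0 := fun t => by
    have hc : IsClosed {z : X × X | inner ℂ ζ (z.2 + ((K : ℂ) * Complex.I) • z.1) = 0} :=
      isClosed_eq (by fun_prop) continuous_const
    refine closure_minimal ?_ hc (hg t)
    rintro _ ⟨φ, rfl⟩
    exact hζ φ
  have h2 : ∀ t, inner ℂ (η t) (u t) = inner ℂ (u t) (η t) := fun t => by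
    have hc : IsClosed {z : X × X | inner ℂ z.2 z.1 = inner ℂ z.1 z.2} :=
      isClosed_eq (by fun_prop) (by fun_prop)
    refine closure_minimal ?_ hc (hg t)
    rintro _ ⟨φ, rfl⟩
    exact hTs φ φ
  have h3 : ∀ t, ‖u t‖ = ‖u 0‖ := by
    have hd : ∀ t, HasDerivAt (fun t => inner ℂ (u t) (u t)) 0 t := fun t => by
      refine ((hu t).inner ℂ (hu t)).congr_deriv ?_
      rw [inner_smul_left, inner_smul_right, h2]
      simp
    intro t
    have := is_const_of_deriv_eq_zero (fun t => (hd t).differentiableAt) (fun t => (hd t).deriv) t 0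
    rw [@norm_eq_sqrt_re_inner ℂ, this, ← @norm_eq_sqrt_re_inner ℂ]
  have h4 : ∀ t, HasDerivAt (fun t : ℝ => Complex.exp (K * t) * inner ℂ ζ (u t)) 0 t := fun t => by
    have e1 : HasDerivAt (fun t : ℝ => Complex.exp (K * t)) (Complex.exp (K * t) * K) t := by
      have := ((Complex.ofRealCLM.hasDerivAt (x := t)).const_mul (K : ℂ)).cexp
      simpa using this
    have e2 := (hasDerivAt_const t ζ).inner ℂ (hu t)
    refine (e1.mul e2).congr_deriv ?_
    have := h1 t
    rw [inner_add_right, inner_smul_right] at this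
    rw [inner_zero_left, add_zero, inner_smul_right, eq_neg_of_add_eq_zero_left this]
    have hI : Complex.I * Complex.I = -1 := Complex.I_mul_I
    linear_combination (Complex.exp (K * t) * K * inner ℂ ζ (u t)) * hI
  have h5 : ∀ t : ℝ, Complex.exp (K * t) * inner ℂ ζ (u t) = inner ℂ ζ (u 0) := fun t => by
    have := is_const_of_deriv_eq_zero (fun t => (h4 t).differentiableAt) (fun t => (h4 t).deriv) t 0
    simpa using this
  have h6 : ∀ r : ℝ, 0 ≤ r → ‖inner ℂ ζ (u 0)‖ ≤ Real.exp (-r) * (‖ζ‖ * ‖u 0‖) := fun r _ => by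
    rw [← h5 (-r / K), norm_mul, Complex.norm_exp]
    have e : ((K : ℂ) * ((-r / K : ℝ) : ℂ)).re = -r := by
      rw [← Complex.ofReal_mul, Complex.ofReal_re]
      field_simp
    rw [e]
    gcongr
    rw [← h3 (-r / K)]
    exact norm_inner_le_norm _ _
  have h7 : Tendsto (fun r : ℝ => Real.exp (-r) * (‖ζ‖ * ‖u 0‖)) atTop (𝓝 0) := by
    simpa using Real.tendsto_exp_neg_atTop_nhds_zero.mul_const (‖ζ‖ * ‖u 0‖)
  have h8 : ‖inner ℂ ζ (u 0)‖ ≤ 0 :=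
    ge_of_tendsto h7 ((eventually_ge_atTop 0).mono h6)
  exact norm_le_zero_iff.1 h8

end RelativeBounds

/-! ### Derivatives, coordinates and the oscillator on test functions -/

section TestFunctions

variable {n : ℕ}

/-- The space `C_c^∞(ℝⁿ)`. -/
def testFunctions (n : ℕ) : Submodule ℂ (RSpace n → ℂ) where
  carrier := {φ | ContDiff ℝ ∞ φ ∧ HasCompactSupport φ}
  zero_mem' := ⟨contDiff_const, HasCompactSupport.zero⟩
  add_mem' := fun ha hb => ⟨ha.1.add hb.1, ha.2.add hb.2⟩
  smul_mem' := fun c _ ha => ⟨contDiff_const.smul ha.1, ha.2.smul_left (f := fun _ => c)⟩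

/-- The standard basis vectors of `ℝⁿ`. -/
noncomputable def stdVec (i : Fin n) : RSpace n := EuclideanSpace.single i (1 : ℝ)

namespace testFunctions

theorem contDiff (φ : testFunctions n) : ContDiff ℝ ∞ (φ : RSpace n → ℂ) := φ.2.1

theorem hasCompactSupport (φ : testFunctions n) : HasCompactSupport (φ : RSpace n → ℂ) := φ.2.2

theorem differentiable (φ : testFunctions n) : Differentiable ℝ (φ : RSpace n → ℂ) :=
  (contDiff φ).differentiable (by simp)

theorem continuous (φ : testFunctions n) : Continuous (φ : RSpace n → ℂ) := (contDiff φ).continuous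

theorem memLp (φ : testFunctions n) (p : ENNReal) : MemLp (φ : RSpace n → ℂ) p volume :=
  (continuous φ).memLp_of_hasCompactSupport (hasCompactSupport φ)

/-- Partial derivatives on test functions. -/
noncomputable def D (i : Fin n) : testFunctions n →ₗ[ℂ] testFunctions n where
  toFun φ := ⟨fun x => fderiv ℝ (φ : RSpace n → ℂ) x (stdVec i),
    ((contDiff φ).fderiv_right (m := ∞) (by simp)).clm_apply contDiff_const,
    (hasCompactSupport φ).fderiv_apply ℝ _⟩
  map_add' φ χ := by
    ext x
    change fderiv ℝ ((φ : RSpace n → ℂ) + (χ : RSpace n → ℂ)) x (stdVec i) = _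
    rw [fderiv_add (differentiable φ x) (differentiable χ x)]
    rfl
  map_smul' c φ := by
    ext x
    change fderiv ℝ (c • (φ : RSpace n → ℂ)) x (stdVec i) = _
    rw [fderiv_const_smul (differentiable φ x)]
    rfl

/-- Multiplication by a coordinate on test functions. -/
noncomputable def Q (i : Fin n) : testFunctions n →ₗ[ℂ] testFunctions n where
  toFun φ := ⟨fun x => ((x i : ℝ) : ℂ) * (φ : RSpace n → ℂ) x, by
    have h : ContDiff ℝ ∞ fun x : RSpace n => ((x i : ℝ) : ℂ) :=
      Complex.ofRealCLM.contDiff.comp (contDiff_piLp_apply (p := 2))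
    exact h.mul (contDiff φ), (hasCompactSupport φ).mul_left⟩
  map_add' φ χ := by
    ext x
    change ((x i : ℝ) : ℂ) * ((φ : RSpace n → ℂ) x + (χ : RSpace n → ℂ) x) = _
    rw [mul_add]
    rfl
  map_smul' c φ := by
    ext x
    change ((x i : ℝ) : ℂ) * (c * (φ : RSpace n → ℂ) x) = c * (((x i : ℝ) : ℂ) * _)
    ring

theorem D_apply (i : Fin n) (φ : testFunctions n) (x : RSpace n) :
    (D i φ : RSpace n → ℂ) x = fderiv ℝ (φ : RSpace n → ℂ) x (stdVec i) := rfl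

theorem Q_apply (i : Fin n) (φ : testFunctions n) (x : RSpace n) :
    (Q i φ : RSpace n → ℂ) x = ((x i : ℝ) : ℂ) * (φ : RSpace n → ℂ) x := rfl

theorem D_comm (i k : Fin n) (φ : testFunctions n) : D i (D k φ) = D k (D i φ) := by
  ext x
  have hd : DifferentiableAt ℝ (fderiv ℝ (φ : RSpace n → ℂ)) x :=
    ((contDiff φ).fderiv_right (m := 1) (by norm_cast)).differentiable (by simp) x
  have key : ∀ i k : Fin n, (D i (D k φ) : RSpace n → ℂ) x =
      fderiv ℝ (fderiv ℝ (φ : RSpace n → ℂ)) x (stdVec i) (stdVec k) := fun i k => by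
    rw [D_apply]
    change fderiv ℝ (fun y => fderiv ℝ (φ : RSpace n → ℂ) y (stdVec k)) x (stdVec i) = _
    rw [fderiv_clm_apply hd (differentiableAt_const _)]
    simp
  rw [key, key]
  have := (contDiff_infty.1 (contDiff φ) 2).contDiffAt (x := x) |>.isSymmSndFDerivAt
    (by simp)
  exact this _ _

theorem Q_comm (i k : Fin n) (φ : testFunctions n) : Q i (Q k φ) = Q k (Q i φ) := by
  ext x
  simp only [Q_apply]
  ring

theorem D_Q (i k : Fin n) (φ : testFunctions n) :
    D i (Q k φ) = (if i = k then φ else 0) + Q k (D i φ) := by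
  ext x
  have h1 : HasFDerivAt (fun x : RSpace n => ((x k : ℝ) : ℂ))
      (Complex.ofRealCLM.comp (EuclideanSpace.proj k : RSpace n →L[ℝ] ℝ)) x :=
    (Complex.ofRealCLM.comp (EuclideanSpace.proj k : RSpace n →L[ℝ] ℝ)).hasFDerivAt
  have h2 := h1.mul (differentiable φ x).hasFDerivAt
  rw [D_apply]
  change fderiv ℝ (fun x : RSpace n => ((x k : ℝ) : ℂ) * (φ : RSpace n → ℂ) x) x (stdVec i) = _
  have h3 : fderiv ℝ (fun x : RSpace n => ((x k : ℝ) : ℂ) * (φ : RSpace n → ℂ) x) x = _ := h2.fderiv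
  rw [h3]
  change _ = ((if i = k then φ else 0 : testFunctions n) : RSpace n → ℂ) x +
    ((x k : ℝ) : ℂ) * fderiv ℝ (φ : RSpace n → ℂ) x (stdVec i)
  by_cases h : i = k
  · subst h
    simp [stdVec, add_comm]
  · simp [stdVec, h, Ne.symm h]

/-- The Laplacian on test functions. -/
noncomputable def lap : testFunctions n →ₗ[ℂ] testFunctions n := ∑ i, D i ∘ₗ D i

theorem lap_eq (φ : testFunctions n) : lap φ = ∑ i, D i (D i φ) := by
  simp [lap, LinearMap.sum_apply]

theorem lap_apply (φ : testFunctions n) (x : RSpace n) :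
    (lap φ : RSpace n → ℂ) x = Laplacian.laplacian (φ : RSpace n → ℂ) x := by
  rw [InnerProductSpace.laplacian_eq_iteratedFDeriv_orthonormalBasis _
    (EuclideanSpace.basisFun (Fin n) ℝ), lap_eq, Submodule.coe_sum, Finset.sum_apply]
  refine Finset.sum_congr rfl fun i _ => ?_
  have hd : DifferentiableAt ℝ (fderiv ℝ (φ : RSpace n → ℂ)) x :=
    ((contDiff φ).fderiv_right (m := 1) (by norm_cast)).differentiable (by simp) x
  rw [iteratedFDeriv_two_apply, D_apply]
  change fderiv ℝ (fun y => fderiv ℝ (φ : RSpace n → ℂ) y (stdVec i)) x (stdVec i) = _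
  rw [fderiv_clm_apply hd (differentiableAt_const _)]
  simp [stdVec]

/-- The embedding of test functions in `L²`. -/
noncomputable def toL2 : testFunctions n →ₗ[ℂ] L2 n where
  toFun φ := (memLp φ 2).toLp _
  map_add' _ _ := rfl
  map_smul' _ _ := rfl

theorem coeFn_toL2 (φ : testFunctions n) : toL2 φ =ᵐ[volume] (φ : RSpace n → ℂ) :=
  (memLp φ 2).coeFn_toLp

/-- Multiplication by a locally square integrable function as a map into `L²`. -/
noncomputable def mulL2 (q : RSpace n → ℝ)
    (hq : ∀ φ : testFunctions n, MemLp (fun x => (q x : ℂ) * (φ : RSpace n → ℂ) x) 2 volume) :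
    testFunctions n →ₗ[ℂ] L2 n where
  toFun φ := (hq φ).toLp _
  map_add' φ χ := by
    rw [← MemLp.toLp_add]
    congr 1
    ext x
    simp [mul_add]
  map_smul' c φ := by
    rw [RingHom.id_apply, ← MemLp.toLp_const_smul]
    congr 1
    ext x
    simp only [SetLike.val_smul, Pi.smul_apply, smul_eq_mul]
    ring

theorem coeFn_mulL2 (q : RSpace n → ℝ) (hq) (φ : testFunctions n) :
    mulL2 q hq φ =ᵐ[volume] fun x => (q x : ℂ) * (φ : RSpace n → ℂ) x :=
  (hq φ).coeFn_toLp

theorem hasTotalRange_toL2 : HasTotalRange (toL2 : testFunctions n →ₗ[ℂ] L2 n) := by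
  intro η hη
  have hd : Dense (Set.range (toL2 : testFunctions n →ₗ[ℂ] L2 n)) := by
    refine (Lp.dense_hasCompactSupport_contDiff (F := ℂ) (μ := (volume : Measure (RSpace n)))
      (p := 2) (by simp)).mono ?_
    rintro f ⟨g, hfg, hg1, hg2⟩
    refine ⟨⟨g, hg2, hg1⟩, ?_⟩
    apply Lp.ext
    exact (coeFn_toL2 _).trans hfg.symm
  apply hd.eq_zero_of_inner_left ℂ
  rintro _ ⟨φ, rfl⟩
  exact hη φ

theorem inner_toL2 (φ χ : testFunctions n) : inner ℂ (toL2 φ) (toL2 χ) =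
    ∫ x, (starRingEnd ℂ) ((φ : RSpace n → ℂ) x) * (χ : RSpace n → ℂ) x := by
  rw [L2.inner_def]
  apply integral_congr_ae
  filter_upwards [coeFn_toL2 φ, coeFn_toL2 χ] with x h1 h2
  rw [h1, h2]
  simp [mul_comm]

theorem inner_D (i : Fin n) (φ χ : testFunctions n) :
    inner ℂ (toL2 (D i φ)) (toL2 χ) = -inner ℂ (toL2 φ) (toL2 (D i χ)) := by
  rw [inner_toL2, inner_toL2]
  have hc : ∀ y, HasFDerivAt (fun x => (starRingEnd ℂ) ((φ : RSpace n → ℂ) x))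
      ((Complex.conjCLE : ℂ →L[ℝ] ℂ).comp (fderiv ℝ (φ : RSpace n → ℂ) y)) y := fun y =>
    (Complex.conjCLE : ℂ →L[ℝ] ℂ).hasFDerivAt.comp y (differentiable φ y).hasFDerivAt
  have hcont : ∀ φ : testFunctions n, Continuous fun x => (starRingEnd ℂ) ((φ : RSpace n → ℂ) x) :=
    fun φ => Complex.continuous_conj.comp (continuous φ)
  have hint : ∀ φ χ : testFunctions n, Integrable
      (fun x => (starRingEnd ℂ) ((φ : RSpace n → ℂ) x) * (χ : RSpace n → ℂ) x) volume := fun φ χ =>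
    ((hcont φ).mul (continuous χ)).integrable_of_hasCompactSupport (hasCompactSupport χ).mul_left
  have e : ∀ x, fderiv ℝ (fun x => (starRingEnd ℂ) ((φ : RSpace n → ℂ) x)) x (stdVec i) =
      (starRingEnd ℂ) ((D i φ : RSpace n → ℂ) x) := fun x => by
    rw [(hc x).fderiv]; rfl
  have := integral_mul_fderiv_eq_neg_fderiv_mul_of_integrable (μ := (volume : Measure (RSpace n)))
    (f := fun x => (starRingEnd ℂ) ((φ : RSpace n → ℂ) x)) (g := (χ : RSpace n → ℂ))
    (v := stdVec i) (by simp only [e]; exact hint (D i φ) χ) (hint φ (D i χ)) (hint φ χ)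
    (fun x _ => (hc x).differentiableAt) (fun x _ => differentiable χ x)
  simp only [e] at this
  rw [eq_neg_iff_add_eq_zero, add_comm, ← eq_neg_iff_add_eq_zero]
  exact this

theorem inner_Q (i : Fin n) (φ χ : testFunctions n) :
    inner ℂ (toL2 (Q i φ)) (toL2 χ) = inner ℂ (toL2 φ) (toL2 (Q i χ)) := by
  rw [inner_toL2, inner_toL2]
  congr 1
  ext x
  simp only [Q_apply, map_mul, Complex.conj_ofReal]
  ring

theorem inner_mulL2 (q : RSpace n → ℝ) (hq) (φ χ : testFunctions n) :
    inner ℂ (mulL2 q hq φ) (toL2 χ) = inner ℂ (toL2 φ) (mulL2 q hq χ) := by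
  rw [L2.inner_def, L2.inner_def]
  apply integral_congr_ae
  filter_upwards [coeFn_toL2 φ, coeFn_toL2 χ, coeFn_mulL2 q hq φ, coeFn_mulL2 q hq χ]
    with x h1 h2 h3 h4
  rw [h1, h2, h3, h4]
  simp only [RCLike.inner_apply, map_mul, Complex.conj_ofReal]
  ring

/-- The inner product of two real multiples of one function is real. -/
theorem im_inner_eq_zero {f g : L2 n} {a b : RSpace n → ℝ} {h : RSpace n → ℂ}
    (hf : f =ᵐ[volume] fun x => (a x : ℂ) * h x) (hg : g =ᵐ[volume] fun x => (b x : ℂ) * h x) :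
    (inner ℂ f g).im = 0 := by
  have hi := L2.integrable_inner (𝕜 := ℂ) f g
  rw [L2.inner_def]
  refine (integral_im hi).symm.trans ?_
  apply integral_eq_zero_of_ae
  filter_upwards [hf, hg] with x h1 h2
  rw [h1, h2]
  simp only [RCLike.inner_apply, map_mul, Complex.conj_ofReal, Pi.zero_apply, RCLike.im_to_complex,
    Complex.mul_im, Complex.mul_re, Complex.ofReal_re, Complex.ofReal_im, Complex.conj_re,
    Complex.conj_im]
  ring

/-- Multiplication by `∑ (c_k x_k² + e_k x_k)` on test functions. -/
noncomputable def quad (c e : Fin n → ℝ) : testFunctions n →ₗ[ℂ] testFunctions n :=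
  ∑ k, ((c k : ℂ) • (Q k ∘ₗ Q k) + (e k : ℂ) • Q k)

theorem quad_eq (c e : Fin n → ℝ) (φ : testFunctions n) :
    quad c e φ = ∑ k, ((c k : ℂ) • Q k (Q k φ) + (e k : ℂ) • Q k φ) := by
  simp only [quad, LinearMap.sum_apply, LinearMap.add_apply, LinearMap.smul_apply,
    LinearMap.comp_apply]

theorem quad_apply (c e : Fin n → ℝ) (φ : testFunctions n) (x : RSpace n) :
    (quad c e φ : RSpace n → ℂ) x =
      ((∑ k, (c k * x k ^ 2 + e k * x k) : ℝ) : ℂ) * (φ : RSpace n → ℂ) x := by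
  rw [quad_eq, Submodule.coe_sum, Finset.sum_apply, Complex.ofReal_sum, Finset.sum_mul]
  refine Finset.sum_congr rfl fun k _ => ?_
  change (c k : ℂ) * ((x k : ℂ) * ((x k : ℂ) * (φ : RSpace n → ℂ) x)) +
    (e k : ℂ) * ((x k : ℂ) * (φ : RSpace n → ℂ) x) = _
  push_cast
  ring

theorem inner_quad (c e : Fin n → ℝ) (φ χ : testFunctions n) :
    inner ℂ (toL2 (quad c e φ)) (toL2 χ) = inner ℂ (toL2 φ) (toL2 (quad c e χ)) := by
  simp only [quad_eq, map_sum, map_add, map_smul, sum_inner, inner_sum, inner_add_left,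
    inner_add_right, inner_smul_left, inner_smul_right, inner_Q, Complex.conj_ofReal]

theorem inner_lap (φ χ : testFunctions n) :
    inner ℂ (toL2 (lap φ)) (toL2 χ) = inner ℂ (toL2 φ) (toL2 (lap χ)) := by
  simp only [lap_eq, map_sum, sum_inner, inner_sum, inner_D, neg_neg]

/-- One derivative of each kind is moved across by parts, so every cross term is a square. Summation
bounds the full Hessian by the Laplacian in `L²`. -/
theorem inner_D_D (i k : Fin n) (φ : testFunctions n) :
    inner ℂ (toL2 (D i (D i φ))) (toL2 (D k (D k φ))) = (‖toL2 (D i (D k φ))‖ ^ 2 : ℝ) := by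
  rw [inner_D, D_comm i k (D k φ), ← inner_D, D_comm k i φ]
  simp [inner_self_eq_norm_sq_to_K]

theorem norm_lap_sq (φ : testFunctions n) :
    ‖toL2 (lap φ)‖ ^ 2 = ∑ i, ∑ k, ‖toL2 (D i (D k φ))‖ ^ 2 := by
  have h : inner ℂ (toL2 (lap φ)) (toL2 (lap φ)) =
      ((∑ i, ∑ k, ‖toL2 (D i (D k φ))‖ ^ 2 : ℝ) : ℂ) := by
    simp only [lap_eq, map_sum, sum_inner, inner_sum, inner_D_D]
    push_cast
    exact Finset.sum_comm
  rw [inner_self_eq_norm_sq_to_K] at h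
  refine Complex.ofReal_injective (Eq.trans ?_ h)
  simp

theorem norm_D_D_le (i k : Fin n) (φ : testFunctions n) :
    ‖toL2 (D i (D k φ))‖ ≤ ‖toL2 (lap φ)‖ := by
  apply (sq_le_sq₀ (norm_nonneg _) (norm_nonneg _)).1
  rw [norm_lap_sq]
  calc ‖toL2 (D i (D k φ))‖ ^ 2 ≤ ∑ k, ‖toL2 (D i (D k φ))‖ ^ 2 :=
        Finset.single_le_sum (f := fun k => ‖toL2 (D i (D k φ))‖ ^ 2)
          (fun _ _ => by positivity) (Finset.mem_univ k)
    _ ≤ _ := Finset.single_le_sum (f := fun i => ∑ k, ‖toL2 (D i (D k φ))‖ ^ 2)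
          (fun _ _ => by positivity) (Finset.mem_univ i)

theorem inner_neg_lap_self (φ : testFunctions n) :
    inner ℂ (toL2 (-lap φ)) (toL2 φ) = ((∑ i, ‖toL2 (D i φ)‖ ^ 2 : ℝ) : ℂ) := by
  simp only [lap_eq, map_neg, map_sum, inner_neg_left, sum_inner, inner_D, ← Finset.sum_neg_distrib]
  push_cast
  refine Finset.sum_congr rfl fun i _ => ?_
  rw [← inner_D, inner_self_eq_norm_sq_to_K]
  simp

theorem norm_D_sq_le (i : Fin n) (φ : testFunctions n) :
    ‖toL2 (D i φ)‖ ^ 2 ≤ ‖toL2 (lap φ)‖ * ‖toL2 φ‖ := by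
  calc ‖toL2 (D i φ)‖ ^ 2 ≤ ∑ i, ‖toL2 (D i φ)‖ ^ 2 :=
        Finset.single_le_sum (f := fun i => ‖toL2 (D i φ)‖ ^ 2)
          (fun _ _ => by positivity) (Finset.mem_univ i)
    _ = (inner ℂ (toL2 (-lap φ)) (toL2 φ)).re := by rw [inner_neg_lap_self, Complex.ofReal_re]
    _ ≤ ‖inner ℂ (toL2 (-lap φ)) (toL2 φ)‖ := Complex.re_le_norm _
    _ ≤ _ := by
      refine (norm_inner_le_norm _ _).trans ?_
      rw [map_neg, norm_neg]

theorem norm_D_le (i : Fin n) (φ : testFunctions n) :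
    ‖toL2 (D i φ)‖ ≤ ‖toL2 (lap φ)‖ + ‖toL2 φ‖ := by
  have h := norm_D_sq_le i φ
  apply (sq_le_sq₀ (norm_nonneg _) (by positivity)).1
  nlinarith [norm_nonneg (toL2 (lap φ)), norm_nonneg (toL2 φ),
    mul_nonneg (norm_nonneg (toL2 (lap φ))) (norm_nonneg (toL2 φ))]

theorem inner_Q_Q (i k : Fin n) (φ : testFunctions n) :
    inner ℂ (toL2 (Q i (Q i φ))) (toL2 (Q k (Q k φ))) = (‖toL2 (Q i (Q k φ))‖ ^ 2 : ℝ) := by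
  rw [inner_Q, Q_comm i k (Q k φ), ← inner_Q, Q_comm k i φ]
  simp [inner_self_eq_norm_sq_to_K]

/-- Multiplication by `|x|²`. -/
noncomputable abbrev rsq : testFunctions n →ₗ[ℂ] testFunctions n := quad (fun _ => 1) fun _ => 0

theorem rsq_eq (φ : testFunctions n) : rsq φ = ∑ k, Q k (Q k φ) := by
  simp [rsq, quad_eq]

theorem norm_rsq_sq (φ : testFunctions n) :
    ‖toL2 (rsq φ)‖ ^ 2 = ∑ i, ∑ k, ‖toL2 (Q i (Q k φ))‖ ^ 2 := by
  have h : inner ℂ (toL2 (rsq φ)) (toL2 (rsq φ)) =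
      ((∑ i, ∑ k, ‖toL2 (Q i (Q k φ))‖ ^ 2 : ℝ) : ℂ) := by
    simp only [rsq_eq, map_sum, sum_inner, inner_sum, inner_Q_Q]
    push_cast
    exact Finset.sum_comm
  rw [inner_self_eq_norm_sq_to_K] at h
  refine Complex.ofReal_injective (Eq.trans ?_ h)
  simp

theorem norm_Q_Q_le (i k : Fin n) (φ : testFunctions n) :
    ‖toL2 (Q i (Q k φ))‖ ≤ ‖toL2 (rsq φ)‖ := by
  apply (sq_le_sq₀ (norm_nonneg _) (norm_nonneg _)).1
  rw [norm_rsq_sq]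
  calc ‖toL2 (Q i (Q k φ))‖ ^ 2 ≤ ∑ k, ‖toL2 (Q i (Q k φ))‖ ^ 2 :=
        Finset.single_le_sum (f := fun k => ‖toL2 (Q i (Q k φ))‖ ^ 2)
          (fun _ _ => by positivity) (Finset.mem_univ k)
    _ ≤ _ := Finset.single_le_sum (f := fun i => ∑ k, ‖toL2 (Q i (Q k φ))‖ ^ 2)
          (fun _ _ => by positivity) (Finset.mem_univ i)

theorem inner_rsq_self (φ : testFunctions n) :
    inner ℂ (toL2 (rsq φ)) (toL2 φ) = ((∑ i, ‖toL2 (Q i φ)‖ ^ 2 : ℝ) : ℂ) := by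
  simp only [rsq_eq, map_sum, sum_inner, inner_Q]
  push_cast
  refine Finset.sum_congr rfl fun i _ => ?_
  rw [← inner_Q, inner_self_eq_norm_sq_to_K]
  simp

theorem norm_Q_le (i : Fin n) (φ : testFunctions n) :
    ‖toL2 (Q i φ)‖ ≤ ‖toL2 (rsq φ)‖ + ‖toL2 φ‖ := by
  have h : ‖toL2 (Q i φ)‖ ^ 2 ≤ ‖toL2 (rsq φ)‖ * ‖toL2 φ‖ := by
    calc ‖toL2 (Q i φ)‖ ^ 2 ≤ ∑ i, ‖toL2 (Q i φ)‖ ^ 2 :=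
          Finset.single_le_sum (f := fun i => ‖toL2 (Q i φ)‖ ^ 2)
            (fun _ _ => by positivity) (Finset.mem_univ i)
      _ = (inner ℂ (toL2 (rsq φ)) (toL2 φ)).re := by rw [inner_rsq_self, Complex.ofReal_re]
      _ ≤ ‖inner ℂ (toL2 (rsq φ)) (toL2 φ)‖ := Complex.re_le_norm _
      _ ≤ _ := norm_inner_le_norm _ _
  apply (sq_le_sq₀ (norm_nonneg _) (by positivity)).1
  nlinarith [norm_nonneg (toL2 (rsq φ)), norm_nonneg (toL2 φ),
    mul_nonneg (norm_nonneg (toL2 (rsq φ))) (norm_nonneg (toL2 φ))]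

theorem norm_quad_le (c e : Fin n → ℝ) (φ : testFunctions n) :
    ‖toL2 (quad c e φ)‖ ≤ (∑ k, (|c k| + |e k|)) * (‖toL2 (rsq φ)‖ + ‖toL2 φ‖) := by
  rw [quad_eq, map_sum, Finset.sum_mul]
  refine (norm_sum_le _ _).trans (Finset.sum_le_sum fun k _ => ?_)
  rw [map_add, map_smul, map_smul, add_mul]
  refine (norm_add_le _ _).trans ?_
  rw [norm_smul, norm_smul, Complex.norm_real, Complex.norm_real, Real.norm_eq_abs,
    Real.norm_eq_abs]
  gcongr
  · exact (norm_Q_Q_le k k φ).trans (by have := norm_nonneg (toL2 φ); linarith)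
  · exact norm_Q_le k φ

/-- Moving one `∂_i` and one `x_k` across leaves a square; the commutator correction appears only
when the two directions agree. -/
theorem inner_neg_D_D_Q_Q (i k : Fin n) (φ : testFunctions n) :
    -inner ℂ (toL2 (D i (D i φ))) (toL2 (Q k (Q k φ))) =
      (‖toL2 (Q k (D i φ))‖ ^ 2 : ℝ) +
        if i = k then 2 * inner ℂ (toL2 (D i φ)) (toL2 (Q i φ)) else 0 := by
  rw [inner_D, neg_neg, D_Q, D_Q, map_add, map_add, map_add, inner_add_right, inner_add_right,
    ← inner_Q, ← inner_Q, inner_self_eq_norm_sq_to_K]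
  by_cases h : i = k
  · subst h
    simp only [if_true, inner_Q, Complex.coe_algebraMap]
    push_cast
    ring
  · simp [h]

/-- The canonical commutation relation, together with the antisymmetry of `∂_i` and the symmetry of
`x_i`. -/
theorem re_inner_D_Q (i : Fin n) (φ : testFunctions n) :
    2 * (inner ℂ (toL2 (D i φ)) (toL2 (Q i φ))).re = -‖toL2 φ‖ ^ 2 := by
  have h : inner ℂ (toL2 (D i φ)) (toL2 (Q i φ)) =
      -(‖toL2 φ‖ ^ 2 : ℝ) - (starRingEnd ℂ) (inner ℂ (toL2 (D i φ)) (toL2 (Q i φ))) := by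
    rw [inner_conj_symm]
    nth_rw 1 [inner_D]
    rw [D_Q, if_pos rfl, map_add, inner_add_right, inner_self_eq_norm_sq_to_K, ← inner_Q]
    simp only [Complex.coe_algebraMap]
    push_cast
    ring
  have h2 := congrArg Complex.re h
  simp only [Complex.sub_re, Complex.neg_re, Complex.ofReal_re, Complex.conj_re] at h2
  linarith

/-- The harmonic oscillator `-Δ + |x|²` on test functions. -/
noncomputable def oscillator : testFunctions n →ₗ[ℂ] testFunctions n := -lap + rsq

/-- In the expansion of the square the cross term `2 Re ⟨-Δφ, |x|²φ⟩` is a sum of squares up to one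
correction `-‖φ‖²` for each coordinate, counted twice; hence the constant `2n`. -/
theorem oscillator_bound (φ : testFunctions n) :
    ‖toL2 (lap φ)‖ ^ 2 + ‖toL2 (rsq φ)‖ ^ 2 ≤ ‖toL2 (oscillator φ)‖ ^ 2 + 2 * n * ‖toL2 φ‖ ^ 2 := by
  have h1 : ‖toL2 (oscillator φ)‖ ^ 2 = ‖toL2 (lap φ)‖ ^ 2 +
      2 * (-inner ℂ (toL2 (lap φ)) (toL2 (rsq φ))).re + ‖toL2 (rsq φ)‖ ^ 2 := by
    rw [oscillator, LinearMap.add_apply, LinearMap.neg_apply, map_add, map_neg, @norm_add_sq ℂ,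
      norm_neg, inner_neg_left]
    rfl
  have h2 : (-inner ℂ (toL2 (lap φ)) (toL2 (rsq φ))).re =
      ∑ i, ∑ k, (-inner ℂ (toL2 (D i (D i φ))) (toL2 (Q k (Q k φ)))).re := by
    simp only [lap_eq, rsq_eq, map_sum, sum_inner, inner_sum, Complex.neg_re, Complex.re_sum,
      Finset.sum_neg_distrib]
    rw [Finset.sum_comm]
  have h3 : -(n * ‖toL2 φ‖ ^ 2) ≤ (-inner ℂ (toL2 (lap φ)) (toL2 (rsq φ))).re := by
    rw [h2]
    have : -(n * ‖toL2 φ‖ ^ 2) = ∑ i : Fin n, ∑ k : Fin n, if i = k then -‖toL2 φ‖ ^ 2 else 0 := by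
      simp
    rw [this]
    refine Finset.sum_le_sum fun i _ => Finset.sum_le_sum fun k _ => ?_
    rw [inner_neg_D_D_Q_Q, Complex.add_re, Complex.ofReal_re]
    have hp := sq_nonneg ‖toL2 (Q k (D i φ))‖
    split_ifs with h
    · have := re_inner_D_Q i φ
      rw [show (2 * inner ℂ (toL2 (D i φ)) (toL2 (Q i φ))).re =
        2 * (inner ℂ (toL2 (D i φ)) (toL2 (Q i φ))).re by simp]
      linarith
    · simp
  rw [h1]
  linarith

theorem inner_oscillator_self (φ : testFunctions n) :
    inner ℂ (toL2 (oscillator φ)) (toL2 φ) =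
      ((∑ i, (‖toL2 (D i φ)‖ ^ 2 + ‖toL2 (Q i φ)‖ ^ 2) : ℝ) : ℂ) := by
  rw [oscillator, LinearMap.add_apply, LinearMap.neg_apply, map_add, inner_add_left,
    inner_neg_lap_self, inner_rsq_self, Finset.sum_add_distrib]
  push_cast
  ring

theorem inner_oscillator (φ χ : testFunctions n) :
    inner ℂ (toL2 (oscillator φ)) (toL2 χ) = inner ℂ (toL2 φ) (toL2 (oscillator χ)) := by
  simp only [oscillator, LinearMap.add_apply, LinearMap.neg_apply, map_add, map_neg,
    inner_add_left, inner_add_right, inner_neg_left, inner_neg_right, inner_lap]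
  rw [inner_quad]

/-- The commutator of `-Δ` with a polynomial of degree two is controlled by the oscillator. -/
theorem abs_im_inner_lap_quad_le (c e : Fin n → ℝ) (φ : testFunctions n) :
    |(inner ℂ (toL2 (-lap φ)) (toL2 (quad c e φ))).im| ≤ (∑ k, (|c k| + |e k|)) *
      ((inner ℂ (toL2 (oscillator φ)) (toL2 φ)).re + ‖toL2 φ‖ ^ 2) := by
  have h1 : ∀ i k, (-inner ℂ (toL2 (D i (D i φ))) (toL2 (Q k φ))).im =
      if i = k then (inner ℂ (toL2 (D i φ)) (toL2 φ)).im else 0 := fun i k => by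
    rw [inner_D, neg_neg, D_Q, map_add, inner_add_right]
    have hr : (inner ℂ (toL2 (D i φ)) (toL2 (Q k (D i φ)))).im = 0 := by
      have := inner_conj_symm (𝕜 := ℂ) (toL2 (D i φ)) (toL2 (Q k (D i φ)))
      rw [inner_Q] at this
      exact Complex.conj_eq_iff_im.1 this
    rw [Complex.add_im, hr, add_zero]
    split_ifs <;> simp
  have h2 : ∀ i k, (-inner ℂ (toL2 (D i (D i φ))) (toL2 (Q k (Q k φ)))).im =
      if i = k then 2 * (inner ℂ (toL2 (D i φ)) (toL2 (Q i φ))).im else 0 := fun i k => by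
    rw [inner_neg_D_D_Q_Q, Complex.add_im, Complex.ofReal_im, zero_add]
    split_ifs <;> simp
  have h3 : (inner ℂ (toL2 (-lap φ)) (toL2 (quad c e φ))).im =
      ∑ k, (c k * (2 * (inner ℂ (toL2 (D k φ)) (toL2 (Q k φ))).im) +
        e k * (inner ℂ (toL2 (D k φ)) (toL2 φ)).im) := by
    have : inner ℂ (toL2 (-lap φ)) (toL2 (quad c e φ)) =
        ∑ k, ∑ i, ((c k : ℂ) * (-inner ℂ (toL2 (D i (D i φ))) (toL2 (Q k (Q k φ)))) +
          (e k : ℂ) * (-inner ℂ (toL2 (D i (D i φ))) (toL2 (Q k φ)))) := by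
      simp only [lap_eq, quad_eq, map_neg, map_sum, map_add, map_smul, inner_neg_left, sum_inner,
        inner_sum, inner_add_right, inner_smul_right, Finset.mul_sum, Finset.sum_add_distrib, ← Finset.sum_neg_distrib]
    rw [this, Complex.im_sum]
    refine Finset.sum_congr rfl fun k _ => ?_
    rw [Complex.im_sum]
    simp only [Complex.add_im, Complex.im_ofReal_mul, h1, h2]
    simp [Finset.sum_add_distrib]
  rw [h3, Finset.sum_mul]
  refine (Finset.abs_sum_le_sum_abs _ _).trans (Finset.sum_le_sum fun k _ => ?_)
  have hk : ‖toL2 (D k φ)‖ ^ 2 + ‖toL2 (Q k φ)‖ ^ 2 ≤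
      (inner ℂ (toL2 (oscillator φ)) (toL2 φ)).re := by
    rw [inner_oscillator_self, Complex.ofReal_re]
    exact Finset.single_le_sum (f := fun i => ‖toL2 (D i φ)‖ ^ 2 + ‖toL2 (Q i φ)‖ ^ 2)
      (fun _ _ => by positivity) (Finset.mem_univ k)
  have b1 : |(inner ℂ (toL2 (D k φ)) (toL2 (Q k φ))).im| ≤ ‖toL2 (D k φ)‖ * ‖toL2 (Q k φ)‖ :=
    (Complex.abs_im_le_norm _).trans (norm_inner_le_norm _ _)
  have b2 : |(inner ℂ (toL2 (D k φ)) (toL2 φ)).im| ≤ ‖toL2 (D k φ)‖ * ‖toL2 φ‖ :=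
    (Complex.abs_im_le_norm _).trans (norm_inner_le_norm _ _)
  refine (abs_add_le _ _).trans ?_
  rw [abs_mul, abs_mul, abs_mul, abs_two, add_mul]
  gcongr
  · nlinarith [sq_nonneg (‖toL2 (D k φ)‖ - ‖toL2 (Q k φ)‖), sq_nonneg ‖toL2 φ‖]
  · nlinarith [sq_nonneg (‖toL2 (D k φ)‖ - ‖toL2 φ‖), sq_nonneg ‖toL2 (Q k φ)‖,
      sq_nonneg ‖toL2 (D k φ)‖, sq_nonneg ‖toL2 φ‖]

end testFunctions

end TestFunctions

/-! ### Essential self-adjointness of the Hamiltonians -/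

section EssentialSelfAdjointness

variable {n : ℕ}

open testFunctions

/-- Multiplication by `q` maps test functions to `L²`. -/
def IsLocallyL2 (q : RSpace n → ℝ) : Prop :=
  ∀ φ : testFunctions n, MemLp (fun x => (q x : ℂ) * (φ : RSpace n → ℂ) x) 2 volume

/-- `V` is bounded relative to the Laplacian, with bound zero. -/
def IsLaplacianSmall (V : RSpace n → ℝ) : Prop :=
  ∃ hV : IsLocallyL2 V, ∀ ε > 0, ∃ C, 0 ≤ C ∧ ∀ φ : testFunctions n,
    ‖mulL2 V hV φ‖ ≤ ε * ‖toL2 (lap φ)‖ + C * ‖toL2 φ‖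

/-- The operator `-Δ + ∑ (c_k x_k² + e_k x_k) + V` from test functions to `L²`. -/
noncomputable def hamiltonian (c e : Fin n → ℝ) (V : RSpace n → ℝ) (hV : IsLocallyL2 V) :
    testFunctions n →ₗ[ℂ] L2 n :=
  toL2 ∘ₗ (-lap + quad c e) + mulL2 V hV

theorem hamiltonian_apply (c e : Fin n → ℝ) (V : RSpace n → ℝ) (hV) (φ : testFunctions n) :
    hamiltonian c e V hV φ = -toL2 (lap φ) + toL2 (quad c e φ) + mulL2 V hV φ := by
  simp [hamiltonian]

theorem inner_hamiltonian (c e : Fin n → ℝ) (V : RSpace n → ℝ) (hV) (φ χ : testFunctions n) :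
    inner ℂ (hamiltonian c e V hV φ) (toL2 χ) = inner ℂ (toL2 φ) (hamiltonian c e V hV χ) := by
  simp only [hamiltonian_apply, inner_add_left, inner_add_right, inner_neg_left, inner_neg_right,
    inner_lap]
  rw [inner_quad, inner_mulL2 V hV]

/-- Since the oscillator is nonnegative, the norm of `(oscillator + b) φ` dominates both the
oscillator term and `b ‖φ‖`. A large `b` therefore absorbs the constants from the smallness of `V`
and from `oscillator_bound`. -/
theorem mulL2_relative_bound {V : RSpace n → ℝ} (hV : IsLocallyL2 V)
    (hsmall : ∀ ε > 0, ∃ C, 0 ≤ C ∧ ∀ φ : testFunctions n,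
      ‖mulL2 V hV φ‖ ≤ ε * ‖toL2 (lap φ)‖ + C * ‖toL2 φ‖) {a : ℝ} (ha : 0 < a) :
    ∃ b₀ : ℝ, ∀ b : ℝ, b₀ ≤ b → ∀ φ : testFunctions n,
      ‖mulL2 V hV φ‖ ≤ a * ‖toL2 (oscillator φ) + (b : ℂ) • toL2 φ‖ := by
  obtain ⟨C, hC0, hC⟩ := hsmall (a / 2) (by positivity)
  -- This threshold makes `(a/2)(2n + 1) + C ≤ (a/2) b`: one half of `a` pays for the Laplacian, the
  -- other for the multiples of `‖φ‖`.
  refine ⟨2 * ((a / 2) * (2 * n + 1) + C) / a + 1, fun b hb φ => ?_⟩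
  have hb0 : 0 < b := lt_of_lt_of_le (by positivity) hb
  have hpos : 0 ≤ (inner ℂ (toL2 (oscillator φ)) (toL2 φ)).re := by
    rw [inner_oscillator_self, Complex.ofReal_re]
    positivity
  have h1 : ‖toL2 (oscillator φ)‖ ^ 2 + b ^ 2 * ‖toL2 φ‖ ^ 2 ≤
      ‖toL2 (oscillator φ) + (b : ℂ) • toL2 φ‖ ^ 2 := by
    rw [@norm_add_sq ℂ, inner_smul_right, norm_smul, Complex.norm_real, Real.norm_eq_abs, mul_pow,
      sq_abs]
    have : RCLike.re ((b : ℂ) * inner ℂ (toL2 (oscillator φ)) (toL2 φ)) =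
        b * (inner ℂ (toL2 (oscillator φ)) (toL2 φ)).re := by simp
    rw [this]
    nlinarith [mul_nonneg hb0.le hpos]
  set M := ‖toL2 (oscillator φ) + (b : ℂ) • toL2 φ‖ with hM
  have hM0 : 0 ≤ M := norm_nonneg _
  have h2 : ‖toL2 (oscillator φ)‖ ≤ M := by
    apply (sq_le_sq₀ (norm_nonneg _) hM0).1
    nlinarith [sq_nonneg (b * ‖toL2 φ‖)]
  have h3 : b * ‖toL2 φ‖ ≤ M := by
    apply (sq_le_sq₀ (by positivity) hM0).1
    nlinarith [sq_nonneg ‖toL2 (oscillator φ)‖]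
  have h4 : ‖toL2 (lap φ)‖ ≤ M + (2 * n + 1) * ‖toL2 φ‖ := by
    apply (sq_le_sq₀ (norm_nonneg _) (by positivity)).1
    have := oscillator_bound φ
    have hn : (0 : ℝ) ≤ n := Nat.cast_nonneg n
    have hφ := norm_nonneg (toL2 φ)
    have e : (M + (2 * n + 1) * ‖toL2 φ‖) ^ 2 = M ^ 2 + 2 * (2 * n + 1) * M * ‖toL2 φ‖ +
      (2 * n + 1) ^ 2 * ‖toL2 φ‖ ^ 2 := by ring
    rw [e]
    have h5 : 0 ≤ 2 * (2 * n + 1) * M * ‖toL2 φ‖ := by positivity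
    have h6 : 2 * n * ‖toL2 φ‖ ^ 2 ≤ (2 * n + 1) ^ 2 * ‖toL2 φ‖ ^ 2 := by
      gcongr
      nlinarith
    have h7 : ‖toL2 (oscillator φ)‖ ^ 2 ≤ M ^ 2 := by gcongr
    nlinarith [sq_nonneg ‖toL2 (rsq φ)‖]
  refine (hC φ).trans ?_
  have h8 : 2 * ((a / 2) * (2 * n + 1) + C) / a ≤ b := by linarith
  rw [div_le_iff₀ ha] at h8
  have h9 := mul_le_mul_of_nonneg_right h8 (norm_nonneg (toL2 φ))
  nlinarith [mul_le_mul_of_nonneg_left h4 (show 0 ≤ a / 2 by positivity)]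

/-- Essential self-adjointness of `-Δ + ∑ (c_k x_k² + e_k x_k) + V`, in terms of ranges. -/
theorem hasTotalRange_hamiltonian
    (hp : HasTotalRange (toL2 ∘ₗ oscillator + Complex.I • toL2 : testFunctions n →ₗ[ℂ] L2 n))
    (hm : HasTotalRange (toL2 ∘ₗ oscillator - Complex.I • toL2 : testFunctions n →ₗ[ℂ] L2 n))
    (c e : Fin n → ℝ) {V : RSpace n → ℝ} (hV : IsLocallyL2 V)
    (hsmall : ∀ ε > 0, ∃ C, 0 ≤ C ∧ ∀ φ : testFunctions n,
      ‖mulL2 V hV φ‖ ≤ ε * ‖toL2 (lap φ)‖ + C * ‖toL2 φ‖) :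
    ∃ K₀ : ℝ, ∀ K : ℝ, K₀ < |K| →
      HasTotalRange (hamiltonian c e V hV + ((K : ℂ) * Complex.I) • toL2) := by
  -- With relative bound `1/4` for `V` the perturbation `2V` has relative bound `1/2 < 1`, so `A +
  -- 2V ≥ 0`, that is, `A ≤ 2 (A + V)` as forms. Taking `b ≥ 2` then gives `A + V ≥ 1`.
  obtain ⟨b₀, hb₀⟩ := mulL2_relative_bound hV hsmall (a := 1 / 4) (by norm_num)
  obtain ⟨b, hb1, hb2⟩ : ∃ b : ℝ, b₀ ≤ b ∧ 2 ≤ b := ⟨max b₀ 2, le_max_left _ _, le_max_right _ _⟩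
  have hpos : ∀ φ : testFunctions n, 0 ≤ (inner ℂ (toL2 (oscillator φ)) (toL2 φ)).re := fun φ => by
    rw [inner_oscillator_self, Complex.ofReal_re]
    positivity
  have htot : ∀ b : ℝ, 0 < b →
      HasTotalRange (toL2 ∘ₗ oscillator + (b : ℂ) • toL2 : testFunctions n →ₗ[ℂ] L2 n) :=
    fun b hb => HasTotalRange.add_smul_of_nonneg inner_oscillator hpos hp hm hb
  let A : testFunctions n →ₗ[ℂ] L2 n := toL2 ∘ₗ oscillator + (b : ℂ) • toL2
  have hAφ : ∀ φ, A φ = toL2 (oscillator φ) + (b : ℂ) • toL2 φ := fun φ => rfl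
  have hAre : ∀ φ, (inner ℂ (A φ) (toL2 φ)).re =
      (inner ℂ (toL2 (oscillator φ)) (toL2 φ)).re + b * ‖toL2 φ‖ ^ 2 := fun φ => by
    rw [hAφ, inner_add_left, inner_smul_left, inner_self_eq_norm_sq_to_K]
    simp [← Complex.ofReal_pow]
  let V' := mulL2 V hV
  have hVsymm : ∀ φ χ, inner ℂ (V' φ) (toL2 χ) = inner ℂ (toL2 φ) (V' χ) := inner_mulL2 V hV
  have hV' : ∀ φ, ‖V' φ‖ ≤ 1 / 4 * ‖A φ‖ := hb₀ b hb1
  have hAsymm : ∀ φ χ, inner ℂ (A φ) (toL2 χ) = inner ℂ (toL2 φ) (A χ) := fun φ χ => by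
    rw [hAφ, hAφ, inner_add_left, inner_add_right, inner_smul_left, inner_smul_right,
      inner_oscillator, Complex.conj_ofReal]
  have hform : ∀ φ, (inner ℂ (A φ) (toL2 φ)).re ≤ 2 * (inner ℂ ((A + V') φ) (toL2 φ)).re :=
    fun φ => by
      have := nonneg_of_relative_bound (j := toL2) (A := A) (V := (2 : ℂ) • V')
        (fun s hs => by
          have h := htot (b + s) (by linarith)
          have e1 : A + (s : ℂ) • toL2 = toL2 ∘ₗ oscillator + ((b + s : ℝ) : ℂ) • toL2 := by
            simp only [A]
            push_cast
            rw [add_smul, add_assoc]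
          rw [e1]
          exact h)
        (fun φ => by
          rw [hAre]
          have := hpos φ
          nlinarith [sq_nonneg ‖toL2 φ‖])
        (fun φ χ => by
          simp only [LinearMap.add_apply, LinearMap.smul_apply, inner_add_left, inner_add_right,
            inner_smul_left, inner_smul_right, hAsymm, hVsymm, map_ofNat]) (a := 1 / 2) (by norm_num) (by norm_num)
        (fun φ => by
          rw [LinearMap.smul_apply, norm_smul]
          have := hV' φ
          simp only [Complex.norm_ofNat]
          linarith) φ
      simp only [LinearMap.add_apply, LinearMap.smul_apply, inner_add_left, inner_smul_left,
        Complex.add_re] at this ⊢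
      simp only [map_ofNat, Complex.mul_re, Complex.re_ofNat, Complex.im_ofNat, zero_mul,
        sub_zero] at this
      linarith
  let N := A + V'
  have hN : HasTotalRange N := (htot b (by linarith)).add (by norm_num) hV'
  have hAN : ∀ φ, 3 / 4 * ‖A φ‖ ≤ ‖N φ‖ := fun φ => by
    have h1 := norm_sub_le_norm_add (A φ) (V' φ)
    have h2 := hV' φ
    change _ ≤ ‖A φ + V' φ‖
    linarith
  -- Subtracting the oscillator's `|x|²` from the quadratic part makes the Hamiltonian equal to `N`
  -- plus a polynomial, and the potential drops out of the difference.
  let c' : Fin n → ℝ := fun k => c k - 1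
  set M := ∑ k, (|c' k| + |e k|) with hM
  have hM0 : 0 ≤ M := Finset.sum_nonneg fun _ _ => by positivity
  have hT : ∀ φ, hamiltonian c e V hV φ = N φ + (toL2 (quad c' e φ) - (b : ℂ) • toL2 φ) :=
    fun φ => by
      have e1 : quad c e φ = rsq φ + quad c' e φ := by
        simp only [rsq, quad_eq, ← Finset.sum_add_distrib]
        refine Finset.sum_congr rfl fun k _ => ?_
        simp only [c']
        push_cast
        module
      rw [hamiltonian_apply, e1]
      change _ = toL2 (oscillator φ) + (b : ℂ) • toL2 φ + V' φ + _
      simp only [oscillator, LinearMap.add_apply, LinearMap.neg_apply, map_add, map_neg]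
      simp only [V']
      abel
  have hAn : ∀ φ, ‖toL2 (rsq φ)‖ + ‖toL2 φ‖ ≤ (2 * n + 3) * ‖A φ‖ := fun φ => by
    have hosc : ‖toL2 (oscillator φ)‖ ≤ ‖A φ‖ :=
      norm_le_norm_add_smul (A := toL2 ∘ₗ oscillator) (j := toL2) φ (hpos φ) (by linarith)
    have hφ : ‖toL2 φ‖ ≤ ‖A φ‖ := by
      have h1 : ‖toL2 φ‖ ^ 2 ≤ ‖A φ‖ * ‖toL2 φ‖ := by
        calc ‖toL2 φ‖ ^ 2 ≤ (inner ℂ (A φ) (toL2 φ)).re := by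
              rw [hAre]
              have := hpos φ
              nlinarith [sq_nonneg ‖toL2 φ‖]
          _ ≤ _ := (Complex.re_le_norm _).trans (norm_inner_le_norm _ _)
      by_contra! hcon
      nlinarith [norm_nonneg (A φ)]
    have h2 : ‖toL2 (rsq φ)‖ ≤ ‖A φ‖ * (2 * n + 2) := by
      apply (sq_le_sq₀ (norm_nonneg _) (by positivity)).1
      have := oscillator_bound φ
      have hn : (0 : ℝ) ≤ n := Nat.cast_nonneg n
      have h3 : ‖toL2 (oscillator φ)‖ ^ 2 ≤ ‖A φ‖ ^ 2 := by gcongr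
      have h4 : 2 * (n : ℝ) * ‖toL2 φ‖ ^ 2 ≤ 2 * n * ‖A φ‖ ^ 2 := by gcongr
      have h5 : (1 + 2 * (n : ℝ)) * ‖A φ‖ ^ 2 ≤ (2 * n + 2) ^ 2 * ‖A φ‖ ^ 2 := by
        gcongr
        nlinarith
      nlinarith [sq_nonneg ‖toL2 (lap φ)‖]
    linarith
  refine ⟨2 * (M * 2), fun K hK => fun η hη => ?_⟩
  refine eq_zero_of_commutator_bound (j := toL2) (T := hamiltonian c e V hV) (N := N)
    (c := 1 + (M * (2 * n + 3) + b * (2 * n + 3)) * (4 / 3)) (d := 2 * (M * 2))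
    hasTotalRange_toL2 hN (fun φ χ => ?_) (fun φ => ?_) (fun φ => ?_) (fun φ => ?_) hK
    (fun φ => hη φ)
  · simp only [N, LinearMap.add_apply, inner_add_left, inner_add_right, hAsymm, hVsymm]
  · rw [hT]
    have h1 := norm_quad_le c' e φ
    have h2 := hAn φ
    have h3 := hAN φ
    have h4 : ‖(b : ℂ) • toL2 φ‖ = b * ‖toL2 φ‖ := by
      rw [norm_smul, Complex.norm_real, Real.norm_of_nonneg (by linarith)]
    have h5 := norm_add_le (N φ) (toL2 (quad c' e φ) - (b : ℂ) • toL2 φ)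
    have h6 := norm_sub_le (toL2 (quad c' e φ)) ((b : ℂ) • toL2 φ)
    have h7 : ‖toL2 (quad c' e φ)‖ ≤ M * ((2 * n + 3) * ‖A φ‖) := h1.trans (by gcongr)
    have h8 : b * ‖toL2 φ‖ ≤ b * ((2 * n + 3) * ‖A φ‖) := by
      gcongr
      have := norm_nonneg (toL2 (rsq φ))
      linarith
    have h9 : ‖A φ‖ ≤ 4 / 3 * ‖N φ‖ := by linarith
    calc _ ≤ ‖N φ‖ + (M * ((2 * n + 3) * ‖A φ‖) + b * ((2 * n + 3) * ‖A φ‖)) := by linarith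
      _ = ‖N φ‖ + (M * (2 * n + 3) + b * (2 * n + 3)) * ‖A φ‖ := by ring
      _ ≤ ‖N φ‖ + (M * (2 * n + 3) + b * (2 * n + 3)) * (4 / 3 * ‖N φ‖) := by gcongr
      _ = _ := by ring
  · have h1 := hform φ
    rw [hAre] at h1
    have := hpos φ
    change _ ≤ (inner ℂ ((A + V') φ) (toL2 φ)).re
    nlinarith [sq_nonneg ‖toL2 φ‖]
  -- Only the Laplacian fails to commute with the polynomial: `N` against itself and against `φ`
  -- gives real numbers, and so do the multiplications by `|x|² + b + V` against the polynomial. No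
  -- regularity of `V` enters.
  · have hmul : (inner ℂ (N φ) (hamiltonian c e V hV φ)).im =
        (inner ℂ (toL2 (-lap φ)) (toL2 (quad c' e φ))).im := by
      have hNN : (inner ℂ (N φ) (N φ)).im = 0 := by
        rw [inner_self_eq_norm_sq_to_K]
        simp [← Complex.ofReal_pow]
      have hNφ : (inner ℂ (N φ) (toL2 φ)).im = 0 := by
        have h1 : inner ℂ (N φ) (toL2 φ) = inner ℂ (toL2 φ) (N φ) := by
          simp only [N, LinearMap.add_apply, inner_add_left, inner_add_right, hAsymm, hVsymm]
        have := inner_conj_symm (𝕜 := ℂ) (N φ) (toL2 φ)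
        rw [← h1] at this
        exact Complex.conj_eq_iff_im.1 this
      have hq : (inner ℂ (toL2 (rsq φ) + (b : ℂ) • toL2 φ + V' φ) (toL2 (quad c' e φ))).im = 0 := by
        refine im_inner_eq_zero (h := (φ : RSpace n → ℂ))
          (a := fun x => (∑ k, ((1 : ℝ) * x k ^ 2 + 0 * x k)) + b + V x)
          (b := fun x => ∑ k, (c' k * x k ^ 2 + e k * x k)) ?_ ?_
        · filter_upwards [Lp.coeFn_add (toL2 (rsq φ) + (b : ℂ) • toL2 φ) (V' φ),
            Lp.coeFn_add (toL2 (rsq φ)) ((b : ℂ) • toL2 φ), Lp.coeFn_smul (b : ℂ) (toL2 φ),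
            coeFn_toL2 (rsq φ), coeFn_toL2 φ, coeFn_mulL2 V hV φ] with x h1 h2 h3 h4 h5 h6
          rw [h1, Pi.add_apply, h2, Pi.add_apply, h3, Pi.smul_apply, h4, h5, h6, quad_apply]
          simp only [smul_eq_mul]
          push_cast
          ring
        · filter_upwards [coeFn_toL2 (quad c' e φ)] with x h1
          rw [h1, quad_apply]
      have hsplit : N φ = toL2 (-lap φ) + (toL2 (rsq φ) + (b : ℂ) • toL2 φ + V' φ) := by
        change toL2 (oscillator φ) + (b : ℂ) • toL2 φ + V' φ = _
        simp only [oscillator, LinearMap.add_apply, LinearMap.neg_apply, map_add, map_neg]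
        abel
      have hNq : (inner ℂ (N φ) (toL2 (quad c' e φ))).im =
          (inner ℂ (toL2 (-lap φ)) (toL2 (quad c' e φ))).im := by
        rw [hsplit, inner_add_left, Complex.add_im, hq, add_zero]
      rw [hT, inner_add_right, inner_sub_right, inner_smul_right, Complex.add_im, Complex.sub_im,
        hNN, hNq, Complex.im_ofReal_mul, hNφ]
      ring
    rw [hmul]
    refine (abs_im_inner_lap_quad_le c' e φ).trans ?_
    have h1 := hform φ
    have h2 := hAre φ
    have h3 := hpos φ
    have h4 : (inner ℂ (toL2 (oscillator φ)) (toL2 φ)).re + ‖toL2 φ‖ ^ 2 ≤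
        2 * (inner ℂ ((A + V') φ) (toL2 φ)).re := by
      nlinarith [sq_nonneg ‖toL2 φ‖]
    have h5 := mul_le_mul_of_nonneg_left h4 hM0
    have h6 : 0 ≤ (inner ℂ ((A + V') φ) (toL2 φ)).re := by
      nlinarith [sq_nonneg ‖toL2 φ‖]
    change _ ≤ 2 * (M * 2) * (inner ℂ ((A + V') φ) (toL2 φ)).re
    nlinarith [mul_nonneg hM0 h6]

theorem coeFn_hamiltonian (c e : Fin n → ℝ) {V q : RSpace n → ℝ} (hV : IsLocallyL2 V)
    (hq : q =ᵐ[volume] fun x => (∑ k, (c k * x k ^ 2 + e k * x k)) + V x) (φ : testFunctions n) :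
    hamiltonian c e V hV φ =ᵐ[volume] schrodingerExpr q (φ : RSpace n → ℂ) := by
  rw [hamiltonian_apply]
  filter_upwards [Lp.coeFn_add (-toL2 (lap φ) + toL2 (quad c e φ)) (mulL2 V hV φ),
    Lp.coeFn_add (-toL2 (lap φ)) (toL2 (quad c e φ)), Lp.coeFn_neg (toL2 (lap φ)),
    coeFn_toL2 (lap φ), coeFn_toL2 (quad c e φ), coeFn_mulL2 V hV φ, hq] with x h1 h2 h3 h4 h5 h6 h7
  rw [h1, Pi.add_apply, h2, Pi.add_apply, h3, Pi.neg_apply, h4, h5, h6, quad_apply, lap_apply,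
    schrodingerExpr, h7]
  push_cast
  ring

theorem mem_graph_minimalSchrodinger_iff (c e : Fin n → ℝ) {V q : RSpace n → ℝ}
    (hV : IsLocallyL2 V)
    (hq : q =ᵐ[volume] fun x => (∑ k, (c k * x k ^ 2 + e k * x k)) + V x) (z : L2 n × L2 n) :
    z ∈ (minimalSchrodinger q).graph ↔ ∃ φ, (toL2 φ, hamiltonian c e V hV φ) = z := by
  rw [mem_graph_minimalSchrodinger]
  constructor
  · rintro ⟨φ, h1, h2, h3, h4⟩
    refine ⟨⟨φ, h1, h2⟩, Prod.ext ?_ ?_⟩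
    · exact Lp.ext ((coeFn_toL2 _).trans h3.symm)
    · exact Lp.ext ((coeFn_hamiltonian c e hV hq _).trans h4.symm)
  · rintro ⟨φ, rfl⟩
    exact ⟨φ, contDiff φ, hasCompactSupport φ, coeFn_toL2 φ, coeFn_hamiltonian c e hV hq φ⟩

/-- Essential self-adjointness on `C_c^∞`. -/
theorem isUniqueSelfAdjointExtension_minimalSchrodinger
    (hp : HasTotalRange (toL2 ∘ₗ oscillator + Complex.I • toL2 : testFunctions n →ₗ[ℂ] L2 n))
    (hm : HasTotalRange (toL2 ∘ₗ oscillator - Complex.I • toL2 : testFunctions n →ₗ[ℂ] L2 n))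
    (c e : Fin n → ℝ) {V q : RSpace n → ℝ} (hV : IsLocallyL2 V)
    (hsmall : ∀ ε > 0, ∃ C, 0 ≤ C ∧ ∀ φ : testFunctions n,
      ‖mulL2 V hV φ‖ ≤ ε * ‖toL2 (lap φ)‖ + C * ‖toL2 φ‖)
    (hq : q =ᵐ[volume] fun x => (∑ k, (c k * x k ^ 2 + e k * x k)) + V x) :
    IsUniqueSelfAdjointExtension (minimalSchrodinger q) (minimalSchrodinger q).closure ∧
      ((minimalSchrodinger q).closure.graph : Set (L2 n × L2 n)) =
        closure (Set.range fun φ : testFunctions n => (toL2 φ, hamiltonian c e V hV φ)) := by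
  obtain ⟨K₀, hK₀⟩ := hasTotalRange_hamiltonian hp hm c e hV hsmall
  have hgr : ((minimalSchrodinger q).graph : Set (L2 n × L2 n)) =
      Set.range fun φ : testFunctions n => (toL2 φ, hamiltonian c e V hV φ) := by
    ext z
    exact mem_graph_minimalSchrodinger_iff c e hV hq z
  have hmem : ∀ φ, (toL2 φ, hamiltonian c e V hV φ) ∈ (minimalSchrodinger q).graph := fun φ =>
    (mem_graph_minimalSchrodinger_iff c e hV hq _).2 ⟨φ, rfl⟩
  have hd : Dense ((minimalSchrodinger q).domain : Set (L2 n)) := by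
    refine hasTotalRange_toL2.denseRange.mono ?_
    rintro _ ⟨φ, rfl⟩
    exact LinearPMap.mem_domain_of_mem_graph (hmem φ)
  have hs : IsSymmetricGraph (minimalSchrodinger q).graph := by
    intro z hz w hw
    obtain ⟨φ, hφ⟩ := (mem_graph_minimalSchrodinger_iff c e hV hq _).1 hz
    obtain ⟨χ, hχ⟩ := (mem_graph_minimalSchrodinger_iff c e hV hq _).1 hw
    rw [← hφ, ← hχ]
    exact inner_hamiltonian c e V hV φ χ
  have hK : K₀ < |(|K₀| + 1)| :=
    lt_of_le_of_lt (le_abs_self _) (lt_of_lt_of_le (lt_add_one _) (le_abs_self _))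
  have hK' : K₀ < |(-(|K₀| + 1))| := by rwa [abs_neg]
  have hran : ∀ K : ℝ, K₀ < |K| → ∀ η : L2 n,
      (∀ z ∈ (minimalSchrodinger q).graph, inner ℂ η (shiftMap K z) = 0) → η = 0 := by
    intro K hK η hη
    refine hK₀ K hK η fun φ => ?_
    rw [LinearMap.add_apply, LinearMap.smul_apply, ← hη _ (hmem φ), shiftMap_apply]
  have h := isUniqueSelfAdjointExtension_closure hd hs (K := |K₀| + 1) (by positivity)
    (hran _ hK) (hran _ hK')
  refine ⟨h.1, ?_⟩
  rw [h.2, Submodule.topologicalClosure_coe, hgr]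

end EssentialSelfAdjointness

/-! ### Sobolev embeddings and infinitesimal smallness of singular potentials -/

section SobolevEmbedding

variable {n : ℕ}

open testFunctions

open scoped ENNReal NNReal

theorem eLpNorm_two_eq (φ : testFunctions n) :
    eLpNorm (φ : RSpace n → ℂ) 2 volume = ENNReal.ofReal ‖toL2 φ‖ := by
  rw [Lp.norm_def, ENNReal.ofReal_toReal (Lp.eLpNorm_ne_top _)]
  exact (eLpNorm_congr_ae (coeFn_toL2 φ)).symm

theorem integral_norm_sq_toL2 (φ : testFunctions n) :
    ∫ x, ‖(φ : RSpace n → ℂ) x‖ ^ 2 = ‖toL2 φ‖ ^ 2 := by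
  have h : ‖toL2 φ‖ ^ 2 = RCLike.re (inner ℂ (toL2 φ) (toL2 φ)) := norm_sq_eq_re_inner _
  rw [h, L2.inner_def]
  have : ∫ x, inner ℂ ((toL2 φ) x) ((toL2 φ) x) =
      ∫ x, ((‖(φ : RSpace n → ℂ) x‖ ^ 2 : ℝ) : ℂ) := by
    refine integral_congr_ae ?_
    filter_upwards [coeFn_toL2 φ] with x hx
    rw [hx, inner_self_eq_norm_sq_to_K]
    simp
  rw [this, integral_complex_ofReal]
  simp

/-- Log-convexity of `L^p` norms, with a common bound at the endpoints. -/
theorem eLpNorm_le_of_interpolation {α F : Type*} [MeasurableSpace α] {μ : Measure α}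
    [NormedAddCommGroup F] {f : α → F} (hf : AEStronglyMeasurable f μ) {a b p : ℝ≥0}
    (ha : 0 < a) (hap : a ≤ p) (hpb : p ≤ b) {A : ℝ≥0∞} (h1 : eLpNorm f a μ ≤ A)
    (h2 : eLpNorm f b μ ≤ A) : eLpNorm f p μ ≤ A := by
  have hp : 0 < p := ha.trans_le hap
  have hb : 0 < b := hp.trans_le hpb
  have key : ∀ q : ℝ≥0, 0 < q → (eLpNorm f q μ ≤ A ↔ ∫⁻ x, ‖f x‖ₑ ^ (q : ℝ) ∂μ ≤ A ^ (q : ℝ)) := by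
    intro q hq
    rw [eLpNorm_nnreal_eq_lintegral hq.ne', one_div, ENNReal.rpow_inv_le_iff (by exact_mod_cast hq)]
  rw [key _ ha] at h1
  rw [key _ hb] at h2
  rw [key _ hp]
  obtain ⟨s, t, hs, ht, hst, hp'⟩ : ∃ s t : ℝ, 0 ≤ s ∧ 0 ≤ t ∧ s + t = 1 ∧ s * a + t * b = p := by
    have : (p : ℝ) ∈ segment ℝ (a : ℝ) b := by
      rw [segment_eq_Icc (by exact_mod_cast hap.trans hpb)]
      exact ⟨by exact_mod_cast hap, by exact_mod_cast hpb⟩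
    obtain ⟨s, t, hs, ht, hst, h⟩ := this
    exact ⟨s, t, hs, ht, hst, by simpa using h⟩
  have hsa : 0 ≤ s * (a : ℝ) := by positivity
  have htb : 0 ≤ t * (b : ℝ) := by positivity
  calc ∫⁻ x, ‖f x‖ₑ ^ (p : ℝ) ∂μ
      = ∫⁻ x, (‖f x‖ₑ ^ (a : ℝ)) ^ s * (‖f x‖ₑ ^ (b : ℝ)) ^ t ∂μ := by
        refine lintegral_congr fun x => ?_
        rw [← ENNReal.rpow_mul, ← ENNReal.rpow_mul, ← hp', mul_comm s, mul_comm t,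
          ENNReal.rpow_add_of_nonneg _ _ (by positivity) (by positivity)]
    _ ≤ (∫⁻ x, ‖f x‖ₑ ^ (a : ℝ) ∂μ) ^ s * (∫⁻ x, ‖f x‖ₑ ^ (b : ℝ) ∂μ) ^ t :=
        ENNReal.lintegral_mul_norm_pow_le (hf.enorm.pow_const _) (hf.enorm.pow_const _) hs ht hst
    _ ≤ (A ^ (a : ℝ)) ^ s * (A ^ (b : ℝ)) ^ t := by gcongr
    _ = A ^ (p : ℝ) := by
        rw [← ENNReal.rpow_mul, ← ENNReal.rpow_mul, ← hp', mul_comm s, mul_comm t,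
          ENNReal.rpow_add_of_nonneg _ _ (by positivity) (by positivity)]

theorem norm_fderiv_le_sum (φ : testFunctions n) (x : RSpace n) :
    ‖fderiv ℝ (φ : RSpace n → ℂ) x‖ ≤ ∑ i, ‖(D i φ : RSpace n → ℂ) x‖ := by
  refine ContinuousLinearMap.opNorm_le_bound _ (Finset.sum_nonneg fun _ _ => norm_nonneg _)
    fun y => ?_
  have hy : y = ∑ i, y i • stdVec i := by
    ext k
    simp [stdVec, Finset.sum_apply, Pi.single_apply]
  conv_lhs => rw [hy]
  rw [map_sum, Finset.sum_mul]
  refine (norm_sum_le _ _).trans (Finset.sum_le_sum fun i _ => ?_)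
  rw [map_smul, norm_smul, D_apply, mul_comm]
  gcongr
  exact PiLp.norm_apply_le y i

theorem eLpNorm_fderiv_le (φ : testFunctions n) {p : ℝ≥0∞} (hp : 1 ≤ p) :
    eLpNorm (fderiv ℝ (φ : RSpace n → ℂ)) p volume ≤
      ∑ i, eLpNorm (D i φ : RSpace n → ℂ) p volume := by
  calc _ ≤ eLpNorm (∑ i, fun x => ‖(D i φ : RSpace n → ℂ) x‖) p volume := by
        refine eLpNorm_mono_real fun x => ?_
        simpa using norm_fderiv_le_sum φ x
    _ ≤ ∑ i, eLpNorm (fun x => ‖(D i φ : RSpace n → ℂ) x‖) p volume :=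
        eLpNorm_sum_le (fun i _ => (continuous _).norm.aestronglyMeasurable) hp
    _ = _ := by simp only [eLpNorm_norm]

theorem eLpNorm_fderiv_two_le (φ : testFunctions n) :
    eLpNorm (fderiv ℝ (φ : RSpace n → ℂ)) 2 volume ≤
      n * ENNReal.ofReal (‖toL2 (lap φ)‖ + ‖toL2 φ‖) := by
  refine (eLpNorm_fderiv_le φ (by norm_num)).trans ?_
  calc _ ≤ ∑ _i : Fin n, ENNReal.ofReal (‖toL2 (lap φ)‖ + ‖toL2 φ‖) := by
        refine Finset.sum_le_sum fun i _ => ?_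
        rw [eLpNorm_two_eq]
        exact ENNReal.ofReal_le_ofReal (norm_D_le i φ)
    _ = _ := by simp

theorem eLpNorm_fderiv_D_two_le (i : Fin n) (φ : testFunctions n) :
    eLpNorm (fderiv ℝ (D i φ : RSpace n → ℂ)) 2 volume ≤
      n * ENNReal.ofReal ‖toL2 (lap φ)‖ := by
  refine (eLpNorm_fderiv_le (D i φ) (by norm_num)).trans ?_
  calc _ ≤ ∑ _k : Fin n, ENNReal.ofReal ‖toL2 (lap φ)‖ := by
        refine Finset.sum_le_sum fun k _ => ?_
        rw [eLpNorm_two_eq]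
        exact ENNReal.ofReal_le_ofReal (norm_D_D_le k i φ)
    _ = _ := by simp

/-- The Sobolev inequality for the gradient of a function in `H²`. -/
theorem exists_eLpNorm_fderiv_le (hn : 3 ≤ n) {p q : ℝ≥0} (hp : 2 ≤ p) (hpq : p ≤ q)
    (hq : (q : ℝ)⁻¹ = 2⁻¹ - (n : ℝ)⁻¹) :
    ∃ K : ℝ≥0, ∀ φ : testFunctions n, eLpNorm (fderiv ℝ (φ : RSpace n → ℂ)) p volume ≤
      K * ENNReal.ofReal (‖toL2 (lap φ)‖ + ‖toL2 φ‖) := by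
  set S : ℝ≥0 := SNormLESNormFDerivOfEqConst ℂ (volume : Measure (RSpace n)) ((2 : ℝ≥0) : ℝ)
  refine ⟨n + n * (S * n), fun φ => ?_⟩
  set A := ENNReal.ofReal (‖toL2 (lap φ)‖ + ‖toL2 φ‖)
  have h2 : eLpNorm (fderiv ℝ (φ : RSpace n → ℂ)) q volume ≤ n * (S * n) * A := by
    refine (eLpNorm_fderiv_le φ ?_).trans ?_
    · exact_mod_cast le_trans (by norm_num) (hp.trans hpq)
    calc _ ≤ ∑ _i : Fin n, (S * n * A : ℝ≥0∞) := by
          refine Finset.sum_le_sum fun i _ => ?_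
          have := eLpNorm_le_eLpNorm_fderiv_of_eq (volume : Measure (RSpace n)) (F := ℂ)
            ((contDiff (D i φ)).of_le (by norm_cast)) (hasCompactSupport (D i φ)) (p := 2)
            (p' := q) (by norm_num) (by simp; omega) (by simpa using hq)
          refine this.trans ?_
          rw [mul_assoc]
          refine mul_le_mul_right ((eLpNorm_fderiv_D_two_le i φ).trans ?_) _
          gcongr
          exact ENNReal.ofReal_le_ofReal (by linarith [norm_nonneg (toL2 φ)])
      _ = _ := by simp [mul_assoc]
  -- The gradient lies in `L²`, and in `L^q` by the Sobolev inequality applied to each first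
  -- derivative; intermediate exponents follow by interpolation.
  refine eLpNorm_le_of_interpolation (a := 2) (b := q)
    ((contDiff φ).continuous_fderiv (by simp)).aestronglyMeasurable (by norm_num) hp hpq ?_ ?_
  · refine (eLpNorm_fderiv_two_le φ).trans ?_
    push_cast
    gcongr
    exact le_self_add
  · refine h2.trans ?_
    push_cast
    gcongr
    exact le_add_self

/-- The Sobolev embedding of `H²` in dimension at least four. -/
theorem exists_eLpNorm_le_of_four_le (hn : 4 ≤ n) {r s : ℝ≥0} (hr : 2 < r) (hrn : r ≤ n)
    (hnr : (n : ℝ) ≤ 2 * r) (hs : (s : ℝ)⁻¹ = 2⁻¹ - (r : ℝ)⁻¹) :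
    ∃ K : ℝ≥0, ∀ φ : testFunctions n, eLpNorm (φ : RSpace n → ℂ) s volume ≤
      K * ENNReal.ofReal (‖toL2 (lap φ)‖ + ‖toL2 φ‖) := by
  have hr' : (2 : ℝ) < r := by exact_mod_cast hr
  have hrn' : (r : ℝ) ≤ n := by exact_mod_cast hrn
  have hn' : (4 : ℝ) ≤ n := by exact_mod_cast hn
  have hrinv : (r : ℝ)⁻¹ < 2⁻¹ := by
    rw [inv_lt_inv₀ (by linarith) (by norm_num)]
    exact hr'
  have hninv : (n : ℝ)⁻¹ ≤ (r : ℝ)⁻¹ := by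
    rw [inv_le_inv₀ (by linarith) (by linarith)]
    exact hrn'
  have hrn2 : (r : ℝ)⁻¹ ≤ 2 * (n : ℝ)⁻¹ := by
    rw [← one_div, ← one_div, mul_one_div, div_le_div_iff₀ (by linarith) (by linarith)]
    linarith
  have hnpos : 0 < (n : ℝ)⁻¹ := by positivity
  -- The exponents are tuned so that `1/s = 1/p - 1/n`. Then `r ≤ n` is the condition `p ≥ 2`, and
  -- `n ≤ 2r` is the condition `p ≤ q` with `q` the Sobolev exponent of `2`.
  obtain ⟨p, hp⟩ : ∃ p : ℝ≥0, (p : ℝ)⁻¹ = 2⁻¹ - (r : ℝ)⁻¹ + (n : ℝ)⁻¹ :=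
    ⟨(2⁻¹ - (r : ℝ)⁻¹ + (n : ℝ)⁻¹)⁻¹.toNNReal, by
      rw [Real.coe_toNNReal _ (by rw [inv_nonneg]; linarith), inv_inv]⟩
  obtain ⟨q, hq⟩ : ∃ q : ℝ≥0, (q : ℝ)⁻¹ = 2⁻¹ - (n : ℝ)⁻¹ :=
    ⟨(2⁻¹ - (n : ℝ)⁻¹)⁻¹.toNNReal, by
      rw [Real.coe_toNNReal _ (by rw [inv_nonneg]; linarith), inv_inv]⟩
  have hp0 : 0 < (p : ℝ)⁻¹ := by rw [hp]; linarith
  have hq0 : 0 < (q : ℝ)⁻¹ := by rw [hq]; linarith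
  have hp2 : (2 : ℝ) ≤ p := by
    rw [← inv_le_inv₀ (inv_pos.1 hp0) (by norm_num), hp]
    linarith
  have hpq : (p : ℝ) ≤ q := by
    rw [← inv_le_inv₀ (inv_pos.1 hq0) (inv_pos.1 hp0), hp, hq]
    linarith
  obtain ⟨K, hK⟩ := exists_eLpNorm_fderiv_le (n := n) (by omega) (p := p) (q := q)
    (by exact_mod_cast hp2) (by exact_mod_cast hpq) hq
  refine ⟨SNormLESNormFDerivOfEqConst ℂ (volume : Measure (RSpace n)) p * K, fun φ => ?_⟩
  have := eLpNorm_le_eLpNorm_fderiv_of_eq (volume : Measure (RSpace n)) (F := ℂ)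
    ((contDiff φ).of_le (by norm_cast)) (hasCompactSupport φ) (p := p) (p' := s)
    (by exact_mod_cast (le_trans (by norm_num) hp2)) (by simp; omega)
    (by rw [hs, NNReal.coe_inv, hp]; simp)
  refine this.trans ?_
  push_cast
  rw [mul_assoc]
  gcongr
  exact hK φ

open FourierTransform SchwartzMap Laplacian in
theorem fourier_laplacian_apply (f : 𝓢(RSpace n, ℂ)) (ξ : RSpace n) :
    𝓕 (Δ f) ξ = -((4 * Real.pi ^ 2 * ‖ξ‖ ^ 2 : ℝ) : ℂ) * 𝓕 f ξ := by
  rw [laplacian_eq_fourierMultiplierCLM, fourierMultiplierCLM_apply, FourierTransform.fourier_smul,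
    FourierTransform.fourier_fourierInv_eq]
  rw [smul_apply, SchwartzMap.smulLeftCLM_apply_apply (by fun_prop)]
  simp only [Complex.real_smul]
  push_cast
  ring

open FourierTransform SchwartzMap Laplacian in
/-- The Sobolev embedding of `H²` in dimension at most three. -/
theorem exists_norm_apply_le_of_le_three (hn : n ≤ 3) :
    ∃ K : ℝ, 0 ≤ K ∧ ∀ (φ : testFunctions n) (x : RSpace n),
      ‖(φ : RSpace n → ℂ) x‖ ≤ K * (‖toL2 (lap φ)‖ + ‖toL2 φ‖) := by
  -- This is where low dimension enters: the square of `(1 + |ξ|²)⁻¹` is integrable because `n < 4`.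
  have hw : MemLp (fun ξ : RSpace n => (1 + ‖ξ‖ ^ 2)⁻¹) 2 volume := by
    rw [memLp_two_iff_integrable_sq (by fun_prop)]
    have hr : (Module.finrank ℝ (RSpace n) : ℝ) < 4 := by
      simp only [finrank_euclideanSpace, Fintype.card_fin]
      exact_mod_cast (show n < 4 by omega)
    refine (integrable_rpow_neg_one_add_norm_sq (μ := volume) hr).congr (ae_of_all _ fun ξ => ?_)
    have : (0 : ℝ) ≤ 1 + ‖ξ‖ ^ 2 := by positivity
    change (1 + ‖ξ‖ ^ 2) ^ (-(4 : ℝ) / 2) = _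
    rw [show -(4 : ℝ) / 2 = -(2 : ℕ) by norm_num, Real.rpow_neg this, Real.rpow_natCast, ← inv_pow]
  set W := ∫ ξ : RSpace n, ((1 + ‖ξ‖ ^ 2)⁻¹) ^ (2 : ℝ)
  refine ⟨W ^ (1 / (2 : ℝ)), by positivity, fun φ x => ?_⟩
  let f : 𝓢(RSpace n, ℂ) := (hasCompactSupport φ).toSchwartzMap (testFunctions.contDiff φ)
  -- In the normalization `e^{-2πi⟨x,ξ⟩}` this constant turns `1 - cΔ` into multiplication by `1 +
  -- |ξ|²`.
  let c : ℝ := (4 * Real.pi ^ 2)⁻¹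
  let χ : testFunctions n := φ - (c : ℂ) • lap φ
  let h : 𝓢(RSpace n, ℂ) := f - (c : ℂ) • Δ f
  have hh : ∀ y, h y = (χ : RSpace n → ℂ) y := fun y => by
    change f y - (c : ℂ) * (Δ f) y = (φ : RSpace n → ℂ) y - (c : ℂ) * (lap φ : RSpace n → ℂ) y
    rw [SchwartzMap.laplacian_apply, lap_apply]
    rfl
  have hc : c * (4 * Real.pi ^ 2) = 1 := inv_mul_cancel₀ (by positivity)
  have hfour : ∀ ξ, ‖𝓕 f ξ‖ = (1 + ‖ξ‖ ^ 2)⁻¹ * ‖𝓕 h ξ‖ := fun ξ => by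
    have e : 𝓕 h ξ = ((1 + ‖ξ‖ ^ 2 : ℝ) : ℂ) * 𝓕 f ξ := by
      have : 𝓕 h = 𝓕 f - (c : ℂ) • 𝓕 (Δ f) := by
        simp only [h]
        rw [sub_eq_add_neg, FourierTransform.fourier_add, FourierTransform.fourier_neg,
          FourierTransform.fourier_smul, ← sub_eq_add_neg]
      rw [this, sub_apply, smul_apply, fourier_laplacian_apply,
        smul_eq_mul]
      have hc' : (c : ℂ) * (4 * (Real.pi : ℂ) ^ 2) = 1 := by exact_mod_cast hc
      push_cast
      linear_combination ‖ξ‖ ^ 2 * 𝓕 f ξ * hc'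
    rw [e, norm_mul, Complex.norm_real, Real.norm_of_nonneg (by positivity),
      inv_mul_cancel_left₀ (by positivity)]
  have hplanch : (∫ ξ, ‖𝓕 h ξ‖ ^ (2 : ℝ)) ^ (1 / (2 : ℝ)) = ‖toL2 χ‖ := by
    have h1 : ∫ ξ, ‖𝓕 h ξ‖ ^ (2 : ℝ) = ‖toL2 χ‖ ^ 2 := by
      simp only [Real.rpow_two]
      rw [integral_norm_sq_fourier, ← integral_norm_sq_toL2]
      simp only [hh]
    rw [h1, ← Real.sqrt_eq_rpow, Real.sqrt_sq (norm_nonneg _)]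
  have hpt : ‖(φ : RSpace n → ℂ) x‖ ≤ ∫ ξ, ‖𝓕 f ξ‖ := by
    have e : (φ : RSpace n → ℂ) x = (𝓕⁻ (𝓕 f)) x := by
      rw [FourierTransform.fourierInv_fourier_eq]
      rfl
    rw [e, SchwartzMap.fourierInv_coe, Real.fourierInv_eq']
    refine (norm_integral_le_integral_norm _).trans (le_of_eq ?_)
    refine integral_congr_ae (ae_of_all _ fun ξ => ?_)
    simp only [norm_smul]
    rw [Complex.norm_exp_ofReal_mul_I, one_mul]
  have hχ : ‖toL2 χ‖ ≤ ‖toL2 (lap φ)‖ + ‖toL2 φ‖ := by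
    have hc0 : 0 ≤ c := by positivity
    have hc1 : c ≤ 1 := by
      have h1 := Real.pi_gt_three
      have h2 : (1 : ℝ) ≤ 4 * Real.pi ^ 2 := by nlinarith
      nlinarith
    simp only [χ, map_sub, map_smul]
    refine (norm_sub_le _ _).trans ?_
    rw [norm_smul, Complex.norm_real, Real.norm_of_nonneg hc0]
    nlinarith [norm_nonneg (toL2 (lap φ))]
  calc ‖(φ : RSpace n → ℂ) x‖ ≤ ∫ ξ, ‖𝓕 f ξ‖ := hpt
    _ = ∫ ξ, (1 + ‖ξ‖ ^ 2)⁻¹ * ‖𝓕 h ξ‖ := integral_congr_ae (ae_of_all _ hfour)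
    _ ≤ W ^ (1 / (2 : ℝ)) * (∫ ξ, ‖𝓕 h ξ‖ ^ (2 : ℝ)) ^ (1 / (2 : ℝ)) := by
        refine integral_mul_le_Lp_mul_Lq_of_nonneg Real.HolderConjugate.two_two
          (ae_of_all _ fun _ => by positivity) (ae_of_all _ fun _ => by positivity) ?_ ?_
        · simpa using hw
        · simpa using ((𝓕 h).memLp 2 volume).norm
    _ ≤ _ := by
        rw [hplanch]
        gcongr

theorem IsLocallyL2.norm_mulL2 {V : RSpace n → ℝ} (hV : IsLocallyL2 V) (φ : testFunctions n) :
    ENNReal.ofReal ‖mulL2 V hV φ‖ =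
      eLpNorm (fun x => (V x : ℂ) * (φ : RSpace n → ℂ) x) 2 volume := by
  rw [Lp.norm_def, ENNReal.ofReal_toReal (Lp.eLpNorm_ne_top _)]
  exact eLpNorm_congr_ae (coeFn_mulL2 V hV φ)

theorem IsLaplacianSmall.of_eLpNorm_le {V : RSpace n → ℝ} (hm : AEStronglyMeasurable V volume)
    (h : ∀ ε > 0, ∃ C, 0 ≤ C ∧ ∀ φ : testFunctions n,
      eLpNorm (fun x => (V x : ℂ) * (φ : RSpace n → ℂ) x) 2 volume ≤
        ENNReal.ofReal (ε * ‖toL2 (lap φ)‖ + C * ‖toL2 φ‖)) : IsLaplacianSmall V := by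
  have hV : IsLocallyL2 V := fun φ => by
    obtain ⟨C, -, hC⟩ := h 1 one_pos
    exact ⟨(Complex.continuous_ofReal.comp_aestronglyMeasurable hm).mul
      (continuous φ).aestronglyMeasurable, (hC φ).trans_lt ENNReal.ofReal_lt_top⟩
  refine ⟨hV, fun ε hε => ?_⟩
  obtain ⟨C, hC0, hC⟩ := h ε hε
  refine ⟨C, hC0, fun φ => ?_⟩
  have := hC φ
  rwa [← hV.norm_mulL2, ENNReal.ofReal_le_ofReal_iff (by positivity)] at this

theorem IsLaplacianSmall.congr {V W : RSpace n → ℝ} (h : IsLaplacianSmall V)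
    (hVW : V =ᵐ[volume] W) : IsLaplacianSmall W := by
  obtain ⟨hV, h⟩ := h
  have he : ∀ φ : testFunctions n, (fun x => (V x : ℂ) * (φ : RSpace n → ℂ) x) =ᵐ[volume]
      fun x => (W x : ℂ) * (φ : RSpace n → ℂ) x := fun φ => by
    filter_upwards [hVW] with x hx
    rw [hx]
  have hW : IsLocallyL2 W := fun φ => (hV φ).ae_eq (he φ)
  refine ⟨hW, fun ε hε => ?_⟩
  obtain ⟨C, hC0, hC⟩ := h ε hε
  refine ⟨C, hC0, fun φ => le_of_eq_of_le (congrArg norm (Lp.ext ?_)) (hC φ)⟩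
  exact (coeFn_mulL2 W hW φ).trans ((he φ).symm.trans (coeFn_mulL2 V hV φ).symm)

theorem IsLaplacianSmall.add {V W : RSpace n → ℝ} (hV : IsLaplacianSmall V)
    (hW : IsLaplacianSmall W) : IsLaplacianSmall fun x => V x + W x := by
  obtain ⟨hV, h1⟩ := hV
  obtain ⟨hW, h2⟩ := hW
  have he : ∀ φ : testFunctions n, (fun x => ((V x + W x : ℝ) : ℂ) * (φ : RSpace n → ℂ) x) =
      fun x => (V x : ℂ) * (φ : RSpace n → ℂ) x + (W x : ℂ) * (φ : RSpace n → ℂ) x := fun φ => by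
    funext x
    push_cast
    ring
  have hVW : IsLocallyL2 fun x => V x + W x := fun φ => by
    rw [he]
    exact (hV φ).add (hW φ)
  refine ⟨hVW, fun ε hε => ?_⟩
  obtain ⟨C₁, hC₁, h1⟩ := h1 (ε / 2) (by positivity)
  obtain ⟨C₂, hC₂, h2⟩ := h2 (ε / 2) (by positivity)
  refine ⟨C₁ + C₂, by positivity, fun φ => ?_⟩
  have e : mulL2 _ hVW φ = mulL2 V hV φ + mulL2 W hW φ := by
    refine Lp.ext ?_
    filter_upwards [Lp.coeFn_add (mulL2 V hV φ) (mulL2 W hW φ), coeFn_mulL2 _ hVW φ,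
      coeFn_mulL2 V hV φ, coeFn_mulL2 W hW φ] with x h1 h2 h3 h4
    rw [h1, h2, Pi.add_apply, h3, h4]
    push_cast
    ring
  rw [e]
  refine (norm_add_le _ _).trans ?_
  linarith [h1 φ, h2 φ]

/-- A potential that is, up to a bounded part, small relative to the graph norm of the Laplacian. -/
theorem IsLaplacianSmall.of_split {V : RSpace n → ℝ} (hm : AEStronglyMeasurable V volume)
    (h : ∀ ε > 0, ∃ (V₁ : RSpace n → ℝ) (M : ℝ≥0), AEStronglyMeasurable V₁ volume ∧
      (∀ᵐ x, |V x - V₁ x| ≤ M) ∧ ∀ φ : testFunctions n,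
        eLpNorm (fun x => (V₁ x : ℂ) * (φ : RSpace n → ℂ) x) 2 volume ≤
          ENNReal.ofReal (ε * (‖toL2 (lap φ)‖ + ‖toL2 φ‖))) : IsLaplacianSmall V := by
  refine IsLaplacianSmall.of_eLpNorm_le hm fun ε hε => ?_
  obtain ⟨V₁, M, hm₁, hM, h⟩ := h ε hε
  refine ⟨ε + M, by positivity, fun φ => ?_⟩
  have hms : ∀ {W : RSpace n → ℝ}, AEStronglyMeasurable W volume →
      AEStronglyMeasurable (fun x => (W x : ℂ) * (φ : RSpace n → ℂ) x) volume := fun hW =>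
    (Complex.continuous_ofReal.comp_aestronglyMeasurable hW).mul
      (continuous φ).aestronglyMeasurable
  have e : (fun x => (V x : ℂ) * (φ : RSpace n → ℂ) x) =
      (fun x => (V₁ x : ℂ) * (φ : RSpace n → ℂ) x) +
        fun x => ((V x - V₁ x : ℝ) : ℂ) * (φ : RSpace n → ℂ) x := by
    funext x
    simp only [Pi.add_apply]
    push_cast
    ring
  rw [e]
  have h2 : eLpNorm (fun x => ((V x - V₁ x : ℝ) : ℂ) * (φ : RSpace n → ℂ) x) 2 volume ≤
      ENNReal.ofReal (M * ‖toL2 φ‖) := by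
    rw [ENNReal.ofReal_mul (by positivity), ← eLpNorm_two_eq, ENNReal.ofReal_coe_nnreal]
    refine eLpNorm_le_nnreal_smul_eLpNorm_of_ae_le_mul (c := M) ?_ 2
    filter_upwards [hM] with x hx
    rw [← NNReal.coe_le_coe]
    simp only [NNReal.coe_mul, coe_nnnorm, norm_mul, Complex.norm_real, Real.norm_eq_abs]
    gcongr
  refine (eLpNorm_add_le (hms hm₁) (hms (hm.sub hm₁)) (by norm_num)).trans ?_
  refine (add_le_add (h φ) h2).trans ?_
  rw [← ENNReal.ofReal_add (by positivity) (by positivity)]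
  exact ENNReal.ofReal_le_ofReal (by linarith)

theorem IsLaplacianSmall.of_memLp_top {V : RSpace n → ℝ} (hV : MemLp V ⊤ volume) :
    IsLaplacianSmall V := by
  refine IsLaplacianSmall.of_split hV.1 fun ε hε => ?_
  refine ⟨0, (eLpNorm V ⊤ volume).toNNReal, aestronglyMeasurable_zero, ?_, fun φ => by simp⟩
  filter_upwards [ae_le_eLpNormEssSup (f := V) (μ := volume)] with x hx
  have h1 : (‖V x‖₊ : ℝ≥0∞) ≤ ((eLpNorm V ⊤ volume).toNNReal : ℝ≥0∞) := by
    rw [ENNReal.coe_toNNReal hV.2.ne, eLpNorm_exponent_top]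
    exact hx
  have h2 : ‖V x‖₊ ≤ (eLpNorm V ⊤ volume).toNNReal := by exact_mod_cast h1
  simpa using NNReal.coe_le_coe.2 h2

/-- `L^p` potentials are small relative to the Laplacian, given a Sobolev embedding. -/
theorem IsLaplacianSmall.of_memLp {p r s : ℝ≥0∞} [hrs : ENNReal.HolderTriple r s 2] (hr : r ≠ 0)
    (hrp : r ≤ p) (hp : p ≠ ⊤) {K : ℝ≥0}
    (hK : ∀ φ : testFunctions n, eLpNorm (φ : RSpace n → ℂ) s volume ≤
      K * ENNReal.ofReal (‖toL2 (lap φ)‖ + ‖toL2 φ‖))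
    {V : RSpace n → ℝ} (hV : MemLp V p volume) : IsLaplacianSmall V := by
  have hp0 : p ≠ 0 := fun h => hr (le_antisymm (h ▸ hrp) zero_le)
  obtain ⟨V₀, hV₀m, hVV₀⟩ := hV.1
  have hV₀ : MemLp V₀ p volume := hV.ae_eq hVV₀
  refine IsLaplacianSmall.congr ?_ hVV₀.symm
  refine IsLaplacianSmall.of_split hV₀m.aestronglyMeasurable fun ε hε => ?_
  -- The set where `V` is at least `1` has finite measure, so there `V` belongs to `L^r` although
  -- only `L^p` with `p ≥ r` is given. Outside it `V` is bounded, and cutting at a high level `M`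
  -- makes the remaining `L^r` part small.
  let S : Set (RSpace n) := {x | 1 ≤ ‖V₀ x‖₊}
  have hS : MeasurableSet S := measurableSet_le measurable_const hV₀m.nnnorm.measurable
  have hSfin : volume S < ⊤ := by
    have := hV₀.meas_ge_lt_top hp0 hp (ε := 1) one_ne_zero
    simpa [S] using this
  have hW : MemLp (S.indicator V₀) r volume := by
    rw [memLp_indicator_iff_restrict hS]
    have : IsFiniteMeasure (volume.restrict S) := ⟨by simpa using hSfin⟩
    exact (hV₀.restrict S).mono_exponent hrp
  obtain ⟨M, hM0, hM⟩ := hW.eLpNorm_indicator_norm_ge_pos_le (hV₀m.indicator hS)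
    (ε := ε / (K + 1)) (by positivity)
  have hmeas : StronglyMeasurable
      ({x | M ≤ ‖S.indicator V₀ x‖₊}.indicator (S.indicator V₀)) := by
    refine (hV₀m.indicator hS).indicator ?_
    exact measurableSet_le measurable_const
      ((hV₀m.indicator hS).nnnorm.measurable.coe_nnreal_real)
  refine ⟨_, (max 1 M).toNNReal, hmeas.aestronglyMeasurable, ae_of_all _ fun x => ?_, fun φ => ?_⟩
  · rw [Real.coe_toNNReal _ (by positivity)]
    by_cases h1 : x ∈ S
    · by_cases h2 : M ≤ ‖V₀ x‖₊
      · simp [Set.indicator, h1]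
        simp at h2
        simp [h2]
      · simp [Set.indicator, h1]
        simp at h2
        simp [not_le.2 h2, h2.le]
    · have : ‖V₀ x‖₊ < 1 := not_le.1 h1
      have h3 : |V₀ x| < 1 := by simpa using NNReal.coe_lt_coe.2 this
      simp [Set.indicator, h1, h3.le]
  · have := eLpNorm_le_eLpNorm_mul_eLpNorm'_of_norm (p := r) (q := s) (r := 2) (μ := volume)
      hmeas.aestronglyMeasurable (continuous φ).aestronglyMeasurable
      (fun (a : ℝ) (b : ℂ) => (a : ℂ) * b) 1 (ae_of_all _ fun x => by simp)
    refine this.trans ?_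
    refine (mul_le_mul' (mul_le_mul_right hM _) (hK φ)).trans ?_
    rw [ENNReal.coe_one, one_mul, ← mul_assoc, ← ENNReal.ofReal_coe_nnreal,
      ← ENNReal.ofReal_mul (by positivity), ← ENNReal.ofReal_mul (by positivity)]
    refine ENNReal.ofReal_le_ofReal ?_
    gcongr
    rw [div_mul_eq_mul_div, div_le_iff₀ (by positivity)]
    nlinarith [K.2]

/-- Hölder's inequality pairs `V ∈ L^r` with `φ ∈ L^s`, `1/r + 1/s = 1/2`: for `n ≤ 3` with `r = 2`
and bounded `φ`, and for `n ≥ 4` with some `r > 2` and a finite `s` covered by the embedding of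
`H²`. -/
theorem IsSingularPotential.isLaplacianSmall {V : RSpace n → ℝ} (hV : IsSingularPotential V) :
    IsLaplacianSmall V := by
  obtain ⟨p, hp, hV⟩ := hV
  rcases le_or_gt n 3 with hn | hn
  · obtain ⟨K, hK0, hK⟩ := exists_norm_apply_le_of_le_three hn
    have h2 := hp.1 hn
    refine IsLaplacianSmall.of_memLp (r := 2) (s := ⊤) (hrs := inferInstance) (by norm_num) ?_
      ENNReal.ofReal_ne_top (K := K.toNNReal) (fun φ => ?_) hV
    · simpa using ENNReal.ofReal_le_ofReal h2
    · refine (eLpNormEssSup_le_of_ae_bound (ae_of_all _ (hK φ))).trans ?_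
      rw [ENNReal.ofReal_mul hK0]
      rfl
  · have hn4 : (4 : ℝ) ≤ n := by exact_mod_cast (show 4 ≤ n by omega)
    obtain ⟨h2p, hnp⟩ : 2 < p ∧ (n : ℝ) ≤ 2 * p := by
      rcases (show n = 4 ∨ 5 ≤ n by omega) with h | h
      · have := hp.2.1 h
        subst h
        exact ⟨this, by push_cast; linarith⟩
      · have h1 := hp.2.2 h
        have h5 : (5 : ℝ) ≤ n := by exact_mod_cast h
        constructor <;> linarith
    -- The embedding requires `n/2 ≤ r ≤ n`; a larger `p` is brought down to `n`.
    let r : ℝ≥0 := (min p n).toNNReal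
    have hr0 : (r : ℝ) = min p n := Real.coe_toNNReal _ (by positivity)
    have hr2 : (2 : ℝ) < r := by
      rw [hr0]
      exact lt_min h2p (by linarith)
    have hrinv : (r : ℝ)⁻¹ < 2⁻¹ := by
      rw [inv_lt_inv₀ (by linarith) (by norm_num)]
      exact hr2
    let s : ℝ≥0 := (2⁻¹ - (r : ℝ)⁻¹)⁻¹.toNNReal
    have hs : (s : ℝ)⁻¹ = 2⁻¹ - (r : ℝ)⁻¹ := by
      simp only [s]
      rw [Real.coe_toNNReal _ (by rw [inv_nonneg]; linarith), inv_inv]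
    have hs0 : s ≠ 0 := by
      rintro h
      rw [h] at hs
      simp at hs
      linarith
    have hr00 : r ≠ 0 := by
      rintro h
      rw [h] at hr2
      norm_num at hr2
    obtain ⟨K, hK⟩ := exists_eLpNorm_le_of_four_le (n := n) (by omega) (r := r) (s := s)
      (by exact_mod_cast hr2)
      (by rw [← NNReal.coe_le_coe, hr0]; simp)
      (by
        rw [hr0]
        rcases min_choice p (n : ℝ) with h | h <;> rw [h] <;> linarith) hs
    have : ENNReal.HolderTriple (r : ℝ≥0∞) s 2 := by
      constructor
      rw [← ENNReal.coe_inv hr00, ← ENNReal.coe_inv hs0, ← ENNReal.coe_add,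
        show (2 : ℝ≥0∞) = ((2 : ℝ≥0) : ℝ≥0∞) by norm_num, ← ENNReal.coe_inv (by norm_num),
        ENNReal.coe_inj, ← NNReal.coe_inj]
      push_cast
      rw [hs]
      ring
    refine IsLaplacianSmall.of_memLp (r := r) (s := s) (by exact_mod_cast hr00) ?_
      ENNReal.ofReal_ne_top hK hV
    rw [ENNReal.ofReal, ENNReal.coe_le_coe]
    exact Real.toNNReal_le_toNNReal (min_le_left _ _)

end SobolevEmbedding

/-! ### Gaussian solutions on the line and their local domination -/

section GaussianPackets

/-- A family `f t` of rapidly decaying solutions of `i ∂ₜ f = -f'' + (c x² + e x) f` on the line,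
with first and second space derivatives `f₁` and `f₂`. -/
structure IsPacket (c e : ℝ) (f f₁ f₂ : ℝ → ℝ → ℂ) : Prop where
  contDiff : ∀ t, ContDiff ℝ ∞ (f t)
  hasDerivAt_fst : ∀ t x, HasDerivAt (f t) (f₁ t x) x
  hasDerivAt_snd : ∀ t x, HasDerivAt (f₁ t) (f₂ t x) x
  hasDerivAt_time : ∀ t x, HasDerivAt (fun s => f s x)
    (-Complex.I * (-f₂ t x + ((c * x ^ 2 + e * x : ℝ) : ℂ) * f t x)) t
  dominated : ∀ t₀, ∃ ε > 0, ∃ C δ : ℝ, 0 < δ ∧ ∀ t, |t - t₀| < ε → ∀ x,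
    ‖f t x‖ ≤ C * Real.exp (-δ * x ^ 2) ∧ ‖f₁ t x‖ ≤ C * Real.exp (-δ * x ^ 2) ∧
    ‖f₂ t x‖ ≤ C * Real.exp (-δ * x ^ 2) ∧
    ‖((c * x ^ 2 + e * x : ℝ) : ℂ) * f t x‖ ≤ C * Real.exp (-δ * x ^ 2)

/-- Half of the Gaussian decay absorbs both the polynomial and the linear exponential: bound the
power by an exponential and complete the square. -/
theorem pow_mul_exp_le {δ : ℝ} (hδ : 0 < δ) (M : ℝ) (k : ℕ) :
    ∃ C, 0 ≤ C ∧ ∀ x : ℝ, (1 + |x|) ^ k * Real.exp (-(2 * δ) * x ^ 2 + M * |x|) ≤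
      C * Real.exp (-δ * x ^ 2) := by
  refine ⟨k.factorial * Real.exp (1 + (M + 1) ^ 2 / (4 * δ)), by positivity, fun x => ?_⟩
  have h1 : (1 + |x|) ^ k ≤ k.factorial * Real.exp (1 + |x|) := by
    have := Real.pow_div_factorial_le_exp (1 + |x|) (by positivity) k
    rw [div_le_iff₀ (by positivity)] at this
    linarith
  calc _ ≤ k.factorial * Real.exp (1 + |x|) * Real.exp (-(2 * δ) * x ^ 2 + M * |x|) := by gcongr
    _ = k.factorial * Real.exp ((1 + |x|) + (-(2 * δ) * x ^ 2 + M * |x|)) := by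
        rw [mul_assoc, ← Real.exp_add]
    _ ≤ k.factorial * Real.exp ((1 + (M + 1) ^ 2 / (4 * δ)) + -δ * x ^ 2) := by
        refine mul_le_mul_of_nonneg_left (Real.exp_le_exp.2 ?_) (by positivity)
        have h2 : 0 ≤ δ * (|x| - (M + 1) / (2 * δ)) ^ 2 := by positivity
        have h3 : δ * (|x| - (M + 1) / (2 * δ)) ^ 2 =
            δ * x ^ 2 - (M + 1) * |x| + (M + 1) ^ 2 / (4 * δ) := by
          rw [sub_sq, sq_abs]
          field_simp
          ring
        linarith
    _ = _ := by rw [Real.exp_add]; ring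

/-- These are the prefactors of a packet and of its first two derivatives, with `P = c₀ + c₁ x`, `L
= 2αx + β`, `a = α` and `k = c₁`. The constant `28 = 6 + 4 + 18` is dictated by the second
derivative. -/
theorem packet_polynomial_bounds {P L a k : ℂ} {Y : ℝ} (hY : 1 ≤ Y) (hP : ‖P‖ ≤ 2 * Y)
    (hL : ‖L‖ ≤ 3 * Y) (ha : ‖a‖ ≤ Y) (hk : ‖k‖ ≤ Y) :
    ‖P‖ ≤ 28 * Y ^ 3 ∧ ‖k + P * L‖ ≤ 28 * Y ^ 3 ∧
      ‖2 * k * L + P * (2 * a + L ^ 2)‖ ≤ 28 * Y ^ 3 := by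
  have h1 : Y ≤ Y ^ 3 := le_self_pow₀ hY (by norm_num)
  have h2 : Y ^ 2 ≤ Y ^ 3 := pow_le_pow_right₀ hY (by norm_num)
  have e0 : ‖P * L‖ ≤ 6 * Y ^ 2 := by
    rw [norm_mul]
    calc ‖P‖ * ‖L‖ ≤ 2 * Y * (3 * Y) := by gcongr
      _ = _ := by ring
  have e1 : ‖2 * k * L‖ ≤ 6 * Y ^ 2 := by
    rw [norm_mul, norm_mul, Complex.norm_ofNat]
    calc 2 * ‖k‖ * ‖L‖ ≤ 2 * Y * (3 * Y) := by gcongr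
      _ = _ := by ring
  have e2 : ‖2 * a + L ^ 2‖ ≤ 2 * Y + (3 * Y) ^ 2 := by
    refine (norm_add_le _ _).trans ?_
    rw [norm_mul, norm_pow, Complex.norm_ofNat]
    gcongr
  have e3 : ‖P * (2 * a + L ^ 2)‖ ≤ 4 * Y ^ 2 + 18 * Y ^ 3 := by
    rw [norm_mul]
    calc _ ≤ 2 * Y * (2 * Y + (3 * Y) ^ 2) := by gcongr
      _ = _ := by ring
  refine ⟨by linarith, (norm_add_le _ _).trans (by linarith),
    (norm_add_le _ _).trans (by linarith)⟩

/-- Coefficients of a solution `(c₀ + c₁ x) exp (α x² + β x)`. -/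
structure PacketCoefficients (c e : ℝ) where
  α : ℝ → ℂ
  β : ℝ → ℂ
  c₀ : ℝ → ℂ
  c₁ : ℝ → ℂ
  re_neg : ∀ t, (α t).re < 0
  hα : ∀ t, HasDerivAt α (Complex.I * (4 * α t ^ 2 - c)) t
  hβ : ∀ t, HasDerivAt β (Complex.I * (4 * α t * β t - e)) t
  hc₀ : ∀ t, HasDerivAt c₀ (Complex.I * (2 * β t * c₁ t + (2 * α t + β t ^ 2) * c₀ t)) t
  hc₁ : ∀ t, HasDerivAt c₁ (Complex.I * ((6 * α t + β t ^ 2) * c₁ t)) t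

namespace PacketCoefficients

variable {c e : ℝ} (p : PacketCoefficients c e)

/-- The Gaussian factor. -/
noncomputable def gauss (t x : ℝ) : ℂ := Complex.exp (p.α t * x ^ 2 + p.β t * x)

/-- The solution with the given coefficients. -/
noncomputable def fn (t x : ℝ) : ℂ := (p.c₀ t + p.c₁ t * x) * p.gauss t x

/-- The space derivative of the solution. -/
noncomputable def fn₁ (t x : ℝ) : ℂ :=
  (p.c₁ t + (p.c₀ t + p.c₁ t * x) * (2 * p.α t * x + p.β t)) * p.gauss t x

/-- The second space derivative of the solution. -/
noncomputable def fn₂ (t x : ℝ) : ℂ :=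
  (2 * p.c₁ t * (2 * p.α t * x + p.β t) +
    (p.c₀ t + p.c₁ t * x) * (2 * p.α t + (2 * p.α t * x + p.β t) ^ 2)) * p.gauss t x

theorem hasDerivAt_gauss (t x : ℝ) :
    HasDerivAt (p.gauss t) ((2 * p.α t * x + p.β t) * p.gauss t x) x := by
  have hx : HasDerivAt (fun x : ℝ => (x : ℂ)) 1 x := Complex.ofRealCLM.hasDerivAt
  refine (((hx.fun_pow 2).const_mul (p.α t)).fun_add (hx.const_mul (p.β t))).cexp.congr_deriv ?_
  simp only [gauss]
  ring

theorem norm_gauss (t x : ℝ) :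
    ‖p.gauss t x‖ = Real.exp ((p.α t).re * x ^ 2 + (p.β t).re * x) := by
  rw [gauss, Complex.norm_exp]
  congr 1
  simp [← Complex.ofReal_pow]

theorem hasDerivAt_fn (t x : ℝ) : HasDerivAt (p.fn t) (p.fn₁ t x) x := by
  have hx : HasDerivAt (fun x : ℝ => (x : ℂ)) 1 x := Complex.ofRealCLM.hasDerivAt
  refine ((((hx.const_mul (p.c₁ t)).const_add (p.c₀ t))).fun_mul
    (p.hasDerivAt_gauss t x)).congr_deriv ?_
  simp only [fn₁]
  ring

theorem hasDerivAt_fn₁ (t x : ℝ) : HasDerivAt (p.fn₁ t) (p.fn₂ t x) x := by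
  have hx : HasDerivAt (fun x : ℝ => (x : ℂ)) 1 x := Complex.ofRealCLM.hasDerivAt
  refine (((((hx.const_mul (p.c₁ t)).const_add (p.c₀ t)).fun_mul
    ((hx.const_mul (2 * p.α t)).add_const (p.β t))).const_add (p.c₁ t)).fun_mul
      (p.hasDerivAt_gauss t x)).congr_deriv ?_
  simp only [fn₂]
  ring

/-- The differential equations for the four coefficients are exactly what comparing powers of `x` in
the Schrödinger equation requires. -/
theorem hasDerivAt_fn_time (t x : ℝ) : HasDerivAt (fun s => p.fn s x)
    (-Complex.I * (-p.fn₂ t x + ((c * x ^ 2 + e * x : ℝ) : ℂ) * p.fn t x)) t := by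
  refine (((p.hc₀ t).fun_add ((p.hc₁ t).mul_const (x : ℂ))).fun_mul
    (((p.hα t).mul_const ((x : ℂ) ^ 2)).fun_add
      ((p.hβ t).mul_const (x : ℂ))).cexp).congr_deriv ?_
  simp only [fn, fn₂, gauss]
  push_cast
  ring

/-- Near `t₀` continuity bounds all coefficients by one `M` and keeps `Re α` below `-2δ`, where `Re
α(t₀) = -4δ`. The polynomial prefactors and the linear exponent are then absorbed at the price of
passing from `2δ` to `δ`. -/
theorem dominated (t₀ : ℝ) : ∃ ε > 0, ∃ C δ : ℝ, 0 < δ ∧ ∀ t, |t - t₀| < ε → ∀ x,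
    ‖p.fn t x‖ ≤ C * Real.exp (-δ * x ^ 2) ∧ ‖p.fn₁ t x‖ ≤ C * Real.exp (-δ * x ^ 2) ∧
    ‖p.fn₂ t x‖ ≤ C * Real.exp (-δ * x ^ 2) ∧
    ‖((c * x ^ 2 + e * x : ℝ) : ℂ) * p.fn t x‖ ≤ C * Real.exp (-δ * x ^ 2) := by
  obtain ⟨M, hM1, hMα, hMβ, hM0, hM1'⟩ : ∃ M : ℝ, 1 ≤ M ∧ ‖p.α t₀‖ < M ∧ ‖p.β t₀‖ < M ∧
      ‖p.c₀ t₀‖ < M ∧ ‖p.c₁ t₀‖ < M := by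
    refine ⟨‖p.α t₀‖ + ‖p.β t₀‖ + ‖p.c₀ t₀‖ + ‖p.c₁ t₀‖ + 1, ?_, ?_, ?_, ?_, ?_⟩ <;>
    linarith [norm_nonneg (p.α t₀), norm_nonneg (p.β t₀), norm_nonneg (p.c₀ t₀),
      norm_nonneg (p.c₁ t₀)]
  set δ := -(p.α t₀).re / 4 with hδ
  have hδ0 : 0 < δ := by linarith [p.re_neg t₀]
  have hev : ∀ᶠ t in 𝓝 t₀, ‖p.α t‖ < M ∧ ‖p.β t‖ < M ∧ ‖p.c₀ t‖ < M ∧ ‖p.c₁ t‖ < M ∧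
      (p.α t).re < -(2 * δ) := by
    have hre : (p.α t₀).re < -(2 * δ) := by
      rw [hδ]
      linarith [p.re_neg t₀]
    exact ((p.hα t₀).continuousAt.norm.eventually_lt_const hMα).and
      (((p.hβ t₀).continuousAt.norm.eventually_lt_const hMβ).and
      (((p.hc₀ t₀).continuousAt.norm.eventually_lt_const hM0).and
      (((p.hc₁ t₀).continuousAt.norm.eventually_lt_const hM1').and
      ((Complex.continuous_re.continuousAt.comp (p.hα t₀).continuousAt).eventually_lt_const
        hre))))
  obtain ⟨ε, hε, hball⟩ := Metric.eventually_nhds_iff.1 hev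
  obtain ⟨C, hC0, hC⟩ := pow_mul_exp_le hδ0 M 3
  set K := 28 * M ^ 3 * (1 + |c| + |e|) with hK
  have hK0 : 0 ≤ K := by positivity
  refine ⟨ε, hε, K * C, δ, hδ0, fun t ht x => ?_⟩
  obtain ⟨h1, h2, h3, h4, h5⟩ := hball (by rwa [Real.dist_eq])
  set X := 1 + |x| with hX
  have hX1 : 1 ≤ X := by rw [hX]; linarith [abs_nonneg x]
  have hxX : |x| ≤ X := by rw [hX]; linarith
  have hg : ‖p.gauss t x‖ ≤ Real.exp (-(2 * δ) * x ^ 2 + M * |x|) := by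
    rw [norm_gauss]
    refine Real.exp_le_exp.2 (add_le_add ?_ ?_)
    · exact mul_le_mul_of_nonneg_right h5.le (sq_nonneg x)
    · refine (le_abs_self _).trans ?_
      rw [abs_mul]
      gcongr
      exact (Complex.abs_re_le_norm _).trans h2.le
  have key : ∀ w : ℂ, ‖w‖ ≤ K * X ^ 3 → ‖w * p.gauss t x‖ ≤ K * C * Real.exp (-δ * x ^ 2) := by
    intro w hw
    rw [norm_mul]
    calc _ ≤ K * X ^ 3 * Real.exp (-(2 * δ) * x ^ 2 + M * |x|) := by gcongr
      _ = K * (X ^ 3 * Real.exp (-(2 * δ) * x ^ 2 + M * |x|)) := by ring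
      _ ≤ K * (C * Real.exp (-δ * x ^ 2)) := mul_le_mul_of_nonneg_left (hC x) hK0
      _ = _ := by ring
  have hxn : ‖(x : ℂ)‖ ≤ X := by simpa using hxX
  have hP : ‖p.c₀ t + p.c₁ t * x‖ ≤ 2 * M * X := by
    refine (norm_add_le _ _).trans ?_
    rw [norm_mul]
    have : ‖p.c₁ t‖ * ‖(x : ℂ)‖ ≤ M * X := by gcongr
    nlinarith
  have hL : ‖2 * p.α t * x + p.β t‖ ≤ 3 * M * X := by
    refine (norm_add_le _ _).trans ?_
    rw [norm_mul, norm_mul, Complex.norm_ofNat]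
    have : ‖p.α t‖ * ‖(x : ℂ)‖ ≤ M * X := by gcongr
    nlinarith
  have hMX : 1 ≤ M * X := one_le_mul_of_one_le_of_one_le hM1 hX1
  set Y := M * X with hY
  have hKX : 28 * Y ^ 3 ≤ K * X ^ 3 := by
    have e1 : K * X ^ 3 = 28 * Y ^ 3 * (1 + |c| + |e|) := by rw [hK, hY]; ring
    rw [e1]
    have : 0 ≤ 28 * Y ^ 3 := by positivity
    nlinarith [abs_nonneg c, abs_nonneg e]
  have hMY : M ≤ Y := le_mul_of_one_le_right (by linarith) hX1
  have hXY : X ≤ Y := le_mul_of_one_le_left (by linarith) hM1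
  have hP' : ‖p.c₀ t + p.c₁ t * x‖ ≤ 2 * Y := by rw [hY]; linarith
  have hL' : ‖2 * p.α t * x + p.β t‖ ≤ 3 * Y := by rw [hY]; linarith
  obtain ⟨k1, k2, k3⟩ := packet_polynomial_bounds hMX hP' hL' (h1.le.trans hMY) (h4.le.trans hMY)
  refine ⟨key _ (k1.trans hKX), key _ (k2.trans hKX), key _ (k3.trans hKX), ?_⟩
  rw [fn, ← mul_assoc]
  refine key _ ?_
  rw [norm_mul, Complex.norm_real, Real.norm_eq_abs]
  have e1 : |c * x ^ 2 + e * x| ≤ (|c| + |e|) * Y ^ 2 := by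
    have h6 : |x| ^ 2 ≤ Y ^ 2 := pow_le_pow_left₀ (abs_nonneg _) (hxX.trans hXY) 2
    have h7 : |x| ≤ Y ^ 2 := (hxX.trans hXY).trans (le_self_pow₀ hMX (by norm_num))
    calc _ ≤ |c| * |x| ^ 2 + |e| * |x| := by
          refine (abs_add_le _ _).trans (le_of_eq ?_)
          rw [abs_mul, abs_mul, abs_pow]
      _ ≤ |c| * Y ^ 2 + |e| * Y ^ 2 := add_le_add (mul_le_mul_of_nonneg_left h6 (abs_nonneg c))
          (mul_le_mul_of_nonneg_left h7 (abs_nonneg e))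
      _ = _ := by ring
  calc _ ≤ (|c| + |e|) * Y ^ 2 * (2 * Y) :=
        mul_le_mul e1 hP' (norm_nonneg _) (by positivity)
    _ = 2 * Y ^ 3 * (|c| + |e|) := by ring
    _ ≤ 28 * Y ^ 3 * (1 + |c| + |e|) := by gcongr <;> linarith
    _ = _ := by rw [hK, hY]; ring

theorem isPacket : IsPacket c e p.fn p.fn₁ p.fn₂ where
  contDiff t := by
    have hx : ContDiff ℝ ∞ fun x : ℝ => (x : ℂ) := Complex.ofRealCLM.contDiff
    exact (contDiff_const.add (contDiff_const.mul hx)).mul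
      (((contDiff_const.mul (hx.pow 2)).add (contDiff_const.mul hx)).cexp)
  hasDerivAt_fst := p.hasDerivAt_fn
  hasDerivAt_snd := p.hasDerivAt_fn₁
  hasDerivAt_time := p.hasDerivAt_fn_time
  dominated := p.dominated

end PacketCoefficients

end GaussianPackets

/-! ### Packets built from complex classical trajectories -/

section ClassicalFlows

open Complex in
/-- A complex solution of the classical equation `y'' + 4 c y = 0` with `y(0) = 1` and
`y'(0) = 2 i κ`, together with a primitive. -/
structure ClassicalFlow (c : ℝ) where
  κ : ℝ
  κ_pos : 0 < κ
  y : ℝ → ℂ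
  y' : ℝ → ℂ
  Y : ℝ → ℂ
  hy : ∀ t, HasDerivAt y (y' t) t
  hy' : ∀ t, HasDerivAt y' (-4 * c * y t) t
  hY : ∀ t, HasDerivAt Y (y t) t
  y_zero : y 0 = 1
  y'_zero : y' 0 = 2 * κ * I
  Y_zero : Y 0 = 0
  wronskian : ∀ t, (y' t * (starRingEnd ℂ) (y t)).im = 2 * κ
  one_le_norm : ∀ t, 1 ≤ ‖y t‖

namespace ClassicalFlow

open Complex ComplexConjugate

/-- The flow of an inverted oscillator. -/
noncomputable def repulsive (ν : ℝ) (hν : 0 < ν) : ClassicalFlow (-ν ^ 2) where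
  κ := ν
  κ_pos := hν
  y t := Real.cosh (2 * ν * t) + Real.sinh (2 * ν * t) * I
  y' t := 2 * ν * (Real.sinh (2 * ν * t) + Real.cosh (2 * ν * t) * I)
  Y t := (Real.sinh (2 * ν * t) + (Real.cosh (2 * ν * t) - 1) * I) / (2 * ν)
  hy t := by
    have h : HasDerivAt (fun t : ℝ => 2 * ν * t) (2 * ν) t := by
      simpa using (hasDerivAt_id t).const_mul (2 * ν)
    refine (h.cosh.ofReal_comp.fun_add (h.sinh.ofReal_comp.mul_const I)).congr_deriv ?_
    push_cast
    ring
  hy' t := by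
    have h : HasDerivAt (fun t : ℝ => 2 * ν * t) (2 * ν) t := by
      simpa using (hasDerivAt_id t).const_mul (2 * ν)
    refine ((h.sinh.ofReal_comp.fun_add (h.cosh.ofReal_comp.mul_const I)).const_mul
      (2 * (ν : ℂ))).congr_deriv ?_
    push_cast
    ring
  hY t := by
    have h : HasDerivAt (fun t : ℝ => 2 * ν * t) (2 * ν) t := by
      simpa using (hasDerivAt_id t).const_mul (2 * ν)
    refine ((h.sinh.ofReal_comp.fun_add
      ((h.cosh.ofReal_comp.sub_const 1).mul_const I)).div_const (2 * (ν : ℂ))).congr_deriv ?_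
    have : (ν : ℂ) ≠ 0 := ofReal_ne_zero.2 hν.ne'
    push_cast
    field_simp
  y_zero := by simp
  y'_zero := by simp
  Y_zero := by simp
  wronskian t := by
    have := Real.cosh_sq_sub_sinh_sq (2 * ν * t)
    simp only [mul_im, mul_re, add_im, add_re, conj_re, conj_im, ofReal_re, ofReal_im, I_re, I_im,
      re_ofNat, im_ofNat]
    linear_combination 2 * ν * this
  one_le_norm t := by
    refine le_trans ?_ (abs_re_le_norm _)
    simp only [mul_re, add_re, ofReal_re, ofReal_im, I_re, I_im]
    have := Real.one_le_cosh (2 * ν * t)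
    rw [abs_of_nonneg] <;> linarith

/-- The flow of a harmonic oscillator. -/
noncomputable def confining (ν : ℝ) (hν : 0 < ν) : ClassicalFlow (ν ^ 2) where
  κ := ν
  κ_pos := hν
  y t := exp (2 * ν * I * t)
  y' t := 2 * ν * I * exp (2 * ν * I * t)
  Y t := (exp (2 * ν * I * t) - 1) / (2 * ν * I)
  hy t := by
    have h : HasDerivAt (fun t : ℝ => 2 * ν * I * (t : ℂ)) (2 * ν * I) t := by
      simpa using (hasDerivAt_id t).ofReal_comp.const_mul (2 * ν * I)
    refine h.cexp.congr_deriv (by ring)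
  hy' t := by
    have h : HasDerivAt (fun t : ℝ => 2 * ν * I * (t : ℂ)) (2 * ν * I) t := by
      simpa using (hasDerivAt_id t).ofReal_comp.const_mul (2 * ν * I)
    refine (h.cexp.const_mul (2 * ν * I)).congr_deriv ?_
    push_cast
    linear_combination 4 * ν ^ 2 * exp (2 * ν * I * t) * I_sq
  hY t := by
    have h : HasDerivAt (fun t : ℝ => 2 * ν * I * (t : ℂ)) (2 * ν * I) t := by
      simpa using (hasDerivAt_id t).ofReal_comp.const_mul (2 * ν * I)
    refine ((h.cexp.sub_const 1).div_const (2 * ν * I)).congr_deriv ?_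
    have : (ν : ℂ) ≠ 0 := ofReal_ne_zero.2 hν.ne'
    field_simp
  y_zero := by simp
  y'_zero := by simp
  Y_zero := by simp
  wronskian t := by
    rw [mul_assoc, mul_conj, normSq_eq_norm_sq, norm_exp]
    simp
  one_le_norm t := by
    rw [norm_exp]
    simp

/-- The free flow. -/
noncomputable def free : ClassicalFlow 0 where
  κ := 1
  κ_pos := one_pos
  y t := 1 + 2 * I * t
  y' _ := 2 * I
  Y t := t + I * t ^ 2
  hy t := by
    simpa using ((hasDerivAt_id t).ofReal_comp.const_mul (2 * I)).const_add 1
  hy' t := by simpa using hasDerivAt_const t (2 * I)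
  hY t := by
    have h : HasDerivAt (fun t : ℝ => (t : ℂ)) 1 t := (hasDerivAt_id t).ofReal_comp
    refine (h.fun_add ((h.fun_pow 2).const_mul I)).congr_deriv ?_
    push_cast
    ring
  y_zero := by simp
  y'_zero := by simp
  Y_zero := by simp
  wronskian t := by simp
  one_le_norm t := by
    refine le_trans ?_ (abs_re_le_norm _)
    simp

variable {c : ℝ} (F : ClassicalFlow c)

theorem y_ne_zero (t : ℝ) : F.y t ≠ 0 := by
  rw [← norm_pos_iff]
  linarith [F.one_le_norm t]

/-- The quadratic coefficient of the Gaussian solution. -/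
noncomputable def α (t : ℝ) : ℂ := I * F.y' t / (4 * F.y t)

/-- The linear coefficient of the Gaussian solution with parameter `z`. -/
noncomputable def β (e : ℝ) (z : ℂ) (t : ℝ) : ℂ := (z - I * e * F.Y t) / F.y t

/-- The conserved Wronskian is the numerator of `Re α` over the denominator `‖y‖²`; thus `‖y t‖` is
the width of the packet up to a constant. -/
theorem α_re (t : ℝ) : (F.α t).re = -(F.κ / (2 * ‖F.y t‖ ^ 2)) := by
  have h := F.wronskian t
  have hy := norm_pos_iff.2 (F.y_ne_zero t)
  have e : F.α t = I * (F.y' t * conj (F.y t)) / ((4 * ‖F.y t‖ ^ 2 : ℝ) : ℂ) := by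
    have h2 : ((4 * ‖F.y t‖ ^ 2 : ℝ) : ℂ) = 4 * (F.y t * conj (F.y t)) := by
      rw [mul_conj, normSq_eq_norm_sq]
      push_cast
      ring
    have h3 : conj (F.y t) ≠ 0 := (map_ne_zero _).2 (F.y_ne_zero t)
    have h4 := F.y_ne_zero t
    rw [h2, α]
    field_simp
  rw [e, div_ofReal_re, I_mul_re, h]
  field_simp
  ring

theorem β_re (e : ℝ) (z : ℂ) (t : ℝ) :
    (F.β e z t).re = ((z - I * e * F.Y t) * conj (F.y t)).re / ‖F.y t‖ ^ 2 := by
  have hy := F.y_ne_zero t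
  have e : F.β e z t = ((z - I * e * F.Y t) * conj (F.y t)) / ((‖F.y t‖ ^ 2 : ℝ) : ℂ) := by
    have h2 : ((‖F.y t‖ ^ 2 : ℝ) : ℂ) = F.y t * conj (F.y t) := by
      rw [mul_conj, normSq_eq_norm_sq]
    have h3 : conj (F.y t) ≠ 0 := (map_ne_zero _).2 (F.y_ne_zero t)
    rw [h2, β]
    field_simp
  rw [e, div_ofReal_re]

/-- The substitution `α = i y'/(4y)` linearizes the Riccati equation into `y'' + 4 c y = 0`. -/
theorem hasDerivAt_α (t : ℝ) : HasDerivAt F.α (I * (4 * F.α t ^ 2 - c)) t := by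
  have hy := F.y_ne_zero t
  refine (((F.hy' t).const_mul I).fun_div ((F.hy t).const_mul 4)
    (mul_ne_zero (by norm_num) hy)).congr_deriv ?_
  simp only [α]
  field_simp
  rw [I_sq]
  ring

/-- Here `y` is an integrating factor: the equation for `β` becomes `(β y)' = -i e y`, which is
solved by the primitive `Y`. -/
theorem hasDerivAt_β (e : ℝ) (z : ℂ) (t : ℝ) :
    HasDerivAt (F.β e z) (I * (4 * F.α t * F.β e z t - e)) t := by
  have hy := F.y_ne_zero t
  refine ((((F.hY t).const_mul (I * e)).const_sub z).fun_div (F.hy t) hy).congr_deriv ?_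
  simp only [α, β]
  field_simp
  linear_combination -((z - I * e * F.Y t) * F.y' t) * I_sq

/-- The logarithm of the normalization of the Gaussian solution. -/
noncomputable def Θ (e : ℝ) (z : ℂ) (t : ℝ) : ℂ :=
  ∫ s in (0 : ℝ)..t, I * (2 * F.α s + F.β e z s ^ 2)

theorem hasDerivAt_Θ (e : ℝ) (z : ℂ) (t : ℝ) :
    HasDerivAt (F.Θ e z) (I * (2 * F.α t + F.β e z t ^ 2)) t := by
  have h1 : Continuous F.α := continuous_iff_continuousAt.2 fun t => (F.hasDerivAt_α t).continuousAt
  have h2 : Continuous (F.β e z) :=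
    continuous_iff_continuousAt.2 fun t => (F.hasDerivAt_β e z t).continuousAt
  have h3 : Continuous fun s => I * (2 * F.α s + F.β e z s ^ 2) := by fun_prop
  exact intervalIntegral.integral_hasDerivAt_right (h3.intervalIntegrable _ _)
    (h3.stronglyMeasurableAtFilter _ _) h3.continuousAt

/-- The Gaussian solution with initial value `exp (-κ x² / 2 + z x)`. -/
noncomputable def packet (e : ℝ) (z : ℂ) : PacketCoefficients c e where
  α := F.α
  β := F.β e z
  c₀ t := exp (F.Θ e z t)
  c₁ _ := 0
  re_neg t := by
    rw [F.α_re, neg_lt_zero]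
    have := F.κ_pos
    have := norm_pos_iff.2 (F.y_ne_zero t)
    positivity
  hα := F.hasDerivAt_α
  hβ := F.hasDerivAt_β e z
  hc₀ t := (F.hasDerivAt_Θ e z t).cexp.congr_deriv (by ring)
  hc₁ t := (hasDerivAt_const t (0 : ℂ)).congr_deriv (by ring)

/-- The space derivative of the free Gaussian solution. -/
noncomputable def derivPacket (F : ClassicalFlow 0) (z : ℂ) : PacketCoefficients 0 0 where
  α := F.α
  β := F.β 0 z
  c₀ t := F.β 0 z t * exp (F.Θ 0 z t)
  c₁ t := 2 * F.α t * exp (F.Θ 0 z t)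
  re_neg := (F.packet 0 z).re_neg
  hα := F.hasDerivAt_α
  hβ := F.hasDerivAt_β 0 z
  hc₀ t := by
    refine ((F.hasDerivAt_β 0 z t).fun_mul (F.hasDerivAt_Θ 0 z t).cexp).congr_deriv ?_
    push_cast
    ring
  hc₁ t := by
    refine (((F.hasDerivAt_α t).const_mul 2).fun_mul (F.hasDerivAt_Θ 0 z t).cexp).congr_deriv ?_
    push_cast
    ring

theorem Θ_zero (e : ℝ) (z : ℂ) : F.Θ e z 0 = 0 := by simp [Θ]

theorem α_zero : F.α 0 = -(F.κ / 2) := by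
  rw [α, F.y_zero, F.y'_zero]
  linear_combination (F.κ : ℂ) / 2 * I_sq

theorem β_zero (e : ℝ) (z : ℂ) : F.β e z 0 = z := by
  rw [β, F.y_zero, F.Y_zero]
  simp

theorem packet_zero (e : ℝ) (z : ℂ) (x : ℝ) :
    (F.packet e z).fn 0 x = exp (-(F.κ / 2) * x ^ 2 + z * x) := by
  simp only [PacketCoefficients.fn, PacketCoefficients.gauss, packet, Θ_zero, α_zero, β_zero]
  simp

theorem derivPacket_zero (F : ClassicalFlow 0) (z : ℂ) (x : ℝ) :
    (F.derivPacket z).fn 0 x = (z - F.κ * x) * exp (-(F.κ / 2) * x ^ 2 + z * x) := by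
  simp only [PacketCoefficients.fn, PacketCoefficients.gauss, derivPacket, Θ_zero, α_zero, β_zero]
  simp only [exp_zero]
  ring

/-- The centre of the Gaussian solution. -/
noncomputable def centre (e : ℝ) (z : ℂ) (t : ℝ) : ℝ :=
  ((z - I * e * F.Y t) * conj (F.y t)).re / F.κ

/-- Conservation of mass determines the modulus of the Gaussian solution. -/
theorem exists_norm_sq_packet (e : ℝ) (z : ℂ) : ∃ K, 0 ≤ K ∧ ∀ t x,
    ‖(F.packet e z).fn t x‖ ^ 2 =
      K / ‖F.y t‖ * Real.exp (-F.κ * ((x - F.centre e z t) / ‖F.y t‖) ^ 2) := by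
  have hκ := F.κ_pos
  let a : ℝ → ℝ := fun t => -(F.α t).re
  let b : ℝ → ℝ := fun t => (F.β e z t).re
  have ha : ∀ t, a t = F.κ / (2 * ‖F.y t‖ ^ 2) := fun t => by simp only [a, α_re, neg_neg]
  have hy : ∀ t, 0 < ‖F.y t‖ := fun t => norm_pos_iff.2 (F.y_ne_zero t)
  have ha0 : ∀ t, 0 < a t := fun t => by
    rw [ha]
    have := hy t
    positivity
  -- Up to a constant, `G` is the logarithm of the total mass `e^{2 Re Θ} ∫ exp (-2a x² + 2b x) dx`.
  -- Its conservation fixes the height of the Gaussian once width and centre are known, without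
  -- computing `Θ`.
  let G : ℝ → ℝ := fun t => 2 * (F.Θ e z t).re - Real.log (a t) / 2 + b t ^ 2 / (2 * a t)
  have hG : ∀ t, HasDerivAt G 0 t := fun t => by
    have h1 : HasDerivAt a (-(I * (4 * F.α t ^ 2 - c)).re) t :=
      (reCLM.hasFDerivAt.comp_hasDerivAt t (F.hasDerivAt_α t)).neg
    have h2 : HasDerivAt b (I * (4 * F.α t * F.β e z t - e)).re t :=
      reCLM.hasFDerivAt.comp_hasDerivAt t (F.hasDerivAt_β e z t)
    have h3 : HasDerivAt (fun t => (F.Θ e z t).re) (I * (2 * F.α t + F.β e z t ^ 2)).re t :=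
      reCLM.hasFDerivAt.comp_hasDerivAt t (F.hasDerivAt_Θ e z t)
    have h0 := ha0 t
    refine (((h3.const_mul 2).fun_sub ((h1.log h0.ne').div_const 2)).fun_add
      ((h2.fun_pow 2).fun_div (h1.const_mul 2) (by positivity))).congr_deriv ?_
    have e1 : (F.α t).re = -a t := by simp [a]
    have e2 : (F.β e z t).re = b t := rfl
    simp only [mul_re, mul_im, sub_re, sub_im, add_re, add_im, I_re, I_im, ofReal_re, ofReal_im,
      re_ofNat, im_ofNat, pow_two, e1, e2]
    field_simp
    ring
  have hGc : ∀ t, G t = G 0 := fun t =>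
    is_const_of_deriv_eq_zero (fun t => (hG t).differentiableAt) (fun t => (hG t).deriv) t 0
  refine ⟨Real.exp (G 0) * √(F.κ / 2), by positivity, fun t x => ?_⟩
  have h0 := ha0 t
  have hc : F.centre e z t = b t / (2 * a t) := by
    have := hy t
    simp only [b]
    rw [β_re, ha, centre]
    field_simp
  have hs : √(F.κ / 2) / ‖F.y t‖ = Real.exp (Real.log (a t) / 2) := by
    have h1 := hy t
    have h2 : √(F.κ / 2) / ‖F.y t‖ = √(a t) := by
      rw [ha, show F.κ / (2 * ‖F.y t‖ ^ 2) = F.κ / 2 / ‖F.y t‖ ^ 2 by field_simp,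
        Real.sqrt_div (by positivity) (‖F.y t‖ ^ 2), Real.sqrt_sq h1.le]
    rw [h2, Real.sqrt_eq_rpow, Real.rpow_def_of_pos h0]
    congr 1
    ring
  have hκa : F.κ * ((x - F.centre e z t) / ‖F.y t‖) ^ 2 = 2 * a t * (x - F.centre e z t) ^ 2 := by
    have h1 := hy t
    rw [ha]
    field_simp
  rw [mul_div_assoc, hs, ← Real.exp_add, ← hGc t, ← Real.exp_add, PacketCoefficients.fn, norm_mul,
    (F.packet e z).norm_gauss]
  have e0 : ‖(F.packet e z).c₀ t + (F.packet e z).c₁ t * x‖ = Real.exp (F.Θ e z t).re := by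
    simp [packet, norm_exp]
  rw [e0, ← Real.exp_add, ← Real.exp_nat_mul, neg_mul, hκa, hc]
  congr 1
  have e1 : ((F.packet e z).α t).re = -a t := by simp [a, packet]
  have e2 : ((F.packet e z).β t).re = b t := rfl
  simp only [G, e1, e2]
  push_cast
  field_simp
  ring

theorem derivPacket_fn (F : ClassicalFlow 0) (z : ℂ) (t x : ℝ) :
    (F.derivPacket z).fn t x = (2 * F.α t * x + F.β 0 z t) * (F.packet 0 z).fn t x := by
  simp only [PacketCoefficients.fn, PacketCoefficients.gauss, derivPacket, packet]
  ring

end ClassicalFlow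

end ClassicalFlows

/-! ### Weighted decay of Gaussian profiles -/

section PacketDecay

/-- Uniform bounds for the mass and the size of a packet. -/
def HasBoundedMass (f : ℝ → ℝ → ℂ) : Prop :=
  ∃ C, 0 ≤ C ∧ (∀ t, ∫⁻ x, ENNReal.ofReal (‖f t x‖ ^ 2) ≤ ENNReal.ofReal C) ∧ ∀ t x, ‖f t x‖ ≤ C

/-- The packet `f` decays like `|t|^{-B}` in mean square with respect to the weight `h^B`. -/
def HasWeightedDecay (h : ℝ → ℝ) (B : ℝ) (f : ℝ → ℝ → ℂ) : Prop :=
  ∃ C T, 0 ≤ C ∧ 1 ≤ T ∧ ∀ t : ℝ, T ≤ |t| →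
    ∫⁻ x, ENNReal.ofReal ((h x ^ B * ‖f t x‖) ^ 2) ≤ ENNReal.ofReal (C * |t| ^ (-(2 * B)))

theorem lintegral_rescaled {G : ℝ → ℝ} (hG : Integrable G) (h0 : ∀ s, 0 ≤ G s) {ρ : ℝ}
    (hρ : 0 < ρ) (m : ℝ) :
    ∫⁻ x, ENNReal.ofReal (G ((x - m) / ρ) / ρ) = ENNReal.ofReal (∫ s, G s) := by
  have h1 : Integrable fun x => G ((x - m) / ρ) / ρ :=
    ((hG.comp_div hρ.ne').comp_sub_right m).div_const ρ
  rw [← ofReal_integral_eq_lintegral_ofReal h1 (ae_of_all _ fun x => div_nonneg (h0 _) hρ.le)]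
  congr 1
  rw [integral_div, integral_sub_right_eq_self (fun x => G (x / ρ)) m,
    Measure.integral_comp_div G ρ, abs_of_pos hρ, smul_eq_mul]
  field_simp

/-- The two profiles serve the two regions into which the line is split, one where the weight is
small and one where the packet is. Rescaling preserves mass, so their widths and centres may depend
on time in any way. -/
theorem HasWeightedDecay.of_le {h : ℝ → ℝ} {B : ℝ} {f : ℝ → ℝ → ℂ} {G₁ G₂ : ℝ → ℝ}
    (h1 : Integrable G₁) (h10 : ∀ s, 0 ≤ G₁ s) (h2 : Integrable G₂) (h20 : ∀ s, 0 ≤ G₂ s)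
    {T : ℝ} (hT : 1 ≤ T) (hle : ∀ t : ℝ, T ≤ |t| → ∃ ρ₁ m₁ ρ₂ m₂ : ℝ, 0 < ρ₁ ∧ 0 < ρ₂ ∧ ∀ᵐ x,
      (h x ^ B * ‖f t x‖) ^ 2 ≤
        |t| ^ (-(2 * B)) * (G₁ ((x - m₁) / ρ₁) / ρ₁ + G₂ ((x - m₂) / ρ₂) / ρ₂)) :
    HasWeightedDecay h B f := by
  have i1 : 0 ≤ ∫ s, G₁ s := integral_nonneg h10
  have i2 : 0 ≤ ∫ s, G₂ s := integral_nonneg h20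
  refine ⟨(∫ s, G₁ s) + ∫ s, G₂ s, T, by positivity, hT, fun t ht => ?_⟩
  obtain ⟨ρ₁, m₁, ρ₂, m₂, hρ₁, hρ₂, hx⟩ := hle t ht
  have ht0 : 0 ≤ |t| ^ (-(2 * B)) := by positivity
  calc _ ≤ ∫⁻ x, ENNReal.ofReal (|t| ^ (-(2 * B))) * (ENNReal.ofReal (G₁ ((x - m₁) / ρ₁) / ρ₁) +
        ENNReal.ofReal (G₂ ((x - m₂) / ρ₂) / ρ₂)) := by
        refine lintegral_mono_ae ?_
        filter_upwards [hx] with x hx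
        rw [← ENNReal.ofReal_add (div_nonneg (h10 _) hρ₁.le) (div_nonneg (h20 _) hρ₂.le),
          ← ENNReal.ofReal_mul ht0]
        exact ENNReal.ofReal_le_ofReal hx
    _ = ENNReal.ofReal (|t| ^ (-(2 * B))) *
        (ENNReal.ofReal (∫ s, G₁ s) + ENNReal.ofReal (∫ s, G₂ s)) := by
        rw [lintegral_const_mul' _ _ ENNReal.ofReal_ne_top, lintegral_add_left',
          lintegral_rescaled h1 h10 hρ₁, lintegral_rescaled h2 h20 hρ₂]
        exact (((h1.comp_div hρ₁.ne').comp_sub_right m₁).div_const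
          ρ₁).aestronglyMeasurable.aemeasurable.ennreal_ofReal
    _ = _ := by
        rw [← ENNReal.ofReal_add i1 i2, ← ENNReal.ofReal_mul ht0, mul_comm]

/-- A Gaussian bound with width `ρ` and centre `m`. -/
def HasGaussianProfile (f : ℝ → ℝ → ℂ) (κ : ℝ) (ρ m : ℝ → ℝ) : Prop :=
  ∃ K, 0 ≤ K ∧ ∀ t x, ‖f t x‖ ^ 2 ≤ K / ρ t * Real.exp (-κ * ((x - m t) / ρ t) ^ 2)

theorem HasGaussianProfile.hasBoundedMass {f : ℝ → ℝ → ℂ} {κ : ℝ} {ρ m : ℝ → ℝ}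
    (h : HasGaussianProfile f κ ρ m) (hκ : 0 < κ) (hρ : ∀ t, 1 ≤ ρ t) : HasBoundedMass f := by
  obtain ⟨K, hK0, hK⟩ := h
  have hi : Integrable fun s : ℝ => K * Real.exp (-κ * s ^ 2) :=
    (integrable_exp_neg_mul_sq hκ).const_mul K
  have hn : ∀ s : ℝ, 0 ≤ K * Real.exp (-κ * s ^ 2) := fun s => by positivity
  have hI : 0 ≤ ∫ s : ℝ, K * Real.exp (-κ * s ^ 2) := integral_nonneg hn
  refine ⟨(∫ s : ℝ, K * Real.exp (-κ * s ^ 2)) + (1 + K), by positivity, fun t => ?_,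
    fun t x => ?_⟩
  · refine le_trans ?_ ((lintegral_rescaled hi hn (ρ := ρ t) (by linarith [hρ t]) (m t)).le.trans
      (ENNReal.ofReal_le_ofReal (by linarith)))
    refine lintegral_mono fun x => ENNReal.ofReal_le_ofReal ((hK t x).trans (le_of_eq ?_))
    ring
  · have h1 : ‖f t x‖ ^ 2 ≤ K := by
      refine (hK t x).trans ?_
      have h2 : K / ρ t ≤ K := div_le_self hK0 (hρ t)
      have h3 : Real.exp (-κ * ((x - m t) / ρ t) ^ 2) ≤ 1 := by
        rw [Real.exp_le_one_iff]
        nlinarith [sq_nonneg ((x - m t) / ρ t)]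
      calc _ ≤ K * 1 := by
            gcongr
        _ = K := mul_one K
    nlinarith [norm_nonneg (f t x)]

theorem sq_mul_exp_le {k : ℝ} (hk : 0 < k) (u : ℝ) (hu : 0 ≤ u) :
    u ^ 2 * Real.exp (-k * u) ≤ 8 / k ^ 2 * Real.exp (-(k / 2) * u) := by
  have h1 : (k * u / 2) ^ 2 / 2 ≤ Real.exp (k * u / 2) := by
    have := Real.pow_div_factorial_le_exp (k * u / 2) (by positivity) 2
    simpa using this
  have h2 : u ^ 2 ≤ 8 / k ^ 2 * Real.exp (k * u / 2) := by
    rw [div_mul_eq_mul_div, le_div_iff₀ (by positivity)]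
    nlinarith
  calc _ ≤ 8 / k ^ 2 * Real.exp (k * u / 2) * Real.exp (-k * u) := by gcongr
    _ = _ := by
      rw [mul_assoc, ← Real.exp_add]
      congr 2
      ring

theorem one_le_japaneseBracket {X : Type*} [Norm X] (x : X) : 1 ≤ japaneseBracket x := by
  rw [japaneseBracket, Real.one_le_sqrt]
  nlinarith [sq_nonneg ‖x‖]

theorem abs_le_japaneseBracket (x : ℝ) : |x| ≤ japaneseBracket x := by
  rw [japaneseBracket, Real.norm_eq_abs]
  exact Real.le_sqrt_of_sq_le (by linarith)

theorem japaneseBracket_sq (x : ℝ) : japaneseBracket x ^ 2 = 1 + x ^ 2 := by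
  rw [japaneseBracket, Real.sq_sqrt (by positivity), Real.norm_eq_abs, sq_abs]

/-- Decay of packets for the logarithmic weight under exponential spreading. -/
theorem HasGaussianProfile.hasWeightedDecay_log {f : ℝ → ℝ → ℂ} {κ : ℝ} {ρ m : ℝ → ℝ}
    (h : HasGaussianProfile f κ ρ m) (hκ : 0 < κ) {ν : ℝ} (hν : 0 < ν)
    (hρ : ∀ t, Real.exp (2 * ν * |t|) / 2 ≤ ρ t) {B : ℝ} (hB0 : 0 < B) (hB : B ≤ 3 / 2) :
    HasWeightedDecay (fun x => (japaneseBracket (Real.log (japaneseBracket x)))⁻¹) B f := by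
  obtain ⟨K, hK0, hK⟩ := h
  have hρ0 : ∀ t, 0 < ρ t := fun t => lt_of_lt_of_le (by positivity) (hρ t)
  refine HasWeightedDecay.of_le (G₁ := fun s => ν ^ (-(2 * B)) * (K * Real.exp (-κ * s ^ 2)))
    (G₂ := fun s => 2 * K * (6 / ν ^ 3) * Real.exp 1 * Real.exp (-1 * s ^ 2)) (T := 1)
    (((integrable_exp_neg_mul_sq hκ).const_mul _).const_mul _) (fun s => by positivity)
    ((integrable_exp_neg_mul_sq one_pos).const_mul _) (fun s => by positivity) le_rfl
    fun t ht => ⟨ρ t, m t, Real.exp (ν * |t|), 0, hρ0 t, Real.exp_pos _, ae_of_all _ fun x => ?_⟩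
  have ht0 : 0 < |t| := by linarith
  set h := (japaneseBracket (Real.log (japaneseBracket x)))⁻¹ with hh
  have hj := one_le_japaneseBracket (Real.log (japaneseBracket x))
  have hh0 : 0 < h := by positivity
  have hh1 : h ≤ 1 := inv_le_one_of_one_le₀ hj
  have e1 : (h ^ B * ‖f t x‖) ^ 2 = h ^ (2 * B) * ‖f t x‖ ^ 2 := by
    rw [mul_pow, ← Real.rpow_natCast (h ^ B), ← Real.rpow_mul hh0.le]
    congr 2
    push_cast
    ring
  rw [e1]
  have hp := hK t x
  set P := K / ρ t * Real.exp (-κ * ((x - m t) / ρ t) ^ 2) with hP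
  have hP0 : 0 ≤ P := by have := hρ0 t; positivity
  set Q := 2 * K * (6 / ν ^ 3) * Real.exp 1 * Real.exp (-1 * ((x - 0) / Real.exp (ν * |t|)) ^ 2) /
    Real.exp (ν * |t|) with hQ
  have hQ0 : 0 ≤ Q := by positivity
  have e2 : ν ^ (-(2 * B)) * (K * Real.exp (-κ * ((x - m t) / ρ t) ^ 2)) / ρ t =
      ν ^ (-(2 * B)) * P := by
    rw [hP]
    ring
  rw [e2]
  have htB : 0 ≤ |t| ^ (-(2 * B)) := by positivity
  have hνB : 0 ≤ ν ^ (-(2 * B)) := by positivity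
  -- Split at `|x| = e^{ν|t|}`, far inside the width `e^{2ν|t|}/2`. Beyond it the weight is at most
  -- `(ν|t|)^{-B}`. Inside, the density is at most `2K e^{-2ν|t|}` on an interval whose length is of
  -- order `e^{ν|t|}`, which leaves exponential decay; a Gaussian of width `e^{ν|t|}` stands in for
  -- the indicator of the interval.
  rcases le_or_gt (Real.exp (ν * |t|)) |x| with hx | hx
  · have h1 : ν * |t| ≤ japaneseBracket (Real.log (japaneseBracket x)) := by
      refine le_trans ?_ (abs_le_japaneseBracket _)
      refine le_trans ?_ (le_abs_self _)
      rw [Real.le_log_iff_exp_le (by linarith [one_le_japaneseBracket x])]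
      exact hx.trans (abs_le_japaneseBracket x)
    have h2 : h ^ (2 * B) ≤ ν ^ (-(2 * B)) * |t| ^ (-(2 * B)) := by
      rw [← Real.mul_rpow hν.le ht0.le, Real.rpow_neg (by positivity), hh, Real.inv_rpow (by positivity)]
      gcongr
    calc _ ≤ ν ^ (-(2 * B)) * |t| ^ (-(2 * B)) * P := by gcongr
      _ = |t| ^ (-(2 * B)) * (ν ^ (-(2 * B)) * P) := by ring
      _ ≤ _ := by gcongr; linarith
  · have h2 : h ^ (2 * B) ≤ 1 := Real.rpow_le_one hh0.le hh1 (by positivity)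
    have h3 : P ≤ 2 * K * Real.exp (-(2 * ν * |t|)) := by
      have hexp : Real.exp (-κ * ((x - m t) / ρ t) ^ 2) ≤ 1 := by
        rw [Real.exp_le_one_iff]
        nlinarith [sq_nonneg ((x - m t) / ρ t)]
      have hKρ : K / ρ t ≤ 2 * K * Real.exp (-(2 * ν * |t|)) := by
        rw [div_le_iff₀ (hρ0 t), Real.exp_neg, mul_assoc, ← div_eq_inv_mul]
        have : (1 : ℝ) / 2 ≤ ρ t / Real.exp (2 * ν * |t|) := by
          rw [le_div_iff₀ (Real.exp_pos _)]
          linarith [hρ t]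
        nlinarith
      calc P ≤ (2 * K * Real.exp (-(2 * ν * |t|))) * 1 := by
            rw [hP]
            gcongr
        _ = _ := mul_one _
    have h4 : Real.exp (-(ν * |t|)) ≤ 6 / ν ^ 3 * |t| ^ (-(2 * B)) := by
      have h5 : (ν * |t|) ^ 3 / 6 ≤ Real.exp (ν * |t|) := by
        have := Real.pow_div_factorial_le_exp (ν * |t|) (by positivity) 3
        simpa [Nat.factorial] using this
      have h6 : |t| ^ (2 * B) ≤ |t| ^ 3 := by
        rw [← Real.rpow_natCast]
        exact Real.rpow_le_rpow_of_exponent_le ht (by push_cast; linarith)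
      rw [Real.exp_neg, Real.rpow_neg ht0.le, ← div_eq_mul_inv, div_div, inv_eq_one_div,
        div_le_div_iff₀ (Real.exp_pos _) (by positivity)]
      calc 1 * (ν ^ 3 * |t| ^ (2 * B)) ≤ 1 * (ν ^ 3 * |t| ^ 3) := by gcongr
        _ ≤ _ := by nlinarith
    have h7 : (1 : ℝ) ≤ Real.exp 1 * Real.exp (-1 * ((x - 0) / Real.exp (ν * |t|)) ^ 2) := by
      rw [← Real.exp_add, Real.one_le_exp_iff, sub_zero, div_pow]
      have : x ^ 2 / Real.exp (ν * |t|) ^ 2 ≤ 1 := by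
        rw [div_le_one (by positivity), ← sq_abs x]
        gcongr
      linarith
    have h8 : 2 * K * Real.exp (-(2 * ν * |t|)) ≤ |t| ^ (-(2 * B)) * Q := by
      have e3 : Real.exp (-(2 * ν * |t|)) = Real.exp (-(ν * |t|)) / Real.exp (ν * |t|) := by
        rw [← Real.exp_sub]
        congr 1
        ring
      rw [e3]
      calc 2 * K * (Real.exp (-(ν * |t|)) / Real.exp (ν * |t|))
          ≤ 2 * K * (6 / ν ^ 3 * |t| ^ (-(2 * B)) / Real.exp (ν * |t|)) *
            (Real.exp 1 * Real.exp (-1 * ((x - 0) / Real.exp (ν * |t|)) ^ 2)) := by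
            refine le_trans ?_ (le_mul_of_one_le_right (by positivity) h7)
            gcongr
        _ = _ := by rw [hQ]; ring
    calc _ ≤ 1 * P := by gcongr
      _ ≤ |t| ^ (-(2 * B)) * Q := by rw [one_mul]; exact h3.trans h8
      _ ≤ _ := by
        gcongr
        have := mul_nonneg hνB hP0
        linarith

/-- Decay of packets with ballistic spreading whose centre is accelerated. -/
theorem HasGaussianProfile.hasWeightedDecay_sqrt {f : ℝ → ℝ → ℂ} {κ : ℝ} {ρ m : ℝ → ℝ}
    (h : HasGaussianProfile f κ ρ m) (hκ : 0 < κ) {a b T : ℝ} (ha : 0 < a) (hb : 0 < b)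
    (hT : 1 ≤ T) (hρ0 : ∀ t, 0 < ρ t) (hρ : ∀ t, T ≤ |t| → ρ t ≤ b * |t|)
    (hm : ∀ t, T ≤ |t| → 2 * a * t ^ 2 ≤ |m t|) {B : ℝ} (hB0 : 0 < B) (hB : B ≤ 2) :
    HasWeightedDecay (fun x => japaneseBracket x ^ (-(1 / 2) : ℝ)) B f := by
  obtain ⟨K, hK0, hK⟩ := h
  refine HasWeightedDecay.of_le (G₁ := fun s => a ^ (-B) * (K * Real.exp (-κ * s ^ 2)))
    (G₂ := fun s => K * (b / a) ^ 4 * (8 / κ ^ 2) * Real.exp (-(κ / 2) * s ^ 2)) (T := T)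
    (((integrable_exp_neg_mul_sq hκ).const_mul _).const_mul _) (fun s => by positivity)
    ((integrable_exp_neg_mul_sq (half_pos hκ)).const_mul _) (fun s => by positivity) hT
    fun t ht => ⟨ρ t, m t, ρ t, m t, hρ0 t, hρ0 t, ae_of_all _ fun x => ?_⟩
  have ht1 : 1 ≤ |t| := hT.trans ht
  have ht0 : 0 < |t| := by linarith
  have hr := hρ0 t
  have hx1 := one_le_japaneseBracket x
  have e1 : ((japaneseBracket x ^ (-(1 / 2) : ℝ)) ^ B * ‖f t x‖) ^ 2 =
      japaneseBracket x ^ (-B) * ‖f t x‖ ^ 2 := by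
    rw [mul_pow, ← Real.rpow_mul (by linarith), ← Real.rpow_natCast (_ ^ (_ : ℝ)),
      ← Real.rpow_mul (by linarith)]
    congr 2
    push_cast
    ring
  rw [e1]
  set s := (x - m t) / ρ t with hs
  have hp : ‖f t x‖ ^ 2 ≤ K / ρ t * Real.exp (-κ * s ^ 2) := hK t x
  have htt : t ^ 2 = |t| ^ 2 := (sq_abs t).symm
  have hP0 : 0 ≤ K / ρ t * Real.exp (-κ * s ^ 2) := by positivity
  have hmt := hm t ht
  -- Split at half of the lower bound for the distance of the centre. Beyond it the weight is small;
  -- inside, `x` is at least `(a/b)|t|` widths away from the centre, and the Gaussian tail pays for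
  -- `|t|^{-2B}` with `2B ≤ 4`.
  rcases le_or_gt (a * t ^ 2) |x| with hx | hx
  · have h2 : japaneseBracket x ^ (-B) ≤ a ^ (-B) * |t| ^ (-(2 * B)) := by
      have e2 : |t| ^ (-(2 * B)) = (|t| ^ 2) ^ (-B) := by
        rw [← Real.rpow_natCast |t| 2, ← Real.rpow_mul ht0.le]
        congr 1
        push_cast
        ring
      rw [e2, ← Real.mul_rpow ha.le (by positivity), ← htt]
      have h0 : 0 < a * t ^ 2 := by rw [htt]; positivity
      exact Real.rpow_le_rpow_of_nonpos h0 (hx.trans (abs_le_japaneseBracket x)) (by linarith)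
    calc _ ≤ a ^ (-B) * |t| ^ (-(2 * B)) * (K / ρ t * Real.exp (-κ * s ^ 2)) := by gcongr
      _ = |t| ^ (-(2 * B)) * (a ^ (-B) * (K * Real.exp (-κ * s ^ 2)) / ρ t + 0) := by ring
      _ ≤ _ := by gcongr; positivity
  · have h2 : japaneseBracket x ^ (-B) ≤ 1 :=
      Real.rpow_le_one_of_one_le_of_nonpos hx1 (by linarith)
    have h3 : a * |t| ^ 2 ≤ |x - m t| := by
      have := abs_sub_abs_le_abs_sub (m t) x
      rw [abs_sub_comm (m t) x] at this
      rw [htt] at hx hmt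
      linarith
    have h4 : a * |t| / b ≤ |s| := by
      rw [hs, abs_div, abs_of_pos hr, div_le_div_iff₀ hb hr]
      calc a * |t| * ρ t ≤ a * |t| * (b * |t|) := by gcongr; exact hρ t ht
        _ = a * |t| ^ 2 * b := by ring
        _ ≤ _ := by gcongr
    have h5 : 1 ≤ (b / a) ^ 4 * |t| ^ (-(2 * B)) * (s ^ 2) ^ 2 := by
      have h6 : |t| ^ (2 * B) ≤ |t| ^ 4 := by
        rw [← Real.rpow_natCast]
        exact Real.rpow_le_rpow_of_exponent_le ht1 (by push_cast; linarith)
      have h7 : |t| ≤ b / a * |s| := by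
        rw [div_mul_eq_mul_div, le_div_iff₀ ha]
        rw [div_le_iff₀ hb] at h4
        linarith
      have h8 : |t| ^ (2 * B) ≤ (b / a) ^ 4 * (s ^ 2) ^ 2 := by
        refine h6.trans ?_
        calc |t| ^ 4 ≤ (b / a * |s|) ^ 4 := by gcongr
          _ = (b / a) ^ 4 * (|s| ^ 2) ^ 2 := by ring
          _ = _ := by rw [sq_abs]
      rw [Real.rpow_neg ht0.le, mul_right_comm, ← div_eq_mul_inv, le_div_iff₀ (by positivity)]
      linarith
    have h9 := sq_mul_exp_le hκ (s ^ 2) (sq_nonneg s)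
    calc _ ≤ 1 * (K / ρ t * Real.exp (-κ * s ^ 2)) := by gcongr
      _ ≤ (b / a) ^ 4 * |t| ^ (-(2 * B)) * (s ^ 2) ^ 2 * (K / ρ t * Real.exp (-κ * s ^ 2)) := by
          gcongr
      _ = (b / a) ^ 4 * |t| ^ (-(2 * B)) * (K / ρ t) * ((s ^ 2) ^ 2 * Real.exp (-κ * s ^ 2)) := by
          ring
      _ ≤ (b / a) ^ 4 * |t| ^ (-(2 * B)) * (K / ρ t) *
          (8 / κ ^ 2 * Real.exp (-(κ / 2) * s ^ 2)) := by gcongr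
      _ = |t| ^ (-(2 * B)) * (0 +
          K * (b / a) ^ 4 * (8 / κ ^ 2) * Real.exp (-(κ / 2) * s ^ 2) / ρ t) := by ring
      _ ≤ _ := by gcongr; positivity

/-- Decay of ballistic packets with vanishing momentum amplitude at zero. -/
theorem HasGaussianProfile.hasWeightedDecay_inv {f : ℝ → ℝ → ℂ} {κ : ℝ} {ρ m : ℝ → ℝ}
    (h : HasGaussianProfile f κ ρ m) (hκ : 0 < κ) (hρ0 : ∀ t, 0 < ρ t)
    (hρ : ∀ t, |t| ≤ ρ t) {A : ℝ} (hA0 : 0 ≤ A)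
    (hA : ∀ t x, ‖f t x‖ ^ 2 ≤ A / ρ t ^ 3 * (1 + x ^ 2)) {B : ℝ} (hB1 : 1 ≤ B)
    (hB : B < 3 / 2) :
    HasWeightedDecay (fun x => (japaneseBracket x)⁻¹) B f := by
  obtain ⟨K, hK0, hK⟩ := h
  -- The exponent `2 - 2B` is above `-1` because `B < 3/2`; this is what limits the decay rate in a
  -- free direction.
  have hint : Integrable ((Set.Icc (-1 : ℝ) 1).indicator fun s : ℝ => A * |s| ^ (2 - 2 * B)) := by
    rw [integrable_indicator_iff measurableSet_Icc]
    refine Integrable.const_mul ?_ A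
    have h1 : IntegrableOn (fun s : ℝ => |s| ^ (2 - 2 * B)) (Set.Ioc 0 1) := by
      have := (intervalIntegral.intervalIntegrable_rpow' (a := 0) (b := 1) (r := 2 - 2 * B)
        (by linarith)).1
      refine this.congr_fun (fun s hs => ?_) measurableSet_Ioc
      simp only [abs_of_pos hs.1]
    have h2 : IntegrableOn (fun s : ℝ => |s| ^ (2 - 2 * B)) (Set.Ico (-1) 0) := by
      have := (IntegrableOn.comp_neg h1)
      simpa using this
    have h3 : Set.Icc (-1 : ℝ) 1 ⊆ Set.Ico (-1) 0 ∪ {0} ∪ Set.Ioc 0 1 := by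
      rintro x ⟨h1, h2⟩
      rcases lt_trichotomy x 0 with h | h | h
      · exact Or.inl (Or.inl ⟨h1, h⟩)
      · exact Or.inl (Or.inr h)
      · exact Or.inr ⟨h, h2⟩
    exact ((h2.union (by simp)).union h1).mono_set h3
  refine HasWeightedDecay.of_le (G₁ := fun s => K * Real.exp (-κ * s ^ 2))
    (G₂ := (Set.Icc (-1 : ℝ) 1).indicator fun s : ℝ => A * |s| ^ (2 - 2 * B)) (T := 1)
    ((integrable_exp_neg_mul_sq hκ).const_mul _) (fun s => by positivity)
    hint (fun s => Set.indicator_nonneg (fun s _ => by positivity) s) le_rfl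
    fun t ht => ⟨ρ t, m t, ρ t, 0, hρ0 t, hρ0 t, ?_⟩
  filter_upwards [Measure.ae_ne volume (0 : ℝ)] with x hx0
  have ht0 : 0 < |t| := by linarith
  have hr := hρ0 t
  have hx1 := one_le_japaneseBracket x
  have e1 : ((japaneseBracket x)⁻¹ ^ B * ‖f t x‖) ^ 2 =
      japaneseBracket x ^ (-(2 * B)) * ‖f t x‖ ^ 2 := by
    rw [mul_pow, ← Real.rpow_natCast (_ ^ (_ : ℝ)), ← Real.rpow_mul (by positivity),
      Real.rpow_neg (by linarith), Real.inv_rpow (by linarith)]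
    congr 3
    push_cast
    ring
  rw [e1]
  have hρB : ρ t ^ (-(2 * B)) ≤ |t| ^ (-(2 * B)) :=
    Real.rpow_le_rpow_of_nonpos ht0 (hρ t) (by linarith)
  have hxpos : 0 < |x| := abs_pos.2 hx0
  rcases le_or_gt (ρ t) |x| with hx | hx
  · have h2 : japaneseBracket x ^ (-(2 * B)) ≤ |t| ^ (-(2 * B)) :=
      (Real.rpow_le_rpow_of_nonpos hr (hx.trans (abs_le_japaneseBracket x)) (by linarith)).trans hρB
    have hG : 0 ≤ (Set.Icc (-1 : ℝ) 1).indicator (fun s : ℝ => A * |s| ^ (2 - 2 * B))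
      ((x - 0) / ρ t) / ρ t := div_nonneg (Set.indicator_nonneg (fun s _ => by positivity) _) hr.le
    calc _ ≤ |t| ^ (-(2 * B)) * (K / ρ t * Real.exp (-κ * ((x - m t) / ρ t) ^ 2)) := by
          gcongr
          exact hK t x
      _ = |t| ^ (-(2 * B)) * (K * Real.exp (-κ * ((x - m t) / ρ t) ^ 2) / ρ t + 0) := by ring
      _ ≤ _ := by gcongr
  · have hmem : (x - 0) / ρ t ∈ Set.Icc (-1 : ℝ) 1 := by
      rw [sub_zero, Set.mem_Icc, ← abs_le, abs_div, abs_of_pos hr, div_le_one hr]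
      exact hx.le
    rw [Set.indicator_of_mem hmem, sub_zero, abs_div, abs_of_pos hr]
    -- Within one width of the origin the factor `1 + x² = ⟨x⟩²` in the density cancels part of the
    -- weight. What is left is `|x|^{2-2B} / ρ³`, which in units of `ρ` is `ρ^{-2B}` times an
    -- integrable profile of unit scale.
    have h2 : japaneseBracket x ^ (-(2 * B)) * (1 + x ^ 2) ≤ |x| ^ (2 - 2 * B) := by
      rw [← japaneseBracket_sq, ← Real.rpow_natCast (japaneseBracket x),
        ← Real.rpow_add (by linarith)]
      have : -(2 * B) + ((2 : ℕ) : ℝ) = 2 - 2 * B := by push_cast; ring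
      rw [this]
      exact Real.rpow_le_rpow_of_nonpos hxpos (abs_le_japaneseBracket x) (by linarith)
    have e3 : |x| ^ (2 - 2 * B) / ρ t ^ 3 = ρ t ^ (-(2 * B)) * ((|x| / ρ t) ^ (2 - 2 * B) / ρ t) := by
      rw [Real.div_rpow hxpos.le hr.le, Real.rpow_sub hr, Real.rpow_neg hr.le]
      have : ρ t ^ (2 * B) ≠ 0 := (Real.rpow_pos_of_pos hr _).ne'
      rw [Real.rpow_two]
      field_simp
    calc _ ≤ japaneseBracket x ^ (-(2 * B)) * (A / ρ t ^ 3 * (1 + x ^ 2)) := by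
          gcongr
          exact hA t x
      _ = A / ρ t ^ 3 * (japaneseBracket x ^ (-(2 * B)) * (1 + x ^ 2)) := by ring
      _ ≤ A / ρ t ^ 3 * |x| ^ (2 - 2 * B) := by gcongr
      _ = A * (|x| ^ (2 - 2 * B) / ρ t ^ 3) := by ring
      _ = ρ t ^ (-(2 * B)) * (0 + A * (|x| / ρ t) ^ (2 - 2 * B) / ρ t) := by
          rw [e3]
          ring
      _ ≤ _ := by gcongr; positivity

end PacketDecay

/-! ### Packets for the four kinds of directions -/

section PacketExistence

namespace ClassicalFlow

theorem hasGaussianProfile_packet {c : ℝ} (F : ClassicalFlow c) (e : ℝ) (z : ℂ) :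
    HasGaussianProfile (F.packet e z).fn F.κ (fun t => ‖F.y t‖) (F.centre e z) := by
  obtain ⟨K, hK0, hK⟩ := F.exists_norm_sq_packet e z
  exact ⟨K, hK0, fun t x => (hK t x).le⟩

theorem exp_le_norm_repulsive {ν : ℝ} (hν : 0 < ν) (t : ℝ) :
    Real.exp (2 * ν * |t|) / 2 ≤ ‖(repulsive ν hν).y t‖ := by
  have h1 : ((repulsive ν hν).y t).re = Real.cosh (2 * ν * |t|) := by
    rw [show 2 * ν * |t| = |2 * ν * t| by rw [abs_mul, abs_of_pos (by positivity : 0 < 2 * ν)], Real.cosh_abs]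
    simp only [repulsive, Complex.add_re, Complex.mul_re, Complex.ofReal_re, Complex.ofReal_im,
      Complex.I_re, Complex.I_im]
    ring
  have h2 := Complex.abs_re_le_norm ((repulsive ν hν).y t)
  rw [h1] at h2
  refine le_trans ?_ ((le_abs_self _).trans h2)
  rw [Real.cosh_eq]
  linarith [Real.exp_pos (-(2 * ν * |t|))]

theorem norm_free_sq (t : ℝ) : ‖free.y t‖ ^ 2 = 1 + 4 * t ^ 2 := by
  rw [← Complex.normSq_eq_norm_sq, Complex.normSq_apply]
  simp [free]
  ring

theorem centre_free (e : ℝ) (z : ℂ) (t : ℝ) :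
    free.centre e z t = z.re + 2 * t * z.im - e * t ^ 2 := by
  simp [centre, free, pow_two]
  ring

/-- The logarithmic derivative of a free packet carries an extra factor `1 / y`. Near `x = 0` the
differentiated packet is therefore smaller by one power of `|t|` than its width alone would give. -/
theorem free_coefficient (z : ℂ) (t x : ℝ) :
    2 * free.α t * x + free.β 0 z t = (z - x) / free.y t := by
  have h := free.y_ne_zero t
  simp only [α, β, show free.y' t = 2 * Complex.I from rfl]
  field_simp
  push_cast
  linear_combination 4 * (x : ℂ) * Complex.I_sq

end ClassicalFlow

open ClassicalFlow

/-- Packets in a repulsive direction. -/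
theorem exists_packet_repulsive {ν : ℝ} (hν : 0 < ν) (z : ℂ) : ∃ f f₁ f₂ : ℝ → ℝ → ℂ,
    IsPacket (-ν ^ 2) 0 f f₁ f₂ ∧ (∀ x : ℝ, f 0 x = Complex.exp (-(ν / 2) * x ^ 2 + z * x)) ∧
    HasBoundedMass f ∧ (∀ B, 1 < B → B ≤ 5 / 4 →
      HasWeightedDecay (fun x => (japaneseBracket (Real.log (japaneseBracket x)))⁻¹) B f) ∧
    ∃ C, 0 ≤ C ∧ ∀ t x, ‖f t x‖ ≤ C * Real.exp (-(ν * |t|)) := by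
  let F := repulsive ν hν
  have hp := F.hasGaussianProfile_packet 0 z
  refine ⟨_, _, _, (F.packet 0 z).isPacket, F.packet_zero 0 z,
    hp.hasBoundedMass F.κ_pos F.one_le_norm, fun B h1 h2 => hp.hasWeightedDecay_log F.κ_pos hν
      (exp_le_norm_repulsive hν) (by linarith) (by linarith), ?_⟩
  obtain ⟨K, hK0, hK⟩ := hp
  refine ⟨√(2 * K), by positivity, fun t x => ?_⟩
  have h1 : ‖(F.packet 0 z).fn t x‖ ^ 2 ≤ 2 * K * Real.exp (-(ν * |t|)) ^ 2 := by
    refine (hK t x).trans ?_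
    have h2 := exp_le_norm_repulsive hν t
    have hy : 0 < ‖F.y t‖ := lt_of_lt_of_le one_pos (F.one_le_norm t)
    have h3 : K / ‖F.y t‖ ≤ 2 * K * Real.exp (-(ν * |t|)) ^ 2 := by
      rw [div_le_iff₀ hy, ← Real.exp_nat_mul]
      have e : Real.exp ((2 : ℕ) * -(ν * |t|)) * Real.exp (2 * ν * |t|) = 1 := by
        rw [← Real.exp_add, Real.exp_eq_one_iff]
        push_cast
        ring
      calc K = 2 * K * (Real.exp ((2 : ℕ) * -(ν * |t|)) * (Real.exp (2 * ν * |t|) / 2)) := by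
            rw [mul_div_assoc', e]
            ring
        _ ≤ 2 * K * (Real.exp ((2 : ℕ) * -(ν * |t|)) * ‖F.y t‖) := by gcongr
        _ = _ := by ring
    have h4 : Real.exp (-F.κ * ((x - F.centre 0 z t) / ‖F.y t‖) ^ 2) ≤ 1 := by
      rw [Real.exp_le_one_iff]
      nlinarith [sq_nonneg ((x - F.centre 0 z t) / ‖F.y t‖), F.κ_pos]
    calc _ ≤ 2 * K * Real.exp (-(ν * |t|)) ^ 2 * 1 := by gcongr
      _ = _ := mul_one _
  apply (sq_le_sq₀ (norm_nonneg _) (by positivity)).1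
  rw [mul_pow, Real.sq_sqrt (by positivity)]
  exact h1

/-- Packets in a confining direction. -/
theorem exists_packet_confining {ν : ℝ} (hν : 0 < ν) (z : ℂ) : ∃ f f₁ f₂ : ℝ → ℝ → ℂ,
    IsPacket (ν ^ 2) 0 f f₁ f₂ ∧ (∀ x : ℝ, f 0 x = Complex.exp (-(ν / 2) * x ^ 2 + z * x)) ∧
    HasBoundedMass f := by
  let F := confining ν hν
  exact ⟨_, _, _, (F.packet 0 z).isPacket, F.packet_zero 0 z,
    (F.hasGaussianProfile_packet 0 z).hasBoundedMass F.κ_pos F.one_le_norm⟩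

/-- Packets in a direction with a constant field. -/
theorem exists_packet_stark {e : ℝ} (he : e ≠ 0) (z : ℂ) : ∃ f f₁ f₂ : ℝ → ℝ → ℂ,
    IsPacket 0 e f f₁ f₂ ∧ (∀ x : ℝ, f 0 x = Complex.exp (-(1 / 2) * x ^ 2 + z * x)) ∧
    HasBoundedMass f ∧ ∀ B, 1 < B → B ≤ 5 / 4 →
      HasWeightedDecay (fun x => japaneseBracket x ^ (-(1 / 2) : ℝ)) B f := by
  let F := free
  have hp := F.hasGaussianProfile_packet e z
  refine ⟨_, _, _, (F.packet e z).isPacket, fun x => ?_,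
    hp.hasBoundedMass F.κ_pos F.one_le_norm, fun B h1 h2 => ?_⟩
  · rw [F.packet_zero e z]
    simp [F, free]
  have he' : 0 < |e| := abs_pos.2 he
  -- For `|t| ≥ T` the linear part of the centre is at most `3‖z‖|t| ≤ |e| t²/2`, so the centre
  -- stays at distance at least `|e| t²/2 = 2 (|e|/4) t²`. The width `√(1 + 4t²)` is at most `3|t|`
  -- once `|t| ≥ 1`.
  refine hp.hasWeightedDecay_sqrt F.κ_pos (a := |e| / 4) (b := 3) (T := 1 + 6 * ‖z‖ / |e|)
    (by positivity) (by norm_num) (by have : 0 ≤ 6 * ‖z‖ / |e| := by positivity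
                                      linarith)
    (fun t => lt_of_lt_of_le one_pos (F.one_le_norm t)) (fun t ht => ?_) (fun t ht => ?_)
    (by linarith) (by linarith)
  · have ht1 : 1 ≤ |t| := le_trans (by have : 0 ≤ 6 * ‖z‖ / |e| := by positivity
                                       linarith) ht
    apply (sq_le_sq₀ (norm_nonneg _) (by positivity)).1
    rw [norm_free_sq, ← sq_abs t]
    nlinarith
  · have h0 : 0 ≤ 6 * ‖z‖ / |e| := by positivity
    have ht1 : 1 ≤ |t| := by linarith
    have h3 : 6 * ‖z‖ ≤ |e| * |t| := by
      have : 6 * ‖z‖ / |e| ≤ |t| := by linarith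
      rw [div_le_iff₀ he'] at this
      linarith
    rw [centre_free]
    have h4 : |z.re + 2 * t * z.im| ≤ 3 * ‖z‖ * |t| := by
      refine (abs_add_le _ _).trans ?_
      rw [abs_mul, abs_mul, abs_two]
      have h5 := Complex.abs_re_le_norm z
      have h6 := mul_le_mul_of_nonneg_left (Complex.abs_im_le_norm z) (abs_nonneg t)
      have h7 : ‖z‖ ≤ ‖z‖ * |t| := le_mul_of_one_le_right (norm_nonneg _) ht1
      linarith
    have h5 : |e| * |t| ^ 2 - 3 * ‖z‖ * |t| ≤ |z.re + 2 * t * z.im - e * t ^ 2| := by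
      have h6 := abs_sub_abs_le_abs_sub (e * t ^ 2) (z.re + 2 * t * z.im)
      rw [abs_sub_comm, abs_mul, abs_pow] at h6
      linarith
    refine le_trans ?_ h5
    rw [← sq_abs t]
    nlinarith

/-- Packets in a free direction. -/
theorem exists_packet_free (z : ℂ) : ∃ f f₁ f₂ : ℝ → ℝ → ℂ,
    IsPacket 0 0 f f₁ f₂ ∧
    (∀ x : ℝ, f 0 x = (z - x) * Complex.exp (-(1 / 2) * x ^ 2 + z * x)) ∧
    HasBoundedMass f ∧ ∀ B, 1 < B → B ≤ 5 / 4 →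
      HasWeightedDecay (fun x => (japaneseBracket x)⁻¹) B f := by
  let F := free
  obtain ⟨K, hK0, hK⟩ := F.exists_norm_sq_packet 0 z
  have hy : ∀ t, 1 ≤ ‖F.y t‖ := F.one_le_norm
  have hfn : ∀ t x, ‖(F.derivPacket z).fn t x‖ ^ 2 = ‖z - x‖ ^ 2 / ‖F.y t‖ ^ 2 *
      (K / ‖F.y t‖ * Real.exp (-1 * ((x - F.centre 0 z t) / ‖F.y t‖) ^ 2)) := fun t x => by
    rw [derivPacket_fn, norm_mul, mul_pow, hK, free_coefficient, norm_div, div_pow]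
    rfl
  have hty : ∀ t, 2 * |t| ≤ ‖F.y t‖ := fun t => by
    apply (sq_le_sq₀ (by positivity) (norm_nonneg _)).1
    rw [norm_free_sq, mul_pow, sq_abs]
    linarith
  -- The factor `|z - x|² / ‖y‖²` grows at most quadratically in the rescaled variable `s`, so half
  -- of the exponent absorbs it and the rate drops from `1` to `1/2`.
  have hp : HasGaussianProfile (F.derivPacket z).fn (1 / 2) (fun t => ‖F.y t‖) (F.centre 0 z) := by
    refine ⟨K * (4 + 32 * ‖z‖ ^ 2), by positivity, fun t x => ?_⟩
    have hy0 : 0 < ‖F.y t‖ := lt_of_lt_of_le one_pos (hy t)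
    set s := (x - F.centre 0 z t) / ‖F.y t‖ with hs
    have h1 : ‖z - x‖ / ‖F.y t‖ ≤ |s| + 4 * ‖z‖ := by
      rw [div_le_iff₀ hy0]
      have h2 : |F.centre 0 z t| ≤ 3 * ‖z‖ * ‖F.y t‖ := by
        rw [centre_free, zero_mul, sub_zero]
        refine (abs_add_le _ _).trans ?_
        rw [abs_mul, abs_mul, abs_two]
        have h5 := Complex.abs_re_le_norm z
        have h6 : 2 * |t| * |z.im| ≤ ‖F.y t‖ * ‖z‖ := by
          gcongr
          · exact hty t
          · exact Complex.abs_im_le_norm z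
        have h7 : ‖z‖ ≤ ‖z‖ * ‖F.y t‖ := le_mul_of_one_le_right (norm_nonneg _) (hy t)
        linarith [mul_nonneg (norm_nonneg z) hy0.le, mul_comm ‖F.y t‖ ‖z‖]
      have h3 : ‖z - x‖ ≤ ‖z‖ + |x| := by
        refine (norm_sub_le _ _).trans ?_
        simp
      have h4 : |x| ≤ |s| * ‖F.y t‖ + |F.centre 0 z t| := by
        have : x = s * ‖F.y t‖ + F.centre 0 z t := by
          rw [hs]
          field_simp
          ring
        calc |x| = |s * ‖F.y t‖ + F.centre 0 z t| := by rw [← this]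
          _ ≤ |s * ‖F.y t‖| + |F.centre 0 z t| := abs_add_le _ _
          _ = _ := by rw [abs_mul, abs_norm]
      have h7 : ‖z‖ ≤ ‖z‖ * ‖F.y t‖ := le_mul_of_one_le_right (norm_nonneg _) (hy t)
      linarith
    have h2 : ‖z - x‖ ^ 2 / ‖F.y t‖ ^ 2 ≤ (4 + 32 * ‖z‖ ^ 2) * Real.exp (s ^ 2 / 2) := by
      rw [← div_pow]
      have h3 : (‖z - x‖ / ‖F.y t‖) ^ 2 ≤ (|s| + 4 * ‖z‖) ^ 2 := by gcongr
      have h4 := Real.add_one_le_exp (s ^ 2 / 2)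
      have h5 : (|s| + 4 * ‖z‖) ^ 2 ≤ 2 * s ^ 2 + 32 * ‖z‖ ^ 2 := by
        rw [← sq_abs s]
        nlinarith [sq_nonneg (|s| - 4 * ‖z‖)]
      have h6 : (1 : ℝ) ≤ Real.exp (s ^ 2 / 2) := Real.one_le_exp (by positivity)
      nlinarith [sq_nonneg ‖z‖]
    rw [hfn]
    calc _ ≤ (4 + 32 * ‖z‖ ^ 2) * Real.exp (s ^ 2 / 2) * (K / ‖F.y t‖ * Real.exp (-1 * s ^ 2)) := by
          gcongr
      _ = K * (4 + 32 * ‖z‖ ^ 2) / ‖F.y t‖ * (Real.exp (s ^ 2 / 2) * Real.exp (-1 * s ^ 2)) := by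
          ring
      _ = _ := by
          rw [← Real.exp_add]
          congr 2
          ring
  refine ⟨_, _, _, (F.derivPacket z).isPacket, fun x => ?_,
    hp.hasBoundedMass (by norm_num) F.one_le_norm, fun B h1 h2 => ?_⟩
  · rw [derivPacket_zero]
    simp [F, free]
  refine hp.hasWeightedDecay_inv (by norm_num) (fun t => lt_of_lt_of_le one_pos (hy t))
    (fun t => le_trans (by linarith [abs_nonneg t]) (hty t))
    (A := 2 * (1 + ‖z‖ ^ 2) * K) (by positivity) (fun t x => ?_) h1.le (by linarith)
  have hy0 : 0 < ‖F.y t‖ := lt_of_lt_of_le one_pos (hy t)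
  have h3 : ‖z - x‖ ^ 2 ≤ 2 * (1 + ‖z‖ ^ 2) * (1 + x ^ 2) := by
    have h4 : ‖z - x‖ ≤ ‖z‖ + |x| := (norm_sub_le _ _).trans (by simp)
    have h5 : ‖z - x‖ ^ 2 ≤ (‖z‖ + |x|) ^ 2 := by gcongr
    have h6 := sq_abs x
    nlinarith [sq_nonneg (‖z‖ - |x|), mul_nonneg (sq_nonneg ‖z‖) (sq_nonneg x)]
  have h4 : Real.exp (-1 * ((x - F.centre 0 z t) / ‖F.y t‖) ^ 2) ≤ 1 := by
    rw [Real.exp_le_one_iff]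
    nlinarith [sq_nonneg ((x - F.centre 0 z t) / ‖F.y t‖)]
  rw [hfn]
  calc _ ≤ 2 * (1 + ‖z‖ ^ 2) * (1 + x ^ 2) / ‖F.y t‖ ^ 2 * (K / ‖F.y t‖ * 1) := by gcongr
    _ = _ := by
      field_simp

end PacketExistence

/-! ### Dominated limits and derivatives in `L²` -/

section SquareIntegrableLimits

variable {α : Type*} [MeasurableSpace α] {μ : Measure α}

/-- Dominated convergence in `L²`. -/
theorem tendsto_toLp_of_dominated {ι : Type*} {l : Filter ι} [l.IsCountablyGenerated]
    {F : ι → α → ℂ} {f : α → ℂ} {G : α → ℝ} (hF : ∀ i, MemLp (F i) 2 μ) (hf : MemLp f 2 μ)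
    (hG : MemLp G 2 μ) (hb : ∀ᶠ i in l, ∀ᵐ x ∂μ, ‖F i x‖ ≤ G x)
    (hlim : ∀ᵐ x ∂μ, Tendsto (fun i => F i x) l (𝓝 (f x))) :
    Tendsto (fun i => (hF i).toLp (F i)) l (𝓝 (hf.toLp f)) := by
  rw [Lp.tendsto_Lp_iff_tendsto_eLpNorm'']
  have h2 : ∀ i, eLpNorm (F i - f) 2 μ = (∫⁻ x, ‖F i x - f x‖ₑ ^ (2 : ℝ) ∂μ) ^ (1 / (2 : ℝ)) :=
    fun i => by
      rw [eLpNorm_eq_lintegral_rpow_enorm_toReal (by norm_num) (by norm_num)]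
      simp
  have hB : MemLp (fun x => G x + ‖f x‖) 2 μ := hG.add hf.norm
  have hlim0 : Tendsto (fun i => ∫⁻ x, ‖F i x - f x‖ₑ ^ (2 : ℝ) ∂μ) l (𝓝 (∫⁻ _, 0 ∂μ)) := by
    refine tendsto_lintegral_filter_of_dominated_convergence'
      (fun x => ‖G x + ‖f x‖‖ₑ ^ (2 : ℝ)) (Eventually.of_forall fun i =>
        ((hF i).1.sub hf.1).enorm.pow_const _) ?_ ?_ ?_
    · filter_upwards [hb] with i hi
      filter_upwards [hi] with x hx
      gcongr
      rw [enorm_le_iff_norm_le]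
      refine (norm_sub_le _ _).trans (le_trans ?_ (le_abs_self _))
      linarith
    · have := lintegral_rpow_enorm_lt_top_of_eLpNorm_lt_top (by norm_num) (by norm_num) hB.2
      simpa using this.ne
    · filter_upwards [hlim] with x hx
      have h3 : Tendsto (fun i => ‖F i x - f x‖ₑ) l (𝓝 0) := by
        have := (hx.sub_const (f x)).enorm
        simpa using this
      have := (ENNReal.continuous_rpow_const (y := (2 : ℝ))).tendsto 0 |>.comp h3
      simpa [Function.comp_def] using this
  simp only [h2]
  have := (ENNReal.continuous_rpow_const (y := (1 / 2 : ℝ))).tendsto _ |>.comp hlim0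
  simpa [Function.comp_def] using this

/-- Differentiation in `L²` under a domination hypothesis. -/
theorem hasDerivAt_toLp_of_dominated {F F' : ℝ → α → ℂ} {G : α → ℝ} {t₀ ε : ℝ} (hε : 0 < ε)
    (hF : ∀ t, MemLp (F t) 2 μ) (hF' : MemLp (F' t₀) 2 μ) (hG : MemLp G 2 μ)
    (hd : ∀ t, |t - t₀| < ε → ∀ x, HasDerivAt (fun s => F s x) (F' t x) t)
    (hb : ∀ t, |t - t₀| < ε → ∀ x, ‖F' t x‖ ≤ G x) :
    HasDerivAt (fun t => (hF t).toLp (F t)) (hF'.toLp (F' t₀)) t₀ := by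
  rw [hasDerivAt_iff_tendsto_slope]
  have hmem : ∀ t, MemLp (fun x => ((t - t₀)⁻¹ : ℝ) • (F t x - F t₀ x)) 2 μ := fun t =>
    ((hF t).sub (hF t₀)).const_smul ((t - t₀)⁻¹ : ℝ)
  have hs : slope (fun t => (hF t).toLp (F t)) t₀ = fun t => (hmem t).toLp _ := by
    funext t
    rw [slope_def_module, ← MemLp.toLp_sub, ← MemLp.toLp_const_smul]
    rfl
  rw [hs]
  refine tendsto_toLp_of_dominated hmem hF' hG ?_ (ae_of_all _ fun x => ?_)
  · have hnear : ∀ᶠ t in 𝓝[≠] t₀, |t - t₀| < ε := by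
      refine nhdsWithin_le_nhds ?_
      filter_upwards [Metric.ball_mem_nhds t₀ hε] with t ht
      simpa [Real.dist_eq] using ht
    filter_upwards [hnear, self_mem_nhdsWithin] with t ht hne
    refine ae_of_all _ fun x => ?_
    have hconv : Convex ℝ (Metric.ball t₀ ε) := convex_ball t₀ ε
    -- The mean value inequality transfers the domination from the derivative to the difference
    -- quotients.
    have := hconv.norm_image_sub_le_of_norm_hasDerivWithin_le (f := fun s => F s x)
      (f' := fun s => F' s x) (C := G x)
      (fun s hs => (hd s (by simpa [Real.dist_eq] using hs) x).hasDerivWithinAt)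
      (fun s hs => hb s (by simpa [Real.dist_eq] using hs) x)
      (Metric.mem_ball_self hε) (show t ∈ Metric.ball t₀ ε by simpa [Real.dist_eq] using ht)
    rw [norm_smul, norm_inv]
    have hpos : 0 < ‖t - t₀‖ := norm_pos_iff.2 (sub_ne_zero.2 hne)
    rw [inv_mul_le_iff₀ hpos]
    linarith
  · have := hasDerivAt_iff_tendsto_slope.1 (hd t₀ (by simpa using hε) x)
    refine this.congr fun t => ?_
    rw [slope_def_module]

end SquareIntegrableLimits

/-! ### Cutoffs and membership in the closed graph -/

section Cutoff

variable {n : ℕ}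

namespace testFunctions

/-- Dilation of a test function. -/
noncomputable def dilate (s : ℝ) (hs : s ≠ 0) (φ : testFunctions n) : testFunctions n :=
  ⟨fun x => (φ : RSpace n → ℂ) (s • x), (contDiff φ).comp (contDiff_const_smul s),
    (hasCompactSupport φ).comp_smul hs⟩

theorem D_dilate (i : Fin n) (s : ℝ) (hs : s ≠ 0) (φ : testFunctions n) :
    D i (dilate s hs φ) = (s : ℂ) • dilate s hs (D i φ) := by
  ext x
  rw [D_apply]
  have h : HasFDerivAt (fun x : RSpace n => s • x) (s • ContinuousLinearMap.id ℝ (RSpace n)) x :=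
    (s • ContinuousLinearMap.id ℝ (RSpace n)).hasFDerivAt
  have h2 : HasFDerivAt (dilate s hs φ : RSpace n → ℂ) _ x :=
    (differentiable φ (s • x)).hasFDerivAt.comp x h
  rw [h2.fderiv]
  change fderiv ℝ (φ : RSpace n → ℂ) (s • x) (s • stdVec i) =
    (s : ℂ) * fderiv ℝ (φ : RSpace n → ℂ) (s • x) (stdVec i)
  rw [map_smul, Complex.real_smul]

theorem exists_bound (φ : testFunctions n) : ∃ A, 0 ≤ A ∧ ∀ x, ‖(φ : RSpace n → ℂ) x‖ ≤ A := by
  obtain ⟨A, hA⟩ := (continuous φ).bounded_above_of_compact_support (hasCompactSupport φ)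
  exact ⟨A, (norm_nonneg _).trans (hA 0), hA⟩

/-- Cutoff functions that exhaust the space and have uniformly bounded derivatives. -/
theorem exists_cutoff (n : ℕ) : ∃ (χ : ℕ → testFunctions n) (A : ℝ), 0 ≤ A ∧
    (∀ k x, ‖(χ k : RSpace n → ℂ) x‖ ≤ A ∧ (∀ i, ‖(D i (χ k) : RSpace n → ℂ) x‖ ≤ A) ∧
      ∀ i, ‖(D i (D i (χ k)) : RSpace n → ℂ) x‖ ≤ A) ∧
    ∀ x, (∀ᶠ k in atTop, (χ k : RSpace n → ℂ) x = 1) ∧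
      (∀ i, Tendsto (fun k => (D i (χ k) : RSpace n → ℂ) x) atTop (𝓝 0)) ∧
      ∀ i, Tendsto (fun k => (D i (D i (χ k)) : RSpace n → ℂ) x) atTop (𝓝 0) := by
  let b : ContDiffBump (0 : RSpace n) := ⟨1, 2, one_pos, one_lt_two⟩
  let φ : testFunctions n := ⟨fun x => (b x : ℂ), Complex.ofRealCLM.contDiff.comp b.contDiff,
    b.hasCompactSupport.comp_left Complex.ofReal_zero⟩
  obtain ⟨A₀, hA₀, h0⟩ := exists_bound φ
  choose A₁ hA₁ h1 using fun i => exists_bound (D i φ)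
  choose A₂ hA₂ h2 using fun i => exists_bound (D i (D i φ))
  set A := A₀ + ∑ i, A₁ i + ∑ i, A₂ i with hA
  have hs1 : 0 ≤ ∑ i, A₁ i := Finset.sum_nonneg fun i _ => hA₁ i
  have hs2 : 0 ≤ ∑ i, A₂ i := Finset.sum_nonneg fun i _ => hA₂ i
  have hAi : ∀ i, A₁ i ≤ A := fun i => by
    have := Finset.single_le_sum (fun i _ => hA₁ i) (Finset.mem_univ i)
    linarith
  have hAi' : ∀ i, A₂ i ≤ A := fun i => by
    have := Finset.single_le_sum (fun i _ => hA₂ i) (Finset.mem_univ i)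
    linarith
  let s : ℕ → ℝ := fun k => (1 : ℝ) / (k + 1)
  have hs0 : ∀ k, 0 < s k := fun k => by positivity
  have hs1' : ∀ k, s k ≤ 1 := fun k => by
    rw [div_le_one (by positivity)]
    linarith [(Nat.cast_nonneg k : (0 : ℝ) ≤ k)]
  have hst : Tendsto s atTop (𝓝 0) := tendsto_one_div_add_atTop_nhds_zero_nat
  have hstc : Tendsto (fun k => (s k : ℂ)) atTop (𝓝 0) := by
    have := (Complex.continuous_ofReal.tendsto 0).comp hst
    simpa [Function.comp_def] using this
  let χ : ℕ → testFunctions n := fun k => dilate (s k) (hs0 k).ne' φ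
  have hD : ∀ k i x, (D i (χ k) : RSpace n → ℂ) x =
      (s k : ℂ) * (D i φ : RSpace n → ℂ) (s k • x) := fun k i x => by
    simp only [χ, D_dilate]
    rfl
  have hDD : ∀ k i x, (D i (D i (χ k)) : RSpace n → ℂ) x =
      (s k : ℂ) * ((s k : ℂ) * (D i (D i φ) : RSpace n → ℂ) (s k • x)) := fun k i x => by
    simp only [χ, D_dilate, map_smul]
    rfl
  have hn : ∀ k (w : ℂ), ‖(s k : ℂ) * w‖ ≤ ‖w‖ := fun k w => by
    rw [norm_mul, Complex.norm_real, Real.norm_of_nonneg (hs0 k).le]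
    exact mul_le_of_le_one_left (norm_nonneg _) (hs1' k)
  have hz : ∀ (w : ℕ → ℂ) (M : ℝ), (∀ k, ‖w k‖ ≤ M) →
      Tendsto (fun k => (s k : ℂ) * w k) atTop (𝓝 0) := fun w M hw => by
    refine squeeze_zero_norm (a := fun k => s k * M) (fun k => ?_) (by simpa using hst.mul_const M)
    rw [norm_mul, Complex.norm_real, Real.norm_of_nonneg (hs0 k).le]
    exact mul_le_mul_of_nonneg_left (hw k) (hs0 k).le
  refine ⟨χ, A, by positivity, fun k x => ⟨?_, fun i => ?_, fun i => ?_⟩, fun x => ⟨?_, fun i => ?_,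
    fun i => ?_⟩⟩
  · exact (h0 _).trans (by linarith)
  · rw [hD]
    exact (hn _ _).trans ((h1 i _).trans (hAi i))
  · rw [hDD]
    exact (hn _ _).trans ((hn _ _).trans ((h2 i _).trans (hAi' i)))
  · have : Tendsto (fun k => s k • x) atTop (𝓝 0) := by simpa using hst.smul_const x
    filter_upwards [this.eventually (Metric.closedBall_mem_nhds 0 one_pos)] with k hk
    have : b (s k • x) = 1 := b.one_of_mem_closedBall hk
    change ((b (s k • x) : ℝ) : ℂ) = 1
    rw [this, Complex.ofReal_one]
  · simp only [hD]
    exact hz _ (A₁ i) fun k => h1 i _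
  · simp only [hDD]
    exact hz _ (A₂ i) fun k => (hn _ _).trans (h2 i _)

/-- The product of a test function and a smooth function. -/
noncomputable def mulSmooth (χ : testFunctions n) (u : RSpace n → ℂ) (hu : ContDiff ℝ ∞ u) :
    testFunctions n :=
  ⟨fun x => (χ : RSpace n → ℂ) x * u x, (contDiff χ).mul hu, (hasCompactSupport χ).mul_right⟩

end testFunctions

open testFunctions

/-- Data of a smooth function together with its first and second pure partial derivatives. -/
structure SmoothWithDerivs (u : RSpace n → ℂ) (u₁ u₂ : Fin n → RSpace n → ℂ) : Prop where
  contDiff : ContDiff ℝ ∞ u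
  differentiable : ∀ i, Differentiable ℝ (u₁ i)
  fderiv_fst : ∀ i x, fderiv ℝ u x (stdVec i) = u₁ i x
  fderiv_snd : ∀ i x, fderiv ℝ (u₁ i) x (stdVec i) = u₂ i x

theorem SmoothWithDerivs.lap_mulSmooth {u : RSpace n → ℂ} {u₁ u₂ : Fin n → RSpace n → ℂ}
    (h : SmoothWithDerivs u u₁ u₂) (χ : testFunctions n) (x : RSpace n) :
    (lap (mulSmooth χ u h.contDiff) : RSpace n → ℂ) x =
      ∑ i, ((χ : RSpace n → ℂ) x * u₂ i x + 2 * ((D i χ : RSpace n → ℂ) x * u₁ i x) +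
        (D i (D i χ) : RSpace n → ℂ) x * u x) := by
  rw [lap_eq, Submodule.coe_sum, Finset.sum_apply]
  refine Finset.sum_congr rfl fun i _ => ?_
  have hu : Differentiable ℝ u := h.contDiff.differentiable (by simp)
  have h1 : ∀ x, (D i (mulSmooth χ u h.contDiff) : RSpace n → ℂ) x =
      (χ : RSpace n → ℂ) x * u₁ i x + (D i χ : RSpace n → ℂ) x * u x := fun x => by
    rw [D_apply]
    have e : fderiv ℝ (mulSmooth χ u h.contDiff : RSpace n → ℂ) x = _ :=
      ((testFunctions.differentiable χ x).hasFDerivAt.mul (hu x).hasFDerivAt).fderiv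
    rw [e, ← h.fderiv_fst, D_apply]
    simp
    ring
  have h2 : (D i (mulSmooth χ u h.contDiff) : RSpace n → ℂ) = fun x =>
      (χ : RSpace n → ℂ) x * u₁ i x + (D i χ : RSpace n → ℂ) x * u x := funext h1
  rw [D_apply, h2]
  have e : fderiv ℝ (fun x => (χ : RSpace n → ℂ) x * u₁ i x + (D i χ : RSpace n → ℂ) x * u x) x = _ :=
    (((testFunctions.differentiable χ x).hasFDerivAt.mul (h.differentiable i x).hasFDerivAt).add
      ((testFunctions.differentiable (D i χ) x).hasFDerivAt.mul (hu x).hasFDerivAt)).fderiv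
  rw [e, D_apply i (D i χ), D_apply i χ, ← h.fderiv_snd, ← h.fderiv_fst]
  simp only [add_apply, smul_apply, smul_eq_mul]
  ring

/-- Smooth functions with square integrable derivatives are in the domain of the closure of
`-Δ + ∑ (c_k x_k² + e_k x_k) + V`. -/
theorem SmoothWithDerivs.mem_closure {u : RSpace n → ℂ} {u₁ u₂ : Fin n → RSpace n → ℂ}
    (h : SmoothWithDerivs u u₁ u₂) (c e : Fin n → ℝ) {V : RSpace n → ℝ} (hV : IsLocallyL2 V)
    (hsmall : ∀ ε > 0, ∃ C, 0 ≤ C ∧ ∀ φ : testFunctions n,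
      ‖mulL2 V hV φ‖ ≤ ε * ‖toL2 (lap φ)‖ + C * ‖toL2 φ‖)
    (hu : MemLp u 2 volume) (hu₁ : ∀ i, MemLp (u₁ i) 2 volume) (hu₂ : ∀ i, MemLp (u₂ i) 2 volume)
    (hq : MemLp (fun x => ((∑ k, (c k * x k ^ 2 + e k * x k) : ℝ) : ℂ) * u x) 2 volume)
    {η : RSpace n → ℂ} (hη : MemLp η 2 volume)
    (hηx : ∀ x, η x = -(∑ i, u₂ i x) + ((∑ k, (c k * x k ^ 2 + e k * x k) : ℝ) : ℂ) * u x) :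
    ∃ w : L2 n, (w =ᵐ[volume] fun x => (V x : ℂ) * u x) ∧
      (hu.toLp u, hη.toLp η + w) ∈
        closure (Set.range fun φ : testFunctions n => (toL2 φ, hamiltonian c e V hV φ)) := by
  obtain ⟨χ, A, hA, hb, hl⟩ := exists_cutoff n
  let φ : ℕ → testFunctions n := fun k => mulSmooth (χ k) u h.contDiff
  have hφx : ∀ k x, (φ k : RSpace n → ℂ) x = (χ k : RSpace n → ℂ) x * u x := fun k x => rfl
  have hφlim : ∀ x, ∀ᶠ k in atTop, (φ k : RSpace n → ℂ) x = u x := fun x => by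
    filter_upwards [(hl x).1] with k hk
    rw [hφx, hk, one_mul]
  have t1 : Tendsto (fun k => toL2 (φ k)) atTop (𝓝 (hu.toLp u)) := by
    refine tendsto_toLp_of_dominated (fun k => memLp (φ k) 2) hu (hu.norm.const_mul A)
      (Eventually.of_forall fun k => ae_of_all _ fun x => ?_) (ae_of_all _ fun x => ?_)
    · rw [hφx, norm_mul]
      exact mul_le_mul_of_nonneg_right (hb k x).1 (norm_nonneg _)
    · exact tendsto_const_nhds.congr' ((hφlim x).mono fun k hk => hk.symm)
  have t2 : Tendsto (fun k => toL2 (quad c e (φ k))) atTop (𝓝 (hq.toLp _)) := by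
    refine tendsto_toLp_of_dominated (fun k => memLp (quad c e (φ k)) 2) hq (hq.norm.const_mul A)
      (Eventually.of_forall fun k => ae_of_all _ fun x => ?_) (ae_of_all _ fun x => ?_)
    · rw [quad_apply, hφx, mul_left_comm, norm_mul]
      exact mul_le_mul_of_nonneg_right (hb k x).1 (norm_nonneg _)
    · refine tendsto_const_nhds.congr' ((hφlim x).mono fun k hk => ?_)
      dsimp only
      rw [quad_apply, hk]
  have hΔ : MemLp (fun x => ∑ i, u₂ i x) 2 volume := memLp_finsetSum _ fun i _ => hu₂ i
  have t3 : Tendsto (fun k => toL2 (lap (φ k))) atTop (𝓝 (hΔ.toLp _)) := by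
    have hG : MemLp (fun x => ∑ i, (A * ‖u₂ i x‖ + 2 * (A * ‖u₁ i x‖) + A * ‖u x‖)) 2 volume :=
      memLp_finsetSum _ fun i _ => (((hu₂ i).norm.const_mul A).add
        (((hu₁ i).norm.const_mul A).const_mul 2)).add (hu.norm.const_mul A)
    refine tendsto_toLp_of_dominated (fun k => memLp (lap (φ k)) 2) hΔ hG
      (Eventually.of_forall fun k => ae_of_all _ fun x => ?_) (ae_of_all _ fun x => ?_)
    · rw [h.lap_mulSmooth]
      refine (norm_sum_le _ _).trans (Finset.sum_le_sum fun i _ => ?_)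
      refine (norm_add₃_le ..).trans ?_
      simp only [norm_mul, Complex.norm_ofNat]
      gcongr
      · exact (hb k x).1
      · exact (hb k x).2.1 i
      · exact (hb k x).2.2 i
    · have hk : ∀ k, (lap (φ k) : RSpace n → ℂ) x = _ := fun k => h.lap_mulSmooth (χ k) x
      simp only [hk]
      refine tendsto_finsetSum _ fun i _ => ?_
      have l1 : Tendsto (fun k => (χ k : RSpace n → ℂ) x) atTop (𝓝 1) :=
        tendsto_const_nhds.congr' ((hl x).1.mono fun k hk => hk.symm)
      have := ((l1.mul_const (u₂ i x)).add ((((hl x).2.1 i).mul_const (u₁ i x)).const_mul 2)).add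
        (((hl x).2.2 i).mul_const (u x))
      simpa using this
  obtain ⟨C, hC0, hC⟩ := hsmall 1 one_pos
  -- No domination is available for `V φ_k`. The relative bound makes it Cauchy instead, because
  -- `φ_k` and `Δ φ_k` already converge.
  have hcau : CauchySeq fun k => mulL2 V hV (φ k) := by
    rw [Metric.cauchySeq_iff']
    intro ε hε
    obtain ⟨N₁, hN₁⟩ := Metric.cauchySeq_iff.1 t1.cauchySeq (ε / (2 * (C + 1))) (by positivity)
    obtain ⟨N₃, hN₃⟩ := Metric.cauchySeq_iff.1 t3.cauchySeq (ε / 2) (by positivity)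
    refine ⟨max N₁ N₃, fun k hk => ?_⟩
    have d1 := hN₁ k (le_trans (le_max_left _ _) hk) (max N₁ N₃) (le_max_left _ _)
    have d3 := hN₃ k (le_trans (le_max_right _ _) hk) (max N₁ N₃) (le_max_right _ _)
    rw [dist_eq_norm] at d1 d3 ⊢
    rw [← map_sub] at d1 d3 ⊢
    rw [← map_sub] at d3
    rw [lt_div_iff₀ (by positivity)] at d1
    have := hC (φ k - φ (max N₁ N₃))
    have d0 := norm_nonneg (toL2 (φ k - φ (max N₁ N₃)))
    linarith
  obtain ⟨w, hw⟩ := cauchySeq_tendsto_of_complete hcau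
  refine ⟨w, ?_, ?_⟩
  -- The limit is identified along an almost everywhere convergent subsequence: at each point the
  -- cutoff eventually equals `1`, so the values are eventually `V u`.
  · have hm : TendstoInMeasure volume (fun k => (mulL2 V hV (φ k) : RSpace n → ℂ)) atTop w :=
      tendstoInMeasure_of_tendsto_Lp hw
    obtain ⟨ns, hns, hlim⟩ := hm.exists_seq_tendsto_ae
    filter_upwards [hlim, ae_all_iff.2 fun k => coeFn_mulL2 V hV (φ k)] with x hx1 hx2
    refine tendsto_nhds_unique hx1 ?_
    simp only [hx2]
    refine tendsto_const_nhds.congr' ?_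
    filter_upwards [hns.tendsto_atTop.eventually (hφlim x)] with k hk
    rw [hk]
  · refine mem_closure_of_tendsto (f := fun k => (toL2 (φ k), hamiltonian c e V hV (φ k)))
      (b := atTop) ?_ (Eventually.of_forall fun k => ⟨φ k, rfl⟩)
    refine t1.prodMk_nhds ?_
    simp only [hamiltonian_apply]
    have hlim := ((t3.neg).add t2).add hw
    have e : hη.toLp η = -hΔ.toLp _ + hq.toLp _ := by
      rw [← MemLp.toLp_neg, ← MemLp.toLp_add]
      congr 1
      funext x
      exact hηx x
    rw [e]
    exact hlim

end Cutoff

/-! ### Products of packets as solutions in `n` dimensions -/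

section ProductStates

variable {n : ℕ}

/-- The product of functions of the single coordinates. -/
noncomputable def prodFn (g : Fin n → ℝ → ℂ) (x : RSpace n) : ℂ := ∏ j, g j (x j)

theorem prodFn_update (g : Fin n → ℝ → ℂ) (i : Fin n) (h : ℝ → ℂ) (x : RSpace n) :
    prodFn (Function.update g i h) x = h (x i) * ∏ j ∈ Finset.univ.erase i, g j (x j) := by
  rw [prodFn, ← Finset.mul_prod_erase _ _ (Finset.mem_univ i), Function.update_self]
  congr 1
  refine Finset.prod_congr rfl fun j hj => ?_
  rw [Function.update_of_ne (Finset.ne_of_mem_erase hj)]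

theorem prodFn_eq_mul (g : Fin n → ℝ → ℂ) (i : Fin n) (x : RSpace n) :
    prodFn g x = g i (x i) * ∏ j ∈ Finset.univ.erase i, g j (x j) := by
  rw [prodFn, Finset.mul_prod_erase _ (fun j => g j (x j)) (Finset.mem_univ i)]

theorem contDiff_prodFn {g : Fin n → ℝ → ℂ} (hg : ∀ j, ContDiff ℝ ∞ (g j)) :
    ContDiff ℝ ∞ (prodFn g) := by
  unfold prodFn
  exact contDiff_prod fun j _ => (hg j).comp (contDiff_piLp_apply (p := 2))

theorem differentiable_prodFn {g : Fin n → ℝ → ℂ} (hg : ∀ j, Differentiable ℝ (g j)) :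
    Differentiable ℝ (prodFn g) := by
  unfold prodFn
  have h : ∀ j : Fin n, Differentiable ℝ fun x : RSpace n => g j (x j) := fun j =>
    (hg j).comp (EuclideanSpace.proj j : RSpace n →L[ℝ] ℝ).differentiable
  intro x
  exact (HasFDerivAt.finsetProd (u := Finset.univ) (g := fun j (x : RSpace n) => g j (x j)) fun j _ => (h j x).hasFDerivAt).differentiableAt

theorem fderiv_prodFn {g : Fin n → ℝ → ℂ} (hg : ∀ j, Differentiable ℝ (g j)) {i : Fin n}
    {g' : ℝ → ℂ} (hi : ∀ s, HasDerivAt (g i) (g' s) s) (x : RSpace n) :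
    fderiv ℝ (prodFn g) x (stdVec i) = prodFn (Function.update g i g') x := by
  have h1 := (differentiable_prodFn hg x).hasFDerivAt
  have h2 : HasDerivAt (fun s : ℝ => x + s • stdVec i) (stdVec i) 0 := by
    simpa using ((hasDerivAt_id (0 : ℝ)).smul_const (stdVec i)).const_add x
  have h3 : HasDerivAt (fun s : ℝ => prodFn g (x + s • stdVec i))
      (fderiv ℝ (prodFn g) x (stdVec i)) 0 := by
    have h1' : HasFDerivAt (prodFn g) (fderiv ℝ (prodFn g) x) (x + (0 : ℝ) • stdVec i) := by
      simpa using h1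
    exact h1'.comp_hasDerivAt 0 h2
  have e : (fun s : ℝ => prodFn g (x + s • stdVec i)) =
      fun s => g i (x i + s) * ∏ j ∈ Finset.univ.erase i, g j (x j) := by
    funext s
    rw [prodFn_eq_mul g i]
    congr 1
    · simp [stdVec]
    · refine Finset.prod_congr rfl fun j hj => ?_
      simp [stdVec, Finset.ne_of_mem_erase hj]
  have h4 : HasDerivAt (fun s : ℝ => g i (x i + s)) (g' (x i)) 0 := by
    have h5 : HasDerivAt (g i) (g' (x i)) (x i + 0) := by simpa using hi (x i)
    exact h5.comp_const_add (x i) 0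
  rw [e] at h3
  rw [prodFn_update]
  exact h3.unique (h4.mul_const _)

theorem memLp_gaussian {δ : ℝ} (hδ : 0 < δ) (C : ℝ) :
    MemLp (fun x : RSpace n => C * Real.exp (-δ * ‖x‖ ^ 2)) 2 volume := by
  refine MemLp.const_mul ?_ C
  rw [memLp_two_iff_integrable_sq (by fun_prop)]
  have h := (GaussianFourier.integrable_cexp_neg_mul_sq_norm_add (V := RSpace n)
    (b := ((2 * δ : ℝ) : ℂ)) (by simpa using hδ) 0 0).norm
  refine h.congr (ae_of_all _ fun x => ?_)
  simp only [Complex.norm_exp, ← Real.exp_nat_mul]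
  congr 1
  simp [← Complex.ofReal_pow]
  ring

theorem norm_prodFn_le {g : Fin n → ℝ → ℂ} {C δ : ℝ}
    (h : ∀ j s, ‖g j s‖ ≤ C * Real.exp (-δ * s ^ 2)) (x : RSpace n) :
    ‖prodFn g x‖ ≤ C ^ n * Real.exp (-δ * ‖x‖ ^ 2) := by
  rw [prodFn, norm_prod]
  refine (Finset.prod_le_prod (fun _ _ => norm_nonneg _) fun j _ => h j (x j)).trans (le_of_eq ?_)
  rw [Finset.prod_mul_distrib, ← Real.exp_sum, EuclideanSpace.norm_sq_eq, Finset.mul_sum]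
  simp

theorem memLp_prodFn {g : Fin n → ℝ → ℂ} (hg : ∀ j, Continuous (g j)) {C δ : ℝ} (hδ : 0 < δ)
    (h : ∀ j s, ‖g j s‖ ≤ C * Real.exp (-δ * s ^ 2)) : MemLp (prodFn g) 2 volume := by
  refine (memLp_gaussian hδ (C ^ n)).mono ?_ (ae_of_all _ fun x => ?_)
  · refine Continuous.aestronglyMeasurable ?_
    unfold prodFn
    fun_prop
  · exact (norm_prodFn_le h x).trans (le_abs_self _)

/-- Uniform domination of finitely many packets. -/
theorem exists_common_domination {c e : Fin n → ℝ} {f f₁ f₂ : Fin n → ℝ → ℝ → ℂ}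
    (hp : ∀ j, IsPacket (c j) (e j) (f j) (f₁ j) (f₂ j)) (t₀ : ℝ) :
    ∃ ε > 0, ∃ C δ : ℝ, 0 ≤ C ∧ 0 < δ ∧ ∀ t, |t - t₀| < ε → ∀ j x,
      ‖f j t x‖ ≤ C * Real.exp (-δ * x ^ 2) ∧ ‖f₁ j t x‖ ≤ C * Real.exp (-δ * x ^ 2) ∧
      ‖f₂ j t x‖ ≤ C * Real.exp (-δ * x ^ 2) ∧
      ‖((c j * x ^ 2 + e j * x : ℝ) : ℂ) * f j t x‖ ≤ C * Real.exp (-δ * x ^ 2) := by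
  choose ε hε C δ hδ h using fun j => (hp j).dominated t₀
  obtain ⟨ε₀, hε₀, hle⟩ : ∃ ε₀ > 0, ∀ j, ε₀ ≤ ε j := by
    rcases isEmpty_or_nonempty (Fin n) with hn | hn
    · exact ⟨1, one_pos, fun j => hn.elim j⟩
    · obtain ⟨j₀, hj₀⟩ := Finite.exists_min ε
      exact ⟨ε j₀, hε j₀, hj₀⟩
  obtain ⟨δ₀, hδ₀, hδle⟩ : ∃ δ₀ > 0, ∀ j, δ₀ ≤ δ j := by
    rcases isEmpty_or_nonempty (Fin n) with hn | hn
    · exact ⟨1, one_pos, fun j => hn.elim j⟩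
    · obtain ⟨j₀, hj₀⟩ := Finite.exists_min δ
      exact ⟨δ j₀, hδ j₀, hj₀⟩
  have hC0 : ∀ j, 0 ≤ C j := fun j => by
    have := (norm_nonneg _).trans (h j t₀ (by simpa using hε j) 0).1
    simpa using this
  refine ⟨ε₀, hε₀, ∑ j, C j, δ₀, Finset.sum_nonneg fun j _ => hC0 j, hδ₀, fun t ht j x => ?_⟩
  have hle' : C j * Real.exp (-δ j * x ^ 2) ≤ (∑ j, C j) * Real.exp (-δ₀ * x ^ 2) := by
    have h1 : C j ≤ ∑ j, C j := Finset.single_le_sum (fun i _ => hC0 i) (Finset.mem_univ j)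
    have h2 : -δ j * x ^ 2 ≤ -δ₀ * x ^ 2 := by
      have := mul_le_mul_of_nonneg_right (hδle j) (sq_nonneg x)
      linarith
    have h3 : 0 ≤ ∑ j, C j := Finset.sum_nonneg fun j _ => hC0 j
    gcongr
  obtain ⟨h1, h2, h3, h4⟩ := h j t (ht.trans_le (hle j)) x
  exact ⟨h1.trans hle', h2.trans hle', h3.trans hle', h4.trans hle'⟩

section

variable {c e : Fin n → ℝ} {f f₁ f₂ : Fin n → ℝ → ℝ → ℂ}

theorem IsPacket.continuous_fst {c e : ℝ} {f f₁ f₂ : ℝ → ℝ → ℂ} (h : IsPacket c e f f₁ f₂) (t : ℝ) :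
    Continuous (f₁ t) :=
  continuous_iff_continuousAt.2 fun x => (h.hasDerivAt_snd t x).continuousAt

theorem IsPacket.continuous_snd {c e : ℝ} {f f₁ f₂ : ℝ → ℝ → ℂ} (h : IsPacket c e f f₁ f₂) (t : ℝ) :
    Continuous (f₂ t) := by
  have h1 : deriv (f t) = f₁ t := funext fun x => (h.hasDerivAt_fst t x).deriv
  have h2 : deriv (f₁ t) = f₂ t := funext fun x => (h.hasDerivAt_snd t x).deriv
  have h3 : ContDiff ℝ ∞ (f₁ t) := h1 ▸ ((contDiff_infty_iff_deriv.1 (h.contDiff t)).2)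
  exact h2 ▸ ((contDiff_infty_iff_deriv.1 h3).2).continuous

theorem smoothWithDerivs_prodFn (hp : ∀ j, IsPacket (c j) (e j) (f j) (f₁ j) (f₂ j)) (t : ℝ) :
    SmoothWithDerivs (prodFn fun j => f j t)
    (fun i => prodFn (Function.update (fun j => f j t) i (f₁ i t)))
    (fun i => prodFn (Function.update (fun j => f j t) i (f₂ i t))) := by
  have hd : ∀ j, Differentiable ℝ (f j t) := fun j x => ((hp j).hasDerivAt_fst t x).differentiableAt
  have hd1 : ∀ i j, Differentiable ℝ (Function.update (fun j => f j t) i (f₁ i t) j) := fun i j => by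
    rcases eq_or_ne j i with rfl | hne
    · rw [Function.update_self]
      exact fun x => ((hp j).hasDerivAt_snd t x).differentiableAt
    · rw [Function.update_of_ne hne]
      exact hd j
  refine ⟨contDiff_prodFn fun j => (hp j).contDiff t, fun i => differentiable_prodFn (hd1 i),
    fun i x => fderiv_prodFn hd (fun s => (hp i).hasDerivAt_fst t s) x, fun i x => ?_⟩
  rw [fderiv_prodFn (hd1 i) (g' := f₂ i t) (fun s => ?_) x, Function.update_idem]
  rw [Function.update_self]
  exact (hp i).hasDerivAt_snd t s

theorem norm_update_le {g : Fin n → ℝ → ℂ} {i : Fin n} {h : ℝ → ℂ} {C δ : ℝ}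
    (hg : ∀ j s, ‖g j s‖ ≤ C * Real.exp (-δ * s ^ 2))
    (hh : ∀ s, ‖h s‖ ≤ C * Real.exp (-δ * s ^ 2)) (j : Fin n) (s : ℝ) :
    ‖Function.update g i h j s‖ ≤ C * Real.exp (-δ * s ^ 2) := by
  rcases eq_or_ne j i with rfl | hne
  · rw [Function.update_self]
    exact hh s
  · rw [Function.update_of_ne hne]
    exact hg j s

theorem continuous_update_apply {g : Fin n → ℝ → ℂ} {i : Fin n} {h : ℝ → ℂ}
    (hg : ∀ j, Continuous (g j)) (hh : Continuous h) (j : Fin n) :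
    Continuous (Function.update g i h j) := by
  rcases eq_or_ne j i with rfl | hne
  · rwa [Function.update_self]
  · rw [Function.update_of_ne hne]
    exact hg j

/-- The image of a product of packets under the Hamiltonian. -/
noncomputable def energyFn (c e : Fin n → ℝ) (f f₂ : Fin n → ℝ → ℝ → ℂ) (t : ℝ) (x : RSpace n) : ℂ :=
  -(∑ i, prodFn (Function.update (fun j => f j t) i (f₂ i t)) x) +
    ((∑ k, (c k * x k ^ 2 + e k * x k) : ℝ) : ℂ) * prodFn (fun j => f j t) x

/-- Separation of variables: each summand lets the one-dimensional Hamiltonian act on a single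
factor. This matches the Leibniz rule for the time derivative of the product. -/
theorem energyFn_eq (t : ℝ) (x : RSpace n) : energyFn c e f f₂ t x =
    ∑ i, prodFn (Function.update (fun j => f j t) i
      fun s => -f₂ i t s + ((c i * s ^ 2 + e i * s : ℝ) : ℂ) * f i t s) x := by
  rw [energyFn, Complex.ofReal_sum, Finset.sum_mul, ← Finset.sum_neg_distrib,
    ← Finset.sum_add_distrib]
  refine Finset.sum_congr rfl fun i _ => ?_
  rw [prodFn_update, prodFn_update, prodFn_eq_mul _ i]
  ring

theorem hasDerivAt_prodFn_time (hp : ∀ j, IsPacket (c j) (e j) (f j) (f₁ j) (f₂ j)) (t : ℝ)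
    (x : RSpace n) :
    HasDerivAt (fun s => prodFn (fun j => f j s) x) (-Complex.I * energyFn c e f f₂ t x) t := by
  have h := HasDerivAt.fun_finsetProd (u := Finset.univ) (f := fun j s => f j s (x j))
    (x := t) fun j _ => (hp j).hasDerivAt_time t (x j)
  refine h.congr_deriv ?_
  rw [energyFn_eq, Finset.mul_sum]
  refine Finset.sum_congr rfl fun i _ => ?_
  rw [prodFn_update, smul_eq_mul]
  ring

section

theorem memLp_prodFn_packet (hp : ∀ j, IsPacket (c j) (e j) (f j) (f₁ j) (f₂ j)) (t : ℝ) :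
    MemLp (prodFn fun j => f j t) 2 volume := by
  obtain ⟨ε, hε, C, δ, -, hδ, h⟩ := exists_common_domination hp t
  exact memLp_prodFn (fun j => ((hp j).contDiff t).continuous) hδ
    fun j s => (h t (by simpa using hε) j s).1

theorem memLp_prodFn_packet_fst (hp : ∀ j, IsPacket (c j) (e j) (f j) (f₁ j) (f₂ j)) (t : ℝ)
    (i : Fin n) :
    MemLp (prodFn (Function.update (fun j => f j t) i (f₁ i t))) 2 volume := by
  obtain ⟨ε, hε, C, δ, -, hδ, h⟩ := exists_common_domination hp t
  have h := h t (by simpa using hε)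
  exact memLp_prodFn (continuous_update_apply (fun j => ((hp j).contDiff t).continuous)
    ((hp i).continuous_fst t)) hδ (norm_update_le (fun j s => (h j s).1) fun s => (h i s).2.1)

theorem memLp_prodFn_packet_snd (hp : ∀ j, IsPacket (c j) (e j) (f j) (f₁ j) (f₂ j)) (t : ℝ)
    (i : Fin n) :
    MemLp (prodFn (Function.update (fun j => f j t) i (f₂ i t))) 2 volume := by
  obtain ⟨ε, hε, C, δ, -, hδ, h⟩ := exists_common_domination hp t
  have h := h t (by simpa using hε)
  exact memLp_prodFn (continuous_update_apply (fun j => ((hp j).contDiff t).continuous)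
    ((hp i).continuous_snd t)) hδ (norm_update_le (fun j s => (h j s).1) fun s => (h i s).2.2.1)

theorem memLp_quad_mul_prodFn_packet (hp : ∀ j, IsPacket (c j) (e j) (f j) (f₁ j) (f₂ j)) (t : ℝ) :
    MemLp (fun x : RSpace n => ((∑ k, (c k * x k ^ 2 + e k * x k) : ℝ) : ℂ) *
      prodFn (fun j => f j t) x) 2 volume := by
  obtain ⟨ε, hε, C, δ, -, hδ, h⟩ := exists_common_domination hp t
  have h := h t (by simpa using hε)
  have e1 : (fun x : RSpace n => ((∑ k, (c k * x k ^ 2 + e k * x k) : ℝ) : ℂ) *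
      prodFn (fun j => f j t) x) = fun x => ∑ i, prodFn (Function.update (fun j => f j t) i
        fun s => ((c i * s ^ 2 + e i * s : ℝ) : ℂ) * f i t s) x := by
    funext x
    rw [Complex.ofReal_sum, Finset.sum_mul]
    refine Finset.sum_congr rfl fun i _ => ?_
    rw [prodFn_update, prodFn_eq_mul _ i]
    ring
  rw [e1]
  refine memLp_finsetSum _ fun i _ => memLp_prodFn
    (continuous_update_apply (fun j => ((hp j).contDiff t).continuous) ?_) hδ
    (norm_update_le (fun j s => (h j s).1) fun s => (h i s).2.2.2)
  have := ((hp i).contDiff t).continuous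
  fun_prop

theorem memLp_energyFn (hp : ∀ j, IsPacket (c j) (e j) (f j) (f₁ j) (f₂ j)) (t : ℝ) :
    MemLp (energyFn c e f f₂ t) 2 volume :=
  ((memLp_finsetSum _ fun i _ => memLp_prodFn_packet_snd hp t i).neg).add
    (memLp_quad_mul_prodFn_packet hp t)

variable (hp : ∀ j, IsPacket (c j) (e j) (f j) (f₁ j) (f₂ j))

/-- The product of packets as an element of `L²`. -/
noncomputable def productState (t : ℝ) : L2 n := (memLp_prodFn_packet hp t).toLp _

/-- The image of the product of packets under the Hamiltonian as an element of `L²`. -/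
noncomputable def productEnergy (t : ℝ) : L2 n := (memLp_energyFn hp t).toLp _

/-- The product of packets solves the Schrödinger equation. -/
theorem hasDerivAt_productState (t : ℝ) :
    HasDerivAt (productState hp) (-Complex.I • productEnergy hp t) t := by
  obtain ⟨ε, hε, C, δ, hC, hδ, h⟩ := exists_common_domination hp t
  -- The factor `n` counts the summands of the energy, and `2C` bounds every factor, including the
  -- altered one, which consists of two terms bounded by `C`.
  have hG := memLp_gaussian (n := n) hδ (n * (2 * C) ^ n)
  have hm := (memLp_energyFn hp t).const_smul (-Complex.I)
  have := hasDerivAt_toLp_of_dominated (F := fun s => prodFn fun j => f j s)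
    (F' := fun s x => -Complex.I • energyFn c e f f₂ s x) hε (memLp_prodFn_packet hp) hm hG
    (fun s _ x => hasDerivAt_prodFn_time hp s x) (fun s hs x => ?_)
  · exact this
  · have h := h s hs
    rw [norm_smul, norm_neg, Complex.norm_I, one_mul, energyFn_eq]
    refine (norm_sum_le _ _).trans ?_
    have hj : ∀ i ∈ (Finset.univ : Finset (Fin n)), ‖prodFn (Function.update (fun j => f j s) i
        fun y => -f₂ i s y + ((c i * y ^ 2 + e i * y : ℝ) : ℂ) * f i s y) x‖ ≤
          (2 * C) ^ n * Real.exp (-δ * ‖x‖ ^ 2) := fun i _ => by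
      refine norm_prodFn_le (norm_update_le (fun j y => (h j y).1.trans ?_) fun y => ?_) x
      · have := Real.exp_pos (-δ * y ^ 2)
        nlinarith
      · refine (norm_add_le _ _).trans ?_
        rw [norm_neg]
        linarith [(h i y).2.2.1, (h i y).2.2.2]
    refine (Finset.sum_le_sum hj).trans (le_of_eq ?_)
    rw [Finset.sum_const, Finset.card_univ, Fintype.card_fin, nsmul_eq_mul]
    ring

/-- The product of packets is in the domain of the perturbed Hamiltonian. -/
theorem exists_productState_mem_closure {V : RSpace n → ℝ} (hV : IsLocallyL2 V)
    (hsmall : ∀ ε > 0, ∃ C, 0 ≤ C ∧ ∀ φ : testFunctions n,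
      ‖testFunctions.mulL2 V hV φ‖ ≤
        ε * ‖testFunctions.toL2 (testFunctions.lap φ)‖ + C * ‖testFunctions.toL2 φ‖) (t : ℝ) :
    ∃ w : L2 n, (w =ᵐ[volume] fun x => (V x : ℂ) * prodFn (fun j => f j t) x) ∧
      (productState hp t, productEnergy hp t + w) ∈ closure (Set.range fun φ : testFunctions n =>
        (testFunctions.toL2 φ, hamiltonian c e V hV φ)) :=
  (smoothWithDerivs_prodFn hp t).mem_closure c e hV hsmall (memLp_prodFn_packet hp t)
    (memLp_prodFn_packet_fst hp t) (memLp_prodFn_packet_snd hp t)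
    (memLp_quad_mul_prodFn_packet hp t) (memLp_energyFn hp t) fun _ => rfl

end

end

end ProductStates

/-! ### Tonelli's theorem for product functions -/

section Fubini

theorem lintegral_pi_prod {n : ℕ} {g : Fin n → ℝ → ENNReal} (hg : ∀ j, Measurable (g j)) :
    ∫⁻ x : Fin n → ℝ, ∏ j, g j (x j) = ∏ j, ∫⁻ s, g j s := by
  induction n with
  | zero => simp [volume_pi]
  | succ n ih =>
    have hm := (volume_preserving_piFinSuccAbove (fun _ : Fin (n + 1) => ℝ) 0).symm
    rw [← hm.lintegral_comp_emb (MeasurableEquiv.measurableEmbedding _), Fin.prod_univ_succ,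
      ← ih fun j => hg j.succ, ← lintegral_prod_mul (hg 0).aemeasurable]
    · refine lintegral_congr fun y => ?_
      rw [Fin.prod_univ_succ]
      simp [MeasurableEquiv.piFinSuccAbove]
    · exact (Finset.measurable_prod _ fun j _ =>
        (hg j.succ).comp (measurable_pi_apply j)).aemeasurable

/-- Tonelli's theorem for products of functions of the single coordinates. -/
theorem lintegral_euclideanSpace_prod {n : ℕ} {g : Fin n → ℝ → ENNReal}
    (hg : ∀ j, Measurable (g j)) :
    ∫⁻ x : RSpace n, ∏ j, g j (x j) = ∏ j, ∫⁻ s, g j s := by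
  rw [← lintegral_pi_prod hg,
    ← (PiLp.volume_preserving_ofLp (Fin n)).lintegral_comp_emb
      (MeasurableEquiv.toLp 2 (Fin n → ℝ)).symm.measurableEmbedding]

end Fubini

/-! ### Integrable decay in time of products -/

section FastDecay

variable {n : ℕ}

/-- The `L²` norm of `F t` decays faster than `|t|^{-B}` for some `B > 1`. -/
def HasFastDecay (F : ℝ → RSpace n → ℂ) : Prop :=
  ∃ B C T : ℝ, 1 < B ∧ 0 ≤ C ∧ 1 ≤ T ∧ ∀ t : ℝ, T ≤ |t| →
    eLpNorm (F t) 2 volume ≤ ENNReal.ofReal (C * |t| ^ (-B))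

theorem HasFastDecay.congr {F G : ℝ → RSpace n → ℂ} (h : HasFastDecay F)
    (hFG : ∀ t, G t =ᵐ[volume] F t) : HasFastDecay G := by
  obtain ⟨B, C, T, h1, h2, h3, h4⟩ := h
  exact ⟨B, C, T, h1, h2, h3, fun t ht => (eLpNorm_congr_ae (hFG t)).trans_le (h4 t ht)⟩

theorem HasFastDecay.of_le {F G : ℝ → RSpace n → ℂ} (h : HasFastDecay F) {K : ℝ}
    (hFG : ∀ t, ∀ᵐ x, ‖G t x‖ ≤ K * ‖F t x‖) : HasFastDecay G := by
  obtain ⟨B, C, T, h1, h2, h3, h4⟩ := h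
  refine ⟨B, max K 0 * C, T, h1, by positivity, h3, fun t ht => ?_⟩
  refine (eLpNorm_le_mul_eLpNorm_of_ae_le_mul (hFG t) 2).trans ?_
  have : ENNReal.ofReal K = ENNReal.ofReal (max K 0) := by
    rcases le_total K 0 with hK | hK
    · rw [max_eq_right hK, ENNReal.ofReal_of_nonpos hK, ENNReal.ofReal_zero]
    · rw [max_eq_left hK]
  rw [mul_assoc, ENNReal.ofReal_mul (le_max_right _ _), this]
  gcongr
  exact h4 t ht

theorem HasFastDecay.zero : HasFastDecay (fun _ _ => 0 : ℝ → RSpace n → ℂ) :=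
  ⟨2, 0, 1, by norm_num, le_rfl, le_rfl, fun t _ => by simp⟩

theorem HasFastDecay.add {F G : ℝ → RSpace n → ℂ} (hF : HasFastDecay F) (hG : HasFastDecay G)
    (mF : ∀ t, AEStronglyMeasurable (F t) volume) (mG : ∀ t, AEStronglyMeasurable (G t) volume) :
    HasFastDecay fun t x => F t x + G t x := by
  obtain ⟨B, C, T, h1, h2, h3, h4⟩ := hF
  obtain ⟨B', C', T', h1', h2', h3', h4'⟩ := hG
  refine ⟨min B B', C + C', max T T', lt_min h1 h1', by positivity, le_max_of_le_left h3,
    fun t ht => ?_⟩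
  have ht1 : 1 ≤ |t| := h3.trans ((le_max_left _ _).trans ht)
  refine (eLpNorm_add_le (mF t) (mG t) (by norm_num)).trans ?_
  refine (add_le_add (h4 t ((le_max_left _ _).trans ht))
    (h4' t ((le_max_right _ _).trans ht))).trans ?_
  rw [← ENNReal.ofReal_add (by positivity) (by positivity), add_mul]
  refine ENNReal.ofReal_le_ofReal (add_le_add ?_ ?_)
  · exact mul_le_mul_of_nonneg_left
      (Real.rpow_le_rpow_of_exponent_le ht1 (neg_le_neg (min_le_left _ _))) h2
  · exact mul_le_mul_of_nonneg_left
      (Real.rpow_le_rpow_of_exponent_le ht1 (neg_le_neg (min_le_right _ _))) h2'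

theorem HasFastDecay.sum {ι : Type*} {s : Finset ι} {F : ι → ℝ → RSpace n → ℂ}
    (hF : ∀ i ∈ s, HasFastDecay (F i))
    (mF : ∀ i ∈ s, ∀ t, AEStronglyMeasurable (F i t) volume) :
    HasFastDecay fun t x => ∑ i ∈ s, F i t x := by
  classical
  induction s using Finset.induction_on with
  | empty => simpa using HasFastDecay.zero
  | insert a s ha ih =>
    simp only [Finset.sum_insert ha]
    refine HasFastDecay.add (hF a (Finset.mem_insert_self _ _))
      (ih (fun i hi => hF i (Finset.mem_insert_of_mem hi))
        fun i hi => mF i (Finset.mem_insert_of_mem hi)) (mF a (Finset.mem_insert_self _ _))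
      fun t => Finset.aestronglyMeasurable_fun_sum _
        fun i hi => mF i (Finset.mem_insert_of_mem hi) t

/-- Decay of a product of packets with respect to a weight in one direction. -/
theorem HasWeightedDecay.hasFastDecay {f : Fin n → ℝ → ℝ → ℂ} {h : ℝ → ℝ} {B : ℝ} {i : Fin n}
    (hf : ∀ j t, Continuous (f j t)) (hh : Measurable h) (h0 : ∀ s, 0 ≤ h s) (hB : 1 < B)
    (hm : ∀ j, HasBoundedMass (f j)) (hd : HasWeightedDecay h B (f i)) :
    HasFastDecay fun t (x : RSpace n) => ((h (x i) ^ B : ℝ) : ℂ) * prodFn (fun j => f j t) x := by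
  obtain ⟨C, T, hC, hT, h1⟩ := hd
  choose M hM hM1 _ using hm
  refine ⟨B, √(C * ∏ j ∈ Finset.univ.erase i, M j), T, hB, Real.sqrt_nonneg _, hT,
    fun t ht => ?_⟩
  have ht0 : 0 < |t| := one_pos.trans_le (hT.trans ht)
  have hP : 0 ≤ ∏ j ∈ Finset.univ.erase i, M j := Finset.prod_nonneg fun j _ => hM j
  set g : Fin n → ℝ → ENNReal := Function.update (fun j s => ENNReal.ofReal (‖f j t s‖ ^ 2)) i
    fun s => ENNReal.ofReal ((h s ^ B * ‖f i t s‖) ^ 2) with hg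
  have hgm : ∀ j, Measurable (g j) := fun j => by
    have := (hf j t).measurable
    have h3 := (hf i t).measurable
    rcases eq_or_ne j i with rfl | hne
    · rw [hg, Function.update_self]
      fun_prop
    · rw [hg, Function.update_of_ne hne]
      fun_prop
  have key : ∫⁻ x : RSpace n, ‖((h (x i) ^ B : ℝ) : ℂ) * prodFn (fun j => f j t) x‖ₑ ^ (2 : ℝ) =
      ∏ j, ∫⁻ s, g j s := by
    rw [← lintegral_euclideanSpace_prod hgm]
    refine lintegral_congr fun x => ?_
    rw [← Finset.mul_prod_erase _ _ (Finset.mem_univ i), prodFn_eq_mul _ i, ← mul_assoc, enorm_mul,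
      ENNReal.mul_rpow_of_nonneg _ _ (by norm_num)]
    congr 1
    · rw [hg, Function.update_self, ← ofReal_norm, ENNReal.ofReal_rpow_of_nonneg (norm_nonneg _)
        (by norm_num), norm_mul, Complex.norm_real, Real.norm_of_nonneg (Real.rpow_nonneg (h0 _) _)]
      norm_num
    · rw [← ofReal_norm, ENNReal.ofReal_rpow_of_nonneg (norm_nonneg _) (by norm_num), norm_prod,
        Real.rpow_ofNat, ← Finset.prod_pow, ENNReal.ofReal_prod_of_nonneg fun _ _ => by positivity]
      refine Finset.prod_congr rfl fun j hj => ?_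
      rw [hg, Function.update_of_ne (Finset.ne_of_mem_erase hj)]
  rw [eLpNorm_eq_lintegral_rpow_enorm_toReal (by norm_num) (by norm_num), ENNReal.toReal_ofNat, key]
  have hle : ∏ j, ∫⁻ s, g j s ≤ ENNReal.ofReal ((√(C * ∏ j ∈ Finset.univ.erase i, M j) *
      |t| ^ (-B)) ^ (2 : ℝ)) := by
    rw [← Finset.mul_prod_erase _ _ (Finset.mem_univ i), Real.rpow_ofNat, mul_pow,
      Real.sq_sqrt (by positivity), ← Real.rpow_natCast (|t| ^ (-B)), ← Real.rpow_mul ht0.le,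
      show C * (∏ j ∈ Finset.univ.erase i, M j) * |t| ^ (-B * (2 : ℕ)) =
        C * |t| ^ (-(2 * B)) * ∏ j ∈ Finset.univ.erase i, M j by
          rw [show -B * ((2 : ℕ) : ℝ) = -(2 * B) by push_cast; ring]; ring,
      ENNReal.ofReal_mul (by positivity), ENNReal.ofReal_prod_of_nonneg fun j _ => hM j]
    refine mul_le_mul' ?_ (Finset.prod_le_prod' fun j hj => ?_)
    · rw [hg, Function.update_self]
      exact h1 t ht
    · rw [hg, Function.update_of_ne (Finset.ne_of_mem_erase hj)]
      exact hM1 j t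
  rw [← ENNReal.ofReal_rpow_of_nonneg (by positivity) (by norm_num)] at hle
  calc _ ≤ (ENNReal.ofReal (√(C * ∏ j ∈ Finset.univ.erase i, M j) *
      |t| ^ (-B)) ^ (2 : ℝ)) ^ (1 / (2 : ℝ)) := by gcongr
    _ = _ := by rw [← ENNReal.rpow_mul]; norm_num

/-- The supremum norm of a product of packets, one of which decays exponentially. -/
theorem norm_prodFn_le_exp {f : Fin n → ℝ → ℝ → ℂ} {ν : ℝ} {i : Fin n}
    (hm : ∀ j, HasBoundedMass (f j))
    (hd : ∃ C, 0 ≤ C ∧ ∀ t x, ‖f i t x‖ ≤ C * Real.exp (-(ν * |t|))) :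
    ∃ C, 0 ≤ C ∧ ∀ t x, ‖prodFn (fun j => f j t) x‖ ≤ C * Real.exp (-(ν * |t|)) := by
  obtain ⟨C, hC, h⟩ := hd
  choose M hM _ hM1 using hm
  refine ⟨C * ∏ j ∈ Finset.univ.erase i, M j,
    mul_nonneg hC (Finset.prod_nonneg fun j _ => hM j), fun t x => ?_⟩
  rw [prodFn_eq_mul _ i, norm_mul, norm_prod]
  calc _ ≤ C * Real.exp (-(ν * |t|)) * ∏ j ∈ Finset.univ.erase i, M j := by
        refine mul_le_mul (h t _) (Finset.prod_le_prod (fun _ _ => norm_nonneg _) fun j _ =>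
          hM1 j t _) (Finset.prod_nonneg fun _ _ => norm_nonneg _) (by positivity)
    _ = _ := by ring

theorem eLpNorm_two_prodFn_le {f : Fin n → ℝ → ℝ → ℂ} (hf : ∀ j t, Continuous (f j t))
    (hm : ∀ j, HasBoundedMass (f j)) :
    ∃ M, 0 ≤ M ∧ ∀ t, eLpNorm (prodFn fun j => f j t) 2 volume ≤ ENNReal.ofReal M := by
  choose M hM hM1 _ using hm
  refine ⟨√(∏ j, M j), Real.sqrt_nonneg _, fun t => ?_⟩
  have key : ∫⁻ x : RSpace n, ‖prodFn (fun j => f j t) x‖ₑ ^ (2 : ℝ) =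
      ∏ j, ∫⁻ s, ENNReal.ofReal (‖f j t s‖ ^ 2) := by
    rw [← lintegral_euclideanSpace_prod fun j => by
      have := (hf j t).measurable
      fun_prop]
    refine lintegral_congr fun x => ?_
    rw [← ofReal_norm, ENNReal.ofReal_rpow_of_nonneg (norm_nonneg _) (by norm_num), prodFn,
      norm_prod, Real.rpow_ofNat, ← Finset.prod_pow,
      ENNReal.ofReal_prod_of_nonneg fun _ _ => by positivity]
  rw [eLpNorm_eq_lintegral_rpow_enorm_toReal (by norm_num) (by norm_num), ENNReal.toReal_ofNat, key]
  have hle : ∏ j, ∫⁻ s, ENNReal.ofReal (‖f j t s‖ ^ 2) ≤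
      ENNReal.ofReal (√(∏ j, M j)) ^ (2 : ℝ) := by
    rw [ENNReal.ofReal_rpow_of_nonneg (Real.sqrt_nonneg _) (by norm_num), Real.rpow_ofNat,
      Real.sq_sqrt (Finset.prod_nonneg fun j _ => hM j),
      ENNReal.ofReal_prod_of_nonneg fun j _ => hM j]
    exact Finset.prod_le_prod' fun j _ => hM1 j t
  calc _ ≤ (ENNReal.ofReal (√(∏ j, M j)) ^ (2 : ℝ)) ^ (1 / (2 : ℝ)) := by gcongr
    _ = _ := by rw [← ENNReal.rpow_mul]; norm_num

end FastDecay

/-! ### Reduction of the decay weight to single directions -/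

section DecayingPotentials

variable {n : ℕ}

/-- The weight in the `j`-th direction that governs the decay of a packet. -/
noncomputable def QuadraticStark.localWeight (S : QuadraticStark n) (j : Fin n) (s : ℝ) : ℝ :=
  if (j : ℕ) < S.nNeg then (japaneseBracket (Real.log (japaneseBracket s)))⁻¹
  else if (j : ℕ) < S.nNeg + S.nPos then 1
  else if (j : ℕ) < S.nNeg + S.nPos + S.nStark then japaneseBracket s ^ (-(1 / 2) : ℝ)
  else (japaneseBracket s)⁻¹

theorem japaneseBracket_le_of_norm_le {X Y : Type*} [NormedAddCommGroup X] [NormedAddCommGroup Y]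
    {x : X} {y : Y} (h : ‖x‖ ≤ ‖y‖) : japaneseBracket x ≤ japaneseBracket y := by
  unfold japaneseBracket
  gcongr

theorem QuadraticStark.localWeight_pos (S : QuadraticStark n) (j : Fin n) (s : ℝ) :
    0 < S.localWeight j s := by
  have h1 := one_pos.trans_le (one_le_japaneseBracket s)
  have h2 := one_pos.trans_le (one_le_japaneseBracket (Real.log (japaneseBracket s)))
  unfold QuadraticStark.localWeight
  split_ifs <;> positivity

theorem QuadraticStark.localWeight_le_one (S : QuadraticStark n) (j : Fin n) (s : ℝ) :
    S.localWeight j s ≤ 1 := by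
  unfold QuadraticStark.localWeight
  split_ifs
  · exact inv_le_one_of_one_le₀ (one_le_japaneseBracket _)
  · exact le_rfl
  · exact Real.rpow_le_one_of_one_le_of_nonpos (one_le_japaneseBracket _) (by norm_num)
  · exact inv_le_one_of_one_le₀ (one_le_japaneseBracket _)

theorem QuadraticStark.measurable_localWeight (S : QuadraticStark n) (j : Fin n) :
    Measurable (S.localWeight j) := by
  unfold QuadraticStark.localWeight
  have h : Measurable fun s : ℝ => japaneseBracket s := by
    unfold japaneseBracket
    fun_prop
  have h' : Measurable fun s : ℝ => japaneseBracket (Real.log (japaneseBracket s)) :=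
    h.comp (Real.measurable_log.comp h)
  split_ifs <;> fun_prop

/-- The directions that occur in the decay weight. -/
def QuadraticStark.active (S : QuadraticStark n) : Finset (Fin n) :=
  Finset.univ.filter fun j => (j : ℕ) < S.nNeg ∨ S.nNeg + S.nPos ≤ (j : ℕ)

/-- The logarithmic factors depend on the whole of `x`, but `⟨ln⟨x⟩⟩ ≥ ⟨ln⟨x_j⟩⟩` and the exponents
are nonpositive, so each factor is dominated by a function of its own coordinate. -/
theorem QuadraticStark.weight_le_prod (S : QuadraticStark n) {b : Fin n → ℝ} (hb : ∀ j, 0 ≤ b j)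
    (x : RSpace n) : S.weight b x ≤ ∏ j ∈ S.active, S.localWeight j (x j) ^ b j := by
  have e1 : ∏ j ∈ S.active, S.localWeight j (x j) ^ b j = ∏ j, S.localWeight j (x j) ^ b j := by
    refine Finset.prod_subset (Finset.subset_univ _) fun j _ hj => ?_
    simp only [QuadraticStark.active, Finset.mem_filter, Finset.mem_univ, true_and, not_or,
      not_lt, not_le] at hj
    rw [QuadraticStark.localWeight, if_neg (by omega), if_pos hj.2, Real.one_rpow]
  rw [e1, QuadraticStark.weight]
  have p1 : ∀ s : ℝ, 0 ≤ japaneseBracket s := fun s =>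
    zero_le_one.trans (one_le_japaneseBracket s)
  have p2 : 0 ≤ japaneseBracket (Real.log (japaneseBracket x)) := p1 _
  refine Finset.prod_le_prod (fun j _ => ?_) fun j _ => ?_
  · have := p1 (x j)
    split_ifs <;> positivity
  · unfold QuadraticStark.localWeight
    split_ifs with h1 h2 h3
    · rw [Real.rpow_neg p2, Real.inv_rpow (p1 _)]
      have h0 : 0 < japaneseBracket (Real.log (japaneseBracket (x j))) :=
        one_pos.trans_le (one_le_japaneseBracket _)
      have hle : japaneseBracket (Real.log (japaneseBracket (x j))) ≤
          japaneseBracket (Real.log (japaneseBracket x)) := by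
        refine japaneseBracket_le_of_norm_le ?_
        have l1 := one_le_japaneseBracket (x j)
        have l2 : japaneseBracket (x j) ≤ japaneseBracket x :=
          japaneseBracket_le_of_norm_le (PiLp.norm_apply_le x j)
        rw [Real.norm_of_nonneg (Real.log_nonneg l1),
          Real.norm_of_nonneg (Real.log_nonneg (l1.trans l2))]
        exact Real.log_le_log (by positivity) l2
      have := hb j
      gcongr
    · simp
    · rw [← Real.rpow_mul (p1 _)]
      refine le_of_eq ?_
      congr 1
      ring
    · rw [Real.rpow_neg (p1 _), Real.inv_rpow (p1 _)]

/-- Replace every local weight by the largest one at the point: the exponents add up, and as local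
weights are at most `1` the total may be lowered to `B`. The maximizing direction depends on `x`,
hence the sum. -/
theorem QuadraticStark.weight_le_sum (S : QuadraticStark n) {b : Fin n → ℝ} (hb : ∀ j, 0 ≤ b j)
    {B : ℝ} (hB : B ≤ S.totalExponent b) (hb1 : 0 < S.totalExponent b) (x : RSpace n) :
    S.weight b x ≤ ∑ j ∈ S.active, S.localWeight j (x j) ^ B := by
  have hsum : S.totalExponent b = ∑ j ∈ S.active, b j := by
    rw [QuadraticStark.totalExponent, QuadraticStark.active, Finset.sum_filter]
  have hne : S.active.Nonempty := by
    by_contra h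
    rw [Finset.not_nonempty_iff_eq_empty] at h
    rw [hsum, h, Finset.sum_empty] at hb1
    exact lt_irrefl _ hb1
  obtain ⟨i, hi, hmax⟩ := S.active.exists_max_image (fun j => S.localWeight j (x j)) hne
  refine (S.weight_le_prod hb x).trans ?_
  calc _ ≤ ∏ j ∈ S.active, S.localWeight i (x i) ^ b j :=
        Finset.prod_le_prod (fun j _ => Real.rpow_nonneg (S.localWeight_pos j _).le _)
          fun j hj => Real.rpow_le_rpow (S.localWeight_pos j _).le (hmax j hj) (hb j)
    _ = S.localWeight i (x i) ^ S.totalExponent b := by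
        rw [hsum, Real.rpow_sum_of_pos (S.localWeight_pos i _)]
    _ ≤ S.localWeight i (x i) ^ B :=
        Real.rpow_le_rpow_of_exponent_ge (S.localWeight_pos i _) (S.localWeight_le_one i _) hB
    _ ≤ _ := Finset.single_le_sum (f := fun j => S.localWeight j (x j) ^ B)
        (fun j _ => Real.rpow_nonneg (S.localWeight_pos j _).le _) hi

theorem QuadraticStark.IsDecayingTerm.hasFastDecay {S : QuadraticStark n} {w : RSpace n → ℝ}
    (hw : S.IsDecayingTerm w) {f : Fin n → ℝ → ℝ → ℂ} (hf : ∀ j t, Continuous (f j t))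
    (hm : ∀ j, HasBoundedMass (f j)) (hd : ∀ j ∈ S.active, ∀ B : ℝ, 1 < B → B ≤ 5 / 4 →
      HasWeightedDecay (S.localWeight j) B (f j)) :
    HasFastDecay fun t x => (w x : ℂ) * prodFn (fun j => f j t) x := by
  obtain ⟨-, b, hb, hb1, C, hC⟩ := hw
  -- The one-dimensional estimates are available for `1 < B ≤ 5/4`; a larger total exponent is
  -- simply not exploited.
  set B : ℝ := min (S.totalExponent b) (5 / 4) with hBdef
  have hB : 1 < B := lt_min hb1 (by norm_num)
  have h := HasFastDecay.sum (s := S.active)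
    (F := fun j t (x : RSpace n) => ((S.localWeight j (x j) ^ B : ℝ) : ℂ) *
      prodFn (fun j => f j t) x)
    (fun j hj => (hd j hj B hB (min_le_right _ _)).hasFastDecay hf (S.measurable_localWeight j)
      (fun s => (S.localWeight_pos j s).le) hB hm) fun j _ t => by
        have h1 : Measurable fun x : RSpace n => S.localWeight j (x j) :=
          (S.measurable_localWeight j).comp (by fun_prop)
        have h2 : Measurable fun x : RSpace n => prodFn (fun j => f j t) x := by
          unfold prodFn
          exact Finset.measurable_fun_prod _ fun j _ => (hf j t).measurable.comp (by fun_prop)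
        exact (by fun_prop : Measurable _).aestronglyMeasurable
  refine h.of_le (K := |C|) fun t => ?_
  filter_upwards [hC] with x hx
  rw [← Finset.sum_mul, norm_mul, norm_mul, ← mul_assoc, ← Complex.ofReal_sum, Complex.norm_real,
    Complex.norm_real, Real.norm_eq_abs, Real.norm_eq_abs]
  refine mul_le_mul_of_nonneg_right (hx.trans ?_) (norm_nonneg _)
  have h0 : 0 ≤ S.weight b x := by
    unfold QuadraticStark.weight japaneseBracket
    refine Finset.prod_nonneg fun j _ => ?_
    split_ifs <;> positivity
  calc C * S.weight b x ≤ |C| * S.weight b x := by gcongr; exact le_abs_self C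
    _ ≤ |C| * |∑ j ∈ S.active, S.localWeight j (x j) ^ B| := by
        gcongr
        exact (S.weight_le_sum hb (min_le_left _ _) (by linarith) x).trans (le_abs_self _)

end DecayingPotentials

/-! ### Decay of `L^p` potentials along exponentially spreading packets -/

section SingularPotentials

variable {n : ℕ}

theorem exp_neg_le_rpow {ν : ℝ} (hν : 0 < ν) :
    ∃ C, 0 ≤ C ∧ ∀ s : ℝ, 1 ≤ s → Real.exp (-(ν * s)) ≤ C * s ^ (-2 : ℝ) := by
  refine ⟨2 / ν ^ 2, by positivity, fun s hs => ?_⟩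
  have h1 := Real.pow_div_factorial_le_exp (ν * s) (by positivity) 2
  have h2 : (Nat.factorial 2 : ℝ) = 2 := by norm_num
  rw [h2] at h1
  rw [Real.rpow_neg (by positivity), Real.rpow_ofNat, Real.exp_neg,
    show 2 / ν ^ 2 * (s ^ 2)⁻¹ = ((ν * s) ^ 2 / 2)⁻¹ by field_simp]
  exact inv_anti₀ (by positivity) h1

/-- Potentials in `L^p` with `2 ≤ p < ∞` decay along packets that spread exponentially. -/
theorem hasFastDecay_mul_of_memLp {V : RSpace n → ℝ} {p : ℝ} (hp : 2 ≤ p)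
    (hV : MemLp V (ENNReal.ofReal p) volume) {u : ℝ → RSpace n → ℂ} {ν C M : ℝ} (hν : 0 < ν)
    (hC : 0 ≤ C) (hM : 0 ≤ M) (hu : ∀ t, AEStronglyMeasurable (u t) volume)
    (h1 : ∀ t x, ‖u t x‖ ≤ C * Real.exp (-(ν * |t|)))
    (h2 : ∀ t, eLpNorm (u t) 2 volume ≤ ENNReal.ofReal M) :
    HasFastDecay fun t x => (V x : ℂ) * u t x := by
  have hp0 : 0 < p := by linarith
  have hW : MemLp (fun x => ‖V x‖ ^ (p / 2)) 2 volume := by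
    have h := hV.norm_rpow_div (ENNReal.ofReal (p / 2))
    rwa [ENNReal.toReal_ofReal (by positivity), ← ENNReal.ofReal_div_of_pos (by positivity),
      show p / (p / 2) = 2 by field_simp, ENNReal.ofReal_ofNat] at h
  obtain ⟨K, hK, hK1⟩ := exp_neg_le_rpow (div_pos hν hp0)
  set N := (eLpNorm (fun x => ‖V x‖ ^ (p / 2)) 2 volume).toReal with hN
  have hN0 : 0 ≤ N := ENNReal.toReal_nonneg
  refine ⟨2, (M + C * N) * K, 1, by norm_num, by positivity, le_rfl, fun t ht => ?_⟩
  -- `V` is split at the level `l`. Where `|V| ≤ l` the bounded mass of `u` gives a contribution of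
  -- order `l`. Where `|V| ≥ l` one has `|V| ≤ l^{1-p/2} |V|^{p/2}` with `|V|^{p/2}` in `L²`, and
  -- the supremum of `u` turns the prefactor into `l^{1-p/2} e^{-ν|t|} ≤ l`.
  set l := Real.exp (-(ν / p * |t|)) with hl
  have hl0 : 0 < l := Real.exp_pos _
  have hl1 : l ^ (1 - p / 2) * Real.exp (-(ν * |t|)) ≤ l := by
    rw [hl, ← Real.exp_mul, ← Real.exp_add]
    refine Real.exp_le_exp.2 ?_
    have e : -(ν / p * |t|) * (1 - p / 2) + -(ν * |t|) = -(ν / p * |t|) - ν * |t| / 2 := by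
      field_simp
      ring
    rw [e]
    have : 0 ≤ ν * |t| / 2 := by positivity
    linarith
  have hpt : ∀ x, ‖(V x : ℂ) * u t x‖ ≤ ‖(l : ℂ) * u t x‖ + C * l * ‖V x‖ ^ (p / 2) := fun x => by
    rw [norm_mul, norm_mul, Complex.norm_real, Complex.norm_real, Real.norm_of_nonneg hl0.le]
    rcases le_total ‖V x‖ l with hle | hle
    · have : 0 ≤ C * l * ‖V x‖ ^ (p / 2) := by positivity
      have := mul_le_mul_of_nonneg_right hle (norm_nonneg (u t x))
      linarith
    · have hV0 : 0 < ‖V x‖ := hl0.trans_le hle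
      have e1 : ‖V x‖ ≤ l ^ (1 - p / 2) * ‖V x‖ ^ (p / 2) := by
        calc ‖V x‖ = ‖V x‖ ^ (1 - p / 2) * ‖V x‖ ^ (p / 2) := by
              rw [← Real.rpow_add hV0, sub_add_cancel, Real.rpow_one]
          _ ≤ _ := by
              gcongr ?_ * _
              exact Real.rpow_le_rpow_of_nonpos hl0 hle (by linarith)
      have : 0 ≤ l * ‖u t x‖ := by positivity
      calc ‖V x‖ * ‖u t x‖ ≤ l ^ (1 - p / 2) * ‖V x‖ ^ (p / 2) * (C * Real.exp (-(ν * |t|))) :=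
            mul_le_mul e1 (h1 t x) (norm_nonneg _) (by positivity)
        _ = C * (l ^ (1 - p / 2) * Real.exp (-(ν * |t|))) * ‖V x‖ ^ (p / 2) := by ring
        _ ≤ C * l * ‖V x‖ ^ (p / 2) := by gcongr
        _ ≤ _ := by linarith
  have e1 : eLpNorm (fun x => ‖(l : ℂ) * u t x‖) 2 volume ≤ ENNReal.ofReal (l * M) := by
    rw [eLpNorm_norm]
    have := eLpNorm_const_smul (l : ℂ) (u t) 2 (volume : Measure (RSpace n))
    rw [show (fun x => (l : ℂ) * u t x) = (l : ℂ) • u t from rfl, this, ← ofReal_norm,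
      Complex.norm_real, Real.norm_of_nonneg hl0.le, ENNReal.ofReal_mul hl0.le]
    gcongr
    exact h2 t
  have e2 : eLpNorm (fun x => C * l * ‖V x‖ ^ (p / 2)) 2 volume ≤ ENNReal.ofReal (C * l * N) := by
    have := eLpNorm_const_smul (C * l) (fun x => ‖V x‖ ^ (p / 2)) 2 (volume : Measure (RSpace n))
    rw [show (fun x => C * l * ‖V x‖ ^ (p / 2)) = (C * l) • fun x => ‖V x‖ ^ (p / 2) from rfl,
      this, ← ofReal_norm, Real.norm_of_nonneg (by positivity),
      ENNReal.ofReal_mul (p := C * l) (by positivity), hN, ENNReal.ofReal_toReal hW.2.ne]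
  calc _ ≤ eLpNorm ((fun x => ‖(l : ℂ) * u t x‖) + fun x => C * l * ‖V x‖ ^ (p / 2)) 2 volume :=
        eLpNorm_mono_real hpt
    _ ≤ _ := eLpNorm_add_le ((hu t).const_mul _).norm (hW.1.const_mul _) (by norm_num)
    _ ≤ ENNReal.ofReal (l * M) + ENNReal.ofReal (C * l * N) := add_le_add e1 e2
    _ = ENNReal.ofReal ((M + C * N) * l) := by
        rw [← ENNReal.ofReal_add (by positivity) (by positivity)]
        congr 1
        ring
    _ ≤ _ := by
        rw [mul_assoc]
        exact ENNReal.ofReal_le_ofReal (mul_le_mul_of_nonneg_left (hK1 _ ht) (by positivity))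

theorem IsAdmissibleExponent.two_le {p : ℝ} (h : IsAdmissibleExponent n p) : 2 ≤ p := by
  obtain ⟨h1, h2, h3⟩ := h
  rcases lt_trichotomy n 4 with hn | hn | hn
  · exact h1 (by omega)
  · exact (h2 hn).le
  · have h4 := h3 (by omega)
    have : (5 : ℝ) ≤ n := by exact_mod_cast hn
    linarith

theorem IsSingularPotential.hasFastDecay {V : RSpace n → ℝ} (hV : IsSingularPotential V)
    {f : Fin n → ℝ → ℝ → ℂ} (hf : ∀ j t, Continuous (f j t)) (hm : ∀ j, HasBoundedMass (f j))
    {i : Fin n} {ν : ℝ} (hν : 0 < ν)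
    (hd : ∃ C, 0 ≤ C ∧ ∀ t x, ‖f i t x‖ ≤ C * Real.exp (-(ν * |t|))) :
    HasFastDecay fun t x => (V x : ℂ) * prodFn (fun j => f j t) x := by
  obtain ⟨p, hp, hV⟩ := hV
  obtain ⟨C, hC, h1⟩ := norm_prodFn_le_exp hm hd
  obtain ⟨M, hM, h2⟩ := eLpNorm_two_prodFn_le hf hm
  refine hasFastDecay_mul_of_memLp hp.two_le hV hν hC hM (fun t => ?_) h1 h2
  refine Continuous.aestronglyMeasurable ?_
  unfold prodFn
  have := fun j => hf j t
  fun_prop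

end SingularPotentials

/-! ### Recovering a Gaussian from the translates of its derivative -/

section Translates

variable {n : ℕ}

/-- It dominates the Gaussians centred at `s v`, uniformly for `s` within distance `1` of `s₀`, by a
multiple of a wider Gaussian centred at `s₀ v`. -/
theorem norm_sq_sub_smul_ge (x v : RSpace n) {s s₀ : ℝ} (h : |s - s₀| < 1) :
    ‖x - s₀ • v‖ ^ 2 / 2 - ‖v‖ ^ 2 ≤ ‖x - s • v‖ ^ 2 := by
  have h1 : ‖x - s₀ • v‖ ≤ ‖x - s • v‖ + ‖v‖ := by
    calc ‖x - s₀ • v‖ = ‖(x - s • v) + (s - s₀) • v‖ := by congr 1; module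
      _ ≤ ‖x - s • v‖ + |s - s₀| * ‖v‖ := by
        refine (norm_add_le _ _).trans ?_
        rw [norm_smul, Real.norm_eq_abs]
      _ ≤ _ := by
        have := mul_le_mul_of_nonneg_right h.le (norm_nonneg v)
        linarith
  have h2 : ‖x - s₀ • v‖ ^ 2 ≤ (‖x - s • v‖ + ‖v‖) ^ 2 := by gcongr
  nlinarith [sq_nonneg (‖x - s • v‖ - ‖v‖)]

/-- A moving Gaussian factor sends `F` to zero in `L²` by dominated convergence, while the other
factor keeps a bounded norm by translation invariance. -/
theorem tendsto_inner_translate (F : L2 n) {v : RSpace n} (hv : v ≠ 0) {G : RSpace n → ℂ}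
    {C δ : ℝ} (hδ : 0 < δ) (hb : ∀ x, ‖G x‖ ≤ C * Real.exp (-δ * ‖x‖ ^ 2))
    (hm : ∀ s : ℝ, MemLp (fun x => G (x - s • v)) 2 volume) :
    Tendsto (fun s : ℝ => inner ℂ F ((hm s).toLp _)) atTop (𝓝 0) := by
  -- split off half of the Gaussian decay and let it act on `F`
  set g : ℝ → RSpace n → ℝ := fun s x => Real.exp (-(δ / 2) * ‖x - s • v‖ ^ 2) with hg
  have hg1 : ∀ s x, ‖(g s x : ℂ)‖ ≤ 1 := fun s x => by
    rw [Complex.norm_real, Real.norm_of_nonneg (Real.exp_pos _).le]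
    refine Real.exp_le_one_iff.2 ?_
    have : 0 ≤ δ / 2 * ‖x - s • v‖ ^ 2 := by positivity
    linarith
  have hgc : ∀ s, Continuous (g s) := fun s => by fun_prop
  have hgc' : ∀ s, Continuous fun x => (g s x : ℂ) := fun s => by fun_prop
  have hA : ∀ s, MemLp (fun x => (g s x : ℂ) * F x) 2 volume := fun s =>
    (Lp.memLp F).mono ((hgc' s).aestronglyMeasurable.mul (Lp.memLp F).1) (ae_of_all _ fun x => by
        rw [norm_mul]
        exact mul_le_of_le_one_left (norm_nonneg _) (hg1 s x))
  have hA0 : Tendsto (fun s : ℝ => (hA s).toLp _) atTop (𝓝 ((MemLp.zero' (ε := ℂ)).toLp _ : L2 n)) := by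
    refine tendsto_toLp_of_dominated hA MemLp.zero' (Lp.memLp F).norm
      (Eventually.of_forall fun s => ae_of_all _ fun x => ?_) (ae_of_all _ fun x => ?_)
    · rw [norm_mul]
      exact mul_le_of_le_one_left (norm_nonneg _) (hg1 s x)
    · have h1 : Tendsto (fun s : ℝ => ‖x - s • v‖) atTop atTop := by
        have h2 : Tendsto (fun s : ℝ => s * ‖v‖ - ‖x‖) atTop atTop :=
          tendsto_atTop_add_const_right _ _ (tendsto_id.atTop_mul_const (norm_pos_iff.2 hv))
        refine tendsto_atTop_mono' _ ?_ h2
        filter_upwards [eventually_ge_atTop 0] with s hs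
        have := norm_sub_norm_le (s • v) x
        rw [norm_smul, Real.norm_of_nonneg hs, norm_sub_rev] at this
        exact this
      have h3 : Tendsto (fun s => g s x) atTop (𝓝 0) := by
        refine Real.tendsto_exp_atBot.comp ?_
        exact ((tendsto_pow_atTop two_ne_zero).comp h1).const_mul_atTop_of_neg (by linarith)
      have h4 : Tendsto (fun s => (g s x : ℂ)) atTop (𝓝 ((0 : ℝ) : ℂ)) :=
        (Complex.continuous_ofReal.tendsto 0).comp h3
      simpa using h4.mul_const (F x)
  have hE := memLp_gaussian (n := n) (half_pos hδ) C
  set N := (eLpNorm (fun x : RSpace n => C * Real.exp (-(δ / 2) * ‖x‖ ^ 2)) 2 volume).toReal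
  have hbound : ∀ s, ‖inner ℂ F ((hm s).toLp _)‖ ≤ ‖(hA s).toLp _‖ * N := fun s => by
    have hinv : ∀ x, (g s x : ℂ) ≠ 0 := fun x => by
      exact_mod_cast (Real.exp_pos _).ne'
    have hle : ∀ x, ‖(g s x : ℂ)⁻¹ * G (x - s • v)‖ ≤
        C * Real.exp (-(δ / 2) * ‖x - s • v‖ ^ 2) := fun x => by
      rw [norm_mul, norm_inv, Complex.norm_real, Real.norm_of_nonneg (Real.exp_pos _).le,
        inv_mul_le_iff₀ (Real.exp_pos _)]
      refine (hb _).trans (le_of_eq ?_)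
      change _ = Real.exp (-(δ / 2) * ‖x - s • v‖ ^ 2) * _
      rw [mul_left_comm, ← Real.exp_add]
      congr 2
      ring
    have hEs : MemLp (fun x : RSpace n => C * Real.exp (-(δ / 2) * ‖x - s • v‖ ^ 2)) 2 volume :=
      hE.comp_measurePreserving (measurePreserving_sub_right volume (s • v))
    have hB : MemLp (fun x => (g s x : ℂ)⁻¹ * G (x - s • v)) 2 volume := by
      refine hEs.mono (AEStronglyMeasurable.mul ?_ (hm s).1)
        (ae_of_all _ fun x => (hle x).trans (le_abs_self _))
      exact ((hgc' s).inv₀ hinv).aestronglyMeasurable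
    have e1 : inner ℂ F ((hm s).toLp _) = inner ℂ ((hA s).toLp _) (hB.toLp _) := by
      rw [L2.inner_def, L2.inner_def]
      refine integral_congr_ae ?_
      filter_upwards [(hm s).coeFn_toLp, (hA s).coeFn_toLp, hB.coeFn_toLp] with x h1 h2 h3
      rw [h1, h2, h3, RCLike.inner_apply, RCLike.inner_apply, map_mul, Complex.conj_ofReal]
      have := hinv x
      field_simp
    have e2 : ‖hB.toLp _‖ ≤ N := by
      rw [Lp.norm_toLp]
      refine ENNReal.toReal_mono hE.2.ne ?_
      refine (eLpNorm_mono_real hle).trans (le_of_eq ?_)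
      exact eLpNorm_comp_measurePreserving (p := 2) hE.1 (measurePreserving_sub_right volume (s • v))
    rw [e1]
    exact (norm_inner_le_norm _ _).trans (mul_le_mul_of_nonneg_left e2 (norm_nonneg _))
  rw [tendsto_zero_iff_norm_tendsto_zero]
  refine squeeze_zero (fun _ => norm_nonneg _) hbound ?_
  have h0 : ((MemLp.zero' (ε := ℂ)).toLp _ : L2 n) = 0 := MemLp.toLp_zero _
  rw [h0] at hA0
  simpa using hA0.norm.mul_const N

/-- If `F` is orthogonal to all translates of a directional derivative of `G`, then `F` is
orthogonal to `G`. -/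
theorem inner_eq_zero_of_translates (F : L2 n) {v : RSpace n} (hv : v ≠ 0) {G G' : RSpace n → ℂ}
    (hG : Continuous G) (hG' : Continuous G')
    (hd : ∀ x s, HasDerivAt (fun r : ℝ => G (x - r • v)) (-G' (x - s • v)) s) {C δ : ℝ}
    (hδ : 0 < δ) (hb : ∀ x, ‖G x‖ ≤ C * Real.exp (-δ * ‖x‖ ^ 2))
    (hb' : ∀ x, ‖G' x‖ ≤ C * Real.exp (-δ * ‖x‖ ^ 2))
    (h : ∀ (s : ℝ) (hs : MemLp (fun x => G' (x - s • v)) 2 volume), inner ℂ F (hs.toLp _) = 0)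
    (hm : MemLp G 2 volume) : inner ℂ F (hm.toLp G) = 0 := by
  have hE : ∀ s : ℝ, MemLp (fun x : RSpace n => C * Real.exp (-δ * ‖x - s • v‖ ^ 2)) 2 volume :=
    fun s => (memLp_gaussian hδ C).comp_measurePreserving
      (measurePreserving_sub_right volume (s • v))
  have hms : ∀ s : ℝ, MemLp (fun x => G (x - s • v)) 2 volume := fun s =>
    (hE s).mono (by fun_prop : Continuous fun x => G (x - s • v)).aestronglyMeasurable
      (ae_of_all _ fun x => (hb _).trans (le_abs_self _))
  have hms' : ∀ s : ℝ, MemLp (fun x => G' (x - s • v)) 2 volume := fun s =>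
    (hE s).mono (by fun_prop : Continuous fun x => G' (x - s • v)).aestronglyMeasurable
      (ae_of_all _ fun x => (hb' _).trans (le_abs_self _))
  have hC : 0 ≤ C := by
    have := (norm_nonneg _).trans (hb 0)
    simpa using this
  have hder : ∀ s, HasDerivAt (fun s : ℝ => inner ℂ F ((hms s).toLp _)) 0 s := fun s => by
    have hdom : MemLp (fun x : RSpace n => C * Real.exp (δ * ‖v‖ ^ 2) *
        Real.exp (-(δ / 2) * ‖x - s • v‖ ^ 2)) 2 volume :=
      (memLp_gaussian (half_pos hδ) (C * Real.exp (δ * ‖v‖ ^ 2))).comp_measurePreserving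
        (measurePreserving_sub_right volume (s • v))
    have h1 := hasDerivAt_toLp_of_dominated (t₀ := s) (F := fun s x => G (x - s • v))
      (F' := fun s x => -G' (x - s • v)) one_pos hms (hms' s).neg hdom (fun t _ x => hd x t)
      fun t ht x => by
        rw [norm_neg]
        refine (hb' _).trans ?_
        rw [mul_assoc, ← Real.exp_add]
        refine mul_le_mul_of_nonneg_left (Real.exp_le_exp.2 ?_) hC
        have := mul_le_mul_of_nonneg_left (norm_sq_sub_smul_ge x v ht) hδ.le
        nlinarith
    have h2 := (innerSL ℂ F).hasFDerivAt.restrictScalars ℝ |>.comp_hasDerivAt s h1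
    refine h2.congr_deriv ?_
    have h3 : ((hms' s).neg.toLp fun x => -G' (x - s • v)) = -(hms' s).toLp _ := MemLp.toLp_neg _
    have h4 : inner ℂ F ((hms' s).neg.toLp fun x => -G' (x - s • v)) = 0 := by
      rw [h3, inner_neg_right, h s, neg_zero]
    exact h4
  -- The inner product with the translate by `s v` does not depend on `s`, yet it vanishes in the
  -- limit as the translate moves off to infinity.
  have hconst : ∀ s, inner ℂ F ((hms s).toLp _) = inner ℂ F ((hms 0).toLp _) := fun s =>
    is_const_of_deriv_eq_zero (fun s => (hder s).differentiableAt) (fun s => (hder s).deriv) s 0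
  have hlim := tendsto_inner_translate F hv hδ hb hms
  have h0 : inner ℂ F ((hms 0).toLp _) = 0 := by
    refine tendsto_nhds_unique (tendsto_const_nhds.congr fun s => ?_) hlim
    exact (hconst s).symm
  have e : hm.toLp G = (hms 0).toLp _ := by
    refine MemLp.toLp_congr _ _ (ae_of_all _ fun x => ?_)
    simp
  rw [e, h0]

end Translates

/-! ### Totality of the coherent states -/

section CoherentStates

variable {n : ℕ}

open FourierTransform in
/-- An integrable function whose Fourier transform vanishes is zero almost everywhere. -/
theorem ae_eq_zero_of_fourier_eq_zero {q : RSpace n → ℂ} (hq : Integrable q)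
    (h : ∀ ξ, 𝓕 q ξ = 0) : ∀ᵐ x, q x = 0 := by
  refine ae_eq_zero_of_integral_contDiff_smul_eq_zero hq.locallyIntegrable fun g hg hgs => ?_
  have hgc : HasCompactSupport fun x => (g x : ℂ) := hgs.comp_left Complex.ofReal_zero
  have hgd : ContDiff ℝ ∞ fun x => (g x : ℂ) := Complex.ofRealCLM.contDiff.comp hg
  set φ : SchwartzMap (RSpace n) ℂ := hgc.toSchwartzMap hgd with hφ
  set χ : SchwartzMap (RSpace n) ℂ := 𝓕⁻ φ with hχ
  have hχφ : 𝓕 χ = φ := FourierTransform.fourier_fourierInv_eq φ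
  -- The self-adjointness of the Fourier integral moves the transform from `q` to the Schwartz
  -- function `χ`, whose transform is the given test function.
  have key := VectorFourier.integral_fourierIntegral_smul_eq_flip (μ := volume) (ν := volume)
    (e := Real.fourierChar) (L := innerₗ (RSpace n)) Real.continuous_fourierChar
    continuous_inner hq (χ.integrable (μ := volume))
  have e1 : ∀ x, VectorFourier.fourierIntegral Real.fourierChar volume (innerₗ (RSpace n)).flip
      (χ : RSpace n → ℂ) x = (g x : ℂ) := fun x => by
    rw [flip_innerₗ]
    have h3 : (𝓕 χ) x = φ x := by rw [hχφ]
    rw [SchwartzMap.fourier_coe] at h3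
    exact h3
  have e2 : ∀ ξ, VectorFourier.fourierIntegral Real.fourierChar volume (innerₗ (RSpace n)) q ξ = 0 :=
    h
  simp only [e1, e2, zero_smul, integral_zero] at key
  rw [key]
  refine integral_congr_ae (ae_of_all _ fun x => ?_)
  simp only [smul_eq_mul, Complex.real_smul]
  ring

/-- A Gaussian coherent state, multiplied by a linear factor in the directions of `J`. -/
noncomputable def coherentFactor (κ : Fin n → ℝ) (J : Finset (Fin n)) (z : Fin n → ℂ) (j : Fin n)
    (s : ℝ) : ℂ :=
  (if j ∈ J then z j - s else 1) * Complex.exp (-(κ j / 2) * s ^ 2 + z j * s)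

theorem continuous_coherentFactor (κ : Fin n → ℝ) (J : Finset (Fin n)) (z : Fin n → ℂ)
    (j : Fin n) : Continuous (coherentFactor κ J z j) := by
  unfold coherentFactor
  split_ifs <;> fun_prop

theorem exists_norm_coherentFactor_le {κ : Fin n → ℝ} (hκ : ∀ j, 0 < κ j) (J : Finset (Fin n))
    (z : Fin n → ℂ) : ∃ C δ : ℝ, 0 ≤ C ∧ 0 < δ ∧
      ∀ j s, ‖coherentFactor κ J z j s‖ ≤ C * Real.exp (-δ * s ^ 2) := by
  obtain ⟨δ, hδ, hle⟩ : ∃ δ > 0, ∀ j, 4 * δ ≤ κ j := by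
    rcases isEmpty_or_nonempty (Fin n) with hn | hn
    · exact ⟨1, one_pos, fun j => hn.elim j⟩
    · obtain ⟨j₀, hj₀⟩ := Finite.exists_min κ
      exact ⟨κ j₀ / 4, by have := hκ j₀; positivity, fun j => by have := hj₀ j; linarith⟩
  set M := ∑ j, ‖z j‖ with hM
  have hM0 : 0 ≤ M := Finset.sum_nonneg fun j _ => norm_nonneg _
  have hzM : ∀ j, ‖z j‖ ≤ M := fun j =>
    Finset.single_le_sum (f := fun j => ‖z j‖) (fun i _ => norm_nonneg _) (Finset.mem_univ j)
  obtain ⟨C, hC, h⟩ := pow_mul_exp_le hδ M 1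
  refine ⟨(1 + M) * C, δ, by positivity, hδ, fun j s => ?_⟩
  have h1 : ‖(if j ∈ J then z j - s else 1 : ℂ)‖ ≤ (1 + M) * (1 + |s|) := by
    have hs := abs_nonneg s
    split_ifs
    · refine (norm_sub_le _ _).trans ?_
      rw [Complex.norm_real, Real.norm_eq_abs]
      nlinarith [hzM j]
    · rw [norm_one]
      nlinarith
  have h2 : ‖Complex.exp (-(κ j / 2) * s ^ 2 + z j * s)‖ ≤
      Real.exp (-(2 * δ) * s ^ 2 + M * |s|) := by
    rw [Complex.norm_exp]
    refine Real.exp_le_exp.2 ?_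
    have e1 : (-(κ j / 2) * (s : ℂ) ^ 2 + z j * s).re = -(κ j / 2) * s ^ 2 + (z j).re * s := by
      have : (-(κ j / 2) * (s : ℂ) ^ 2 + z j * s) =
          ((-(κ j / 2) * s ^ 2 : ℝ) : ℂ) + z j * (s : ℂ) := by push_cast; ring
      rw [this, Complex.add_re, Complex.ofReal_re, Complex.re_mul_ofReal]
    rw [e1]
    have e2 : (z j).re * s ≤ M * |s| := by
      calc (z j).re * s ≤ |(z j).re * s| := le_abs_self _
        _ = |(z j).re| * |s| := abs_mul _ _
        _ ≤ M * |s| := by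
          gcongr
          exact (Complex.abs_re_le_norm _).trans (hzM j)
    have e3 := mul_le_mul_of_nonneg_right (hle j) (sq_nonneg s)
    linarith
  rw [coherentFactor, norm_mul]
  calc _ ≤ (1 + M) * (1 + |s|) * Real.exp (-(2 * δ) * s ^ 2 + M * |s|) := by gcongr
    _ = (1 + M) * ((1 + |s|) ^ 1 * Real.exp (-(2 * δ) * s ^ 2 + M * |s|)) := by ring
    _ ≤ (1 + M) * (C * Real.exp (-δ * s ^ 2)) := by
        refine mul_le_mul_of_nonneg_left (h s) (by positivity)
    _ = _ := by ring

theorem memLp_coherent {κ : Fin n → ℝ} (hκ : ∀ j, 0 < κ j) (J : Finset (Fin n))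
    (z : Fin n → ℂ) : MemLp (prodFn (coherentFactor κ J z)) 2 volume := by
  obtain ⟨C, δ, -, hδ, h⟩ := exists_norm_coherentFactor_le hκ J z
  exact memLp_prodFn (continuous_coherentFactor κ J z) hδ h

/-- The coherent state as an element of `L²`. -/
noncomputable def coherentState {κ : Fin n → ℝ} (hκ : ∀ j, 0 < κ j) (J : Finset (Fin n))
    (z : Fin n → ℂ) : L2 n := (memLp_coherent hκ J z).toLp _

theorem prodFn_sub_smul_stdVec (g : Fin n → ℝ → ℂ) (i : Fin n) (s : ℝ) (x : RSpace n) :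
    prodFn g (x - s • stdVec i) = g i (x i - s) * ∏ j ∈ Finset.univ.erase i, g j (x j) := by
  rw [prodFn_eq_mul _ i]
  congr 1
  · simp [stdVec]
  · refine Finset.prod_congr rfl fun j hj => ?_
    simp [stdVec, Finset.ne_of_mem_erase hj]

/-- Up to a scalar, translating along a direction with `κ i = 1` only shifts the parameter `z i`.
Orthogonality to all parameters therefore includes orthogonality to all translates. -/
theorem prodFn_coherentFactor_sub {κ : Fin n → ℝ} {J : Finset (Fin n)} {i : Fin n}
    (hi : κ i = 1) (z : Fin n → ℂ) (s : ℝ) (x : RSpace n) :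
    Complex.exp (-(z i) ^ 2 / 2) * prodFn (coherentFactor κ J z) (x - s • stdVec i) =
      Complex.exp (-(z i + s) ^ 2 / 2) *
        prodFn (coherentFactor κ J (Function.update z i (z i + s))) x := by
  rw [prodFn_sub_smul_stdVec, prodFn_eq_mul _ i, ← mul_assoc, ← mul_assoc]
  congr 1
  · rw [coherentFactor, coherentFactor, Function.update_self, hi, mul_left_comm,
      mul_left_comm (Complex.exp _), ← Complex.exp_add, ← Complex.exp_add]
    push_cast
    congr 1
    · split_ifs <;> ring
    · congr 1
      ring
  · refine Finset.prod_congr rfl fun j hj => ?_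
    rw [coherentFactor, coherentFactor, Function.update_of_ne (Finset.ne_of_mem_erase hj)]

/-- Because `κ i = 1`, the factor `z i - s` is the logarithmic derivative of the Gaussian in that
coordinate. The state with `i` inserted is thus a partial derivative of the state without it, and
the translation argument recovers the latter. -/
theorem inner_coherentState_eq_zero_of_insert {κ : Fin n → ℝ} (hκ : ∀ j, 0 < κ j)
    {J : Finset (Fin n)} {i : Fin n} (hiJ : i ∉ J) (hi : κ i = 1) (F : L2 n)
    (h : ∀ z, inner ℂ F (coherentState hκ (insert i J) z) = 0) (z : Fin n → ℂ) :
    inner ℂ F (coherentState hκ J z) = 0 := by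
  set a := Complex.exp (-(z i) ^ 2 / 2) with ha
  have ha0 : a ≠ 0 := Complex.exp_ne_zero _
  obtain ⟨C₁, δ₁, hC₁, hδ₁, h₁⟩ := exists_norm_coherentFactor_le hκ J z
  obtain ⟨C₂, δ₂, hC₂, hδ₂, h₂⟩ := exists_norm_coherentFactor_le hκ (insert i J) z
  have hc : ∀ J, Continuous fun x : RSpace n => a * prodFn (coherentFactor κ J z) x := fun J => by
    unfold prodFn
    have := continuous_coherentFactor κ J z
    fun_prop
  have hm : MemLp (fun x => a * prodFn (coherentFactor κ J z) x) 2 volume :=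
    (memLp_coherent hκ J z).const_mul a
  have hv : (stdVec i : RSpace n) ≠ 0 := by simp [stdVec]
  have key : inner ℂ F (hm.toLp _) = 0 := by
    refine inner_eq_zero_of_translates F hv (hc J) (hc (insert i J)) (fun x s => ?_)
      (C := ‖a‖ * (C₁ ^ n + C₂ ^ n)) (lt_min hδ₁ hδ₂) (fun x => ?_) (fun x => ?_) (fun s hs => ?_) hm
    · have e1 : ∀ r : ℝ, a * prodFn (coherentFactor κ J z) (x - r • stdVec i) =
          Complex.exp (-(r + (z i - x i)) ^ 2 / 2) *
            ∏ j ∈ Finset.univ.erase i, coherentFactor κ J z j (x j) := fun r => by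
        rw [prodFn_sub_smul_stdVec, ← mul_assoc, coherentFactor, if_neg hiJ, one_mul, ha, hi,
          ← Complex.exp_add]
        congr 2
        push_cast
        ring
      have e2 : a * prodFn (coherentFactor κ (insert i J) z) (x - s • stdVec i) =
          (s + (z i - x i)) * Complex.exp (-(s + (z i - x i)) ^ 2 / 2) *
            ∏ j ∈ Finset.univ.erase i, coherentFactor κ J z j (x j) := by
        rw [prodFn_sub_smul_stdVec, ← mul_assoc, coherentFactor,
          if_pos (Finset.mem_insert_self _ _), ha, hi, mul_left_comm, ← Complex.exp_add]
        congr 1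
        · congr 1
          · push_cast
            ring
          · congr 1
            push_cast
            ring
        · refine Finset.prod_congr rfl fun j hj => ?_
          simp only [coherentFactor, Finset.mem_insert, Finset.ne_of_mem_erase hj, false_or]
      simp only [e1, e2]
      have h1 : HasDerivAt (fun r : ℝ => (r : ℂ) + (z i - x i)) 1 s :=
        (Complex.ofRealCLM.hasDerivAt (x := s)).add_const _
      refine (((h1.fun_pow 2).fun_neg.div_const 2).cexp.mul_const _).congr_deriv ?_
      push_cast
      ring
    · rw [norm_mul, mul_assoc]
      refine mul_le_mul_of_nonneg_left ((norm_prodFn_le h₁ x).trans ?_) (norm_nonneg a)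
      have h3 : C₁ ^ n ≤ C₁ ^ n + C₂ ^ n := le_add_of_nonneg_right (by positivity)
      have h4 := min_le_left δ₁ δ₂
      gcongr
    · rw [norm_mul, mul_assoc]
      refine mul_le_mul_of_nonneg_left ((norm_prodFn_le h₂ x).trans ?_) (norm_nonneg a)
      have h3 : C₂ ^ n ≤ C₁ ^ n + C₂ ^ n := le_add_of_nonneg_left (by positivity)
      have h4 := min_le_right δ₁ δ₂
      gcongr
    · have e3 : hs.toLp _ = Complex.exp (-(z i + s) ^ 2 / 2) •
          coherentState hκ (insert i J) (Function.update z i (z i + s)) := by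
        rw [coherentState, ← MemLp.toLp_const_smul]
        refine MemLp.toLp_congr _ _ (ae_of_all _ fun x => ?_)
        exact prodFn_coherentFactor_sub hi z s x
      rw [e3, inner_smul_right, h, mul_zero]
  have e : hm.toLp _ = a • coherentState hκ J z := rfl
  rw [e, inner_smul_right] at key
  exact (mul_eq_zero.1 key).resolve_left ha0

/-- Strip off the linear factors one direction at a time. For the remaining pure Gaussians,
imaginary parameters make the inner products the Fourier transform of `conj F` times a fixed
Gaussian, which vanishes nowhere. -/
theorem eq_zero_of_inner_coherentState {κ : Fin n → ℝ} (hκ : ∀ j, 0 < κ j)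
    {J : Finset (Fin n)} (hJ : ∀ j ∈ J, κ j = 1) (F : L2 n)
    (h : ∀ z, inner ℂ F (coherentState hκ J z) = 0) : F = 0 := by
  have h0 : ∀ z, inner ℂ F (coherentState hκ ∅ z) = 0 := by
    induction J using Finset.induction_on with
    | empty => exact h
    | insert i J hi ih =>
      exact ih (fun j hj => hJ j (Finset.mem_insert_of_mem hj))
        (inner_coherentState_eq_zero_of_insert hκ hi (hJ i (Finset.mem_insert_self _ _)) F h)
  set Γ : RSpace n → ℂ := prodFn (coherentFactor κ ∅ 0) with hΓ
  have hΓ0 : ∀ x, Γ x ≠ 0 := fun x => by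
    rw [hΓ, prodFn, Finset.prod_ne_zero_iff]
    intro j _
    simp [coherentFactor, Complex.exp_ne_zero]
  have hq : Integrable fun x => (starRingEnd ℂ) (F x) * Γ x :=
    (Lp.memLp F).star.integrable_mul (memLp_coherent hκ ∅ 0)
  have hq0 := ae_eq_zero_of_fourier_eq_zero hq fun ξ => by
    -- The parameter `-2πi ξ` turns the linear exponent into the Fourier character at `ξ`.
    have h1 := h0 fun j => -(2 * Real.pi * ξ j) * Complex.I
    rw [coherentState, L2.inner_def] at h1
    rw [← h1, Real.fourier_eq']
    refine integral_congr_ae ?_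
    filter_upwards [(memLp_coherent hκ ∅ fun j => -(2 * Real.pi * ξ j) * Complex.I).coeFn_toLp] with x hx
    rw [hx, RCLike.inner_apply, smul_eq_mul, hΓ, prodFn, prodFn]
    rw [mul_left_comm, mul_comm _ (starRingEnd ℂ _)]
    congr 1
    simp only [coherentFactor, Finset.notMem_empty, if_false, one_mul]
    rw [← Complex.exp_sum, ← Complex.exp_sum, ← Complex.exp_add]
    congr 1
    have hin : inner ℝ x ξ = ∑ j, x j * ξ j := by
      rw [PiLp.inner_apply]
      exact Finset.sum_congr rfl fun j _ => by simp [mul_comm]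
    rw [hin]
    push_cast
    rw [Finset.mul_sum, Finset.sum_mul, ← Finset.sum_add_distrib]
    refine Finset.sum_congr rfl fun j _ => ?_
    simp only [Pi.zero_apply]
    ring
  apply Lp.ext
  filter_upwards [hq0, Lp.coeFn_zero ℂ 2 (volume : Measure (RSpace n))] with x h1 h2
  rw [h2]
  simpa [hΓ0 x] using h1

end CoherentStates

/-! ### From packets to self-adjointness and wave operators -/

section Assembly

variable {n : ℕ}

open testFunctions

theorem isLaplacianSmall_zero : IsLaplacianSmall fun _ : RSpace n => (0 : ℝ) :=
  IsLaplacianSmall.of_memLp_top MemLp.zero'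

theorem productState_zero_eq_coherentState {c e : Fin n → ℝ} {f f₁ f₂ : Fin n → ℝ → ℝ → ℂ}
    (hp : ∀ j, IsPacket (c j) (e j) (f j) (f₁ j) (f₂ j)) {κ : Fin n → ℝ} (hκ : ∀ j, 0 < κ j)
    {J : Finset (Fin n)} {z : Fin n → ℂ} (h : ∀ j x, f j 0 x = coherentFactor κ J z j x) :
    productState hp 0 = coherentState hκ J z := by
  refine MemLp.toLp_congr _ _ (ae_of_all _ fun x => ?_)
  exact Finset.prod_congr rfl fun j _ => h j _

theorem productState_mem_closure_free {c e : Fin n → ℝ} {f f₁ f₂ : Fin n → ℝ → ℝ → ℂ}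
    (hp : ∀ j, IsPacket (c j) (e j) (f j) (f₁ j) (f₂ j))
    (h0 : IsLocallyL2 fun _ : RSpace n => (0 : ℝ))
    (hsmall : ∀ ε > 0, ∃ C, 0 ≤ C ∧ ∀ φ : testFunctions n,
      ‖mulL2 _ h0 φ‖ ≤ ε * ‖toL2 (lap φ)‖ + C * ‖toL2 φ‖) (t : ℝ) :
    (productState hp t, productEnergy hp t) ∈ closure (Set.range fun φ : testFunctions n =>
      (toL2 φ, hamiltonian c e _ h0 φ)) := by
  obtain ⟨w, hw, hmem⟩ := exists_productState_mem_closure hp h0 hsmall t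
  have hw0 : w = 0 := by
    apply Lp.ext
    filter_upwards [hw, Lp.coeFn_zero ℂ 2 (volume : Measure (RSpace n))] with x h1 h2
    rw [h1, h2]
    simp
  rwa [hw0, add_zero] at hmem

/-- The oscillator packets evolve inside its closed graph, so `inner_eq_zero_of_flow` makes a
deficiency vector orthogonal to every coherent state, and these are total. This gives essential
self-adjointness of the oscillator without a spectral decomposition. -/
theorem hasTotalRange_oscillator {K : ℝ} (hK : K ≠ 0) :
    HasTotalRange (toL2 ∘ₗ oscillator + ((K : ℂ) * Complex.I) • toL2 :
      testFunctions n →ₗ[ℂ] L2 n) := by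
  intro ζ hζ
  obtain ⟨h0, hsmall⟩ := isLaplacianSmall_zero (n := n)
  have hT : ∀ φ : testFunctions n, hamiltonian 1 0 _ h0 φ = toL2 (oscillator φ) := fun φ => by
    have hm : mulL2 _ h0 φ = 0 := by
      apply Lp.ext
      filter_upwards [coeFn_mulL2 _ h0 φ, Lp.coeFn_zero ℂ 2 (volume : Measure (RSpace n))]
        with x h1 h2
      rw [h1, h2]
      simp
    rw [hamiltonian_apply, hm, add_zero, oscillator, LinearMap.add_apply, LinearMap.neg_apply,
      map_add, map_neg]
    rfl
  refine eq_zero_of_inner_coherentState (κ := fun _ => 1) (fun _ => one_pos) (J := ∅)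
    (fun _ _ => rfl) ζ fun z => ?_
  choose f f₁ f₂ hp hf _ using fun j => exists_packet_confining one_pos (z j)
  have hp' : ∀ j, IsPacket ((1 : Fin n → ℝ) j) ((0 : Fin n → ℝ) j) (f j) (f₁ j) (f₂ j) :=
    fun j => by simpa using hp j
  rw [← productState_zero_eq_coherentState hp' (fun _ => one_pos) fun j x => by
    rw [hf, coherentFactor, if_neg (Finset.notMem_empty _), one_mul]]
  refine inner_eq_zero_of_flow (inner_hamiltonian 1 0 _ h0) (hasDerivAt_productState hp')
    (productState_mem_closure_free hp' h0 hsmall) hK fun φ => ?_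
  rw [hT]
  exact hζ φ

namespace QuadraticStark

/-- The coefficient of `x_k²` in `U`. -/
noncomputable def coeff (S : QuadraticStark n) (k : Fin n) : ℝ :=
  if (k : ℕ) < S.nNeg then -S.freq k ^ 2
  else if (k : ℕ) < S.nNeg + S.nPos then S.freq k ^ 2 else 0

/-- The coefficient of `x_k` in `U`. -/
noncomputable def force (S : QuadraticStark n) (k : Fin n) : ℝ :=
  if (k : ℕ) < S.nNeg + S.nPos then 0
  else if (k : ℕ) < S.nNeg + S.nPos + S.nStark then S.field k else 0

/-- The inverse square width of the packets at time zero. -/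
noncomputable def width (S : QuadraticStark n) (k : Fin n) : ℝ :=
  if (k : ℕ) < S.nNeg + S.nPos then S.freq k else 1

/-- The directions on which `U` does not depend. -/
def freeDirections (S : QuadraticStark n) : Finset (Fin n) :=
  Finset.univ.filter fun k => S.nNeg + S.nPos + S.nStark ≤ (k : ℕ)

theorem U_eq (S : QuadraticStark n) (x : RSpace n) :
    S.U x = ∑ k, (S.coeff k * x k ^ 2 + S.force k * x k) := by
  refine Finset.sum_congr rfl fun k _ => ?_
  unfold coeff force
  split_ifs <;> first | omega | ring

theorem width_pos (S : QuadraticStark n) (k : Fin n) : 0 < S.width k := by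
  unfold width
  split_ifs with h
  · exact S.freq_pos k h
  · exact one_pos

theorem width_eq_one (S : QuadraticStark n) {k : Fin n} (hk : k ∈ S.freeDirections) :
    S.width k = 1 := by
  simp only [freeDirections, Finset.mem_filter, Finset.mem_univ, true_and] at hk
  rw [width, if_neg (by omega)]

theorem exists_packet (S : QuadraticStark n) (z : Fin n → ℂ) (k : Fin n) :
    ∃ f f₁ f₂ : ℝ → ℝ → ℂ, IsPacket (S.coeff k) (S.force k) f f₁ f₂ ∧
      (∀ x, f 0 x = coherentFactor S.width S.freeDirections z k x) ∧ HasBoundedMass f ∧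
      (k ∈ S.active → ∀ B : ℝ, 1 < B → B ≤ 5 / 4 → HasWeightedDecay (S.localWeight k) B f) ∧
      ((k : ℕ) < S.nNeg → ∃ C, 0 ≤ C ∧ ∀ t x, ‖f t x‖ ≤ C * Real.exp (-(S.freq k * |t|))) := by
  have hmem : k ∈ S.freeDirections ↔ S.nNeg + S.nPos + S.nStark ≤ (k : ℕ) := by
    simp [freeDirections]
  have hact : k ∈ S.active ↔ (k : ℕ) < S.nNeg ∨ S.nNeg + S.nPos ≤ (k : ℕ) := by
    simp [active]
  by_cases h1 : (k : ℕ) < S.nNeg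
  · have h2 : (k : ℕ) < S.nNeg + S.nPos := by omega
    obtain ⟨f, f₁, f₂, hp, h0, hm, hd, hs⟩ := exists_packet_repulsive (S.freq_pos k h2) (z k)
    refine ⟨f, f₁, f₂, ?_, fun x => ?_, hm, fun _ => ?_, fun _ => hs⟩
    · rwa [coeff, if_pos h1, force, if_pos h2]
    · rw [h0, coherentFactor, if_neg (by rw [hmem]; omega), one_mul, width, if_pos h2]
    · have e : S.localWeight k =
          fun x => (japaneseBracket (Real.log (japaneseBracket x)))⁻¹ := by
        funext x
        rw [localWeight, if_pos h1]
      rwa [e]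
  by_cases h2 : (k : ℕ) < S.nNeg + S.nPos
  · obtain ⟨f, f₁, f₂, hp, h0, hm⟩ := exists_packet_confining (S.freq_pos k h2) (z k)
    refine ⟨f, f₁, f₂, ?_, fun x => ?_, hm, fun h => ?_, fun h => absurd h h1⟩
    · rwa [coeff, if_neg h1, if_pos h2, force, if_pos h2]
    · rw [h0, coherentFactor, if_neg (by rw [hmem]; omega), one_mul, width, if_pos h2]
    · rw [hact] at h
      omega
  by_cases h3 : (k : ℕ) < S.nNeg + S.nPos + S.nStark
  · obtain ⟨f, f₁, f₂, hp, h0, hm, hd⟩ :=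
      exists_packet_stark (S.field_ne_zero k (not_lt.1 h2) h3) (z k)
    refine ⟨f, f₁, f₂, ?_, fun x => ?_, hm, fun _ => ?_, fun h => absurd h h1⟩
    · rwa [coeff, if_neg h1, if_neg h2, force, if_neg h2, if_pos h3]
    · rw [h0, coherentFactor, if_neg (by rw [hmem]; omega), one_mul, width, if_neg h2,
        Complex.ofReal_one]
    · have e : S.localWeight k = fun x => japaneseBracket x ^ (-(1 / 2) : ℝ) := by
        funext x
        rw [localWeight, if_neg h1, if_neg h2, if_pos h3]
      rwa [e]
  · obtain ⟨f, f₁, f₂, hp, h0, hm, hd⟩ := exists_packet_free (z k)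
    refine ⟨f, f₁, f₂, ?_, fun x => ?_, hm, fun _ => ?_, fun h => absurd h h1⟩
    · rwa [coeff, if_neg h1, if_neg h2, force, if_neg h2, if_neg h3]
    · rw [h0, coherentFactor, if_pos (by rw [hmem]; omega), width, if_neg h2,
        Complex.ofReal_one]
    · have e : S.localWeight k = fun x => (japaneseBracket x)⁻¹ := by
        funext x
        rw [localWeight, if_neg h1, if_neg h2, if_neg h3]
      rwa [e]

end QuadraticStark

/-- Families of factors whose products are used as trial states. -/
structure QuadraticStark.IsTrialFamily (S : QuadraticStark n) (f : Fin n → ℝ → ℝ → ℂ) : Prop where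
  continuous : ∀ j t, Continuous (f j t)
  mass : ∀ j, HasBoundedMass (f j)
  decay : ∀ j ∈ S.active, ∀ B : ℝ, 1 < B → B ≤ 5 / 4 →
    HasWeightedDecay (S.localWeight j) B (f j)
  exp_decay : ∀ j : Fin n, (j : ℕ) < S.nNeg →
    ∃ C, 0 ≤ C ∧ ∀ t x, ‖f j t x‖ ≤ C * Real.exp (-(S.freq j * |t|))

/-- Cook's method with `v(t) = V u(t)`, where `u` is the product of packets starting at a coherent
state. Both self-adjoint extensions are closures from test functions, so the cutoff argument
provides the required membership in their graphs at every time. -/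
theorem QuadraticStark.scatteringConclusion_of_hasFastDecay (S : QuadraticStark n)
    {V : RSpace n → ℝ} (hV : IsLaplacianSmall V) (hd : ∀ f, S.IsTrialFamily f →
      HasFastDecay fun t x => (V x : ℂ) * prodFn (fun j => f j t) x) :
    ScatteringConclusion S V := by
  obtain ⟨hV, hsmall⟩ := hV
  obtain ⟨h0, hsmall0⟩ := isLaplacianSmall_zero (n := n)
  have hpos : HasTotalRange (toL2 ∘ₗ oscillator + Complex.I • toL2 : testFunctions n →ₗ[ℂ] L2 n) := by
    simpa using hasTotalRange_oscillator (n := n) one_ne_zero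
  have hneg : HasTotalRange (toL2 ∘ₗ oscillator - Complex.I • toL2 : testFunctions n →ₗ[ℂ] L2 n) := by
    have := hasTotalRange_oscillator (n := n) (neg_ne_zero.2 one_ne_zero)
    simpa [sub_eq_add_neg] using this
  have hq : (fun x => S.U x + V x) =ᵐ[volume]
      fun x => (∑ k, (S.coeff k * x k ^ 2 + S.force k * x k)) + V x :=
    ae_of_all _ fun x => by simp only [S.U_eq]
  have hq0 : S.U =ᵐ[volume] fun x => (∑ k, (S.coeff k * x k ^ 2 + S.force k * x k)) + 0 :=
    ae_of_all _ fun x => by simp only [S.U_eq, add_zero]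
  obtain ⟨hA₀, hg₀⟩ := isUniqueSelfAdjointExtension_minimalSchrodinger hpos hneg S.coeff S.force
    h0 hsmall0 hq0
  obtain ⟨hA, hg⟩ := isUniqueSelfAdjointExtension_minimalSchrodinger hpos hneg S.coeff S.force
    hV hsmall hq
  refine ⟨fun φ hφ hφc => ?_, _, _, hA₀, hA, waveOperatorsExist_of_cook hA₀.1.2 hA.1.2
    (D := Set.range (coherentState S.width_pos S.freeDirections)) (fun η hη => ?_) ?_⟩
  · exact (Lp.memLp (hamiltonian S.coeff S.force V hV ⟨φ, hφ, hφc⟩)).ae_eq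
      (coeFn_hamiltonian S.coeff S.force hV hq ⟨φ, hφ, hφc⟩)
  · exact eq_zero_of_inner_coherentState S.width_pos (fun j hj => S.width_eq_one hj) η
      fun z => hη _ ⟨z, rfl⟩
  · rintro _ ⟨z, rfl⟩
    choose f f₁ f₂ hp hz hm hw hs using S.exists_packet z
    choose w hwV hwmem using exists_productState_mem_closure hp hV hsmall
    refine ⟨productState hp, productEnergy hp, w,
      productState_zero_eq_coherentState hp S.width_pos hz, hasDerivAt_productState hp,
      fun t => ?_, fun t => ?_, ?_⟩
    · rw [← SetLike.mem_coe, hg₀]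
      exact productState_mem_closure_free hp h0 hsmall0 t
    · rw [← SetLike.mem_coe, hg]
      exact hwmem t
    · obtain ⟨B, C, T, hB, hC, hT, hle⟩ := hd f
        ⟨fun j t => ((hp j).contDiff t).continuous, hm, hw, hs⟩
      refine ⟨C, B, T, hB, by linarith, fun t ht => ?_⟩
      rw [Lp.norm_def, eLpNorm_congr_ae (hwV t)]
      exact ENNReal.toReal_le_of_le_ofReal (by positivity) (hle t ht)

theorem QuadraticStark.IsTrialFamily.aestronglyMeasurable_mul {S : QuadraticStark n}
    {f : Fin n → ℝ → ℝ → ℂ} (hf : S.IsTrialFamily f) {V : RSpace n → ℝ}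
    (hV : AEStronglyMeasurable V volume) (t : ℝ) :
    AEStronglyMeasurable (fun x => (V x : ℂ) * prodFn (fun j => f j t) x) volume := by
  refine (Complex.continuous_ofReal.comp_aestronglyMeasurable hV).mul
    (Continuous.aestronglyMeasurable ?_)
  unfold prodFn
  have := hf.continuous
  fun_prop

theorem QuadraticStark.IsDecaying.memLp {S : QuadraticStark n} {W : RSpace n → ℝ}
    (hW : S.IsDecaying W) : MemLp W ⊤ volume := by
  obtain ⟨m, w, hw, hWw⟩ := hW
  exact (memLp_finsetSum _ fun i _ => (hw i).1).ae_eq hWw.symm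

theorem QuadraticStark.IsDecaying.hasFastDecay {S : QuadraticStark n} {W : RSpace n → ℝ}
    (hW : S.IsDecaying W) {f : Fin n → ℝ → ℝ → ℂ} (hf : S.IsTrialFamily f) :
    HasFastDecay fun t x => (W x : ℂ) * prodFn (fun j => f j t) x := by
  obtain ⟨m, w, hw, hWw⟩ := hW
  have h := HasFastDecay.sum (s := Finset.univ)
    (fun i _ => (hw i).hasFastDecay hf.continuous hf.mass hf.decay)
    fun i _ t => hf.aestronglyMeasurable_mul (hw i).1.1 t
  refine h.congr fun t => ?_
  filter_upwards [hWw] with x hx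
  rw [hx, Complex.ofReal_sum, Finset.sum_mul]

theorem QuadraticStark.scatteringConclusion_of_isDecaying (S : QuadraticStark n)
    {V : RSpace n → ℝ} (hV : S.IsDecaying V) : ScatteringConclusion S V :=
  S.scatteringConclusion_of_hasFastDecay (IsLaplacianSmall.of_memLp_top hV.memLp)
    fun _ hf => hV.hasFastDecay hf

/-- One repulsive direction, here the one with index `0`, supplies the exponential decay of the
supremum norm that both singular parts need; the decaying part is handled by the weights. -/
theorem QuadraticStark.scatteringConclusion_of_isSingularPotential (S : QuadraticStark n)
    (hS : 1 ≤ S.nNeg) {V V₁ V₂ W : RSpace n → ℝ} (h₁ : IsSingularPotential V₁)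
    (h₂ : IsSingularPotential V₂) (hW : S.IsDecaying W)
    (hV : V =ᵐ[volume] fun x => V₁ x + V₂ x + W x) : ScatteringConclusion S V := by
  refine S.scatteringConclusion_of_hasFastDecay (((h₁.isLaplacianSmall.add h₂.isLaplacianSmall).add
    (IsLaplacianSmall.of_memLp_top hW.memLp)).congr hV.symm) fun f hf => ?_
  have hn : 0 < n := by
    have := S.le_dim
    omega
  have hs : ∀ {V' : RSpace n → ℝ}, IsSingularPotential V' →
      HasFastDecay fun t x => (V' x : ℂ) * prodFn (fun j => f j t) x := fun h =>
    h.hasFastDecay hf.continuous hf.mass (S.freq_pos ⟨0, hn⟩ (by simp only; omega))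
      (hf.exp_decay ⟨0, hn⟩ hS)
  have hmeas : ∀ {V' : RSpace n → ℝ}, IsSingularPotential V' → AEStronglyMeasurable V' volume :=
    fun ⟨_, _, h⟩ => h.1
  have m1 := hf.aestronglyMeasurable_mul (hmeas h₁)
  have m2 := hf.aestronglyMeasurable_mul (hmeas h₂)
  refine (((hs h₁).add (hs h₂) m1 m2).add (hW.hasFastDecay hf) (fun t => (m1 t).add (m2 t))
    (hf.aestronglyMeasurable_mul hW.memLp.1)).congr fun t => ?_
  filter_upwards [hV] with x hx
  rw [hx]
  push_cast
  ring

end Assembly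

theorem theorem5p1 {n : ℕ} (S : QuadraticStark n) (V : RSpace n → ℝ) :
    (1 ≤ S.nNeg → S.nPos ≤ 1 →
      (∃ V₁ V₂ W : RSpace n → ℝ, IsSingularPotential V₁ ∧ IsSingularPotential V₂ ∧
        S.IsDecaying W ∧ V =ᵐ[volume] fun x => V₁ x + V₂ x + W x) →
      ScatteringConclusion S V) ∧
    (1 ≤ S.nNeg →
      (∃ V₁ V₂ W : RSpace n → ℝ, IsSingularPotential V₁ ∧ IsSingularPotential V₂ ∧
        IsEssCompactlySupported V₁ ∧ IsEssCompactlySupported V₂ ∧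
        S.IsDecaying W ∧ V =ᵐ[volume] fun x => V₁ x + V₂ x + W x) →
      ScatteringConclusion S V) ∧
    (S.IsDecaying V → ScatteringConclusion S V) :=
  ⟨fun hS _ ⟨_, _, _, h₁, h₂, hW, hV⟩ =>
      S.scatteringConclusion_of_isSingularPotential hS h₁ h₂ hW hV,
    fun hS ⟨_, _, _, h₁, h₂, _, _, hW, hV⟩ =>
      S.scatteringConclusion_of_isSingularPotential hS h₁ h₂ hW hV,
    S.scatteringConclusion_of_isDecaying⟩
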